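/- Let $n\ge 2$, let $\Omega\subset\mathbb R^n$ be open, and let $2\le p\le q$ satisfy $\frac qp<1+\frac2n$. Write $\Omega'\Subset\Omega$ when $\Omega'$ is open and $\overline{\Omega'}$ is a compact subset of $\Omega$. Let $h:\Omega\times\mathbb R^n\to\mathbb R$ be continuous, with gradient $D_\xi h(x,\xi)$ existing and locally Lipschitz continuous on $\Omega\times\mathbb R^n$, and suppose that for every $\Omega'\Subset\Omega$ there are constants $c_1,c_2,c_3>0$ with $$c_1|\xi|^{p-2}|\lambda|^2\le\sum_{i,j}h_{\xi_i\xi_j}(x,\xi)\lambda_i\lambda_j\le c_2(1+|\xi|^{p-2})|\lambda|^2,\qquad \sum_i|h_{\xi_ix_k}(x,\xi)|\le c_3|\xi|^{p-1}$$ for all $\lambda\in\mathbb R^n$, all $k=1,\dots,n$ and almost every $(x,\xi)\in\Omega'\times\mathbb R^n$ (these second derivatives exist almost everywhere). Put $f(x,\xi)=h(x,\xi)+|\xi_n|^q$. A local minimizer of $\int_\Omega f(x,Du)\,dx$ is a weakly differentiable function $u$ such that for every $\Omega'\Subset\Omega$ the function $f(x,Du)$ is integrable on $\Omega'$ and $\int_{\Omega'}f(x,Du)\,dx\le\int_{\Omega'}f(x,Du+D\psi)\,dx$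 for all $\psi\in W^{1,2}(\Omega)$ with support in $\Omega'$. It belongs to the a-priori smooth class if for every $\Omega'\Subset\Omega$ one has $u\in W^{2,2}(\Omega')$ and $$\int_{\Omega'}|Du|^2(1+|Du|^{q-2})\,dx+\int_{\Omega'}(1+|Du|^{q-2})|D^2u|^2\,dx<+\infty .$$ (i) Every local minimizer in the a-priori smooth class is locally Lipschitz continuous in $\Omega$ (after modification on a null set). (ii) Let $\Omega'\Subset\Omega$ be such that $1+f$ is bounded below by a positive constant on $\Omega'\times\mathbb R^n$ (for instance $f\ge0$). Then there are exponents $\theta_1,\theta_3>1$, $\theta_2,\theta_4>0$, a radius $R_0>0$ and a constant $c>0$, all independent of $u$, such that every local minimizer $u$ in the a-priori smooth class satisfies $$\|Du\|_{L^\infty(B_\rho;\mathbb R^n)}^2\le\frac{c}{(R-\rho)^{\theta_2}}\Big(\int_{B_R}(1+f(x,Du))\,dx\Big)^{\theta_1},$$ $$\int_{B_\rho}|Du|^{p-2}|D^2u|^2\,dx\le\frac{c}{(R-\rho)^{\theta_4}}\Big(\int_{B_R}(1+f(x,Du))\,dx\Big)^{\theta_3}$$ for all concentric balls $B_\rho\subset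 B_R\subset\Omega'$ of radii $0<\rho<R\le R_0$. (iii) If $p=2$, the conclusions of (i) and (ii), the latter for every $\Omega'\Subset\Omega$, hold for the integrand $f(x,\xi)=\sum_{i,j}a_{ij}(x)\xi_i\xi_j+|\xi_n|^q$, where the $a_{ij}$ are locally Lipschitz continuous in $\Omega$ and for every $\Omega'\Subset\Omega$ there are $c_1,c_2>0$ with $c_1|\lambda|^2\le\sum_{i,j}a_{ij}(x)\lambda_i\lambda_j\le c_2|\lambda|^2$ for all $x\in\Omega'$, $\lambda\in\mathbb R^n$. -/

import Mathlib

open MeasureTheory Set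

open scoped ContDiff Gradient ENNReal

noncomputable section

namespace AnisotropicEnergy

/-- `ℝⁿ` with the Euclidean norm. -/
abbrev E (n : ℕ) : Type := EuclideanSpace ℝ (Fin n)

/-- `Ω'` is an open set compactly contained in `Ω`. -/
def CompactlyContained {n : ℕ} (Ω' Ω : Set (E n)) : Prop :=
  IsOpen Ω' ∧ IsCompact (closure Ω') ∧ closure Ω' ⊆ Ω

/-- `G` is the weak (distributional) gradient of `u` in the open set `Ω`. -/
def HasWeakGradient {n : ℕ} (Ω : Set (E n)) (u : E n → ℝ) (G : E n → E n) : Prop :=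
  LocallyIntegrableOn u Ω ∧ LocallyIntegrableOn G Ω ∧
    ∀ φ : E n → ℝ, ContDiff ℝ ∞ φ → HasCompactSupport φ → tsupport φ ⊆ Ω →
      ∀ i : Fin n,
        ∫ x in Ω, u x * fderiv ℝ φ x (EuclideanSpace.single i 1) = - ∫ x in Ω, G x i * φ x

/-- `ψ ∈ W^{1,2}(Ω)`, with weak gradient `Dψ`. -/
def IsW12 {n : ℕ} (Ω : Set (E n)) (ψ : E n → ℝ) (Dψ : E n → E n) : Prop :=
  HasWeakGradient Ω ψ Dψ ∧ MemLp ψ 2 (volume.restrict Ω) ∧ MemLp Dψ 2 (volume.restrict Ω)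

/-- `u ∈ W^{2,2}(Ω)`, with weak gradient `Du` and weak Hessian `D2u`;
the `i`-th row `D2u x i` is the gradient of the `i`-th partial derivative of `u`. -/
def IsW22 {n : ℕ} (Ω : Set (E n)) (u : E n → ℝ) (Du : E n → E n)
    (D2u : E n → Fin n → E n) : Prop :=
  IsW12 Ω u Du ∧ ∀ i, IsW12 Ω (fun x => Du x i) (fun x => D2u x i)

/-- `|D²u(x)|²`, the sum of the squares of all second derivatives. -/
def hessSq {n : ℕ} (D2u : E n → Fin n → E n) (x : E n) : ℝ :=
  ∑ i, ‖D2u x i‖ ^ 2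

/-- A function `u` with weak gradient `Du` is a local minimizer of `v ↦ ∫_Ω f(x, Dv) dx`:
on each `Ω'` compactly contained in `Ω` the energy is finite and not larger than that of any
competitor `u + ψ` with `ψ ∈ W^{1,2}(Ω)` supported in `Ω'`. (A competitor whose energy density is
not integrable on `Ω'` has energy `+∞` when `f` is bounded from below on `Ω' × ℝⁿ`.) -/
def IsLocalMinimizer {n : ℕ} (Ω : Set (E n)) (f : E n → E n → ℝ)
    (u : E n → ℝ) (Du : E n → E n) : Prop :=
  HasWeakGradient Ω u Du ∧
    ∀ Ω', CompactlyContained Ω' Ω →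
      IntegrableOn (fun x => f x (Du x)) Ω' ∧
      ∀ (ψ : E n → ℝ) (Dψ : E n → E n), IsW12 Ω ψ Dψ → tsupport ψ ⊆ Ω' →
        IntegrableOn (fun x => f x (Du x + Dψ x)) Ω' →
          ∫ x in Ω', f x (Du x) ≤ ∫ x in Ω', f x (Du x + Dψ x)

/-- The a-priori smooth class: on each `Ω'` compactly contained in `Ω`, `u ∈ W^{2,2}(Ω')` and
`|Du|^{2γ} g₂(|Du|)^{2γ-1}` and `g₂(|Du|) |D²u|²` are integrable. -/
def InSmoothClass {n : ℕ} (γ : ℝ) (g₂ : ℝ → ℝ) (Ω : Set (E n))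
    (u : E n → ℝ) (Du : E n → E n) (D2u : E n → Fin n → E n) : Prop :=
  ∀ Ω', CompactlyContained Ω' Ω →
    IsW22 Ω' u Du D2u ∧
    IntegrableOn (fun x => ‖Du x‖ ^ (2 * γ) * g₂ ‖Du x‖ ^ (2 * γ - 1)) Ω' ∧
    IntegrableOn (fun x => g₂ ‖Du x‖ * hessSq D2u x) Ω'

/-- Local minimizers of `∫_Ω f(x, Du) dx` in the a-priori smooth class, for the parameters of the
anisotropic integral, `γ = 1` and `g₂(t) = 1 + t^{q-2}`. -/
def IsSmoothLocalMinimizer {n : ℕ} (q : ℝ) (Ω : Set (E n)) (f : E n → E n → ℝ)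
    (u : E n → ℝ) (Du : E n → E n) (D2u : E n → Fin n → E n) : Prop :=
  IsLocalMinimizer Ω f u Du ∧ InSmoothClass 1 (fun t => 1 + t ^ (q - 2)) Ω u Du D2u

/-- The standing assumptions on `h = h(x, ξ)`: it is continuous on `Ω × ℝⁿ`, its gradient in `ξ`
exists and is locally Lipschitz on `Ω × ℝⁿ`, and the second derivatives `h_{ξᵢξⱼ}`, `h_{ξᵢxₖ}`
(which exist almost everywhere) satisfy the local `p`-ellipticity and growth conditions. -/
structure IsPElliptic {n : ℕ} (p : ℝ) (Ω : Set (E n)) (h : E n → E n → ℝ) : Prop where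
  continuousOn : ContinuousOn (fun z : E n × E n => h z.1 z.2) (Ω ×ˢ univ)
  differentiable : ∀ x ∈ Ω, Differentiable ℝ (h x)
  locallyLipschitz : LocallyLipschitzOn (Ω ×ˢ univ) (fun z : E n × E n => ∇ (h z.1) z.2)
  bounds : ∀ Ω', CompactlyContained Ω' Ω →
    ∃ c₁ c₂ c₃ : ℝ, 0 < c₁ ∧ 0 < c₂ ∧ 0 < c₃ ∧
      ∀ᵐ z : E n × E n, z.1 ∈ Ω' →
        (∀ v : E n,
          c₁ * ‖z.2‖ ^ (p - 2) * ‖v‖ ^ 2 ≤ inner ℝ (fderiv ℝ (∇ (h z.1)) z.2 v) v ∧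
          inner ℝ (fderiv ℝ (∇ (h z.1)) z.2 v) v ≤ c₂ * (1 + ‖z.2‖ ^ (p - 2)) * ‖v‖ ^ 2) ∧
        ∀ k : Fin n,
          ∑ i, |fderiv ℝ (fun y => ∇ (h y) z.2) z.1 (EuclideanSpace.single k 1) i|
            ≤ c₃ * ‖z.2‖ ^ (p - 1)

/-- `a = (aᵢⱼ)` has locally Lipschitz entries in `Ω` and is positive definite, uniformly on each
`Ω'` compactly contained in `Ω`. -/
def IsEllipticMatrix {n : ℕ} (Ω : Set (E n)) (a : E n → Matrix (Fin n) (Fin n) ℝ) : Prop :=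
  (∀ i j, LocallyLipschitzOn Ω (fun x => a x i j)) ∧
    ∀ Ω', CompactlyContained Ω' Ω →
      ∃ c₁ c₂ : ℝ, 0 < c₁ ∧ 0 < c₂ ∧ ∀ x ∈ Ω', ∀ v : E n,
        c₁ * ‖v‖ ^ 2 ≤ ∑ i, ∑ j, a x i j * v i * v j ∧
        ∑ i, ∑ j, a x i j * v i * v j ≤ c₂ * ‖v‖ ^ 2

/-- The integrand `h(x, ξ) + |ξₙ|^q`, where `ξₙ` is the last coordinate of `ξ`. -/
def anisotropicIntegrand {n : ℕ} (hn : 2 ≤ n) (q : ℝ) (h : E n → E n → ℝ) :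
    E n → E n → ℝ :=
  fun x ξ => h x ξ + |ξ ⟨n - 1, by omega⟩| ^ q

/-- Every local minimizer in the a-priori smooth class is (has a representative which is) locally
Lipschitz continuous in `Ω`. -/
def LocallyLipschitzMinimizers {n : ℕ} (q : ℝ) (Ω : Set (E n)) (f : E n → E n → ℝ) : Prop :=
  ∀ (u : E n → ℝ) (Du : E n → E n) (D2u : E n → Fin n → E n),
    IsSmoothLocalMinimizer q Ω f u Du D2u →
      ∃ v : E n → ℝ, LocallyLipschitzOn Ω v ∧ u =ᵐ[volume.restrict Ω] v

/-- The a-priori estimates on concentric balls contained in `Ω'`, with `g₁(t) = t^{p-2}`; exponents,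
radius and constant do not depend on the minimizer. -/
def UniformEstimates {n : ℕ} (p q : ℝ) (Ω Ω' : Set (E n)) (f : E n → E n → ℝ) : Prop :=
  ∃ θ₁ θ₂ θ₃ θ₄ R₀ c : ℝ, 1 < θ₁ ∧ 0 < θ₂ ∧ 1 < θ₃ ∧ 0 < θ₄ ∧ 0 < R₀ ∧ 0 < c ∧
    ∀ (u : E n → ℝ) (Du : E n → E n) (D2u : E n → Fin n → E n),
      IsSmoothLocalMinimizer q Ω f u Du D2u →
      ∀ (x₀ : E n) (ρ R : ℝ), 0 < ρ → ρ < R → R ≤ R₀ → Metric.ball x₀ R ⊆ Ω' →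
        eLpNorm Du ∞ (volume.restrict (Metric.ball x₀ ρ)) ^ 2 ≤
            ENNReal.ofReal (c / (R - ρ) ^ θ₂ *
              (∫ x in Metric.ball x₀ R, (1 + f x (Du x))) ^ θ₁) ∧
        ∫ x in Metric.ball x₀ ρ, ‖Du x‖ ^ (p - 2) * hessSq D2u x ≤
            c / (R - ρ) ^ θ₄ * (∫ x in Metric.ball x₀ R, (1 + f x (Du x))) ^ θ₃

end AnisotropicEnergy

end

/-! The proof is a Moser iteration for the differentiated Euler–Lagrange equation of A = D_ξ f,
arranged so that nothing beyond the a-priori class is used.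

Structure. The bounds on the second derivatives of h hold only almost everywhere. Integrated along
lines and extended by continuity they become inequalities between differences that hold everywhere
(`IsPElliptic.exists_structure`). With m = max(|ξ|,|η|) these are monotonicity, ⟨A(x,ξ)-A(x,η), ξ-η⟩
≥ c m^{p-2}|ξ-η|², and cocoercivity, |A(x,ξ)-A(x,η)|² ≤ C(1+m^{q-2})⟨A(x,ξ)-A(x,η), ξ-η⟩. The latter
replaces the Cauchy–Schwarz inequality for the quadratic form of the symmetric matrix D²_ξ f. The
term |ξ_n|^q is convex and independent of x: it harms neither monotonicity nor the growth |ξ|^{p-1}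
of differences in x, and only raises p to q in the cocoercivity. `GrowthField` records the outcome.

Caccioppoli inequality. By convexity in ξ, minimality gives the Euler–Lagrange equation. Its
difference quotient in direction e_s is tested with η² G(Δu), where G is the primitive of a
truncation of |·|^{2β}; cocoercivity absorbs the flux. With N = max(1,|u_1|,…,|u_n|) the result
(`SmoothSolution.caccioppoli`) is, up to the truncation, ∫_{B_ρ} |u_s|^{2β} |Du|^{p-2} |Du_s|² ≤ C
(R-ρ)^{-2} ∫_{B_R} N^{q+2β}. The truncation makes the test function admissible, and the right-hand
side is allowed to be infinite, so no higher integrability is presupposed.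

Gain and iteration. The Sobolev inequality with exponent 2σ, σ = m/(m-1), m > n/2, converts
integrability of N^{q+2β} into that of N^{σ(p+2β)} (`SmoothSolution.exists_gain`). An exponent α
thus becomes σ(α-(q-p)). Starting from q the exponents increase to infinity provided m(q-p) < q, and
the iteration (`ae_rpow_le_of_gain`) bounds sup N^d by C(R-ρ)^{-2m}(1+∫N^q), where d = q-m(q-p).

Interpolation. Writing N^q ≤ (sup N)^{q-p} N^p and iterating over increasing balls, sup N reappears
on the right with the power (q-p)/d, which is below 1 exactly when m(q-p) < p. Since sup N is
already known to be finite, the iteration closes (`exists_sup_bound`). Some m > n/2 with m(q-p) < p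
exists if and only if q/p < 1+2/n.

Conclusion. A bounded gradient gives a Lipschitz representative, which is (i). A positive lower
bound for 1+f upgrades to κ(1+|ξ|^p) ≤ 1+f, which turns p-energies into energies of f; the
Caccioppoli inequality with β = 0 supplies the second-derivative estimate of (ii). In (iii) the
quadratic form satisfies the hypotheses with p = 2 and the integrand is nonnegative. -/

noncomputable section

namespace AnisotropicEnergy

/-! ### Almost-everywhere derivative bounds along lines -/

section Lines

/-- Lipschitz functions are absolutely continuous, so a derivative bound known only almost
everywhere can be integrated. This is how the almost-everywhere ellipticity becomes usable. -/
lemma LipschitzOnWith.mul_le_sub_of_le_deriv {K : NNReal} {φ : ℝ → ℝ} {a b m : ℝ} (hab : a ≤ b)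
    (hφ : LipschitzOnWith K φ (Icc a b)) (h : ∀ᵐ τ, τ ∈ Icc a b → m ≤ deriv φ τ) :
    m * (b - a) ≤ φ b - φ a := by
  have hac : AbsolutelyContinuousOnInterval φ a b := by
    apply LipschitzOnWith.absolutelyContinuousOnInterval (K := K)
    rwa [uIcc_of_le hab]
  rw [← hac.integral_deriv_eq_sub]
  have : ∫ _ in a..b, m = m * (b - a) := by simp [mul_comm]
  rw [← this]
  apply intervalIntegral.integral_mono_ae_restrict hab (by simp) hac.intervalIntegrable_deriv
  exact (ae_restrict_iff' measurableSet_Icc).2 h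

lemma LipschitzOnWith.sub_le_mul_of_deriv_le {K : NNReal} {φ : ℝ → ℝ} {a b m : ℝ} (hab : a ≤ b)
    (hφ : LipschitzOnWith K φ (Icc a b)) (h : ∀ᵐ τ, τ ∈ Icc a b → deriv φ τ ≤ m) :
    φ b - φ a ≤ m * (b - a) := by
  have hac : AbsolutelyContinuousOnInterval φ a b := by
    apply LipschitzOnWith.absolutelyContinuousOnInterval (K := K)
    rwa [uIcc_of_le hab]
  rw [← hac.integral_deriv_eq_sub]
  have : ∫ _ in a..b, m = m * (b - a) := by simp [mul_comm]
  rw [← this]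
  apply intervalIntegral.integral_mono_ae_restrict hab hac.intervalIntegrable_deriv (by simp)
  exact (ae_restrict_iff' measurableSet_Icc).2 h

/-- An almost sure property holds almost everywhere along almost every line of given direction. -/
lemma ae_ae_line {n : ℕ} {P : E n → Prop} (hP : ∀ᵐ y, P y) (v : E n) :
    ∀ᵐ y : E n, ∀ᵐ τ : ℝ, P (y + τ • v) := by
  set S := toMeasurable volume {y | ¬ P y} with hS
  have hS0 : volume S = 0 := by rw [hS, measure_toMeasurable]; exact hP
  have hSm : MeasurableSet S := measurableSet_toMeasurable _ _
  have hm : MeasurableSet {z : ℝ × E n | z.2 + z.1 • v ∉ S} := by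
    apply MeasurableSet.compl
    exact (by fun_prop : Measurable fun z : ℝ × E n => z.2 + z.1 • v) hSm
  have h1 : ∀ τ : ℝ, ∀ᵐ y : E n, y + τ • v ∉ S := by
    intro τ
    have := (measurePreserving_add_right (volume : Measure (E n)) (τ • v)).quasiMeasurePreserving
    exact this.ae (measure_eq_zero_iff_ae_notMem.1 hS0)
  have h2 : ∀ᵐ z : ℝ × E n, z.2 + z.1 • v ∉ S :=
    (Measure.ae_prod_iff_ae_ae hm).2 (Filter.Eventually.of_forall h1)
  have h3 : ∀ᵐ z : E n × ℝ, z.1 + z.2 • v ∉ S := by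
    have := (Measure.measurePreserving_swap (μ := (volume : Measure (E n)))
      (ν := (volume : Measure ℝ))).quasiMeasurePreserving
    exact this.ae h2
  have h4 := Measure.ae_ae_of_ae_prod h3
  filter_upwards [h4] with y hy
  filter_upwards [hy] with τ hτ
  by_contra hc
  exact hτ (subset_toMeasurable _ _ hc)

end Lines

/-! ### Cocoercivity of monotone gradients -/

section Cocoercive

variable {n : ℕ} {F : E n → ℝ}

lemma hasDerivAt_line (hF : Differentiable ℝ F) (ξ v : E n) (τ : ℝ) :
    HasDerivAt (fun τ : ℝ => F (ξ + τ • v)) (inner ℝ (∇ F (ξ + τ • v)) v) τ := by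
  have h1 : HasDerivAt (fun τ : ℝ => ξ + τ • v) v τ := by
    simpa using ((hasDerivAt_id τ).smul_const v).const_add ξ
  have h2 := ((hF (ξ + τ • v)).hasGradientAt.hasFDerivAt).comp_hasDerivAt τ h1
  exact h2

lemma exists_mean_value (hF : Differentiable ℝ F) (ξ v : E n) :
    ∃ θ ∈ Ioo (0 : ℝ) 1, F (ξ + v) - F ξ = inner ℝ (∇ F (ξ + θ • v)) v := by
  have hd := hasDerivAt_line hF ξ v
  obtain ⟨θ, hθ, h⟩ := exists_hasDerivAt_eq_slope (fun τ : ℝ => F (ξ + τ • v))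
    (fun τ => inner ℝ (∇ F (ξ + τ • v)) v) zero_lt_one
    (fun τ _ => (hd τ).continuousAt.continuousWithinAt) (fun τ _ => hd τ)
  exact ⟨θ, hθ, by simpa using h.symm⟩

/-- A monotone gradient makes F convex, so F lies above its tangent planes: the gradient at the
intermediate point of the mean value theorem is compared with the one at ξ. -/
lemma inner_gradient_le_sub (hF : Differentiable ℝ F)
    (hmono : ∀ ξ η : E n, 0 ≤ inner ℝ (∇ F ξ - ∇ F η) (ξ - η)) (ξ v : E n) :
    inner ℝ (∇ F ξ) v ≤ F (ξ + v) - F ξ := by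
  obtain ⟨θ, ⟨h0, h1⟩, h⟩ := exists_mean_value hF ξ v
  rw [h]
  have := hmono (ξ + θ • v) ξ
  rw [add_sub_cancel_left, inner_smul_right, inner_sub_left] at this
  have := nonneg_of_mul_nonneg_right this h0
  linarith

/-- A gradient which is monotone and bounded above by a quadratic form on a ball
is cocoercive on the ball of a third of the radius. -/
lemma norm_sub_sq_le_mul_inner (hF : Differentiable ℝ F)
    (hmono : ∀ ξ η : E n, 0 ≤ inner ℝ (∇ F ξ - ∇ F η) (ξ - η)) {r L : ℝ} (hL : 0 < L)
    (hup : ∀ ξ η : E n, ‖ξ‖ ≤ 3 * r → ‖η‖ ≤ 3 * r →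
      inner ℝ (∇ F ξ - ∇ F η) (ξ - η) ≤ L * ‖ξ - η‖ ^ 2)
    {ξ η : E n} (hξ : ‖ξ‖ ≤ r) (hη : ‖η‖ ≤ r) :
    ‖∇ F ξ - ∇ F η‖ ^ 2 ≤ 4 * L * inner ℝ (∇ F ξ - ∇ F η) (ξ - η) := by
  set G := ∇ F ξ - ∇ F η with hG
  set P := inner ℝ G (ξ - η) with hP
  have hr : 0 ≤ r := (norm_nonneg _).trans hξ
  have hP0 : 0 ≤ P := hmono ξ η
  have hPL : P ≤ L * ‖ξ - η‖ ^ 2 := hup ξ η (by linarith) (by linarith)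
  have hd : ‖ξ - η‖ ≤ 2 * r := (norm_sub_le _ _).trans (by linarith)
  rcases eq_or_ne G 0 with h0 | h0
  · rw [h0]; simp; positivity
  have hGpos : 0 < ‖G‖ := norm_pos_iff.2 h0
  -- Step from ξ by a vector v of length τ in the direction -G. The tangent inequalities at η
  -- (evaluated at ξ + v) and at ξ (evaluated at η) bound F(ξ+v) - F(ξ) from below, the quadratic
  -- upper bound controls it from above. The intermediate point has norm at most r + τ ≤ 3r because
  -- ‖ξ-η‖ ≤ 2r; this is the reason for the radius 3r.
  have key : ∀ τ : ℝ, 0 ≤ τ → τ ≤ ‖ξ - η‖ → τ * ‖G‖ ≤ P + L * τ ^ 2 := by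
    intro τ hτ0 hτ1
    set v : E n := -(τ / ‖G‖) • G with hv
    have hvn : ‖v‖ = τ := by
      rw [hv, norm_smul, norm_neg, Real.norm_eq_abs, abs_of_nonneg (by positivity)]
      field_simp
    have hGv : inner ℝ G v = - (τ * ‖G‖) := by
      rw [hv, inner_smul_right, real_inner_self_eq_norm_sq]
      field_simp
    obtain ⟨θ, ⟨ht0, ht1⟩, hmv⟩ := exists_mean_value hF ξ v
    have hθv : ‖θ • v‖ ≤ τ := by
      rw [norm_smul, Real.norm_eq_abs, abs_of_pos ht0, hvn]
      nlinarith
    have h1 := hup (ξ + θ • v) ξ ((norm_add_le _ _).trans (by linarith)) (by linarith)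
    rw [add_sub_cancel_left, inner_smul_right, norm_smul, Real.norm_eq_abs, abs_of_pos ht0,
      hvn] at h1
    have h2 : inner ℝ (∇ F (ξ + θ • v) - ∇ F ξ) v ≤ L * τ ^ 2 := by
      have : θ * inner ℝ (∇ F (ξ + θ • v) - ∇ F ξ) v ≤ θ * (L * θ * τ ^ 2) := by
        calc _ ≤ _ := h1
          _ = _ := by ring
      have := le_of_mul_le_mul_left this ht0
      have h3 : L * θ * τ ^ 2 ≤ L * 1 * τ ^ 2 := by gcongr
      linarith
    rw [inner_sub_left] at h2
    have h3 := inner_gradient_le_sub hF hmono η (ξ + v - η)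
    have h4 := inner_gradient_le_sub hF hmono ξ (η - ξ)
    rw [add_sub_cancel] at h3 h4
    have h5 : inner ℝ (∇ F η) (ξ + v - η) = inner ℝ (∇ F η) (ξ - η) + inner ℝ (∇ F η) v := by
      rw [← inner_add_right]; congr 1; abel
    have h6 : inner ℝ (∇ F ξ) (η - ξ) = - inner ℝ (∇ F ξ) (ξ - η) := by
      rw [← inner_neg_right]; congr 1; abel
    rw [hG, inner_sub_left] at hGv
    rw [hP, hG, inner_sub_left]
    linarith
  -- The optimal step τ = ‖G‖/(2L) gives the claim. If it is not allowed then ‖G‖ > 2L‖ξ-η‖, and the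
  -- step τ = ‖ξ-η‖ contradicts P ≤ L‖ξ-η‖².
  rcases le_or_gt (‖G‖ / (2 * L)) ‖ξ - η‖ with hc | hc
  · have := key (‖G‖ / (2 * L)) (by positivity) hc
    have h2 : ‖G‖ / (2 * L) * ‖G‖ - L * (‖G‖ / (2 * L)) ^ 2 = ‖G‖ ^ 2 / (4 * L) := by
      field_simp; ring
    have h3 : ‖G‖ ^ 2 / (4 * L) ≤ P := by linarith
    rw [div_le_iff₀ (by positivity)] at h3
    linarith
  · exfalso
    have hdpos : 0 < ‖ξ - η‖ := by
      rw [norm_pos_iff, sub_ne_zero]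
      rintro rfl
      simp [hG] at h0
    have := key ‖ξ - η‖ (norm_nonneg _) le_rfl
    rw [lt_div_iff₀ (by positivity)] at hc
    nlinarith

end Cocoercive


/-! ### From Hessian bounds to bounds on differences -/

section Monotone

variable {n : ℕ}

/-- A strict violation would hold on a nonempty open set, which has positive measure. With
continuity this removes each "almost every" from the structure conditions. -/
lemma forall_of_ae_of_isClosed {X : Type*} [TopologicalSpace X] [MeasurableSpace X]
    {μ : Measure X} [μ.IsOpenPosMeasure] {U : Set X} (hU : IsOpen U) {f g : X → ℝ}
    (hf : ContinuousOn f U) (hg : ContinuousOn g U) (h : ∀ᵐ x ∂μ, x ∈ U → f x ≤ g x) :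
    ∀ x ∈ U, f x ≤ g x := by
  by_contra! hc
  obtain ⟨x, hx, hlt⟩ := hc
  have ho : IsOpen (U ∩ {y | g y < f y}) := by
    have := (hf.sub hg).isOpen_inter_preimage hU (isOpen_Ioi (a := (0 : ℝ)))
    convert this using 2
    ext y; simp
  have hpos := ho.measure_pos μ ⟨x, hx, hlt⟩
  have : μ (U ∩ {y | g y < f y}) = 0 := by
    refine measure_mono_null ?_ h
    rintro y ⟨hy, hyl⟩
    simp only [mem_compl_iff, mem_ofPred_eq, not_forall, not_le]
    exact ⟨hy, hyl⟩
  exact hpos.ne' this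

/-- Along almost every line in direction v the derivative of ⟨B(ξ+τv), v⟩ is the quadratic form of
DB. For the upper bound, |ξ+τv| never exceeds the larger endpoint norm M. For the lower bound, |v| ≤
2M, so on the quarter of the segment next to the longer endpoint |ξ+τv| ≥ M/2, while the rest
contributes nonnegatively; hence the constant c₁/4 (1/2)^{p-2}. Continuity then covers all ξ. -/
lemma inner_bounds_of_ae_fderiv [NeZero n] {B : E n → E n} (hB : LocallyLipschitz B) {p c₁ c₂ : ℝ}
    (hp : 2 ≤ p) (hc₁ : 0 < c₁) (hc₂ : 0 < c₂)
    (hae : ∀ᵐ ξ, ∀ v : E n, c₁ * ‖ξ‖ ^ (p - 2) * ‖v‖ ^ 2 ≤ inner ℝ (fderiv ℝ B ξ v) v ∧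
      inner ℝ (fderiv ℝ B ξ v) v ≤ c₂ * (1 + ‖ξ‖ ^ (p - 2)) * ‖v‖ ^ 2) (ξ v : E n) :
    c₁ / 4 * (1 / 2) ^ (p - 2) * max ‖ξ‖ ‖ξ + v‖ ^ (p - 2) * ‖v‖ ^ 2 ≤
        inner ℝ (B (ξ + v) - B ξ) v ∧
      inner ℝ (B (ξ + v) - B ξ) v ≤ c₂ * (1 + max ‖ξ‖ ‖ξ + v‖ ^ (p - 2)) * ‖v‖ ^ 2 := by
  rcases eq_or_ne v 0 with rfl | hv
  · simp
  have hp2 : 0 ≤ p - 2 := by linarith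
  have hBc : Continuous B := hB.continuous
  have hne : ∀ᵐ ξ : E n, ξ ≠ 0 := by
    have : volume ({0} : Set (E n)) = 0 := measure_singleton _
    exact measure_eq_zero_iff_ae_notMem.1 this
  have hgood : ∀ᵐ ξ : E n, ∀ᵐ τ : ℝ,
      HasDerivAt (fun τ : ℝ => inner ℝ (B (ξ + τ • v)) v)
        (inner ℝ (fderiv ℝ B (ξ + τ • v) v) v) τ ∧
      c₁ * ‖ξ + τ • v‖ ^ (p - 2) * ‖v‖ ^ 2 ≤ inner ℝ (fderiv ℝ B (ξ + τ • v) v) v ∧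
      inner ℝ (fderiv ℝ B (ξ + τ • v) v) v ≤ c₂ * (1 + ‖ξ + τ • v‖ ^ (p - 2)) * ‖v‖ ^ 2 := by
    filter_upwards [ae_ae_line (hae.and hne) v] with ξ hξ
    filter_upwards [hξ] with τ ⟨hτ, hτ0⟩
    refine ⟨?_, (hτ v).1, (hτ v).2⟩
    -- The ellipticity itself forces differentiability away from the origin: at a point of
    -- non-differentiability `fderiv` is 0 by convention, which contradicts the positive lower
    -- bound.
    have hd : DifferentiableAt ℝ B (ξ + τ • v) := by
      by_contra hnd
      have h1 := (hτ v).1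
      rw [fderiv_zero_of_not_differentiableAt hnd] at h1
      simp only [zero_apply, inner_zero_left] at h1
      have h2 : 0 < ‖ξ + τ • v‖ := norm_pos_iff.2 hτ0
      have h3 : 0 < ‖v‖ := norm_pos_iff.2 hv
      have : 0 < c₁ * ‖ξ + τ • v‖ ^ (p - 2) * ‖v‖ ^ 2 := by positivity
      linarith
    have h1 : HasDerivAt (fun τ : ℝ => ξ + τ • v) v τ := by
      simpa using ((hasDerivAt_id τ).smul_const v).const_add ξ
    have h2 := hd.hasFDerivAt.comp_hasDerivAt τ h1
    simpa using h2.inner ℝ (hasDerivAt_const τ v)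
  have hlip : ∀ ξ : E n, ∃ K, LipschitzOnWith K (fun τ : ℝ => inner ℝ (B (ξ + τ • v)) v) (Icc 0 1) := by
    intro ξ
    apply LocallyLipschitzOn.exists_lipschitzOnWith_of_compact isCompact_Icc
    apply LocallyLipschitz.locallyLipschitzOn
    have h1 : LocallyLipschitz (fun τ : ℝ => ξ + τ • v) := by
      have : ContDiff ℝ 1 (fun τ : ℝ => ξ + τ • v) := by fun_prop
      exact this.locallyLipschitz
    have h2 : LocallyLipschitz (fun w : E n => inner ℝ w v) := by
      have : ContDiff ℝ 1 (fun w : E n => inner ℝ w v) := contDiff_id.inner ℝ contDiff_const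
      exact this.locallyLipschitz
    exact h2.comp (hB.comp h1)
  constructor
  · refine forall_of_ae_of_isClosed (μ := volume) (U := univ) isOpen_univ
      (f := fun ξ => c₁ / 4 * (1 / 2) ^ (p - 2) * max ‖ξ‖ ‖ξ + v‖ ^ (p - 2) * ‖v‖ ^ 2)
      (g := fun ξ => inner ℝ (B (ξ + v) - B ξ) v) ?_ ?_ ?_ ξ (mem_univ _)
    · apply Continuous.continuousOn
      have : Continuous fun ξ : E n => max ‖ξ‖ ‖ξ + v‖ ^ (p - 2) :=
        (by fun_prop : Continuous fun ξ : E n => max ‖ξ‖ ‖ξ + v‖).rpow_const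
          (fun _ => Or.inr hp2)
      fun_prop
    · apply Continuous.continuousOn
      fun_prop
    · filter_upwards [hgood] with ξ hξ _
      obtain ⟨K, hK⟩ := hlip ξ
      set φ := fun τ : ℝ => inner ℝ (B (ξ + τ • v)) v with hφ
      have hmono : ∀ a b : ℝ, 0 ≤ a → a ≤ b → b ≤ 1 → ∀ M : ℝ, 0 ≤ M →
          (∀ τ ∈ Icc a b, M ≤ ‖ξ + τ • v‖) →
          c₁ * M ^ (p - 2) * ‖v‖ ^ 2 * (b - a) ≤ φ b - φ a := by
        intro a b ha hab hb M hM hMle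
        apply LipschitzOnWith.mul_le_sub_of_le_deriv hab (hK.mono (Icc_subset_Icc ha hb))
        filter_upwards [hξ] with τ ⟨h1, h2, _⟩ hτ
        rw [h1.deriv]
        refine le_trans ?_ h2
        have := hMle τ hτ
        gcongr
      have h0 : φ 0 = inner ℝ (B ξ) v := by simp [hφ]
      have h1 : φ 1 = inner ℝ (B (ξ + v)) v := by simp [hφ]
      have hnn : ∀ a b : ℝ, 0 ≤ a → a ≤ b → b ≤ 1 → 0 ≤ φ b - φ a := by
        intro a b ha hab hb
        refine le_trans ?_ (hmono a b ha hab hb 0 le_rfl (fun _ _ => norm_nonneg _))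
        have : 0 ≤ b - a := by linarith
        positivity
      rw [inner_sub_left, ← h0, ← h1]
      set M := max ‖ξ‖ ‖ξ + v‖ with hM
      have hM0 : 0 ≤ M := le_max_of_le_left (norm_nonneg _)
      have hvM : ‖v‖ ≤ 2 * M := by
        have : v = (ξ + v) - ξ := by abel
        calc ‖v‖ = ‖(ξ + v) - ξ‖ := by rw [← this]
          _ ≤ ‖ξ + v‖ + ‖ξ‖ := norm_sub_le _ _
          _ ≤ 2 * M := by
            have := le_max_left ‖ξ‖ ‖ξ + v‖
            have := le_max_right ‖ξ‖ ‖ξ + v‖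
            linarith
      have e1 : c₁ / 4 * (1 / 2) ^ (p - 2) * M ^ (p - 2) * ‖v‖ ^ 2
          = c₁ * (1 / 2 * M) ^ (p - 2) * ‖v‖ ^ 2 * (1 / 4) := by
        rw [Real.mul_rpow (by norm_num) hM0]; ring
      rw [e1]
      rcases le_total ‖ξ + v‖ ‖ξ‖ with hle | hle
      · have hMe : M = ‖ξ‖ := max_eq_left hle
        have := hmono 0 (1 / 4) le_rfl (by norm_num) (by norm_num) (1 / 2 * M) (by positivity) (by
          intro τ ⟨ht0, ht1⟩
          have h2 : ‖ξ‖ ≤ ‖ξ + τ • v‖ + ‖τ • v‖ := by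
            simpa using norm_sub_le (ξ + τ • v) (τ • v)
          rw [norm_smul, Real.norm_eq_abs, abs_of_nonneg ht0] at h2
          nlinarith [norm_nonneg v])
        have h3 := hnn (1 / 4) 1 (by norm_num) (by norm_num) le_rfl
        rw [sub_zero] at this
        linarith
      · have hMe : M = ‖ξ + v‖ := max_eq_right hle
        have := hmono (3 / 4) 1 (by norm_num) (by norm_num) le_rfl (1 / 2 * M) (by positivity) (by
          intro τ ⟨ht0, ht1⟩
          have h2 : ‖ξ + v‖ ≤ ‖ξ + τ • v‖ + ‖(1 - τ) • v‖ := by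
            have : ξ + v = (ξ + τ • v) + (1 - τ) • v := by rw [sub_smul, one_smul]; abel
            calc ‖ξ + v‖ = ‖(ξ + τ • v) + (1 - τ) • v‖ := by rw [← this]
              _ ≤ _ := norm_add_le _ _
          rw [norm_smul, Real.norm_eq_abs, abs_of_nonneg (by linarith)] at h2
          nlinarith [norm_nonneg v])
        have h3 := hnn 0 (3 / 4) le_rfl (by norm_num) (by norm_num)
        have h4 : (1 : ℝ) - 3 / 4 = 1 / 4 := by norm_num
        rw [h4] at this
        linarith
  · refine forall_of_ae_of_isClosed (μ := volume) (U := univ) isOpen_univ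
      (f := fun ξ => inner ℝ (B (ξ + v) - B ξ) v)
      (g := fun ξ => c₂ * (1 + max ‖ξ‖ ‖ξ + v‖ ^ (p - 2)) * ‖v‖ ^ 2) ?_ ?_ ?_ ξ (mem_univ _)
    · apply Continuous.continuousOn
      fun_prop
    · apply Continuous.continuousOn
      have : Continuous fun ξ : E n => max ‖ξ‖ ‖ξ + v‖ ^ (p - 2) :=
        (by fun_prop : Continuous fun ξ : E n => max ‖ξ‖ ‖ξ + v‖).rpow_const
          (fun _ => Or.inr hp2)
      fun_prop
    · filter_upwards [hgood] with ξ hξ _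
      obtain ⟨K, hK⟩ := hlip ξ
      have := LipschitzOnWith.sub_le_mul_of_deriv_le (m := c₂ * (1 + max ‖ξ‖ ‖ξ + v‖ ^ (p - 2)) * ‖v‖ ^ 2)
        zero_le_one hK (by
          filter_upwards [hξ] with τ ⟨h1, _, h2⟩ ⟨ht0, ht1⟩
          rw [h1.deriv]
          refine h2.trans ?_
          have h3 : ‖ξ + τ • v‖ ≤ max ‖ξ‖ ‖ξ + v‖ := by
            have : ξ + τ • v = (1 - τ) • ξ + τ • (ξ + v) := by
              rw [sub_smul, one_smul, smul_add]; abel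
            rw [this]
            refine (norm_add_le _ _).trans ?_
            rw [norm_smul, norm_smul, Real.norm_eq_abs, Real.norm_eq_abs,
              abs_of_nonneg ht0, abs_of_nonneg (by linarith : 0 ≤ 1 - τ)]
            have := le_max_left ‖ξ‖ ‖ξ + v‖
            have := le_max_right ‖ξ‖ ‖ξ + v‖
            nlinarith
          gcongr)
      simpa [inner_sub_left] using this

end Monotone

/-! ### Lipschitz dependence on x -/

section SpatialLipschitz

variable {n : ℕ}

lemma norm_le_sum_abs (v : E n) : ‖v‖ ≤ ∑ i, |v i| := by
  have h : ‖v‖ ^ 2 ≤ (∑ i, |v i|) ^ 2 := by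
    rw [EuclideanSpace.norm_sq_eq]
    simpa using Finset.sum_sq_le_sq_sum_of_nonneg (s := Finset.univ) (f := fun i => |v i|)
      (fun i _ => abs_nonneg _)
  exact le_of_sq_le_sq h (Finset.sum_nonneg fun i _ => abs_nonneg _)

lemma abs_apply_le_norm (v : E n) (i : Fin n) : |v i| ≤ ‖v‖ := by
  simpa using PiLp.norm_apply_le v i

/-- Each coordinate of B is integrated along almost every segment parallel to the k-th axis; summing
the n coordinate bounds produces the factor n. Restricting to a ball keeps the whole segment inside
Ω' by convexity. -/
lemma norm_sub_le_of_ae_fderiv {Ω' : Set (E n)} (hΩ' : IsOpen Ω') {B : E n → E n} {K : NNReal}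
    (hB : LipschitzOnWith K B Ω') {M : ℝ} (k : Fin n)
    (hae : ∀ᵐ x, x ∈ Ω' →
      ∑ i, |fderiv ℝ B x (EuclideanSpace.single k 1) i| ≤ M)
    {x₀ : E n} {R : ℝ} (hR : Metric.ball x₀ R ⊆ Ω') {x : E n} {t : ℝ}
    (hx : x ∈ Metric.ball x₀ R) (hxt : x + t • EuclideanSpace.single k 1 ∈ Metric.ball x₀ R) :
    ‖B (x + t • EuclideanSpace.single k 1) - B x‖ ≤ n * (M * |t|) := by
  set e : E n := EuclideanSpace.single k 1 with he
  set U : Set (E n) := Metric.ball x₀ R ∩ (fun y => y + t • e) ⁻¹' Metric.ball x₀ R with hU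
  have hUo : IsOpen U := Metric.isOpen_ball.inter (Metric.isOpen_ball.preimage (by fun_prop))
  have hBc : ContinuousOn B Ω' := hB.continuousOn
  -- An upper bound on `fderiv` is compatible with its default value 0, so here differentiability
  -- has to come from Rademacher's theorem.
  have hdiff : ∀ᵐ x, x ∈ Ω' → DifferentiableAt ℝ B x := by
    have := (ae_restrict_iff' hΩ'.measurableSet).1 (hB.ae_differentiableWithinAt (μ := volume) hΩ'.measurableSet)
    filter_upwards [this] with x hx hxΩ
    exact (hx hxΩ).differentiableAt (hΩ'.mem_nhds hxΩ)
  have hline := ae_ae_line (hdiff.and hae) (t • e)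
  have hseg : ∀ y ∈ U, ∀ τ ∈ Icc (0 : ℝ) 1, y + τ • (t • e) ∈ Ω' := by
    intro y hy τ hτ
    apply hR
    have := (convex_ball x₀ R).add_smul_sub_mem hy.1 hy.2 hτ
    simpa using this
  have hcoord : ∀ i, ∀ y ∈ U, |B (y + t • e) i - B y i| ≤ M * |t| := by
    intro i
    refine forall_of_ae_of_isClosed (μ := volume) hUo (f := fun y => |B (y + t • e) i - B y i|)
      (g := fun _ => M * |t|) ?_ continuousOn_const ?_
    · have h1 : ContinuousOn (fun y => B (y + t • e)) U :=
        hBc.comp (by fun_prop) (fun y hy => hR hy.2)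
      have h2 : ContinuousOn B U := hBc.mono (fun y hy => hR hy.1)
      have hi : Continuous fun v : E n => v i := by fun_prop
      exact ((hi.comp_continuousOn h1).sub (hi.comp_continuousOn h2)).abs
    · filter_upwards [hline] with y hy hyU
      have hlip : LipschitzOnWith (K * ‖t • e‖₊) (fun τ : ℝ => B (y + τ • (t • e)) i) (Icc 0 1) := by
        apply LipschitzOnWith.of_dist_le_mul
        intro a ha b hb
        have h1 := hB.dist_le_mul _ (hseg y hyU a ha) _ (hseg y hyU b hb)
        have h2 : dist (B (y + a • (t • e)) i) (B (y + b • (t • e)) i)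
            ≤ dist (B (y + a • (t • e))) (B (y + b • (t • e))) := by
          rw [Real.dist_eq, dist_eq_norm]
          exact abs_apply_le_norm (B (y + a • (t • e)) - B (y + b • (t • e))) i
        refine h2.trans (h1.trans ?_)
        rw [dist_add_left, dist_eq_norm, ← sub_smul, norm_smul]
        push_cast
        rw [Real.dist_eq, Real.norm_eq_abs]
        exact le_of_eq (by ring)
      have hder : ∀ᵐ τ : ℝ, τ ∈ Icc (0 : ℝ) 1 →
          |deriv (fun τ : ℝ => B (y + τ • (t • e)) i) τ| ≤ M * |t| := by
        filter_upwards [hy] with τ ⟨h1, h2⟩ hτ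
        have hm := hseg y hyU τ hτ
        have hl : HasDerivAt (fun τ : ℝ => y + τ • (t • e)) (t • e) τ := by
          simpa using ((hasDerivAt_id τ).smul_const (t • e)).const_add y
        have h3 := (h1 hm).hasFDerivAt.comp_hasDerivAt τ hl
        have h4 : HasDerivAt (fun τ : ℝ => B (y + τ • (t • e)) i)
            ((fderiv ℝ B (y + τ • (t • e)) (t • e)) i) τ :=
          (EuclideanSpace.proj (𝕜 := ℝ) i : E n →L[ℝ] ℝ).hasFDerivAt.comp_hasDerivAt τ h3
        rw [h4.deriv, map_smul, PiLp.smul_apply, smul_eq_mul, abs_mul, mul_comm]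
        gcongr
        refine le_trans ?_ (h2 hm)
        exact Finset.single_le_sum
          (f := fun i => |(fderiv ℝ B (y + τ • (t • e)) (EuclideanSpace.single k 1)) i|)
          (fun i _ => abs_nonneg _) (Finset.mem_univ i)
      have hu := LipschitzOnWith.sub_le_mul_of_deriv_le (m := M * |t|) zero_le_one hlip (by
        filter_upwards [hder] with τ h hτ using (abs_le.1 (h hτ)).2)
      have hl := LipschitzOnWith.mul_le_sub_of_le_deriv (m := -(M * |t|)) zero_le_one hlip (by
        filter_upwards [hder] with τ h hτ using (abs_le.1 (h hτ)).1)
      simp only [zero_smul, add_zero, one_smul, sub_zero, mul_one] at hu hl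
      exact abs_le.2 ⟨hl, hu⟩
  calc ‖B (x + t • e) - B x‖ ≤ ∑ i, |(B (x + t • e) - B x) i| := norm_le_sum_abs _
    _ ≤ ∑ _i : Fin n, M * |t| := Finset.sum_le_sum fun i _ => hcoord i x ⟨hx, hxt⟩
    _ = n * (M * |t|) := by simp

end SpatialLipschitz

/-! ### Structure conditions for h -/

section Structure

variable {n : ℕ}

/-- Everything later uses h only through pointwise inequalities of this kind, in which no second
derivative appears. Monotonicity comes from the Hessian bound along lines, cocoercivity from
`norm_sub_sq_le_mul_inner`, the x-dependence from the mixed derivatives, and the bounds at ξ = 0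
from compactness of the closure of Ω'. -/
lemma IsPElliptic.exists_structure [NeZero n] {p : ℝ} (hp : 2 ≤ p) {Ω : Set (E n)}
    {h : E n → E n → ℝ} (hh : IsPElliptic p Ω h) {Ω' : Set (E n)}
    (hΩ' : CompactlyContained Ω' Ω) :
    ∃ c C : ℝ, 0 < c ∧ 0 < C ∧
      (∀ x ∈ Ω', ∀ ξ η : E n, c * max ‖ξ‖ ‖η‖ ^ (p - 2) * ‖ξ - η‖ ^ 2 ≤
        inner ℝ (∇ (h x) ξ - ∇ (h x) η) (ξ - η)) ∧
      (∀ x ∈ Ω', ∀ ξ η : E n, ‖∇ (h x) ξ - ∇ (h x) η‖ ^ 2 ≤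
        C * (1 + max ‖ξ‖ ‖η‖ ^ (p - 2)) * inner ℝ (∇ (h x) ξ - ∇ (h x) η) (ξ - η)) ∧
      (∀ x₀ R, Metric.ball x₀ R ⊆ Ω' → ∀ (k : Fin n) (t : ℝ), ∀ x ∈ Metric.ball x₀ R,
        x + t • EuclideanSpace.single k 1 ∈ Metric.ball x₀ R → ∀ ξ : E n,
        ‖∇ (h (x + t • EuclideanSpace.single k 1)) ξ - ∇ (h x) ξ‖ ≤ C * ‖ξ‖ ^ (p - 1) * |t|) ∧
      (∀ x ∈ Ω', ‖∇ (h x) 0‖ ≤ C ∧ |h x 0| ≤ C) := by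
  obtain ⟨ho, hcpt, hsub⟩ := hΩ'
  obtain ⟨c₁, c₂, c₃, hc₁, hc₂, hc₃, hae⟩ := hh.bounds Ω' ⟨ho, hcpt, hsub⟩
  have hp2 : 0 ≤ p - 2 := by linarith
  have hΩsub : Ω' ⊆ Ω := subset_closure.trans hsub
  have hAc : ContinuousOn (fun z : E n × E n => ∇ (h z.1) z.2) (Ω ×ˢ univ) :=
    hh.locallyLipschitz.continuousOn
  have hAx : ∀ ξ : E n, ContinuousOn (fun x => ∇ (h x) ξ) Ω := fun ξ =>
    hAc.comp (f := fun x : E n => (x, ξ)) (by fun_prop) (fun x hx => ⟨hx, mem_univ _⟩)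
  have hlipξ : ∀ x ∈ Ω, LocallyLipschitz (fun ξ => ∇ (h x) ξ) := by
    intro x hx ξ
    obtain ⟨K, t, ht, hK⟩ := hh.locallyLipschitz (x := (x, ξ)) ⟨hx, mem_univ _⟩
    refine ⟨K, (fun η : E n => (x, η)) ⁻¹' t, ?_, ?_⟩
    · have h1 : Filter.Tendsto (fun η : E n => (x, η)) (nhds ξ) (nhdsWithin (x, ξ) (Ω ×ˢ univ)) := by
        apply tendsto_nhdsWithin_of_tendsto_nhds_of_eventually_within
        · exact (Continuous.prodMk_right x).tendsto ξ
        · exact Filter.Eventually.of_forall fun η => ⟨hx, mem_univ _⟩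
      exact h1 ht
    · intro a ha b hb
      have := hK ha hb
      simpa [Prod.edist_eq] using this
  have hlipx : ∀ ξ : E n, ∃ K, LipschitzOnWith K (fun x => ∇ (h x) ξ) Ω' := by
    intro ξ
    have hc : IsCompact (closure Ω' ×ˢ ({ξ} : Set (E n))) := hcpt.prod isCompact_singleton
    obtain ⟨K, hK⟩ := LocallyLipschitzOn.exists_lipschitzOnWith_of_compact hc
      (hh.locallyLipschitz.mono (prod_mono hsub (subset_univ _)))
    refine ⟨K, fun a ha b hb => ?_⟩
    have := hK (x := (a, ξ)) ⟨subset_closure ha, rfl⟩ (y := (b, ξ)) ⟨subset_closure hb, rfl⟩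
    simpa [Prod.edist_eq] using this
  -- monotonicity and upper bounds for all `x`
  have hboth : ∀ ξ v : E n, ∀ x ∈ Ω',
      c₁ / 4 * (1 / 2) ^ (p - 2) * max ‖ξ‖ ‖ξ + v‖ ^ (p - 2) * ‖v‖ ^ 2 ≤
        inner ℝ (∇ (h x) (ξ + v) - ∇ (h x) ξ) v ∧
      inner ℝ (∇ (h x) (ξ + v) - ∇ (h x) ξ) v ≤
        c₂ * (1 + max ‖ξ‖ ‖ξ + v‖ ^ (p - 2)) * ‖v‖ ^ 2 := by
    intro ξ v
    have hx : ∀ᵐ x, x ∈ Ω' →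
      c₁ / 4 * (1 / 2) ^ (p - 2) * max ‖ξ‖ ‖ξ + v‖ ^ (p - 2) * ‖v‖ ^ 2 ≤
        inner ℝ (∇ (h x) (ξ + v) - ∇ (h x) ξ) v ∧
      inner ℝ (∇ (h x) (ξ + v) - ∇ (h x) ξ) v ≤
        c₂ * (1 + max ‖ξ‖ ‖ξ + v‖ ^ (p - 2)) * ‖v‖ ^ 2 := by
      filter_upwards [Measure.ae_ae_of_ae_prod hae] with x hx hxΩ
      exact inner_bounds_of_ae_fderiv (hlipξ x (hΩsub hxΩ)) hp hc₁ hc₂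
        (by filter_upwards [hx] with ζ hζ using (hζ hxΩ).1) ξ v
    have hcont : ContinuousOn (fun x => inner ℝ (∇ (h x) (ξ + v) - ∇ (h x) ξ) v) Ω' :=
      (((hAx (ξ + v)).sub (hAx ξ)).inner continuousOn_const).mono hΩsub
    intro x hxΩ
    exact ⟨forall_of_ae_of_isClosed (μ := volume) ho
        (f := fun _ => c₁ / 4 * (1 / 2) ^ (p - 2) * max ‖ξ‖ ‖ξ + v‖ ^ (p - 2) * ‖v‖ ^ 2)
        continuousOn_const hcont
        (by filter_upwards [hx] with y hy hyΩ using (hy hyΩ).1) x hxΩ,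
      forall_of_ae_of_isClosed (μ := volume) ho
        (g := fun _ => c₂ * (1 + max ‖ξ‖ ‖ξ + v‖ ^ (p - 2)) * ‖v‖ ^ 2)
        hcont continuousOn_const
        (by filter_upwards [hx] with y hy hyΩ using (hy hyΩ).2) x hxΩ⟩
  have hlow : ∀ x ∈ Ω', ∀ ξ η : E n,
      c₁ / 4 * (1 / 2) ^ (p - 2) * max ‖ξ‖ ‖η‖ ^ (p - 2) * ‖ξ - η‖ ^ 2 ≤
        inner ℝ (∇ (h x) ξ - ∇ (h x) η) (ξ - η) := by
    intro x hx ξ η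
    have := (hboth η (ξ - η) x hx).1
    rwa [add_sub_cancel, max_comm] at this
  have hup : ∀ x ∈ Ω', ∀ ξ η : E n, inner ℝ (∇ (h x) ξ - ∇ (h x) η) (ξ - η) ≤
      c₂ * (1 + max ‖ξ‖ ‖η‖ ^ (p - 2)) * ‖ξ - η‖ ^ 2 := by
    intro x hx ξ η
    have := (hboth η (ξ - η) x hx).2
    rwa [add_sub_cancel, max_comm] at this
  obtain ⟨M₁, hM₁⟩ := hcpt.exists_bound_of_continuousOn ((hAx 0).mono hsub)
  obtain ⟨M₂, hM₂⟩ := hcpt.exists_bound_of_continuousOn (f := fun x => h x 0)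
    ((hh.continuousOn.comp (f := fun x : E n => (x, (0 : E n))) (by fun_prop)
      (fun x hx => ⟨hx, mem_univ _⟩)).mono hsub)
  set C := 4 * c₂ * 3 ^ (p - 2) + n * c₃ + |M₁| + |M₂| with hC
  have hC1 : 4 * c₂ * 3 ^ (p - 2) ≤ C := by
    have : 0 ≤ n * c₃ + |M₁| + |M₂| := by positivity
    linarith
  have hC2 : n * c₃ ≤ C := by
    have : 0 ≤ 4 * c₂ * 3 ^ (p - 2) + |M₁| + |M₂| := by positivity
    linarith
  have hC3 : |M₁| ≤ C := by
    have : 0 ≤ 4 * c₂ * 3 ^ (p - 2) + n * c₃ + |M₂| := by positivity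
    linarith
  have hC4 : |M₂| ≤ C := by
    have : 0 ≤ 4 * c₂ * 3 ^ (p - 2) + n * c₃ + |M₁| := by positivity
    linarith
  refine ⟨c₁ / 4 * (1 / 2) ^ (p - 2), C, by positivity, by positivity, hlow, ?_, ?_, ?_⟩
  · intro x hx ξ η
    set r := max ‖ξ‖ ‖η‖ with hr
    have hr0 : 0 ≤ r := le_max_of_le_left (norm_nonneg _)
    have hmono : ∀ ξ η : E n, 0 ≤ inner ℝ (∇ (h x) ξ - ∇ (h x) η) (ξ - η) := fun ξ η =>
      le_trans (by positivity) (hlow x hx ξ η)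
    -- The quadratic upper bound is needed on the ball of radius 3r, which costs the factor 3^{p-2}
    -- contained in C.
    have := norm_sub_sq_le_mul_inner (hh.differentiable x (hΩsub hx)) hmono
      (r := r) (L := c₂ * (1 + (3 * r) ^ (p - 2))) (by positivity) (by
        intro a b ha hb
        refine (hup x hx a b).trans ?_
        have : max ‖a‖ ‖b‖ ≤ 3 * r := max_le ha hb
        gcongr) (le_max_left _ _) (le_max_right ‖ξ‖ ‖η‖)
    refine this.trans ?_
    refine mul_le_mul_of_nonneg_right ?_ (hmono ξ η)
    have h3 : (1 : ℝ) ≤ 3 ^ (p - 2) := Real.one_le_rpow (by norm_num) hp2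
    rw [Real.mul_rpow (by norm_num) hr0]
    calc 4 * (c₂ * (1 + 3 ^ (p - 2) * r ^ (p - 2)))
        ≤ 4 * (c₂ * (3 ^ (p - 2) + 3 ^ (p - 2) * r ^ (p - 2))) := by gcongr
      _ = (4 * c₂ * 3 ^ (p - 2)) * (1 + r ^ (p - 2)) := by ring
      _ ≤ C * (1 + r ^ (p - 2)) := by gcongr
  · intro x₀ R hR k t x hx hxt
    -- The product null set is sliced in the other order: for almost every fixed ξ the bound holds
    -- for almost every x. Continuity in ξ then gives all ξ.
    have hae' : ∀ᵐ ξ : E n, ∀ᵐ x : E n, x ∈ Ω' →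
        ∑ i, |fderiv ℝ (fun y => ∇ (h y) ξ) x (EuclideanSpace.single k 1) i|
          ≤ c₃ * ‖ξ‖ ^ (p - 1) := by
      have hsw : ∀ᵐ z : E n × E n, z.2 ∈ Ω' →
          ∑ i, |fderiv ℝ (fun y => ∇ (h y) z.1) z.2 (EuclideanSpace.single k 1) i|
            ≤ c₃ * ‖z.1‖ ^ (p - 1) := by
        have hq := (Measure.measurePreserving_swap (μ := (volume : Measure (E n)))
          (ν := (volume : Measure (E n)))).quasiMeasurePreserving
        filter_upwards [hq.ae hae] with z hz hzΩ using (hz hzΩ).2 k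
      exact Measure.ae_ae_of_ae_prod hsw
    have hcont : ∀ y ∈ Ω, Continuous (fun ξ : E n => ∇ (h y) ξ) := fun y hy =>
      (hlipξ y hy).continuous
    have hx' : x ∈ Ω := hΩsub (hR hx)
    have hxt' := hΩsub (hR hxt)
    intro ξ
    refine forall_of_ae_of_isClosed (μ := volume) (U := univ) isOpen_univ
      (f := fun ξ => ‖∇ (h (x + t • EuclideanSpace.single k 1)) ξ - ∇ (h x) ξ‖)
      (g := fun ξ => C * ‖ξ‖ ^ (p - 1) * |t|)
      (((hcont _ hxt').sub (hcont _ hx')).norm.continuousOn) ?_ ?_ ξ (mem_univ _)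
    · apply Continuous.continuousOn
      have : Continuous fun ξ : E n => ‖ξ‖ ^ (p - 1) :=
        continuous_norm.rpow_const fun _ => Or.inr (by linarith)
      fun_prop
    · filter_upwards [hae'] with ξ hξ _
      obtain ⟨K, hK⟩ := hlipx ξ
      refine (norm_sub_le_of_ae_fderiv ho hK k hξ hR hx hxt).trans ?_
      calc n * (c₃ * ‖ξ‖ ^ (p - 1) * |t|) = (n * c₃) * ‖ξ‖ ^ (p - 1) * |t| := by ring
        _ ≤ C * ‖ξ‖ ^ (p - 1) * |t| := by gcongr
  · intro x hx
    exact ⟨(hM₁ x (subset_closure hx)).trans ((le_abs_self _).trans hC3),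
      (hM₂ x (subset_closure hx)).trans ((le_abs_self _).trans hC4)⟩

end Structure

/-! ### The derivative of |r|^q -/

section Power

/-- Bernoulli's inequality for y/x, multiplied by x^a. -/
lemma rpow_sub_rpow_le {a x y : ℝ} (ha : 1 ≤ a) (hy : 0 ≤ y) (hyx : y ≤ x) :
    x ^ a - y ^ a ≤ a * x ^ (a - 1) * (x - y) := by
  rcases eq_or_lt_of_le (hy.trans hyx) with h0 | hx
  · have : y = x := le_antisymm hyx (h0 ▸ hy)
    simp [this]
  have hb := one_add_mul_self_le_rpow_one_add (s := y / x - 1) (by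
    have : 0 ≤ y / x := by positivity
    linarith) ha
  rw [add_sub_cancel, Real.div_rpow hy hx.le] at hb
  have hxa : 0 < x ^ a := by positivity
  rw [le_div_iff₀ hxa] at hb
  have h1 : x ^ a = x ^ (a - 1) * x := by
    rw [← Real.rpow_add_one hx.ne']; simp
  have h2 : (1 + a * (y / x - 1)) * x ^ a = x ^ a - a * x ^ (a - 1) * (x - y) := by
    rw [h1]; field_simp; ring
  linarith

lemma abs_rpow_mul_self_of_nonneg {q r : ℝ} (hq : 2 ≤ q) (hr : 0 ≤ r) :
    q * |r| ^ (q - 2) * r = q * r ^ (q - 1) := by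
  rw [abs_of_nonneg hr]
  rcases eq_or_lt_of_le hr with rfl | hr
  · rw [Real.zero_rpow (by linarith : q - 1 ≠ 0)]; ring
  · rw [mul_assoc, ← Real.rpow_add_one hr.ne']; ring_nf

/-- The derivative of |r|^q is odd, so two arguments of the same sign reduce to the nonnegative
case, where `rpow_sub_rpow_le` applies. For opposite signs the two terms add up and are estimated
separately. -/
lemma power_deriv_estimate_aux {q : ℝ} (hq : 2 ≤ q) {r s : ℝ} (hsr : s ≤ r) :
    0 ≤ q * |r| ^ (q - 2) * r - q * |s| ^ (q - 2) * s ∧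
      q * |r| ^ (q - 2) * r - q * |s| ^ (q - 2) * s ≤
        q * q * max |r| |s| ^ (q - 2) * (r - s) := by
  have hodd : ∀ t : ℝ, q * |-t| ^ (q - 2) * (-t) = -(q * |t| ^ (q - 2) * t) := by
    intro t; rw [abs_neg]; ring
  have hpos : ∀ {r s : ℝ}, 0 ≤ s → s ≤ r →
      0 ≤ q * |r| ^ (q - 2) * r - q * |s| ^ (q - 2) * s ∧
      q * |r| ^ (q - 2) * r - q * |s| ^ (q - 2) * s ≤
        q * q * max |r| |s| ^ (q - 2) * (r - s) := by
    intro r s hs hsr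
    have hr := hs.trans hsr
    rw [abs_rpow_mul_self_of_nonneg hq hr, abs_rpow_mul_self_of_nonneg hq hs, abs_of_nonneg hr,
      abs_of_nonneg hs, max_eq_left hsr]
    constructor
    · have : s ^ (q - 1) ≤ r ^ (q - 1) := Real.rpow_le_rpow hs hsr (by linarith)
      nlinarith
    · have h1 := rpow_sub_rpow_le (a := q - 1) (by linarith) hs hsr
      have h2 : q - 1 - 1 = q - 2 := by ring
      rw [h2] at h1
      have h3 : 0 ≤ r ^ (q - 2) * (r - s) := mul_nonneg (by positivity) (by linarith)
      nlinarith
  rcases le_total 0 s with hs | hs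
  · exact hpos hs hsr
  rcases le_total r 0 with hr | hr
  · have := hpos (r := -s) (s := -r) (by linarith) (by linarith)
    rw [hodd, hodd, abs_neg, abs_neg, max_comm] at this
    constructor
    · linarith [this.1]
    · convert this.2 using 1 <;> ring
  · have hm1 : |r| ^ (q - 2) ≤ max |r| |s| ^ (q - 2) :=
      Real.rpow_le_rpow (abs_nonneg _) (le_max_left _ _) (by linarith)
    have hm2 : |s| ^ (q - 2) ≤ max |r| |s| ^ (q - 2) :=
      Real.rpow_le_rpow (abs_nonneg _) (le_max_right _ _) (by linarith)
    have h1 : 0 ≤ |r| ^ (q - 2) := by positivity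
    have h2 : 0 ≤ |s| ^ (q - 2) := by positivity
    set m := max |r| |s| ^ (q - 2)
    have h3 : |r| ^ (q - 2) * r ≤ m * r := by gcongr
    have h4 : |s| ^ (q - 2) * (-s) ≤ m * (-s) := mul_le_mul_of_nonneg_right hm2 (by linarith)
    constructor
    · have := mul_nonneg h1 hr
      have := mul_nonneg h2 (neg_nonneg.2 hs)
      nlinarith
    · have h5 : 0 ≤ m * (r - s) := mul_nonneg (h1.trans hm1) (by linarith)
      have h6 : |r| ^ (q - 2) * r - |s| ^ (q - 2) * s ≤ m * (r - s) := by linarith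
      calc _ = q * (|r| ^ (q - 2) * r - |s| ^ (q - 2) * s) := by ring
        _ ≤ q * (q * (m * (r - s))) := by
          gcongr
          nlinarith
        _ = _ := by ring

/-- Monotonicity and cocoercivity of the derivative of `|r|^q`. -/
lemma power_deriv_estimate {q : ℝ} (hq : 2 ≤ q) (r s : ℝ) :
    0 ≤ (q * |r| ^ (q - 2) * r - q * |s| ^ (q - 2) * s) * (r - s) ∧
      (q * |r| ^ (q - 2) * r - q * |s| ^ (q - 2) * s) ^ 2 ≤
        q * q * max |r| |s| ^ (q - 2) *
          ((q * |r| ^ (q - 2) * r - q * |s| ^ (q - 2) * s) * (r - s)) := by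
  rcases le_total s r with h | h
  · obtain ⟨h1, h2⟩ := power_deriv_estimate_aux hq h
    refine ⟨mul_nonneg h1 (by linarith), ?_⟩
    nlinarith
  · obtain ⟨h1, h2⟩ := power_deriv_estimate_aux hq h
    rw [max_comm] at h2
    refine ⟨by nlinarith, ?_⟩
    nlinarith

end Power

/-! ### General fields of (p,q)-growth -/

/-- Monotone vector fields with `p`-coercivity, `q`-growth and Lipschitz dependence on `x`. -/
structure GrowthField {n : ℕ} (p q : ℝ) (Ω' : Set (E n)) (A : E n → E n → E n) (c C : ℝ) :
    Prop where
  c_pos : 0 < c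
  C_pos : 0 < C
  cont : ContinuousOn (fun z : E n × E n => A z.1 z.2) (Ω' ×ˢ univ)
  mono : ∀ x ∈ Ω', ∀ ξ η : E n, c * max ‖ξ‖ ‖η‖ ^ (p - 2) * ‖ξ - η‖ ^ 2 ≤
    inner ℝ (A x ξ - A x η) (ξ - η)
  coco : ∀ x ∈ Ω', ∀ ξ η : E n, ‖A x ξ - A x η‖ ^ 2 ≤
    C * (1 + max ‖ξ‖ ‖η‖ ^ (q - 2)) * inner ℝ (A x ξ - A x η) (ξ - η)
  lip : ∀ x₀ R, Metric.ball x₀ R ⊆ Ω' → ∀ (k : Fin n) (t : ℝ), ∀ x ∈ Metric.ball x₀ R,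
    x + t • EuclideanSpace.single k 1 ∈ Metric.ball x₀ R → ∀ ξ : E n,
    ‖A (x + t • EuclideanSpace.single k 1) ξ - A x ξ‖ ≤ C * ‖ξ‖ ^ (p - 1) * |t|
  zero : ∀ x ∈ Ω', ‖A x 0‖ ≤ C

lemma rpow_le_one_add_rpow {x a b : ℝ} (hx : 0 ≤ x) (ha : 0 ≤ a) (hab : a ≤ b) :
    x ^ a ≤ 1 + x ^ b := by
  rcases le_total x 1 with h | h
  · have := Real.rpow_le_one hx h ha
    have : 0 ≤ x ^ b := by positivity
    linarith
  · have := Real.rpow_le_rpow_of_exponent_le h hab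
    linarith

/-- Cocoercivity between ξ and 0, combined with Cauchy–Schwarz, allows one factor |A(x,ξ)-A(x,0)| to
be cancelled. -/
lemma GrowthField.norm_le {n : ℕ} {p q : ℝ} {Ω' : Set (E n)} {A : E n → E n → E n} {c C : ℝ}
    (hA : GrowthField p q Ω' A c C) (hq : 2 ≤ q) {x : E n} (hx : x ∈ Ω') (ξ : E n) :
    ‖A x ξ‖ ≤ 3 * C * (1 + ‖ξ‖ ^ (q - 1)) := by
  have h1 := hA.coco x hx ξ 0
  rw [norm_zero, max_eq_left (norm_nonneg _), sub_zero] at h1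
  have h2 : inner ℝ (A x ξ - A x 0) ξ ≤ ‖A x ξ - A x 0‖ * ‖ξ‖ := real_inner_le_norm _ _
  have hC := hA.C_pos
  have h3 : ‖A x ξ - A x 0‖ ≤ C * (1 + ‖ξ‖ ^ (q - 2)) * ‖ξ‖ := by
    rcases eq_or_lt_of_le (norm_nonneg (A x ξ - A x 0)) with h0 | h0
    · rw [← h0]; positivity
    · have : ‖A x ξ - A x 0‖ ^ 2 ≤ C * (1 + ‖ξ‖ ^ (q - 2)) * (‖A x ξ - A x 0‖ * ‖ξ‖) :=
        h1.trans (by gcongr)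
      have : ‖A x ξ - A x 0‖ * ‖A x ξ - A x 0‖ ≤
          ‖A x ξ - A x 0‖ * (C * (1 + ‖ξ‖ ^ (q - 2)) * ‖ξ‖) := by nlinarith
      exact le_of_mul_le_mul_left this h0
  have h4 : ‖A x ξ‖ ≤ ‖A x ξ - A x 0‖ + ‖A x 0‖ := by
    simpa using norm_add_le (A x ξ - A x 0) (A x 0)
  have h5 := hA.zero x hx
  have h6 : ‖ξ‖ ^ (q - 2) * ‖ξ‖ = ‖ξ‖ ^ (q - 1) := by
    rcases eq_or_lt_of_le (norm_nonneg ξ) with h0 | h0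
    · rw [← h0, Real.zero_rpow (by linarith : q - 1 ≠ 0)]; ring
    · rw [← Real.rpow_add_one h0.ne']; ring_nf
  have h7 : ‖ξ‖ ≤ 1 + ‖ξ‖ ^ (q - 1) := by
    have := rpow_le_one_add_rpow (norm_nonneg ξ) zero_le_one (by linarith : (1 : ℝ) ≤ q - 1)
    rwa [Real.rpow_one] at this
  have h8 : C * (1 + ‖ξ‖ ^ (q - 2)) * ‖ξ‖ = C * ‖ξ‖ + C * ‖ξ‖ ^ (q - 1) := by
    rw [← h6]; ring
  have h9 : 0 ≤ ‖ξ‖ ^ (q - 1) := by positivity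
  have h10 : C * ‖ξ‖ ≤ C * (1 + ‖ξ‖ ^ (q - 1)) := by gcongr
  have h11 : 0 ≤ C * ‖ξ‖ ^ (q - 1) := by positivity
  nlinarith

/-! ### The anisotropic integrand -/

section Anisotropic

variable {n : ℕ} (hn : 2 ≤ n) {p q : ℝ}

lemma hasGradientAt_anisotropicIntegrand (hq : 2 ≤ q) {h : E n → E n → ℝ} {x : E n}
    (hd : Differentiable ℝ (h x)) (ξ : E n) :
    HasGradientAt (anisotropicIntegrand hn q h x)
      (∇ (h x) ξ + (q * |ξ ⟨n - 1, by omega⟩| ^ (q - 2) * ξ ⟨n - 1, by omega⟩) •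
        EuclideanSpace.single ⟨n - 1, by omega⟩ (1 : ℝ)) ξ := by
  set j : Fin n := ⟨n - 1, by omega⟩
  have h1 : HasFDerivAt (fun ξ : E n => ξ j) (EuclideanSpace.proj (𝕜 := ℝ) j : E n →L[ℝ] ℝ) ξ :=
    (EuclideanSpace.proj (𝕜 := ℝ) j : E n →L[ℝ] ℝ).hasFDerivAt
  have h2 := (hasDerivAt_abs_rpow (ξ j) (by linarith : 1 < q)).comp_hasFDerivAt ξ h1
  have h3 := ((hd ξ).hasGradientAt.hasFDerivAt).add h2
  have hE : InnerProductSpace.toDual ℝ (E n) (∇ (h x) ξ +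
      (q * |ξ j| ^ (q - 2) * ξ j) • EuclideanSpace.single j (1 : ℝ)) =
      InnerProductSpace.toDual ℝ (E n) (∇ (h x) ξ) +
        (q * |ξ j| ^ (q - 2) * ξ j) • (EuclideanSpace.proj (𝕜 := ℝ) j : E n →L[ℝ] ℝ) := by
    ext v
    simp [InnerProductSpace.toDual_apply_apply, inner_smul_left,
      EuclideanSpace.inner_single_left]
  rw [hasGradientAt_iff_hasFDerivAt, hE]
  exact h3

/-- The inner products for h and for |ξ_n|^q add, both are nonnegative, and |X+Y|² ≤ 2|X|²+2|Y|²
preserves cocoercivity, now with the weight 1+m^{q-2}. Since |ξ_n|^q does not involve x, the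
difference in x cancels it and keeps the growth p-1. -/
lemma exists_growthField_anisotropic (hp : 2 ≤ p) (hpq : p ≤ q) {Ω : Set (E n)}
    {h : E n → E n → ℝ} (hh : IsPElliptic p Ω h) {Ω' : Set (E n)}
    (hΩ' : CompactlyContained Ω' Ω) :
    ∃ c C : ℝ, GrowthField p q Ω' (fun x => ∇ (anisotropicIntegrand hn q h x)) c C := by
  have : NeZero n := ⟨by omega⟩
  obtain ⟨c, C, hc, hC, h1, h2, h3, h4⟩ := hh.exists_structure hp hΩ'
  have hq : 2 ≤ q := hp.trans hpq
  have hsub : Ω' ⊆ Ω := subset_closure.trans hΩ'.2.2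
  set j : Fin n := ⟨n - 1, by omega⟩ with hj
  set e : E n := EuclideanSpace.single j (1 : ℝ) with he
  set b : ℝ → ℝ := fun r => q * |r| ^ (q - 2) * r with hb
  have hg : ∀ x ∈ Ω', ∀ ξ, ∇ (anisotropicIntegrand hn q h x) ξ = ∇ (h x) ξ + b (ξ j) • e :=
    fun x hx ξ =>
      (hasGradientAt_anisotropicIntegrand hn hq (hh.differentiable x (hsub hx)) ξ).gradient
  have hne : ‖e‖ = 1 := by simp [he]
  have hinner : ∀ x ∈ Ω', ∀ ξ η : E n,
      inner ℝ (∇ (anisotropicIntegrand hn q h x) ξ - ∇ (anisotropicIntegrand hn q h x) η) (ξ - η)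
      = inner ℝ (∇ (h x) ξ - ∇ (h x) η) (ξ - η) + (b (ξ j) - b (η j)) * (ξ j - η j) := by
    intro x hx ξ η
    rw [hg x hx, hg x hx, add_sub_add_comm, ← sub_smul, inner_add_left, inner_smul_left]
    simp [he, EuclideanSpace.inner_single_left]
  refine ⟨c, 4 * C + 2 * (q * q), hc, by positivity, ?_, ?_, ?_, ?_, ?_⟩
  · have hcont : ContinuousOn (fun z : E n × E n => ∇ (h z.1) z.2 + b (z.2 j) • e) (Ω' ×ˢ univ) := by
      apply ContinuousOn.add
      · exact hh.locallyLipschitz.continuousOn.mono (prod_mono hsub Subset.rfl)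
      · apply Continuous.continuousOn
        have : Continuous b := by
          have : Continuous fun r : ℝ => |r| ^ (q - 2) :=
            continuous_abs.rpow_const fun _ => Or.inr (by linarith)
          fun_prop
        fun_prop
    exact hcont.congr fun z hz => hg z.1 hz.1 z.2
  · intro x hx ξ η
    rw [hinner x hx]
    have := (power_deriv_estimate hq (ξ j) (η j)).1
    have := h1 x hx ξ η
    linarith
  · intro x hx ξ η
    rw [hinner x hx, hg x hx, hg x hx, add_sub_add_comm, ← sub_smul]
    obtain ⟨hb0, hb1⟩ := power_deriv_estimate hq (ξ j) (η j)
    set P := inner ℝ (∇ (h x) ξ - ∇ (h x) η) (ξ - η) with hP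
    set Q := (b (ξ j) - b (η j)) * (ξ j - η j) with hQ
    have hP0 : 0 ≤ P := le_trans (by positivity) (h1 x hx ξ η)
    have hM0 : 0 ≤ max ‖ξ‖ ‖η‖ := le_max_of_le_left (norm_nonneg _)
    set w := max ‖ξ‖ ‖η‖ ^ (q - 2) with hw
    have hw0 : 0 ≤ w := by positivity
    have e1 : ‖∇ (h x) ξ - ∇ (h x) η‖ ^ 2 ≤ C * (2 * (1 + w)) * P := by
      refine (h2 x hx ξ η).trans ?_
      have := rpow_le_one_add_rpow hM0 (by linarith : 0 ≤ p - 2) (by linarith : p - 2 ≤ q - 2)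
      gcongr
      linarith
    have e2 : (b (ξ j) - b (η j)) ^ 2 ≤ q * q * (1 + w) * Q := by
      refine hb1.trans (mul_le_mul_of_nonneg_right ?_ hb0)
      gcongr
      have : max |ξ j| |η j| ^ (q - 2) ≤ w := by
        apply Real.rpow_le_rpow (le_max_of_le_left (abs_nonneg _)) _ (by linarith)
        exact max_le_max (abs_apply_le_norm _ _) (abs_apply_le_norm _ _)
      linarith
    have e3 : ‖∇ (h x) ξ - ∇ (h x) η + (b (ξ j) - b (η j)) • e‖ ^ 2 ≤
        2 * ‖∇ (h x) ξ - ∇ (h x) η‖ ^ 2 + 2 * (b (ξ j) - b (η j)) ^ 2 := by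
      have := norm_add_le (∇ (h x) ξ - ∇ (h x) η) ((b (ξ j) - b (η j)) • e)
      rw [norm_smul, hne, mul_one, Real.norm_eq_abs] at this
      calc _ ≤ (‖∇ (h x) ξ - ∇ (h x) η‖ + |b (ξ j) - b (η j)|) ^ 2 := by gcongr
        _ ≤ 2 * ‖∇ (h x) ξ - ∇ (h x) η‖ ^ 2 + 2 * |b (ξ j) - b (η j)| ^ 2 := by
          nlinarith [sq_nonneg (‖∇ (h x) ξ - ∇ (h x) η‖ - |b (ξ j) - b (η j)|)]
        _ = _ := by rw [sq_abs]
    have e4 : 0 ≤ C * (1 + w) * Q := by positivity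
    have e5 : 0 ≤ q * q * (1 + w) * P := by positivity
    calc _ ≤ _ := e3
      _ ≤ 2 * (C * (2 * (1 + w)) * P) + 2 * (q * q * (1 + w) * Q) := by gcongr
      _ ≤ (4 * C + 2 * (q * q)) * (1 + w) * (P + Q) := by nlinarith
  · intro x₀ R hR k t x hx hxt ξ
    rw [hg _ (hR hxt), hg _ (hR hx), add_sub_add_right_eq_sub]
    refine (h3 x₀ R hR k t x hx hxt ξ).trans ?_
    gcongr
    nlinarith [mul_self_nonneg q]
  · intro x hx
    rw [hg x hx]
    have : b ((0 : E n) j) = 0 := by simp [hb]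
    rw [this, zero_smul, add_zero]
    refine (h4 x hx).1.trans ?_
    nlinarith [mul_self_nonneg q]

/-- The integrand controls `|ξ|^p` from above. -/
lemma exists_coercive_anisotropic (hp : 2 ≤ p) {Ω : Set (E n)}
    {h : E n → E n → ℝ} (hh : IsPElliptic p Ω h) {Ω' : Set (E n)}
    (hΩ' : CompactlyContained Ω' Ω) {ε : ℝ} (hε : 0 < ε)
    (hpos : ∀ x ∈ Ω', ∀ ξ, ε ≤ 1 + anisotropicIntegrand hn q h x ξ) :
    ∃ κ : ℝ, 0 < κ ∧ ∀ x ∈ Ω', ∀ ξ : E n,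
      κ * (1 + ‖ξ‖ ^ p) ≤ 1 + anisotropicIntegrand hn q h x ξ := by
  have : NeZero n := ⟨by omega⟩
  obtain ⟨c, C, hc, hC, h1, h2, h3, h4⟩ := hh.exists_structure hp hΩ'
  have hsub : Ω' ⊆ Ω := subset_closure.trans hΩ'.2.2
  set c' := c * (1 / 2) ^ p with hc'
  have hc'0 : 0 < c' := by positivity
  have hlow : ∀ x ∈ Ω', ∀ ξ : E n,
      c' * ‖ξ‖ ^ p - C - C * ‖ξ‖ ≤ anisotropicIntegrand hn q h x ξ := by
    intro x hx ξ
    have hd := hh.differentiable x (hsub hx)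
    have hmono : ∀ ξ η : E n, 0 ≤ inner ℝ (∇ (h x) ξ - ∇ (h x) η) (ξ - η) := fun ξ η =>
      le_trans (by positivity) (h1 x hx ξ η)
    -- Going from 0 to ξ in two equal steps: the tangent inequalities at 0 and at ζ differ by
    -- ⟨∇h(ζ)-∇h(0), ζ⟩, and monotonicity bounds this below by c|ζ|^p.
    set ζ : E n := (1 / 2 : ℝ) • ξ with hζ
    have hζζ : ζ + ζ = ξ := by rw [hζ, ← add_smul]; norm_num
    have g1 := inner_gradient_le_sub hd hmono ζ ζ
    have g2 := inner_gradient_le_sub hd hmono 0 ζ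
    rw [hζζ] at g1
    rw [zero_add] at g2
    have g3 := h1 x hx ζ 0
    rw [norm_zero, max_eq_left (norm_nonneg _), sub_zero, inner_sub_left] at g3
    have hζn : ‖ζ‖ = 1 / 2 * ‖ξ‖ := by rw [hζ, norm_smul]; norm_num
    have g4 : c * ‖ζ‖ ^ (p - 2) * ‖ζ‖ ^ 2 = c' * ‖ξ‖ ^ p := by
      have : ‖ζ‖ ^ (p - 2) * ‖ζ‖ ^ 2 = ‖ζ‖ ^ p := by
        rw [← Real.rpow_natCast ‖ζ‖ 2, ← Real.rpow_add_of_nonneg (norm_nonneg _) (by linarith)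
          (by norm_num)]
        congr 1; push_cast; ring
      rw [mul_assoc, this, hζn, Real.mul_rpow (by norm_num) (norm_nonneg _), hc']; ring
    have g5 : |inner ℝ (∇ (h x) 0) ζ| ≤ C * (1 / 2 * ‖ξ‖) := by
      refine (abs_real_inner_le_norm _ _).trans ?_
      rw [hζn]
      gcongr
      exact (h4 x hx).1
    have g6 := abs_le.1 (h4 x hx).2
    have g7 := abs_le.1 g5
    have g8 : 0 ≤ |ξ ⟨n - 1, by omega⟩| ^ q := by positivity
    simp only [anisotropicIntegrand]
    linarith
  -- for large `ξ` use the lower bound, for small `ξ` the positivity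
  obtain ⟨T, hT1, hT⟩ : ∃ T : ℝ, 1 ≤ T ∧ ∀ t : ℝ, T ≤ t → c' / 2 * t ^ p ≤ c' * t ^ p - C - C * t := by
    refine ⟨max 1 (4 * C / c'), le_max_left _ _, fun t ht => ?_⟩
    have ht1 : 1 ≤ t := (le_max_left _ _).trans ht
    have ht2 : 4 * C / c' ≤ t := (le_max_right _ _).trans ht
    rw [div_le_iff₀ hc'0] at ht2
    have h5 : t ^ (2 : ℝ) ≤ t ^ p := Real.rpow_le_rpow_of_exponent_le ht1 hp
    rw [Real.rpow_two] at h5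
    have h6 : c' / 2 * t ^ 2 ≤ c' / 2 * t ^ p := by gcongr
    nlinarith
  refine ⟨min (c' / 4) (ε / (1 + T ^ p)), by positivity, fun x hx ξ => ?_⟩
  rcases le_total ‖ξ‖ T with hle | hle
  · refine le_trans ?_ (hpos x hx ξ)
    have : ‖ξ‖ ^ p ≤ T ^ p := Real.rpow_le_rpow (norm_nonneg _) hle (by linarith)
    calc _ ≤ ε / (1 + T ^ p) * (1 + T ^ p) := by
          gcongr
          exact min_le_right _ _
      _ = ε := by field_simp
  · have h5 := hT _ hle
    have h6 := hlow x hx ξ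
    have h7 : 1 ≤ ‖ξ‖ ^ p := Real.one_le_rpow (hT1.trans hle) (by linarith)
    calc _ ≤ c' / 4 * (1 + ‖ξ‖ ^ p) := by
          gcongr
          exact min_le_left _ _
      _ ≤ c' / 4 * (‖ξ‖ ^ p + ‖ξ‖ ^ p) := by gcongr
      _ ≤ _ := by nlinarith

end Anisotropic

/-! ### The Euler–Lagrange equation -/

section EulerLagrange

variable {n : ℕ}

lemma gradient_apply_eq_fderiv (ψ : E n → ℝ) (x w : E n) :
    inner ℝ (∇ ψ x) w = fderiv ℝ ψ x w := by
  simp [gradient]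

lemma gradient_coord (ψ : E n → ℝ) (x : E n) (i : Fin n) :
    (∇ ψ x) i = fderiv ℝ ψ x (EuclideanSpace.single i 1) := by
  rw [← gradient_apply_eq_fderiv, EuclideanSpace.inner_single_right, one_mul, conj_trivial]

lemma continuous_gradient {ψ : E n → ℝ} (hψ : ContDiff ℝ 1 ψ) : Continuous (∇ ψ) :=
  (InnerProductSpace.toDual ℝ (E n)).symm.continuous.comp (hψ.continuous_fderiv one_ne_zero)

lemma hasCompactSupport_gradient {ψ : E n → ℝ} (hc : HasCompactSupport ψ) :
    HasCompactSupport (∇ ψ) :=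
  (hc.fderiv ℝ).comp_left (map_zero _)

lemma isW12_of_contDiff {ψ : E n → ℝ} (hψ : ContDiff ℝ 1 ψ) (hc : HasCompactSupport ψ)
    {Ω : Set (E n)} (hΩ : tsupport ψ ⊆ Ω) : IsW12 Ω ψ (∇ ψ) := by
  have hgc := continuous_gradient hψ
  have hgs := hasCompactSupport_gradient hc
  refine ⟨⟨hψ.continuous.locallyIntegrable.locallyIntegrableOn _,
    hgc.locallyIntegrable.locallyIntegrableOn _, ?_⟩, ?_, ?_⟩
  · intro φ hφ hφc _ i
    have hz : ∀ x ∉ Ω, ψ x = 0 := fun x hx => by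
      by_contra h
      exact hx (hΩ (subset_closure h))
    have hz' : ∀ x ∉ Ω, (∇ ψ x) i = 0 := fun x hx => by
      have : fderiv ℝ ψ x = 0 := by
        by_contra h
        exact hx (hΩ (support_fderiv_subset ℝ h))
      rw [gradient_coord, this]; rfl
    rw [setIntegral_eq_integral_of_forall_compl_eq_zero (fun x hx => by rw [hz x hx, zero_mul]),
      setIntegral_eq_integral_of_forall_compl_eq_zero (fun x hx => by rw [hz' x hx, zero_mul])]
    simp_rw [gradient_coord]
    have hφ1 : ContDiff ℝ 1 φ := hφ.of_le (by exact_mod_cast le_top)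
    have cψ : Continuous fun x => fderiv ℝ ψ x (EuclideanSpace.single i 1) :=
      (hψ.continuous_fderiv one_ne_zero).clm_apply continuous_const
    have cφ : Continuous fun x => fderiv ℝ φ x (EuclideanSpace.single i 1) :=
      (hφ1.continuous_fderiv one_ne_zero).clm_apply continuous_const
    apply integral_mul_fderiv_eq_neg_fderiv_mul_of_integrable
    · exact (cψ.mul hφ.continuous).integrable_of_hasCompactSupport hφc.mul_left
    · exact (hψ.continuous.mul cφ).integrable_of_hasCompactSupport hc.mul_right
    · exact (hψ.continuous.mul hφ.continuous).integrable_of_hasCompactSupport hc.mul_right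
    · exact fun x _ => (hψ.differentiable one_ne_zero) x
    · exact fun x _ => (hφ1.differentiable one_ne_zero) x
  · exact (hψ.continuous.memLp_of_hasCompactSupport hc).restrict _
  · exact (hgc.memLp_of_hasCompactSupport hgs).restrict _

lemma aestronglyMeasurable_comp_continuousOn {X : Type*} [TopologicalSpace X]
    [TopologicalSpace.PseudoMetrizableSpace X] [SecondCountableTopology X] [Nonempty X]
    {Ω' : Set (E n)} (hΩ' : IsOpen Ω') {g : E n → E n → X}
    (hg : ContinuousOn (fun z : E n × E n => g z.1 z.2) (Ω' ×ˢ univ)) {w : E n → E n}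
    (hw : AEStronglyMeasurable w (volume.restrict Ω')) :
    AEStronglyMeasurable (fun x => g x (w x)) (volume.restrict Ω') := by
  borelize X
  classical
  have hS : MeasurableSet (Ω' ×ˢ (univ : Set (E n))) := (hΩ'.prod isOpen_univ).measurableSet
  set G : E n × E n → X := (Ω' ×ˢ univ).piecewise (fun z => g z.1 z.2)
    (fun _ => Classical.arbitrary X) with hG
  have hGm : Measurable G := hg.measurable_piecewise continuousOn_const hS
  have h1 : AEMeasurable (fun x => G (x, w x)) (volume.restrict Ω') :=
    hGm.comp_aemeasurable (aemeasurable_id.prodMk hw.aemeasurable)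
  refine h1.aestronglyMeasurable.congr ?_
  filter_upwards [ae_restrict_mem hΩ'.measurableSet] with x hx
  simp [hG, hx]

lemma rpow_add_le {a b q : ℝ} (ha : 0 ≤ a) (hb : 0 ≤ b) (hq : 0 ≤ q) :
    (a + b) ^ q ≤ 2 ^ q * (a ^ q + b ^ q) := by
  have h1 : a + b ≤ 2 * max a b := by
    have := le_max_left a b
    have := le_max_right a b
    linarith
  have h2 : max a b ^ q ≤ a ^ q + b ^ q := by
    rcases le_total a b with h | h
    · rw [max_eq_right h]; have : 0 ≤ a ^ q := by positivity
      linarith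
    · rw [max_eq_left h]; have : 0 ≤ b ^ q := by positivity
      linarith
  calc (a + b) ^ q ≤ (2 * max a b) ^ q := by gcongr
    _ = 2 ^ q * max a b ^ q := Real.mul_rpow (by norm_num) (le_max_of_le_left ha)
    _ ≤ _ := by gcongr

lemma GrowthField.norm_add_le {p q : ℝ} {Ω' : Set (E n)} {A : E n → E n → E n} {c C : ℝ}
    (hA : GrowthField p q Ω' A c C) (hq : 2 ≤ q) {x : E n} (hx : x ∈ Ω') {M : ℝ} {ξ w : E n}
    (hw : ‖w‖ ≤ M) :
    ‖A x (ξ + w)‖ ≤ 3 * C * (2 + 2 ^ q * M ^ q + 2 ^ q * ‖ξ‖ ^ q) := by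
  have hC := hA.C_pos
  have hM : 0 ≤ M := (norm_nonneg _).trans hw
  refine (hA.norm_le hq hx _).trans ?_
  have h1 := rpow_le_one_add_rpow (norm_nonneg (ξ + w)) (by linarith : 0 ≤ q - 1)
    (by linarith : q - 1 ≤ q)
  have h2 : ‖ξ + w‖ ^ q ≤ (‖ξ‖ + M) ^ q := by
    gcongr
    exact (_root_.norm_add_le _ _).trans (by linarith)
  have h3 := rpow_add_le (norm_nonneg ξ) hM (by linarith : 0 ≤ q)
  exact mul_le_mul_of_nonneg_left (by linarith) (by positivity)

lemma abs_integrand_le {p q : ℝ} {Ω' : Set (E n)} {f : E n → E n → ℝ} {c C : ℝ}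
    (hA : GrowthField p q Ω' (fun x => ∇ (f x)) c C) (hq : 2 ≤ q)
    (hfd : ∀ x ∈ Ω', Differentiable ℝ (f x)) {M₀ : ℝ} (hf0 : ∀ x ∈ Ω', |f x 0| ≤ M₀)
    {x : E n} (hx : x ∈ Ω') (ξ : E n) :
    |f x ξ| ≤ M₀ + 3 * C * (1 + 2 * ‖ξ‖ ^ q) := by
  have hC := hA.C_pos
  obtain ⟨θ, ⟨ht0, ht1⟩, hθ⟩ := exists_mean_value (hfd x hx) 0 ξ
  rw [zero_add, zero_add] at hθ
  have h1 := hA.norm_le hq hx (θ • ξ)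
  have h2 : ‖θ • ξ‖ ^ (q - 1) ≤ ‖ξ‖ ^ (q - 1) := by
    apply Real.rpow_le_rpow (norm_nonneg _) _ (by linarith)
    rw [norm_smul, Real.norm_eq_abs, abs_of_pos ht0]
    nlinarith [norm_nonneg ξ]
  have h3 : |inner ℝ (∇ (f x) (θ • ξ)) ξ| ≤ 3 * C * (1 + ‖ξ‖ ^ (q - 1)) * ‖ξ‖ := by
    refine (abs_real_inner_le_norm _ _).trans ?_
    gcongr
    refine h1.trans ?_
    gcongr
  have h4 : ‖ξ‖ ^ (q - 1) * ‖ξ‖ = ‖ξ‖ ^ q := by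
    rcases eq_or_lt_of_le (norm_nonneg ξ) with h0 | h0
    · rw [← h0, Real.zero_rpow (by linarith : q ≠ 0)]; ring
    · rw [← Real.rpow_add_one h0.ne']; ring_nf
  have h5 : ‖ξ‖ ≤ 1 + ‖ξ‖ ^ q := by
    have := rpow_le_one_add_rpow (norm_nonneg ξ) zero_le_one (by linarith : (1 : ℝ) ≤ q)
    rwa [Real.rpow_one] at this
  have h6 : 3 * C * (1 + ‖ξ‖ ^ (q - 1)) * ‖ξ‖ = 3 * C * (‖ξ‖ + ‖ξ‖ ^ q) := by rw [← h4]; ring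
  have h7 : 3 * C * (‖ξ‖ + ‖ξ‖ ^ q) ≤ 3 * C * (1 + 2 * ‖ξ‖ ^ q) := by
    exact mul_le_mul_of_nonneg_left (by linarith) (by positivity)
  have h8 := hf0 x hx
  have h9 : f x ξ = f x 0 + inner ℝ (∇ (f x) (θ • ξ)) ξ := by linarith
  rw [h9]
  refine (abs_add_le _ _).trans ?_
  linarith

/-- The Euler–Lagrange equation of a local minimizer. -/
lemma IsLocalMinimizer.euler_lagrange {p q : ℝ} {Ω Ω' : Set (E n)} {f : E n → E n → ℝ} {c C : ℝ}
    (hΩ' : CompactlyContained Ω' Ω)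
    (hA : GrowthField p q Ω' (fun x => ∇ (f x)) c C) (hq : 2 ≤ q)
    (hfd : ∀ x ∈ Ω', Differentiable ℝ (f x)) {M₀ : ℝ} (hf0 : ∀ x ∈ Ω', |f x 0| ≤ M₀)
    (hfc : ContinuousOn (fun z : E n × E n => f z.1 z.2) (Ω' ×ˢ univ))
    {u : E n → ℝ} {Du : E n → E n} (hu : IsLocalMinimizer Ω f u Du)
    (hDum : AEStronglyMeasurable Du (volume.restrict Ω'))
    (hDu : IntegrableOn (fun x => ‖Du x‖ ^ q) Ω')
    {ψ : E n → ℝ} (hψ : ContDiff ℝ 1 ψ) (hc : HasCompactSupport ψ) (hs : tsupport ψ ⊆ Ω') :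
    ∫ x in Ω', fderiv ℝ ψ x (∇ (f x) (Du x)) = 0 := by
  have hCpos := hA.C_pos
  have hsub : Ω' ⊆ Ω := subset_closure.trans hΩ'.2.2
  have hfin : IsFiniteMeasure (volume.restrict Ω') :=
    ⟨by rw [Measure.restrict_apply_univ]
        exact (measure_mono subset_closure).trans_lt hΩ'.2.1.measure_lt_top⟩
  -- one-sided version
  have main : ∀ ψ : E n → ℝ, ContDiff ℝ 1 ψ → HasCompactSupport ψ → tsupport ψ ⊆ Ω' →
      0 ≤ ∫ x in Ω', fderiv ℝ ψ x (∇ (f x) (Du x)) := by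
    intro ψ hψ hc hs
    have hgc := continuous_gradient hψ
    obtain ⟨M, hM⟩ := (hasCompactSupport_gradient hc).exists_bound_of_continuous hgc
    have hM0 : 0 ≤ M := (norm_nonneg _).trans (hM 0)
    set t : ℕ → ℝ := fun k => 1 / ((k : ℝ) + 1) with ht
    have ht0 : ∀ k, 0 < t k := fun k => by positivity
    have ht1 : ∀ k, t k ≤ 1 := fun k => by
      rw [ht, div_le_one (by positivity)]
      simp
    have htlim : Filter.Tendsto t Filter.atTop (nhds 0) := tendsto_one_div_add_atTop_nhds_zero_nat
    have hmeas : ∀ s : ℝ, AEStronglyMeasurable (fun x => Du x + s • ∇ ψ x) (volume.restrict Ω') :=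
      fun s => hDum.add (hgc.const_smul s).aestronglyMeasurable
    have hAm : ∀ s : ℝ, AEStronglyMeasurable
        (fun x => ∇ (f x) (Du x + s • ∇ ψ x)) (volume.restrict Ω') := fun s =>
      aestronglyMeasurable_comp_continuousOn hΩ'.1 hA.cont (hmeas s)
    have hbound : ∀ s : ℝ, 0 ≤ s → s ≤ 1 → ∀ x ∈ Ω',
        ‖inner ℝ (∇ (f x) (Du x + s • ∇ ψ x)) (∇ ψ x)‖ ≤
          3 * C * (2 + 2 ^ q * M ^ q + 2 ^ q * ‖Du x‖ ^ q) * M := by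
      intro s hs0 hs1 x hx
      refine (abs_real_inner_le_norm _ _).trans ?_
      have h1 : ‖s • ∇ ψ x‖ ≤ M := by
        rw [norm_smul, Real.norm_eq_abs, abs_of_nonneg hs0]
        have := hM x
        nlinarith [norm_nonneg (∇ ψ x)]
      have := hA.norm_add_le hq hx (ξ := Du x) h1
      exact mul_le_mul this (hM x) (norm_nonneg _) (by positivity)
    have hbi : IntegrableOn (fun x => 3 * C * (2 + 2 ^ q * M ^ q + 2 ^ q * ‖Du x‖ ^ q) * M) Ω' :=
      (((integrable_const _).add (hDu.const_mul _)).const_mul _).mul_const _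
    have hlim := tendsto_integral_of_dominated_convergence (μ := volume.restrict Ω')
      (F := fun k x => inner ℝ (∇ (f x) (Du x + t k • ∇ ψ x)) (∇ ψ x))
      (f := fun x => inner ℝ (∇ (f x) (Du x)) (∇ ψ x))
      (fun x => 3 * C * (2 + 2 ^ q * M ^ q + 2 ^ q * ‖Du x‖ ^ q) * M)
      (fun k => (hAm (t k)).inner hgc.aestronglyMeasurable) hbi
      (fun k => by
        filter_upwards [ae_restrict_mem hΩ'.1.measurableSet] with x hx
        exact hbound (t k) (ht0 k).le (ht1 k) x hx)
      (by
        filter_upwards [ae_restrict_mem hΩ'.1.measurableSet] with x hx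
        have hcx : Continuous (fun ξ => ∇ (f x) ξ) := by
          rw [← continuousOn_univ]
          exact hA.cont.comp (f := fun ξ : E n => (x, ξ)) (by fun_prop) (fun ξ _ => ⟨hx, mem_univ _⟩)
        have h1 : Filter.Tendsto (fun k => Du x + t k • ∇ ψ x) Filter.atTop (nhds (Du x)) := by
          simpa using (htlim.smul_const (∇ ψ x)).const_add (Du x)
        exact ((hcx.tendsto _).comp h1).inner tendsto_const_nhds)
    -- Convexity bounds f(x, Du+t∇ψ) - f(x, Du) above by t⟨∇f(x, Du+t∇ψ), ∇ψ⟩. Minimality therefore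
    -- gives a sign for every t > 0 before any limit is taken; dominated convergence as t → 0 and
    -- the replacement of ψ by -ψ finish the proof.
    have hk : ∀ k, 0 ≤ ∫ x in Ω', inner ℝ (∇ (f x) (Du x + t k • ∇ ψ x)) (∇ ψ x) := by
      intro k
      have hgrad : ∇ (fun x => t k * ψ x) = fun x => t k • ∇ ψ x := by
        funext x
        have : fderiv ℝ (fun x => t k * ψ x) x = t k • fderiv ℝ ψ x :=
          fderiv_const_mul (hψ.differentiable one_ne_zero x) (t k)
        simp only [gradient, this, map_smul]
      have hts : tsupport (fun x => t k * ψ x) ⊆ tsupport ψ := tsupport_mul_subset_right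
      have hw : IsW12 Ω (fun x => t k * ψ x) (fun x => t k • ∇ ψ x) := by
        rw [← hgrad]
        exact isW12_of_contDiff (contDiff_const.mul hψ) hc.mul_left (hts.trans (hs.trans hsub))
      have hfint : IntegrableOn (fun x => f x (Du x + t k • ∇ ψ x)) Ω' := by
        refine Integrable.mono' (g := fun x => M₀ + 3 * C * (1 + 2 * (2 ^ q * (‖Du x‖ ^ q + M ^ q)))) ?_
          (aestronglyMeasurable_comp_continuousOn hΩ'.1 hfc (hmeas (t k))) ?_
        · exact (integrable_const _).add (((integrable_const _).add
            (((hDu.add (integrable_const _)).const_mul _).const_mul _)).const_mul _)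
        · filter_upwards [ae_restrict_mem hΩ'.1.measurableSet] with x hx
          rw [Real.norm_eq_abs]
          refine (abs_integrand_le hA hq hfd hf0 hx _).trans ?_
          have h1 : ‖t k • ∇ ψ x‖ ≤ M := by
            rw [norm_smul, Real.norm_eq_abs, abs_of_pos (ht0 k)]
            have := hM x
            have := ht1 k
            nlinarith [norm_nonneg (∇ ψ x)]
          have h2 : ‖Du x + t k • ∇ ψ x‖ ^ q ≤ (‖Du x‖ + M) ^ q := by
            gcongr
            exact (norm_add_le _ _).trans (by linarith)
          have h3 := rpow_add_le (norm_nonneg (Du x)) hM0 (by linarith : 0 ≤ q)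
          gcongr
          exact h2.trans h3
      obtain ⟨hi0, hmin⟩ := hu.2 Ω' hΩ'
      have h1 := hmin _ _ hw (hts.trans hs) hfint
      have h2 : 0 ≤ ∫ x in Ω', (f x (Du x + t k • ∇ ψ x) - f x (Du x)) := by
        rw [integral_sub hfint hi0]; linarith
      have hfint2 : IntegrableOn (fun x => inner ℝ (∇ (f x) (Du x + t k • ∇ ψ x)) (∇ ψ x)) Ω' := by
        refine Integrable.mono' hbi ((hAm (t k)).inner hgc.aestronglyMeasurable) ?_
        filter_upwards [ae_restrict_mem hΩ'.1.measurableSet] with x hx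
        exact hbound (t k) (ht0 k).le (ht1 k) x hx
      have h3 : ∫ x in Ω', (f x (Du x + t k • ∇ ψ x) - f x (Du x)) ≤
          ∫ x in Ω', t k * inner ℝ (∇ (f x) (Du x + t k • ∇ ψ x)) (∇ ψ x) := by
        apply setIntegral_mono_on (hfint.sub hi0) (hfint2.const_mul _) hΩ'.1.measurableSet
        intro x hx
        have hmono : ∀ ξ η : E n, 0 ≤ inner ℝ (∇ (f x) ξ - ∇ (f x) η) (ξ - η) := fun ξ η =>
          le_trans (by have := hA.c_pos; positivity) (hA.mono x hx ξ η)
        have := inner_gradient_le_sub (hfd x hx) hmono (Du x + t k • ∇ ψ x) (-(t k • ∇ ψ x))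
        rw [add_neg_cancel_right, inner_neg_right, inner_smul_right] at this
        simp only [Pi.sub_apply]
        linarith
      rw [integral_const_mul] at h3
      exact nonneg_of_mul_nonneg_right (h2.trans h3) (ht0 k)
    have h0 := ge_of_tendsto' hlim hk
    have e : ∀ x, fderiv ℝ ψ x (∇ (f x) (Du x)) = inner ℝ (∇ (f x) (Du x)) (∇ ψ x) := fun x => by
      rw [← gradient_apply_eq_fderiv, real_inner_comm]
    simp_rw [e]
    exact h0
  refine le_antisymm ?_ (main ψ hψ hc hs)
  have h1 := main (fun x => - ψ x) hψ.neg hc.neg (by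
    have : tsupport (fun x => - ψ x) = tsupport ψ := by
      simp [tsupport, Function.support_fun_neg]
    rwa [this])
  have h2 : ∀ x, fderiv ℝ (fun x => - ψ x) x = - fderiv ℝ ψ x := fun x => fderiv_fun_neg
  simp only [h2, neg_apply, integral_neg] at h1
  linarith

end EulerLagrange

/-! ### Averages of translates -/

section Average

variable {n : ℕ}

/-- No integrability is assumed. If f - g is not integrable, the right side is infinite; if it is,
then f and g are integrable together or not at all, and in the latter case both Bochner integrals
are 0 by convention. -/
lemma enorm_integral_sub_integral_le {α : Type*} [MeasurableSpace α] {μ : Measure α} {f g : α → ℝ}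
    (hf : AEStronglyMeasurable f μ) (hg : AEStronglyMeasurable g μ) :
    ‖∫ x, f x ∂μ - ∫ x, g x ∂μ‖ₑ ≤ ∫⁻ x, ‖f x - g x‖ₑ ∂μ := by
  by_cases hfg : Integrable (fun x => f x - g x) μ
  · by_cases hgi : Integrable g μ
    · have hfi : Integrable f μ :=
        (hfg.add hgi).congr (Filter.Eventually.of_forall fun x => by simp)
      rw [← integral_sub hfi hgi]
      exact enorm_integral_le_lintegral_enorm _
    · have hfi : ¬ Integrable f μ := fun h => hgi
        ((h.sub hfg).congr (Filter.Eventually.of_forall fun x => by simp))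
      rw [integral_undef hfi, integral_undef hgi]
      simp
  · have : ∫⁻ x, ‖f x - g x‖ₑ ∂μ = ⊤ := by
      by_contra h
      exact hfg ⟨hf.sub hg, lt_top_iff_ne_top.2 h⟩
    rw [this]
    exact le_top

lemma lintegral_rpow_le_of_isProbabilityMeasure {α : Type*} [MeasurableSpace α] {μ : Measure α}
    [IsProbabilityMeasure μ] {h : α → ℝ≥0∞} (hh : AEMeasurable h μ) {a : ℝ} (ha : 1 ≤ a) :
    (∫⁻ x, h x ∂μ) ^ a ≤ ∫⁻ x, h x ^ a ∂μ := by
  rcases eq_or_lt_of_le ha with rfl | ha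
  · simp
  have hc := Real.HolderConjugate.conjExponent ha
  have h1 := ENNReal.lintegral_mul_le_Lp_mul_Lq μ hc hh (aemeasurable_const (b := (1 : ℝ≥0∞)))
  simp only [Pi.mul_apply, mul_one, ENNReal.one_rpow, lintegral_const, measure_univ] at h1
  calc (∫⁻ x, h x ∂μ) ^ a ≤ ((∫⁻ x, h x ^ a ∂μ) ^ (1 / a)) ^ a := by
        gcongr
    _ = _ := by
        rw [← ENNReal.rpow_mul, one_div, inv_mul_cancel₀ (by linarith), ENNReal.rpow_one]

/-- The average of the translates `f (x - y)` with respect to the weight `μ`. -/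
def avg (μ : Measure (E n)) (f : E n → ℝ) (x : E n) : ℝ := ∫ y, f (x - y) ∂μ

lemma measurable_avg (μ : Measure (E n)) [SFinite μ] {f : E n → ℝ} (hf : Measurable f) :
    Measurable (avg μ f) := by
  have : StronglyMeasurable (fun z : E n × E n => f (z.1 - z.2)) :=
    (hf.comp (by fun_prop)).stronglyMeasurable
  exact this.integral_prod_right.measurable

/-- Averaging against a probability measure contracts L^a: Jensen's inequality, Tonelli, and
translation invariance. It serves both for mollification and for averages along segments, hence the
general measure μ and the sets K and L. -/
lemma lintegral_avg_sub_rpow_le {μ : Measure (E n)} [IsProbabilityMeasure μ] {f g : E n → ℝ}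
    (hf : Measurable f) (hg : Measurable g) {K L : Set (E n)} (hK : MeasurableSet K)
    (hL : MeasurableSet L) (hKL : ∀ᵐ y ∂μ, ∀ x ∈ K, x - y ∈ L) {a : ℝ} (ha : 1 ≤ a) :
    ∫⁻ x in K, ‖avg μ f x - avg μ g x‖ₑ ^ a ≤ ∫⁻ x in L, ‖f x - g x‖ₑ ^ a := by
  have hm : Measurable (fun z : E n × E n => ‖f (z.1 - z.2) - g (z.1 - z.2)‖ₑ ^ a) := by
    fun_prop
  calc ∫⁻ x in K, ‖avg μ f x - avg μ g x‖ₑ ^ a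
      ≤ ∫⁻ x in K, ∫⁻ y, ‖f (x - y) - g (x - y)‖ₑ ^ a ∂μ := by
        apply lintegral_mono
        intro x
        refine le_trans ?_ (lintegral_rpow_le_of_isProbabilityMeasure (by fun_prop) ha)
        apply ENNReal.rpow_le_rpow _ (by linarith)
        exact enorm_integral_sub_integral_le (hf.comp (by fun_prop)).aestronglyMeasurable
          (hg.comp (by fun_prop)).aestronglyMeasurable
    _ = ∫⁻ y, (∫⁻ x in K, ‖f (x - y) - g (x - y)‖ₑ ^ a) ∂μ :=
        lintegral_lintegral_swap hm.aemeasurable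
    _ ≤ ∫⁻ _, (∫⁻ x in L, ‖f x - g x‖ₑ ^ a) ∂μ := by
        apply lintegral_mono_ae
        filter_upwards [hKL] with y hy
        rw [← lintegral_indicator hK, ← lintegral_indicator hL]
        calc ∫⁻ x, K.indicator (fun x => ‖f (x - y) - g (x - y)‖ₑ ^ a) x
            ≤ ∫⁻ x, L.indicator (fun x => ‖f x - g x‖ₑ ^ a) (x - y) := by
              apply lintegral_mono
              intro x
              by_cases hx : x ∈ K
              · simp only [indicator_of_mem hx, indicator_of_mem (hy x hx), le_refl]
              · simp [indicator_of_notMem hx]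
          _ = _ := lintegral_sub_right_eq_self (fun x => L.indicator (fun x => ‖f x - g x‖ₑ ^ a) x) y
    _ = _ := by simp

lemma lintegral_avg_rpow_le {μ : Measure (E n)} [IsProbabilityMeasure μ] {f : E n → ℝ}
    (hf : Measurable f) {K L : Set (E n)} (hK : MeasurableSet K)
    (hL : MeasurableSet L) (hKL : ∀ᵐ y ∂μ, ∀ x ∈ K, x - y ∈ L) {a : ℝ} (ha : 1 ≤ a) :
    ∫⁻ x in K, ‖avg μ f x‖ₑ ^ a ≤ ∫⁻ x in L, ‖f x‖ₑ ^ a := by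
  simpa [avg] using lintegral_avg_sub_rpow_le hf (measurable_const (a := (0 : ℝ))) hK hL hKL ha

/-- Continuity of translations in L^a, taken from the continuous action of translations on `Lp`. -/
lemma tendsto_lintegral_translate_sub {f : E n → ℝ} {a : ℝ} (ha : 1 ≤ a)
    (hf : MemLp f (ENNReal.ofReal a) volume) :
    Filter.Tendsto (fun y : E n => ∫⁻ x, ‖f (x - y) - f x‖ₑ ^ a) (nhds 0) (nhds 0) := by
  have ha0 : 0 < a := by linarith
  have h1 : Fact (1 ≤ ENNReal.ofReal a) := ⟨by simpa using ha⟩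
  have h2 : Fact (ENNReal.ofReal a ≠ ⊤) := ⟨ENNReal.ofReal_ne_top⟩
  have hcont : Continuous (fun y : E n => (DomAddAct.mk (-y)) +ᵥ hf.toLp f) := by
    have : Continuous (fun y : E n => DomAddAct.mk (-y)) :=
      DomAddAct.continuous_mk.comp continuous_neg
    exact this.vadd continuous_const
  have h0 : (DomAddAct.mk (-(0 : E n))) +ᵥ hf.toLp f = hf.toLp f := by simp
  have ht := (hcont.tendsto 0).edist (tendsto_const_nhds (x := hf.toLp f))
  rw [h0, edist_self] at ht
  have he : ∀ y : E n, edist ((DomAddAct.mk (-y)) +ᵥ hf.toLp f) (hf.toLp f) ^ a =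
      ∫⁻ x, ‖f (x - y) - f x‖ₑ ^ a := by
    intro y
    rw [DomAddAct.mk_vadd_toLp, Lp.edist_toLp_toLp, eLpNorm_eq_lintegral_rpow_enorm_toReal
      (by simpa using ha0) ENNReal.ofReal_ne_top, ENNReal.toReal_ofReal ha0.le,
      ← ENNReal.rpow_mul, one_div, inv_mul_cancel₀ ha0.ne', ENNReal.rpow_one]
    refine lintegral_congr fun x => ?_
    simp [sub_eq_neg_add]
  have h3 := (ENNReal.continuous_rpow_const (y := a)).tendsto 0 |>.comp ht
  simp only [ENNReal.zero_rpow_of_pos ha0] at h3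
  exact h3.congr he

lemma exists_forall_lintegral_avg_sub_le {f : E n → ℝ} (hfm : Measurable f) {a : ℝ} (ha : 1 ≤ a)
    (hf : MemLp f (ENNReal.ofReal a) volume) {ε : ℝ≥0∞} (hε : 0 < ε) :
    ∃ δ > 0, ∀ (μ : Measure (E n)), IsProbabilityMeasure μ → (∀ᵐ y ∂μ, ‖y‖ ≤ δ) →
      ∫⁻ x, ‖avg μ f x - f x‖ₑ ^ a ≤ ε := by
  have h1 := (tendsto_lintegral_translate_sub ha hf).eventually (ge_mem_nhds hε)
  obtain ⟨δ, hδ, hball⟩ := Metric.eventually_nhds_iff_ball.1 h1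
  refine ⟨δ / 2, by positivity, fun μ hμ hy => ?_⟩
  have hm : Measurable (fun z : E n × E n => ‖f (z.1 - z.2) - f z.1‖ₑ ^ a) := by fun_prop
  calc ∫⁻ x, ‖avg μ f x - f x‖ₑ ^ a
      ≤ ∫⁻ x, ∫⁻ y, ‖f (x - y) - f x‖ₑ ^ a ∂μ := by
        apply lintegral_mono
        intro x
        refine le_trans ?_ (lintegral_rpow_le_of_isProbabilityMeasure (by fun_prop) ha)
        apply ENNReal.rpow_le_rpow _ (by linarith)
        have := enorm_integral_sub_integral_le (μ := μ) (f := fun y => f (x - y))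
          (g := fun _ => f x) (hfm.comp (by fun_prop)).aestronglyMeasurable
          aestronglyMeasurable_const
        simpa [avg] using this
    _ = ∫⁻ y, (∫⁻ x, ‖f (x - y) - f x‖ₑ ^ a) ∂μ := lintegral_lintegral_swap hm.aemeasurable
    _ ≤ ∫⁻ _, ε ∂μ := by
        apply lintegral_mono_ae
        filter_upwards [hy] with y hy
        exact hball y (by rw [mem_ball_zero_iff]; linarith)
    _ = ε := by simp

lemma tendsto_lintegral_avg_sub {f : E n → ℝ} (hfm : Measurable f) {a : ℝ} (ha : 1 ≤ a)
    (hf : MemLp f (ENNReal.ofReal a) volume) {μ : ℕ → Measure (E n)}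
    [∀ k, IsProbabilityMeasure (μ k)] {δ : ℕ → ℝ} (hδ : Filter.Tendsto δ Filter.atTop (nhds 0))
    (hμ : ∀ k, ∀ᵐ y ∂(μ k), ‖y‖ ≤ δ k) :
    Filter.Tendsto (fun k => ∫⁻ x, ‖avg (μ k) f x - f x‖ₑ ^ a) Filter.atTop (nhds 0) := by
  rw [ENNReal.tendsto_nhds_zero]
  intro ε hε
  obtain ⟨η, hη, h⟩ := exists_forall_lintegral_avg_sub_le hfm ha hf hε
  filter_upwards [hδ.eventually (ge_mem_nhds hη)] with k hk
  refine h (μ k) inferInstance ?_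
  filter_upwards [hμ k] with y hy using hy.trans hk

end Average

/-! ### Mollification and weak derivatives -/

section Mollifier

variable {n : ℕ}

/-- A sequence of mollifiers, with radii tending to zero. -/
def bump (n : ℕ) (k : ℕ) : ContDiffBump (0 : E n) where
  rIn := 1 / (2 * ((k : ℝ) + 1))
  rOut := 1 / ((k : ℝ) + 1)
  rIn_pos := by positivity
  rIn_lt_rOut := by
    have : (0 : ℝ) < (k : ℝ) + 1 := by positivity
    apply one_div_lt_one_div_of_lt this
    linarith

/-- The probability measure whose density is the `k`-th mollifier. -/
def bumpMeasure (n : ℕ) (k : ℕ) : Measure (E n) :=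
  volume.withDensity fun y => ENNReal.ofReal ((bump n k).normed volume y)

instance (k : ℕ) : IsProbabilityMeasure (bumpMeasure n k) := by
  constructor
  rw [bumpMeasure, withDensity_apply _ MeasurableSet.univ, Measure.restrict_univ,
    ← ofReal_integral_eq_lintegral_ofReal (bump n k).integrable_normed
      (Filter.Eventually.of_forall fun y => (bump n k).nonneg_normed y),
    (bump n k).integral_normed, ENNReal.ofReal_one]

lemma ae_bumpMeasure_norm_le (k : ℕ) : ∀ᵐ y ∂(bumpMeasure n k), ‖y‖ ≤ 1 / ((k : ℝ) + 1) := by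
  rw [bumpMeasure, ae_withDensity_iff
    ((bump n k).continuous_normed.measurable.ennreal_ofReal)]
  refine Filter.Eventually.of_forall fun y hy => ?_
  have h1 : y ∈ Function.support ((bump n k).normed volume) := by
    intro h0
    rw [h0, ENNReal.ofReal_zero] at hy
    exact hy rfl
  rw [(bump n k).support_normed_eq, mem_ball_zero_iff] at h1
  exact h1.le

/-- The `k`-th mollification. -/
def moll (k : ℕ) (f : E n → ℝ) : E n → ℝ := avg (bumpMeasure n k) f

lemma measurable_moll (k : ℕ) {f : E n → ℝ} (hf : Measurable f) : Measurable (moll k f) :=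
  measurable_avg _ hf

lemma moll_eq_convolution (k : ℕ) (f : E n → ℝ) :
    moll k f = MeasureTheory.convolution ((bump n k).normed volume) f
      (ContinuousLinearMap.lsmul ℝ ℝ) volume := by
  funext x
  rw [moll, avg, bumpMeasure, integral_withDensity_eq_integral_toReal_smul
    ((bump n k).continuous_normed.measurable.ennreal_ofReal)
    (Filter.Eventually.of_forall fun y => ENNReal.ofReal_lt_top)]
  simp only [convolution, ContinuousLinearMap.lsmul_apply]
  refine integral_congr_ae (Filter.Eventually.of_forall fun y => ?_)
  simp only [ENNReal.toReal_ofReal ((bump n k).nonneg_normed y)]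

lemma contDiff_moll (k : ℕ) {f : E n → ℝ} (hf : LocallyIntegrable f) {m : ℕ∞} :
    ContDiff ℝ m (moll k f) := by
  rw [moll_eq_convolution]
  exact (bump n k).hasCompactSupport_normed.contDiff_convolution_left _
    (bump n k).contDiff_normed hf

lemma ae_tendsto_moll {f : E n → ℝ} (hf : LocallyIntegrable f) :
    ∀ᵐ x, Filter.Tendsto (fun k => moll k f x) Filter.atTop (nhds (f x)) := by
  simp_rw [moll_eq_convolution]
  apply ContDiffBump.ae_convolution_tendsto_right_of_locallyIntegrable (K := 2)
  · exact tendsto_one_div_add_atTop_nhds_zero_nat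
  · refine Filter.Eventually.of_forall fun k => ?_
    simp only [bump]
    have : (0 : ℝ) < (k : ℝ) + 1 := by positivity
    field_simp
    rfl
  · exact hf

lemma tendsto_lintegral_moll_sub {f : E n → ℝ} (hfm : Measurable f) {a : ℝ} (ha : 1 ≤ a)
    (hf : MemLp f (ENNReal.ofReal a) volume) :
    Filter.Tendsto (fun k => ∫⁻ x, ‖moll k f x - f x‖ₑ ^ a) Filter.atTop (nhds 0) :=
  tendsto_lintegral_avg_sub hfm ha hf tendsto_one_div_add_atTop_nhds_zero_nat
    ae_bumpMeasure_norm_le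

/-- `g` is the weak `s`-th partial derivative of `f` in `Ω`; both functions are defined on the
whole space. -/
def HasWeakPartial (Ω : Set (E n)) (s : Fin n) (f g : E n → ℝ) : Prop :=
  ∀ φ : E n → ℝ, ContDiff ℝ ∞ φ → HasCompactSupport φ → tsupport φ ⊆ Ω →
    ∫ x, f x * fderiv ℝ φ x (EuclideanSpace.single s 1) = - ∫ x, g x * φ x

/-- Differentiation falls on the kernel, and t ↦ ρ(x-t) is an admissible test function as soon as
the closed ball that carries it lies in Ω. -/
lemma HasWeakPartial.fderiv_moll {Ω : Set (E n)} {s : Fin n} {f g : E n → ℝ}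
    (h : HasWeakPartial Ω s f g) (hf : LocallyIntegrable f) {k : ℕ}
    {x : E n} (hx : Metric.closedBall x (1 / ((k : ℝ) + 1)) ⊆ Ω) :
    fderiv ℝ (moll k f) x (EuclideanSpace.single s 1) = moll k g x := by
  set e : E n := EuclideanSpace.single s 1 with he
  set ρ := (bump n k).normed (volume : Measure (E n)) with hρ
  have hρc : ContDiff ℝ ∞ ρ := (bump n k).contDiff_normed
  have hρ1 : ContDiff ℝ 1 ρ := (bump n k).contDiff_normed (n := 1)
  have hρs : HasCompactSupport ρ := (bump n k).hasCompactSupport_normed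
  have hd := hρs.hasFDerivAt_convolution_left (ContinuousLinearMap.lsmul ℝ ℝ) hρ1 hf x
  rw [← moll_eq_convolution] at hd
  rw [hd.fderiv, convolution, ContinuousLinearMap.integral_apply]
  · have e1 : ∫ t, ((ContinuousLinearMap.precompL (E n) (ContinuousLinearMap.lsmul ℝ ℝ))
        (fderiv ℝ ρ t) (f (x - t))) e = ∫ t, f (x - t) * fderiv ℝ ρ t e := by
      refine integral_congr_ae (Filter.Eventually.of_forall fun t => ?_)
      simp [ContinuousLinearMap.precompL_apply, mul_comm]
    rw [e1]
    have e2 : ∫ t, f (x - t) * fderiv ℝ ρ t e = ∫ t, f t * fderiv ℝ ρ (x - t) e := by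
      rw [← integral_sub_left_eq_self (fun t => f t * fderiv ℝ ρ (x - t) e) volume x]
      simp
    rw [e2]
    set ψ : E n → ℝ := fun t => ρ (x - t) with hψ
    have hψd : ∀ t, fderiv ℝ ψ t e = - fderiv ℝ ρ (x - t) e := by
      intro t
      have h1 : HasFDerivAt (fun t : E n => x - t) (-(ContinuousLinearMap.id ℝ (E n))) t := by
        simpa using (hasFDerivAt_id t).const_sub x
      have h2 := ((hρ1.differentiable one_ne_zero (x - t)).hasFDerivAt).comp t h1
      have h3 : HasFDerivAt ψ _ t := h2
      rw [h3.fderiv]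
      simp
    have hψt : tsupport ψ ⊆ Metric.closedBall x (1 / ((k : ℝ) + 1)) := by
      apply closure_minimal _ Metric.isClosed_closedBall
      intro t ht
      have h1 : x - t ∈ Function.support ρ := ht
      rw [hρ, (bump n k).support_normed_eq, mem_ball_zero_iff] at h1
      rw [Metric.mem_closedBall, dist_comm, dist_eq_norm]
      exact h1.le
    have hψs : HasCompactSupport ψ :=
      (isCompact_closedBall x _).of_isClosed_subset (isClosed_tsupport _) hψt
    have hw := h ψ (hρc.comp (contDiff_const.sub contDiff_id)) hψs (hψt.trans hx)
    simp_rw [← he, hψd, mul_neg, integral_neg, neg_inj] at hw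
    rw [hw, moll_eq_convolution, convolution]
    rw [← integral_sub_left_eq_self (fun t => g t * ψ t) volume x]
    refine integral_congr_ae (Filter.Eventually.of_forall fun t => ?_)
    simp [hψ, hρ, mul_comm]
  · have hci := (hρs.fderiv ℝ).convolutionExists_left
      (ContinuousLinearMap.precompL (E n) (ContinuousLinearMap.lsmul ℝ ℝ))
      (hρ1.continuous_fderiv one_ne_zero) hf x
    exact hci

end Mollifier

/-! ### Difference quotients as averages along segments -/

section Segment

variable {n : ℕ}

/-- Fatou's lemma for a sequence with converging bounds; it carries several of the limit passages
below. -/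
lemma lintegral_le_of_tendsto_ae {α : Type*} [MeasurableSpace α] {μ : Measure α}
    {F : ℕ → α → ℝ≥0∞} {G : α → ℝ≥0∞} (hF : ∀ k, AEMeasurable (F k) μ)
    (hlim : ∀ᵐ x ∂μ, Filter.Tendsto (fun k => F k x) Filter.atTop (nhds (G x)))
    {b : ℕ → ℝ≥0∞} {β : ℝ≥0∞} (hb : ∀ᶠ k in Filter.atTop, ∫⁻ x, F k x ∂μ ≤ b k)
    (hβ : Filter.Tendsto b Filter.atTop (nhds β)) : ∫⁻ x, G x ∂μ ≤ β := by
  calc ∫⁻ x, G x ∂μ = ∫⁻ x, Filter.liminf (fun k => F k x) Filter.atTop ∂μ := by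
        apply lintegral_congr_ae
        filter_upwards [hlim] with x hx using hx.liminf_eq.symm
    _ ≤ Filter.liminf (fun k => ∫⁻ x, F k x ∂μ) Filter.atTop := lintegral_liminf_le' hF
    _ ≤ Filter.liminf b Filter.atTop := Filter.liminf_le_liminf hb
    _ = β := hβ.liminf_eq

lemma norm_smul_single (s : Fin n) (t : ℝ) :
    ‖t • (EuclideanSpace.single s (1 : ℝ) : E n)‖ = |t| := by
  rw [norm_smul]; simp

/-- The uniform distribution on the segment from `0` to `-t eₛ`. -/
def segMeasure (s : Fin n) (t : ℝ) : Measure (E n) :=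
  Measure.map (fun τ : ℝ => -((τ * t) • EuclideanSpace.single s (1 : ℝ)))
    (volume.restrict (Icc (0 : ℝ) 1))

lemma measurable_seg (s : Fin n) (t : ℝ) :
    Measurable (fun τ : ℝ => -((τ * t) • (EuclideanSpace.single s (1 : ℝ) : E n))) := by
  fun_prop

instance (s : Fin n) (t : ℝ) : IsProbabilityMeasure (segMeasure s t) := by
  have : IsProbabilityMeasure ((volume : Measure ℝ).restrict (Icc (0 : ℝ) 1)) := ⟨by simp⟩
  exact Measure.isProbabilityMeasure_map (measurable_seg s t).aemeasurable

lemma ae_segMeasure {s : Fin n} {t : ℝ} {P : E n → Prop} (hP : MeasurableSet {y | P y})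
    (h : ∀ τ ∈ Icc (0 : ℝ) 1, P (-((τ * t) • EuclideanSpace.single s (1 : ℝ)))) :
    ∀ᵐ y ∂(segMeasure s t), P y := by
  rw [segMeasure, ae_map_iff (measurable_seg s t).aemeasurable hP]
  filter_upwards [ae_restrict_mem measurableSet_Icc] with τ hτ using h τ hτ

lemma ae_segMeasure_norm_le (s : Fin n) (t : ℝ) : ∀ᵐ y ∂(segMeasure s t), ‖y‖ ≤ |t| := by
  apply ae_segMeasure (measurableSet_le (by fun_prop) (by fun_prop))
  intro τ hτ
  rw [norm_neg, norm_smul_single, abs_mul, abs_of_nonneg hτ.1]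
  have := hτ.2
  have := abs_nonneg t
  nlinarith

lemma avg_segMeasure {s : Fin n} {t : ℝ} {f : E n → ℝ} (hf : Measurable f) (x : E n) :
    avg (segMeasure s t) f x =
      ∫ τ in (0 : ℝ)..1, f (x + (τ * t) • EuclideanSpace.single s (1 : ℝ)) := by
  rw [avg, segMeasure, integral_map (measurable_seg s t).aemeasurable
    (show AEStronglyMeasurable (fun y => f (x - y)) _ from
      (hf.comp (by fun_prop)).aestronglyMeasurable), intervalIntegral.integral_of_le zero_le_one,
    integral_Icc_eq_integral_Ioc]
  simp

lemma sub_eq_mul_avg_of_contDiff {F : E n → ℝ} (hF : ContDiff ℝ 1 F) {g : E n → ℝ}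
    (hg : Measurable g) {s : Fin n} {t : ℝ} {x : E n}
    (h : ∀ τ ∈ Icc (0 : ℝ) 1,
      fderiv ℝ F (x + (τ * t) • EuclideanSpace.single s (1 : ℝ)) (EuclideanSpace.single s 1) =
        g (x + (τ * t) • EuclideanSpace.single s (1 : ℝ))) :
    F (x + t • EuclideanSpace.single s (1 : ℝ)) - F x = t * avg (segMeasure s t) g x := by
  set e : E n := EuclideanSpace.single s (1 : ℝ) with he
  have hd : ∀ τ : ℝ, HasDerivAt (fun τ : ℝ => F (x + (τ * t) • e))
      (t * fderiv ℝ F (x + (τ * t) • e) e) τ := by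
    intro τ
    have h1 : HasDerivAt (fun τ : ℝ => x + (τ * t) • e) (t • e) τ := by
      simpa using (((hasDerivAt_id τ).mul_const t).smul_const e).const_add x
    have h2 := ((hF.differentiable one_ne_zero (x + (τ * t) • e)).hasFDerivAt).comp_hasDerivAt τ h1
    rw [map_smul, smul_eq_mul] at h2
    exact h2
  have hc : Continuous fun τ : ℝ => t * fderiv ℝ F (x + (τ * t) • e) e := by
    have := hF.continuous_fderiv one_ne_zero
    fun_prop
  have := intervalIntegral.integral_eq_sub_of_hasDerivAt (a := 0) (b := 1)
    (fun τ _ => hd τ) (hc.intervalIntegrable _ _)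
  simp only [one_mul, zero_mul, zero_smul, add_zero] at this
  rw [← this, avg_segMeasure hg, intervalIntegral.integral_const_mul]
  congr 1
  apply intervalIntegral.integral_congr
  intro τ hτ
  rw [uIcc_of_le zero_le_one] at hτ
  exact h τ hτ

lemma moll_sub_eq_mul_avg {Ω : Set (E n)} {s : Fin n} {f g : E n → ℝ}
    (h : HasWeakPartial Ω s f g) (hf : LocallyIntegrable f) (hg : Measurable g)
    {x₀ : E n} {R ρ t : ℝ} (hR : Metric.ball x₀ R ⊆ Ω) {k : ℕ}
    (hk : ρ + |t| + 1 / ((k : ℝ) + 1) < R) {x : E n} (hx : x ∈ Metric.closedBall x₀ ρ) :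
    moll k f (x + t • EuclideanSpace.single s 1) - moll k f x =
      t * avg (segMeasure s t) (moll k g) x := by
  apply sub_eq_mul_avg_of_contDiff (contDiff_moll k hf) (measurable_avg _ hg)
  intro τ hτ
  apply h.fderiv_moll hf
  refine Subset.trans (fun y hy => ?_) hR
  rw [Metric.mem_closedBall, dist_eq_norm] at hy hx
  rw [Metric.mem_ball, dist_eq_norm]
  have h1 : ‖(τ * t) • (EuclideanSpace.single s (1 : ℝ) : E n)‖ ≤ |t| := by
    rw [norm_smul_single, abs_mul, abs_of_nonneg hτ.1]
    nlinarith [hτ.2, abs_nonneg t]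
  have h2 : y - x₀ = (y - (x + (τ * t) • (EuclideanSpace.single s (1 : ℝ) : E n))) + (x - x₀) +
      (τ * t) • (EuclideanSpace.single s (1 : ℝ) : E n) := by abel
  rw [h2]
  have h3 := norm_add_le ((y - (x + (τ * t) • (EuclideanSpace.single s (1 : ℝ) : E n))) + (x - x₀))
    ((τ * t) • (EuclideanSpace.single s (1 : ℝ) : E n))
  have h4 := norm_add_le (y - (x + (τ * t) • (EuclideanSpace.single s (1 : ℝ) : E n))) (x - x₀)
  linarith

/-- Difference quotients are averages of the weak derivative. -/
lemma HasWeakPartial.sub_eq_mul_avg {Ω : Set (E n)} {s : Fin n} {f g : E n → ℝ}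
    (h : HasWeakPartial Ω s f g) (hf : Integrable f) (hfm : Measurable f) (hg : Integrable g)
    (hgm : Measurable g) {x₀ : E n} {R ρ t : ℝ} (hR : Metric.ball x₀ R ⊆ Ω) (ht : ρ + |t| < R) :
    ∀ᵐ x, x ∈ Metric.ball x₀ ρ →
      f (x + t • EuclideanSpace.single s 1) - f x = t * avg (segMeasure s t) g x := by
  set e : E n := EuclideanSpace.single s 1 with he
  have hBm : MeasurableSet (Metric.ball x₀ ρ) := measurableSet_ball
  have hlim0 := tendsto_lintegral_moll_sub hgm le_rfl
    (by rw [ENNReal.ofReal_one]; exact memLp_one_iff_integrable.2 hg)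
  simp only [ENNReal.rpow_one] at hlim0
  have hS : Measurable (avg (segMeasure s t) g) := measurable_avg _ hgm
  have hM : ∀ k, Measurable (moll k f) := fun k => measurable_avg _ hfm
  -- For the mollifications the identity is exact once the mollifier radius is below R-ρ-|t|.
  -- Almost-everywhere convergence on the left and L¹ convergence on the right make the L¹ norm of
  -- the defect vanish.
  have hzero : ∫⁻ x in Metric.ball x₀ ρ,
      ‖f (x + t • e) - f x - t * avg (segMeasure s t) g x‖ₑ ≤ ‖t‖ₑ * 0 := by
    refine lintegral_le_of_tendsto_ae
      (F := fun k x => ‖moll k f (x + t • e) - moll k f x - t * avg (segMeasure s t) g x‖ₑ)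
      (b := fun k => ‖t‖ₑ * ∫⁻ x, ‖moll k g x - g x‖ₑ) ?_ ?_ ?_ ?_
    · intro k
      have := hM k
      fun_prop
    · apply ae_restrict_of_ae
      have h1 := ae_tendsto_moll hf.locallyIntegrable
      have h2 := (measurePreserving_add_right (volume : Measure (E n))
        (t • e)).quasiMeasurePreserving.ae h1
      filter_upwards [h1, h2] with x hx1 hx2
      exact ((hx2.sub hx1).sub_const _).enorm
    · have : ∀ᶠ k : ℕ in Filter.atTop, 1 / ((k : ℝ) + 1) < R - (ρ + |t|) :=
        tendsto_one_div_add_atTop_nhds_zero_nat.eventually (gt_mem_nhds (by linarith))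
      filter_upwards [this] with k hk
      calc ∫⁻ x in Metric.ball x₀ ρ,
            ‖moll k f (x + t • e) - moll k f x - t * avg (segMeasure s t) g x‖ₑ
          = ∫⁻ x in Metric.ball x₀ ρ,
            ‖t‖ₑ * ‖avg (segMeasure s t) (moll k g) x - avg (segMeasure s t) g x‖ₑ := by
            apply setLIntegral_congr_fun hBm
            intro x hx
            simp only
            rw [moll_sub_eq_mul_avg h hf.locallyIntegrable hgm hR (by linarith)
              (Metric.ball_subset_closedBall hx), ← mul_sub, enorm_mul]
        _ = ‖t‖ₑ * ∫⁻ x in Metric.ball x₀ ρ,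
            ‖avg (segMeasure s t) (moll k g) x - avg (segMeasure s t) g x‖ₑ ^ (1 : ℝ) := by
            have : Measurable (moll k g) := measurable_moll k hgm
            have := measurable_avg (segMeasure s t) this
            rw [lintegral_const_mul _ (by fun_prop)]
            simp
        _ ≤ ‖t‖ₑ * ∫⁻ x in univ, ‖moll k g x - g x‖ₑ ^ (1 : ℝ) := by
            refine mul_le_mul_of_nonneg_left ?_ zero_le
            exact lintegral_avg_sub_rpow_le (measurable_moll k hgm) hgm hBm MeasurableSet.univ
              (by simp) le_rfl
        _ = _ := by simp
    · exact ENNReal.Tendsto.const_mul hlim0 (Or.inr enorm_ne_top)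
  rw [mul_zero, nonpos_iff_eq_zero, lintegral_eq_zero_iff (by fun_prop)] at hzero
  have := (ae_restrict_iff' hBm).1 hzero
  filter_upwards [this] with x hx hxb
  have := hx hxb
  simp only [Pi.zero_apply, enorm_eq_zero] at this
  linarith

/-- Weak second derivatives commute. -/
lemma ae_symm_of_hasWeakPartial {Ω : Set (E n)} (hΩ : IsOpen Ω) {i j : Fin n}
    {f fi fj fij fji : E n → ℝ} (hi : HasWeakPartial Ω i f fi) (hj : HasWeakPartial Ω j f fj)
    (hij : HasWeakPartial Ω j fi fij) (hji : HasWeakPartial Ω i fj fji)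
    (hfij : Integrable fij) (hfji : Integrable fji) :
    ∀ᵐ x, x ∈ Ω → fij x = fji x := by
  have key : ∀ φ : E n → ℝ, ContDiff ℝ ∞ φ → HasCompactSupport φ → tsupport φ ⊆ Ω →
      ∫ x, φ x • (fij x - fji x) = 0 := by
    intro φ hφ hc hs
    have hpart : ∀ l : Fin n, ContDiff ℝ ∞ (fun x => fderiv ℝ φ x (EuclideanSpace.single l 1)) ∧
        HasCompactSupport (fun x => fderiv ℝ φ x (EuclideanSpace.single l 1)) ∧
        tsupport (fun x => fderiv ℝ φ x (EuclideanSpace.single l 1)) ⊆ Ω := by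
      intro l
      refine ⟨?_, ?_, ?_⟩
      · exact (hφ.fderiv_right (m := ∞) (by simp)).clm_apply contDiff_const
      · exact (hc.fderiv ℝ).comp_left (g := fun L : E n →L[ℝ] ℝ => L (EuclideanSpace.single l 1)) rfl
      · refine Subset.trans ?_ ((tsupport_fderiv_subset ℝ).trans hs)
        apply closure_mono
        intro x hx h0
        apply hx
        simp only
        rw [h0]; rfl
    have hsym : ∀ x, fderiv ℝ (fun y => fderiv ℝ φ y (EuclideanSpace.single j 1)) x
        (EuclideanSpace.single i 1) =
        fderiv ℝ (fun y => fderiv ℝ φ y (EuclideanSpace.single i 1)) x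
        (EuclideanSpace.single j 1) := by
      intro x
      have hd : DifferentiableAt ℝ (fderiv ℝ φ) x :=
        (hφ.fderiv_right (m := 1) (by norm_cast)).differentiable one_ne_zero x
      have hs2 : IsSymmSndFDerivAt ℝ φ x := hφ.contDiffAt.isSymmSndFDerivAt (by
        simp only [minSmoothness_of_isRCLikeNormedField]; exact ENat.LEInfty.out)
      have h1 : ∀ l m : Fin n, fderiv ℝ (fun y => fderiv ℝ φ y (EuclideanSpace.single l 1)) x
          (EuclideanSpace.single m 1) = fderiv ℝ (fderiv ℝ φ) x (EuclideanSpace.single m 1)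
            (EuclideanSpace.single l 1) := by
        intro l m
        have := (hd.hasFDerivAt.clm_apply (hasFDerivAt_const (EuclideanSpace.single l (1:ℝ)) x)).fderiv
        rw [this]
        simp
      rw [h1, h1]
      exact hs2.eq _ _
    have h1 := hij φ hφ hc hs
    have h2 := hji φ hφ hc hs
    have h3 := hi _ (hpart j).1 (hpart j).2.1 (hpart j).2.2
    have h4 := hj _ (hpart i).1 (hpart i).2.1 (hpart i).2.2
    simp_rw [hsym] at h3
    have h5 : ∫ x, fij x * φ x = ∫ x, fji x * φ x := by linarith
    obtain ⟨M, hM⟩ := hc.exists_bound_of_continuous hφ.continuous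
    have hb : ∀ {w : E n → ℝ}, Integrable w → Integrable (fun x => w x * φ x) := fun hw =>
      hw.mul_bdd (c := M) hφ.continuous.aestronglyMeasurable (Filter.Eventually.of_forall hM)
    have : ∀ x, φ x • (fij x - fji x) = fij x * φ x - fji x * φ x := fun x => by
      rw [smul_eq_mul]; ring
    simp_rw [this]
    rw [integral_sub (hb hfij) (hb hfji), h5, sub_self]
  have := hΩ.ae_eq_zero_of_integral_contDiff_smul_eq_zero (μ := volume)
    ((hfij.sub hfji).locallyIntegrable.locallyIntegrableOn Ω)
    (fun φ hφ hc hs => key φ hφ hc hs)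
  filter_upwards [this] with x hx hxΩ
  have := hx hxΩ
  simp only [Pi.sub_apply] at this
  linarith

end Segment

/-! ### Cut-off functions -/

section Cutoff

variable {n : ℕ}

lemma exists_deriv_smoothTransition_le : ∃ K : ℝ, 0 < K ∧ ∀ x, |deriv Real.smoothTransition x| ≤ K := by
  have hc : Continuous (deriv Real.smoothTransition) :=
    (Real.smoothTransition.contDiff (n := 1)).continuous_deriv le_rfl
  obtain ⟨K, hK⟩ := (isCompact_Icc (a := (0 : ℝ)) (b := 1)).exists_bound_of_continuousOn hc.continuousOn
  refine ⟨max K 1, by positivity, fun x => ?_⟩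
  by_cases hx : x ∈ Icc (0 : ℝ) 1
  · exact (hK x hx).trans (le_max_left _ _)
  · have : deriv Real.smoothTransition x = 0 := by
      rcases lt_or_ge x 0 with h0 | h0
      · have : Real.smoothTransition =ᶠ[nhds x] fun _ => (0 : ℝ) := by
          filter_upwards [gt_mem_nhds h0] with y hy
          exact Real.smoothTransition.zero_of_nonpos hy.le
        rw [this.deriv_eq]; simp
      · have h1 : 1 < x := by
          by_contra h; exact hx ⟨h0, not_lt.1 h⟩
        have : Real.smoothTransition =ᶠ[nhds x] fun _ => (1 : ℝ) := by
          filter_upwards [lt_mem_nhds h1] with y hy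
          exact Real.smoothTransition.one_of_one_le hy.le
        rw [this.deriv_eq]; simp
    rw [this, abs_zero]
    positivity

/-- Cut-off functions between concentric balls. -/
lemma exists_cutoff (n : ℕ) : ∃ K : ℝ, 0 < K ∧ ∀ (x₀ : E n) (ρ R : ℝ), 0 < ρ → ρ < R →
    ∃ η : E n → ℝ, ContDiff ℝ 1 η ∧ (∀ x, 0 ≤ η x ∧ η x ≤ 1) ∧
      (∀ x ∈ Metric.ball x₀ ρ, η x = 1) ∧ tsupport η ⊆ Metric.closedBall x₀ R ∧
      HasCompactSupport η ∧ ∀ x, ‖fderiv ℝ η x‖ ≤ K / (R - ρ) := by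
  obtain ⟨K, hK, hKle⟩ := exists_deriv_smoothTransition_le
  refine ⟨2 * K, by positivity, fun x₀ ρ R hρ hρR => ?_⟩
  have hD : 0 < R ^ 2 - ρ ^ 2 := by nlinarith
  -- The squared norm keeps the function smooth at the centre. The slope is at most a constant times
  -- 2R/(R²-ρ²), hence at most that constant times 2/(R-ρ).
  set a : E n → ℝ := fun x => (R ^ 2 - ‖x - x₀‖ ^ 2) / (R ^ 2 - ρ ^ 2) with ha
  have hac : ContDiff ℝ 1 a := by
    have : ContDiff ℝ 1 (fun x : E n => ‖x - x₀‖ ^ 2) := (contDiff_id.sub contDiff_const).norm_sq ℝ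
    exact (contDiff_const.sub this).div_const _
  set η : E n → ℝ := fun x => Real.smoothTransition (a x) with hη
  have hηc : ContDiff ℝ 1 η := Real.smoothTransition.contDiff.comp hac
  have hout : ∀ x, R ≤ ‖x - x₀‖ → η x = 0 := by
    intro x hx
    apply Real.smoothTransition.zero_of_nonpos
    apply div_nonpos_of_nonpos_of_nonneg _ hD.le
    nlinarith
  have hts : tsupport η ⊆ Metric.closedBall x₀ R := by
    apply closure_minimal _ Metric.isClosed_closedBall
    intro x hx
    rw [Metric.mem_closedBall, dist_eq_norm]
    by_contra h
    exact hx (hout x (not_le.1 h).le)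
  refine ⟨η, hηc, fun x => ⟨Real.smoothTransition.nonneg _, Real.smoothTransition.le_one _⟩, ?_,
    hts, (isCompact_closedBall x₀ R).of_isClosed_subset (isClosed_tsupport _) hts, ?_⟩
  · intro x hx
    rw [Metric.mem_ball, dist_eq_norm] at hx
    apply Real.smoothTransition.one_of_one_le
    rw [ha, one_le_div hD]
    nlinarith [norm_nonneg (x - x₀)]
  · intro x
    by_cases hx : x ∈ Metric.closedBall x₀ R
    · rw [Metric.mem_closedBall, dist_eq_norm] at hx
      have h1 : HasFDerivAt (fun x : E n => ‖x - x₀‖ ^ 2) (2 • (innerSL ℝ (x - x₀))) x := by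
        simpa using ((hasFDerivAt_id x).sub_const x₀).norm_sq
      have h2 : HasFDerivAt a ((R ^ 2 - ρ ^ 2)⁻¹ • (-(2 • (innerSL ℝ (x - x₀))) : E n →L[ℝ] ℝ)) x := by
        simpa [ha, div_eq_mul_inv, mul_comm] using (h1.const_sub (R ^ 2)).const_mul (R ^ 2 - ρ ^ 2)⁻¹
      have h3 := ((Real.smoothTransition.contDiff (n := 1)).differentiable one_ne_zero
        (a x)).hasDerivAt.comp_hasFDerivAt x h2
      have h4 : fderiv ℝ η x = _ := h3.fderiv
      rw [h4, norm_smul, norm_smul, norm_neg, Real.norm_eq_abs, Real.norm_eq_abs,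
        abs_of_pos (inv_pos.2 hD)]
      have h5 : ‖2 • (innerSL ℝ (x - x₀))‖ ≤ 2 * R := by
        rw [← Nat.cast_smul_eq_nsmul ℝ, norm_smul, innerSL_apply_norm]
        simp only [Nat.cast_ofNat, Real.norm_ofNat]
        linarith
      calc _ ≤ K * ((R ^ 2 - ρ ^ 2)⁻¹ * (2 * R)) := by
            gcongr
            exact hKle _
        _ = 2 * K / (R - ρ) * (R / (R + ρ)) := by
            have h6 : R ^ 2 - ρ ^ 2 = (R - ρ) * (R + ρ) := by ring
            have : R - ρ ≠ 0 := by linarith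
            have : R + ρ ≠ 0 := by linarith
            rw [h6]; field_simp
        _ ≤ 2 * K / (R - ρ) * 1 := by
            have : 0 < R - ρ := by linarith
            gcongr
            rw [div_le_one (by linarith)]
            linarith
        _ = _ := mul_one _
    · have : fderiv ℝ η x = 0 := by
        by_contra h
        exact hx (hts (support_fderiv_subset ℝ h))
      rw [this, norm_zero]
      have : 0 < R - ρ := by linarith
      positivity

end Cutoff

/-! ### Sobolev inequality for truncated functions -/

section Sobolev

variable {n : ℕ}

lemma eLpNorm_sq_eq {α F : Type*} [MeasurableSpace α] [NormedAddCommGroup F] {μ : Measure α}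
    {f : α → F} {σ : ℝ} (hσ : 0 < σ) {r : NNReal} (hr : (r : ℝ) = 2 * σ) :
    eLpNorm f r μ ^ (2 : ℝ) = (∫⁻ x, ‖f x‖ₑ ^ (2 * σ) ∂μ) ^ (1 / σ) := by
  have hr0 : (r : ℝ≥0∞) ≠ 0 := by
    have : (0 : ℝ) < r := by rw [hr]; positivity
    exact_mod_cast this.ne'
  rw [eLpNorm_eq_lintegral_rpow_enorm_toReal hr0 ENNReal.coe_ne_top, ENNReal.coe_toReal, hr,
    ← ENNReal.rpow_mul]
  congr 1
  field_simp

/-- With 1/p₀ = 1/n + 1/(2σ) the exponent 2σ is the Sobolev conjugate of p₀. The hypothesis says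
1/p₀ > 1/2, and n ≥ 2, σ > 1 give p₀ ≥ 1, so Hölder's inequality on the unit ball raises the
gradient norm from L^{p₀} to L². Thus n = 2 needs no separate treatment. -/
lemma exists_sobolev (hn : 2 ≤ n) {σ : ℝ} (hσ : 1 < σ) (h : 1 / 2 < 1 / (n : ℝ) + 1 / (2 * σ)) :
    ∃ CS : ℝ≥0∞, CS ≠ ⊤ ∧ ∀ (x₀ : E n) (F : E n → ℝ), ContDiff ℝ 1 F →
      tsupport F ⊆ Metric.closedBall x₀ 1 →
      (∫⁻ x, ‖F x‖ₑ ^ (2 * σ)) ^ (1 / σ) ≤ CS * ∫⁻ x, ‖fderiv ℝ F x‖ₑ ^ (2 : ℝ) := by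
  have hn0 : (0 : ℝ) < n := by positivity
  have hn2 : (2 : ℝ) ≤ n := by exact_mod_cast hn
  set p₀ : ℝ := (1 / (n : ℝ) + 1 / (2 * σ))⁻¹ with hp₀
  have hp₀pos : 0 < p₀ := by positivity
  have hp₀2 : p₀ ≤ 2 := by
    rw [hp₀, inv_le_comm₀ (by positivity) (by norm_num)]
    linarith
  have hp₀1 : 1 ≤ p₀ := by
    rw [hp₀, one_le_inv₀ (by positivity)]
    have h1 : 1 / (n : ℝ) ≤ 1 / 2 := one_div_le_one_div_of_le (by norm_num) hn2
    have h2 : 1 / (2 * σ) ≤ 1 / 2 := one_div_le_one_div_of_le (by norm_num) (by linarith)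
    linarith
  obtain ⟨P, hP⟩ : ∃ P : NNReal, (P : ℝ) = p₀ := ⟨⟨p₀, hp₀pos.le⟩, rfl⟩
  obtain ⟨r, hr⟩ : ∃ r : NNReal, (r : ℝ) = 2 * σ := ⟨⟨2 * σ, by positivity⟩, rfl⟩
  have hP1 : 1 ≤ P := by rw [← NNReal.coe_le_coe, hP]; simpa using hp₀1
  have hP2 : P ≤ 2 := by rw [← NNReal.coe_le_coe, hP]; simpa using hp₀2
  set V : ℝ≥0∞ := volume (Metric.closedBall (0 : E n) 1) with hV
  have hVtop : V ≠ ⊤ := measure_closedBall_lt_top.ne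
  set C₀ : ℝ≥0∞ := (SNormLESNormFDerivOfEqConst ℝ (volume : Measure (E n)) P : ℝ≥0∞)
  refine ⟨(C₀ * V ^ (1 / p₀ - 1 / 2)) ^ (2 : ℝ), ?_, fun x₀ F hF hs => ?_⟩
  · apply ENNReal.rpow_ne_top_of_nonneg (by norm_num)
    apply ENNReal.mul_ne_top ENNReal.coe_ne_top
    apply ENNReal.rpow_ne_top_of_nonneg _ hVtop
    have := one_div_le_one_div_of_le hp₀pos hp₀2
    linarith
  · have hc : HasCompactSupport F :=
      (isCompact_closedBall x₀ 1).of_isClosed_subset (isClosed_tsupport _) hs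
    have h1 := eLpNorm_le_eLpNorm_fderiv_of_eq (volume : Measure (E n)) hF hc (p := P) (p' := r)
      hP1 (by simp; omega) (by
        rw [hr, NNReal.coe_inv, hP, hp₀, inv_inv, finrank_euclideanSpace, Fintype.card_fin,
          one_div, one_div]
        ring)
    have h2 : eLpNorm (fderiv ℝ F) P volume =
        eLpNorm (fderiv ℝ F) P (volume.restrict (Metric.closedBall x₀ 1)) := by
      have hsf : Function.support (fun x => ‖fderiv ℝ F x‖) ⊆ Metric.closedBall x₀ 1 :=
        fun x hx => hs (support_fderiv_subset ℝ (fun h0 => hx (by simp [h0])))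
      rw [← eLpNorm_norm (fderiv ℝ F), ← eLpNorm_norm (fderiv ℝ F)
        (μ := volume.restrict (Metric.closedBall x₀ 1)), eLpNorm_restrict_eq_of_support_subset hsf]
    have h3 : eLpNorm (fderiv ℝ F) P (volume.restrict (Metric.closedBall x₀ 1)) ≤
        eLpNorm (fderiv ℝ F) 2 (volume.restrict (Metric.closedBall x₀ 1)) * V ^ (1 / p₀ - 1 / 2) := by
      have := eLpNorm_le_eLpNorm_mul_rpow_measure_univ (p := (P : ℝ≥0∞)) (q := 2)
        (μ := volume.restrict (Metric.closedBall x₀ 1)) (by exact_mod_cast hP2)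
        (hF.continuous_fderiv one_ne_zero).aestronglyMeasurable
      rw [Measure.restrict_apply_univ, Measure.addHaar_closedBall_center] at this
      simpa [hP] using this
    have h4 : eLpNorm (fderiv ℝ F) 2 (volume.restrict (Metric.closedBall x₀ 1)) ≤
        eLpNorm (fderiv ℝ F) ((2 : NNReal) : ℝ≥0∞) volume :=
      eLpNorm_mono_measure _ Measure.restrict_le_self
    have h5 : eLpNorm F r volume ≤
        (C₀ * V ^ (1 / p₀ - 1 / 2)) * eLpNorm (fderiv ℝ F) ((2 : NNReal) : ℝ≥0∞) volume := by
      calc _ ≤ _ := h1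
        _ ≤ C₀ * (eLpNorm (fderiv ℝ F) ((2 : NNReal) : ℝ≥0∞) volume * V ^ (1 / p₀ - 1 / 2)) := by
          rw [h2]
          gcongr
          exact h3.trans (by gcongr)
        _ = _ := by ring
    have h6 := ENNReal.rpow_le_rpow h5 (by norm_num : (0 : ℝ) ≤ 2)
    rw [ENNReal.mul_rpow_of_nonneg _ _ (by norm_num), eLpNorm_sq_eq (by linarith) hr,
      eLpNorm_sq_eq (σ := 1) one_pos (by norm_num)] at h6
    simpa using h6

lemma norm_fderiv_sq_eq_sum (F : E n → ℝ) (x : E n) :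
    ‖fderiv ℝ F x‖ ^ 2 = ∑ j, (fderiv ℝ F x (EuclideanSpace.single j 1)) ^ 2 := by
  have h1 : ‖fderiv ℝ F x‖ = ‖∇ F x‖ := by simp [gradient]
  rw [h1, EuclideanSpace.norm_sq_eq]
  simp [gradient_coord]

/-- The Sobolev inequality for `η Ψ(v)`, with `v` a Sobolev function. -/
lemma sobolev_comp {σ : ℝ} (hσ : 1 < σ) {CS : ℝ≥0∞} {x₀ : E n}
    (hCS : ∀ F : E n → ℝ, ContDiff ℝ 1 F → tsupport F ⊆ Metric.closedBall x₀ 1 →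
      (∫⁻ x, ‖F x‖ₑ ^ (2 * σ)) ^ (1 / σ) ≤ CS * ∫⁻ x, ‖fderiv ℝ F x‖ₑ ^ (2 : ℝ)) (hCST : CS ≠ ⊤)
    {Ω : Set (E n)} {R ρ : ℝ} (hR1 : R ≤ 1) (hρR : ρ < R) (hRΩ : Metric.ball x₀ R ⊆ Ω)
    {v : E n → ℝ} {g : Fin n → E n → ℝ} (hvm : Measurable v) (hgm : ∀ j, Measurable (g j))
    (hv : MemLp v 2) (hg : ∀ j, MemLp (g j) 2) (hweak : ∀ j, HasWeakPartial Ω j v (g j))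
    {η : E n → ℝ} (hη : ContDiff ℝ 1 η) (hη1 : ∀ x, 0 ≤ η x ∧ η x ≤ 1)
    (hηs : tsupport η ⊆ Metric.closedBall x₀ ρ) {K : ℝ} (hK : ∀ x, ‖fderiv ℝ η x‖ ≤ K)
    {Ψ Ψ' : ℝ → ℝ} (hΨ : ∀ r, HasDerivAt Ψ (Ψ' r) r) (hΨc : Continuous Ψ') {L : ℝ}
    (hL : ∀ r, |Ψ' r| ≤ L) :
    (∫⁻ x, ‖η x * Ψ (v x)‖ₑ ^ (2 * σ)) ^ (1 / σ) ≤
      CS * ∫⁻ x, ENNReal.ofReal (4 * (‖fderiv ℝ η x‖ ^ 2 * Ψ (v x) ^ 2 +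
        η x ^ 2 * Ψ' (v x) ^ 2 * ∑ j, g j x ^ 2)) := by
  have hL0 : 0 ≤ L := (abs_nonneg _).trans (hL 0)
  have hK0 : 0 ≤ K := (norm_nonneg _).trans (hK x₀)
  have h2e : ENNReal.ofReal 2 = 2 := by norm_num
  have hvli : LocallyIntegrable v := hv.locallyIntegrable (by norm_num)
  have hΨ1 : ContDiff ℝ 1 Ψ := by
    rw [contDiff_one_iff_deriv]
    refine ⟨fun r => (hΨ r).differentiableAt, ?_⟩
    have : deriv Ψ = Ψ' := funext fun r => (hΨ r).deriv
    rwa [this]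
  have hΨlip : ∀ a b, |Ψ a - Ψ b| ≤ L * |a - b| := by
    intro a b
    have := Convex.norm_image_sub_le_of_norm_hasDerivWithin_le (f := Ψ) (f' := Ψ') (s := univ)
      (C := L) (fun r _ => (hΨ r).hasDerivWithinAt) (fun r _ => hL r) convex_univ
      (mem_univ b) (mem_univ a)
    simpa using this
  set F : ℕ → E n → ℝ := fun k x => η x * Ψ (moll k v x) with hF
  have hF1 : ∀ k, ContDiff ℝ 1 (F k) := fun k => hη.mul (hΨ1.comp (contDiff_moll k hvli))
  have hFs : ∀ k, tsupport (F k) ⊆ Metric.closedBall x₀ ρ := fun k =>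
    (tsupport_mul_subset_left).trans hηs
  have hmv := fun k => measurable_moll k hvm
  have hmg := fun k j => measurable_moll k (hgm j)
  -- In the gradient of η Ψ(v_k), with v_k the mollification of v, Ψ(v_k) and ∇v_k are replaced by
  -- their limits at a cost collected in `Err`; two uses of (a+b)² ≤ 2a²+2b² give the factors 4. As
  -- Ψ' is merely continuous, Ψ'(v_k) stays in `Main` and is passed to the limit by domination
  -- through L.
  set Err : ℕ → ℝ≥0∞ := fun k => ENNReal.ofReal (4 * (K ^ 2 * L ^ 2)) *
      (∫⁻ x, ‖moll k v x - v x‖ₑ ^ (2 : ℝ)) +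
    ∑ j, ENNReal.ofReal (4 * L ^ 2) * (∫⁻ x, ‖moll k (g j) x - g j x‖ₑ ^ (2 : ℝ)) with hErr
  have hErr0 : Filter.Tendsto Err Filter.atTop (nhds 0) := by
    have h1 := tendsto_lintegral_moll_sub hvm (by norm_num : (1 : ℝ) ≤ 2) (by rwa [h2e])
    have h2 : ∀ j, Filter.Tendsto (fun k => ∫⁻ x, ‖moll k (g j) x - g j x‖ₑ ^ (2 : ℝ))
        Filter.atTop (nhds 0) := fun j =>
      tendsto_lintegral_moll_sub (hgm j) (by norm_num : (1 : ℝ) ≤ 2) (by rw [h2e]; exact hg j)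
    have h3 : (0 : ℝ≥0∞) = ENNReal.ofReal (4 * (K ^ 2 * L ^ 2)) * 0 +
        ∑ j : Fin n, ENNReal.ofReal (4 * L ^ 2) * 0 := by simp
    rw [h3]
    exact (ENNReal.Tendsto.const_mul h1 (Or.inr ENNReal.ofReal_ne_top)).add
      (tendsto_finsetSum _ fun j _ => ENNReal.Tendsto.const_mul (h2 j) (Or.inr ENNReal.ofReal_ne_top))
  -- the main part of the right-hand side
  set Main : ℕ → ℝ≥0∞ := fun k => ∫⁻ x, ENNReal.ofReal (4 * (‖fderiv ℝ η x‖ ^ 2 * Ψ (v x) ^ 2 +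
        η x ^ 2 * Ψ' (moll k v x) ^ 2 * ∑ j, g j x ^ 2)) with hMain
  have hdη : Measurable (fun x => ‖fderiv ℝ η x‖) :=
    (hη.continuous_fderiv one_ne_zero).norm.measurable
  have hηm : Measurable η := hη.continuous.measurable
  have hΨm : Measurable Ψ := hΨ1.continuous.measurable
  have hΨ'm : Measurable Ψ' := hΨc.measurable
  have hsplit : ∀ w : E n → ℝ, Measurable w → ∫⁻ x, ENNReal.ofReal (4 * (‖fderiv ℝ η x‖ ^ 2 * Ψ (v x) ^ 2 +
        η x ^ 2 * Ψ' (w x) ^ 2 * ∑ j, g j x ^ 2)) =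
      (∫⁻ x, ENNReal.ofReal (4 * (‖fderiv ℝ η x‖ ^ 2 * Ψ (v x) ^ 2))) +
      ∫⁻ x, ENNReal.ofReal (4 * (η x ^ 2 * Ψ' (w x) ^ 2 * ∑ j, g j x ^ 2)) := by
    intro w hw
    rw [← lintegral_add_left (by fun_prop)]
    refine lintegral_congr fun x => ?_
    rw [mul_add, ENNReal.ofReal_add (by positivity)
      (by have : 0 ≤ ∑ j, g j x ^ 2 := Finset.sum_nonneg fun j _ => sq_nonneg _
          positivity)]
  have hMainlim : Filter.Tendsto Main Filter.atTop (nhds (∫⁻ x, ENNReal.ofReal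
      (4 * (‖fderiv ℝ η x‖ ^ 2 * Ψ (v x) ^ 2 + η x ^ 2 * Ψ' (v x) ^ 2 * ∑ j, g j x ^ 2)))) := by
    have : Main = fun k => (∫⁻ x, ENNReal.ofReal (4 * (‖fderiv ℝ η x‖ ^ 2 * Ψ (v x) ^ 2))) +
      ∫⁻ x, ENNReal.ofReal (4 * (η x ^ 2 * Ψ' (moll k v x) ^ 2 * ∑ j, g j x ^ 2)) :=
      funext fun k => hsplit _ (hmv k)
    rw [this, hsplit v hvm]
    refine tendsto_const_nhds.add ?_
    refine tendsto_lintegral_of_dominated_convergence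
      (fun x => ENNReal.ofReal (4 * (L ^ 2 * ∑ j, g j x ^ 2))) ?_ ?_ ?_ ?_
    · intro k
      have := hmv k
      fun_prop
    · intro k
      refine Filter.Eventually.of_forall fun x => ?_
      apply ENNReal.ofReal_le_ofReal
      have h0 : 0 ≤ ∑ j, g j x ^ 2 := Finset.sum_nonneg fun j _ => sq_nonneg _
      have h1 : η x ^ 2 ≤ 1 := pow_le_one₀ (hη1 x).1 (hη1 x).2
      have h2 : Ψ' (moll k v x) ^ 2 ≤ L ^ 2 := by
        rw [← sq_abs]
        have := hL (moll k v x)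
        gcongr
      have h3 : η x ^ 2 * Ψ' (moll k v x) ^ 2 ≤ 1 * L ^ 2 := by gcongr
      rw [one_mul] at h3
      gcongr
    · have hfint : Integrable (fun x => 4 * (L ^ 2 * ∑ j, g j x ^ 2)) := by
        apply Integrable.const_mul
        apply Integrable.const_mul
        exact integrable_finsetSum _ fun j _ => (hg j).integrable_sq
      have := hfint.lintegral_lt_top
      exact this.ne
    · filter_upwards [ae_tendsto_moll hvli] with x hx
      apply ENNReal.tendsto_ofReal
      exact ((((hΨc.tendsto _).comp hx).pow 2).const_mul _ |>.mul_const _).const_mul 4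
  have hstep : ∀ᶠ k in Filter.atTop,
      (∫⁻ x, ‖F k x‖ₑ ^ (2 * σ)) ^ (1 / σ) ≤ CS * (Main k + Err k) := by
    have : ∀ᶠ k : ℕ in Filter.atTop, 1 / ((k : ℝ) + 1) < R - ρ :=
      tendsto_one_div_add_atTop_nhds_zero_nat.eventually (gt_mem_nhds (by linarith))
    filter_upwards [this] with k hk
    refine (hCS (F k) (hF1 k) ((hFs k).trans (Metric.closedBall_subset_closedBall (by linarith)))).trans ?_
    refine mul_le_mul_of_nonneg_left ?_ zero_le
    have hpt : ∀ x, ‖fderiv ℝ (F k) x‖ₑ ^ (2 : ℝ) ≤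
        ENNReal.ofReal (4 * (‖fderiv ℝ η x‖ ^ 2 * Ψ (v x) ^ 2 +
          η x ^ 2 * Ψ' (moll k v x) ^ 2 * ∑ j, g j x ^ 2)) +
        (ENNReal.ofReal (4 * (K ^ 2 * L ^ 2)) * ‖moll k v x - v x‖ₑ ^ (2 : ℝ) +
          ∑ j, ENNReal.ofReal (4 * L ^ 2) * ‖moll k (g j) x - g j x‖ₑ ^ (2 : ℝ)) := by
      intro x
      have hen : ∀ r : ℝ, ‖r‖ₑ ^ (2 : ℝ) = ENNReal.ofReal (r ^ 2) := fun r => by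
        rw [← ofReal_norm, ENNReal.ofReal_rpow_of_nonneg (norm_nonneg _) (by norm_num),
          Real.rpow_two, Real.norm_eq_abs, sq_abs]
      have hen' : ‖fderiv ℝ (F k) x‖ₑ ^ (2 : ℝ) = ENNReal.ofReal (‖fderiv ℝ (F k) x‖ ^ 2) := by
        rw [← ofReal_norm, ENNReal.ofReal_rpow_of_nonneg (norm_nonneg _) (by norm_num),
          Real.rpow_two]
      have hS0 : 0 ≤ ∑ j, g j x ^ 2 := Finset.sum_nonneg fun j _ => sq_nonneg _
      rw [hen', hen]
      simp_rw [hen, ← ENNReal.ofReal_mul (show 0 ≤ 4 * L ^ 2 by positivity)]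
      rw [← ENNReal.ofReal_mul (by positivity), ← ENNReal.ofReal_sum_of_nonneg
        (fun j _ => by positivity), ← ENNReal.ofReal_add (by positivity)
        (Finset.sum_nonneg fun j _ => by positivity), ← ENNReal.ofReal_add (by positivity)
        (add_nonneg (by positivity) (Finset.sum_nonneg fun j _ => by positivity))]
      apply ENNReal.ofReal_le_ofReal
      by_cases hx : x ∈ Metric.closedBall x₀ ρ
      · have hd1 : HasFDerivAt (moll k v) (fderiv ℝ (moll k v) x) x :=
          ((contDiff_moll (m := 1) k hvli).differentiable (by simp) x).hasFDerivAt
        have hd2 := (hΨ (moll k v x)).comp_hasFDerivAt x hd1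
        have hd3 := ((hη.differentiable one_ne_zero x).hasFDerivAt).mul hd2
        have hd4 : fderiv ℝ (F k) x = η x • (Ψ' (moll k v x) • fderiv ℝ (moll k v) x) +
            Ψ (moll k v x) • fderiv ℝ η x := hd3.fderiv
        have hn1 : ‖fderiv ℝ (F k) x‖ ≤ η x * |Ψ' (moll k v x)| * ‖fderiv ℝ (moll k v) x‖ +
            |Ψ (moll k v x)| * ‖fderiv ℝ η x‖ := by
          rw [hd4]
          refine (norm_add_le _ _).trans ?_
          rw [norm_smul, norm_smul, norm_smul, Real.norm_eq_abs, Real.norm_eq_abs,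
            Real.norm_eq_abs, abs_of_nonneg (hη1 x).1, mul_assoc]
        have hn2 : ‖fderiv ℝ (moll k v) x‖ ^ 2 = ∑ j, (moll k (g j) x) ^ 2 := by
          rw [norm_fderiv_sq_eq_sum]
          refine Finset.sum_congr rfl fun j _ => ?_
          rw [(hweak j).fderiv_moll hvli]
          refine Subset.trans (fun y hy => ?_) hRΩ
          rw [Metric.mem_closedBall] at hy hx
          rw [Metric.mem_ball]
          have := dist_triangle y x x₀
          linarith
        have hn3 : ∑ j, (moll k (g j) x) ^ 2 ≤ 2 * (∑ j, g j x ^ 2) +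
            2 * ∑ j, (moll k (g j) x - g j x) ^ 2 := by
          rw [Finset.mul_sum, Finset.mul_sum, ← Finset.sum_add_distrib]
          refine Finset.sum_le_sum fun j _ => ?_
          nlinarith [sq_nonneg (moll k (g j) x - 2 * g j x)]
        have hn4 : Ψ (moll k v x) ^ 2 ≤ 2 * Ψ (v x) ^ 2 + 2 * (L ^ 2 * (moll k v x - v x) ^ 2) := by
          have h1 := hΨlip (moll k v x) (v x)
          have h2 : (Ψ (moll k v x) - Ψ (v x)) ^ 2 ≤ L ^ 2 * (moll k v x - v x) ^ 2 := by
            rw [← sq_abs, ← sq_abs (moll k v x - v x), ← mul_pow]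
            gcongr
          nlinarith [sq_nonneg (Ψ (moll k v x) - 2 * Ψ (v x))]
        have hn5 : Ψ' (moll k v x) ^ 2 ≤ L ^ 2 := by
          rw [← sq_abs]
          have := hL (moll k v x)
          gcongr
        have hn6 : η x ^ 2 ≤ 1 := pow_le_one₀ (hη1 x).1 (hη1 x).2
        have hn7 : ‖fderiv ℝ η x‖ ^ 2 ≤ K ^ 2 := by
          have := hK x
          gcongr
        set A := η x ^ 2 * Ψ' (moll k v x) ^ 2 with hA
        have hA0 : 0 ≤ A := by positivity
        have hAL : A ≤ L ^ 2 := by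
          calc A ≤ 1 * L ^ 2 := by rw [hA]; gcongr
            _ = _ := one_mul _
        set B := ‖fderiv ℝ η x‖ ^ 2 with hB
        have hB0 : 0 ≤ B := by positivity
        have hsum0 : 0 ≤ ∑ j, (moll k (g j) x - g j x) ^ 2 :=
          Finset.sum_nonneg fun j _ => sq_nonneg _
        calc ‖fderiv ℝ (F k) x‖ ^ 2
            ≤ (η x * |Ψ' (moll k v x)| * ‖fderiv ℝ (moll k v) x‖ +
            |Ψ (moll k v x)| * ‖fderiv ℝ η x‖) ^ 2 := by gcongr
          _ ≤ 2 * (η x * |Ψ' (moll k v x)| * ‖fderiv ℝ (moll k v) x‖) ^ 2 +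
            2 * (|Ψ (moll k v x)| * ‖fderiv ℝ η x‖) ^ 2 := by
              nlinarith [sq_nonneg (η x * |Ψ' (moll k v x)| * ‖fderiv ℝ (moll k v) x‖ -
                |Ψ (moll k v x)| * ‖fderiv ℝ η x‖)]
          _ = 2 * (A * ∑ j, (moll k (g j) x) ^ 2) + 2 * (B * Ψ (moll k v x) ^ 2) := by
              rw [mul_pow, mul_pow, mul_pow, sq_abs, sq_abs, hn2]; ring
          _ ≤ 2 * (A * (2 * (∑ j, g j x ^ 2) + 2 * ∑ j, (moll k (g j) x - g j x) ^ 2)) +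
              2 * (B * (2 * Ψ (v x) ^ 2 + 2 * (L ^ 2 * (moll k v x - v x) ^ 2))) := by gcongr
          _ = 4 * (B * Ψ (v x) ^ 2 + A * ∑ j, g j x ^ 2) +
              (4 * (B * L ^ 2) * (moll k v x - v x) ^ 2 +
                4 * A * ∑ j, (moll k (g j) x - g j x) ^ 2) := by ring
          _ ≤ 4 * (B * Ψ (v x) ^ 2 + A * ∑ j, g j x ^ 2) +
              (4 * (K ^ 2 * L ^ 2) * (moll k v x - v x) ^ 2 +
                4 * L ^ 2 * ∑ j, (moll k (g j) x - g j x) ^ 2) := by gcongr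
          _ = _ := by simp only [Finset.mul_sum]
      · have : fderiv ℝ (F k) x = 0 := by
          by_contra h
          exact hx ((hFs k) (support_fderiv_subset ℝ h))
        rw [this, norm_zero]
        have : 0 ≤ ∑ j, 4 * L ^ 2 * (moll k (g j) x - g j x) ^ 2 :=
          Finset.sum_nonneg fun j _ => by positivity
        rw [zero_pow two_ne_zero]
        exact add_nonneg (by positivity) (add_nonneg (by positivity) this)
    refine (lintegral_mono hpt).trans (le_of_eq ?_)
    have := hmv k
    have := hmg k
    rw [lintegral_add_left (by fun_prop), lintegral_add_left (by fun_prop),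
      lintegral_const_mul _ (by fun_prop), lintegral_finsetSum _ (fun j _ => by fun_prop)]
    congr 2
    refine Finset.sum_congr rfl fun j _ => ?_
    rw [lintegral_const_mul _ (by fun_prop)]
  -- pass to the limit
  have hlimR : Filter.Tendsto (fun k => CS * (Main k + Err k)) Filter.atTop (nhds (CS * _)) :=
    ENNReal.Tendsto.const_mul (hMainlim.add hErr0) (Or.inr hCST)
  rw [add_zero] at hlimR
  set RHS := ∫⁻ x, ENNReal.ofReal (4 * (‖fderiv ℝ η x‖ ^ 2 * Ψ (v x) ^ 2 +
        η x ^ 2 * Ψ' (v x) ^ 2 * ∑ j, g j x ^ 2)) with hRHS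
  have hσ0 : 0 < σ := by linarith
  have hfat : ∫⁻ x, ‖η x * Ψ (v x)‖ₑ ^ (2 * σ) ≤ (CS * RHS) ^ σ := by
    refine lintegral_le_of_tendsto_ae (F := fun k x => ‖F k x‖ₑ ^ (2 * σ))
      (b := fun k => (CS * (Main k + Err k)) ^ σ) ?_ ?_ ?_ ?_
    · intro k
      have := (hF1 k).continuous.measurable
      fun_prop
    · filter_upwards [ae_tendsto_moll hvli] with x hx
      have h1 : Filter.Tendsto (fun k => F k x) Filter.atTop (nhds (η x * Ψ (v x))) :=
        ((hΨ1.continuous.tendsto _).comp hx).const_mul _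
      exact ((ENNReal.continuous_rpow_const).tendsto _).comp h1.enorm
    · filter_upwards [hstep] with k hk
      have := ENNReal.rpow_le_rpow hk hσ0.le
      rwa [← ENNReal.rpow_mul, one_div, inv_mul_cancel₀ hσ0.ne', ENNReal.rpow_one] at this
    · exact ((ENNReal.continuous_rpow_const).tendsto _).comp hlimR
  have := ENNReal.rpow_le_rpow hfat (by positivity : 0 ≤ 1 / σ)
  rwa [← ENNReal.rpow_mul, mul_one_div_cancel hσ0.ne', ENNReal.rpow_one] at this

end Sobolev

/-- Solutions of the Euler–Lagrange equation in the a-priori smooth class, with globally defined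
measurable representatives of the function, its gradient and its Hessian. -/
structure SmoothSolution {n : ℕ} (q : ℝ) (Ω' : Set (E n)) (A : E n → E n → E n)
    (U : E n → ℝ) (V : E n → E n) (W : E n → Fin n → E n) : Prop where
  isOpen : IsOpen Ω'
  volume_ne_top : volume Ω' ≠ ⊤
  U_meas : Measurable U
  U_int : Integrable U
  V_meas : Measurable V
  V_int : Integrable V
  V_two : MemLp V 2
  V_mem : MemLp V (ENNReal.ofReal q)
  W_meas : ∀ i, Measurable (fun x => W x i)
  W_int : ∀ i, Integrable (fun x => W x i)
  W_two : ∀ i, MemLp (fun x => W x i) 2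
  U_weak : ∀ i, HasWeakPartial Ω' i U (fun x => V x i)
  V_weak : ∀ i j, HasWeakPartial Ω' j (fun x => V x i) (fun x => W x i j)
  euler : ∀ ψ : E n → ℝ, ContDiff ℝ 1 ψ → HasCompactSupport ψ → tsupport ψ ⊆ Ω' →
    ∫ x in Ω', fderiv ℝ ψ x (A x (V x)) = 0

/-! ### The difference of the Euler–Lagrange equation -/

section Difference

variable {n : ℕ}

lemma measurable_coord (i : Fin n) : Measurable (fun v : E n => v i) :=
  (by fun_prop : Continuous fun v : E n => v i).measurable

lemma memLp_coord {V : E n → E n} {r : ℝ≥0∞} (hV : MemLp V r) (i : Fin n) :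
    MemLp (fun x => V x i) r :=
  hV.of_le ((by fun_prop : Continuous fun v : E n => v i).comp_aestronglyMeasurable hV.1)
    (Filter.Eventually.of_forall fun x => abs_apply_le_norm (V x) i)

lemma tendsto_lintegral_mul_zero {α : Type*} [MeasurableSpace α] {μ : Measure α} {q q' : ℝ}
    (hq : q.HolderConjugate q') {f : ℕ → α → ℝ≥0∞} (hf : ∀ k, AEMeasurable (f k) μ)
    {d : α → ℝ≥0∞} (hd : AEMeasurable d μ) (hdf : ∫⁻ x, d x ^ q' ∂μ ≠ ⊤)
    (hlim : Filter.Tendsto (fun k => ∫⁻ x, f k x ^ q ∂μ) Filter.atTop (nhds 0)) :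
    Filter.Tendsto (fun k => ∫⁻ x, f k x * d x ∂μ) Filter.atTop (nhds 0) := by
  have h1 : Filter.Tendsto (fun k => (∫⁻ x, f k x ^ q ∂μ) ^ (1 / q) * (∫⁻ x, d x ^ q' ∂μ) ^ (1 / q'))
      Filter.atTop (nhds 0) := by
    have h2 := ((ENNReal.continuous_rpow_const (y := 1 / q)).tendsto 0).comp hlim
    rw [ENNReal.zero_rpow_of_pos (one_div_pos.2 hq.pos)] at h2
    have h3 := ENNReal.Tendsto.mul_const (b := (∫⁻ x, d x ^ q' ∂μ) ^ (1 / q')) h2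
      (Or.inr (ENNReal.rpow_ne_top_of_nonneg (one_div_pos.2 hq.symm.pos).le hdf))
    rwa [zero_mul] at h3
  refine tendsto_of_tendsto_of_tendsto_of_le_of_le tendsto_const_nhds h1 (fun k => zero_le)
    (fun k => ENNReal.lintegral_mul_le_Lp_mul_Lq μ hq (hf k) hd)

variable {p q c C : ℝ} {Ω' : Set (E n)} {A : E n → E n → E n} {U : E n → ℝ} {V : E n → E n}
  {W : E n → Fin n → E n}

/-- The flux grows like |V|^{q-1}, so for V in L^q it lies in the dual space L^{q/(q-1)}. This
duality makes the pairing of flux differences with differences of V meaningful and stable under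
approximation. -/
lemma SmoothSolution.memLp_flux (hS : SmoothSolution q Ω' A U V W)
    (hA : GrowthField p q Ω' A c C) (hq : 2 ≤ q) :
    MemLp (Ω'.indicator fun x => A x (V x)) (ENNReal.ofReal (q / (q - 1))) := by
  have hC := hA.C_pos
  have hfin : IsFiniteMeasure (volume.restrict Ω') :=
    ⟨by rw [Measure.restrict_apply_univ]; exact hS.volume_ne_top.lt_top⟩
  rw [memLp_indicator_iff_restrict hS.isOpen.measurableSet]
  have h1 : MemLp (fun x => ‖V x‖ ^ (q - 1)) (ENNReal.ofReal (q / (q - 1)))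
      (volume.restrict Ω') := by
    have := (hS.V_mem.restrict Ω').norm_rpow_div (ENNReal.ofReal (q - 1))
    rw [ENNReal.toReal_ofReal (by linarith)] at this
    rwa [ENNReal.ofReal_div_of_pos (by linarith)]
  have h2 : MemLp (fun x => 3 * C * (1 + ‖V x‖ ^ (q - 1))) (ENNReal.ofReal (q / (q - 1)))
      (volume.restrict Ω') := ((memLp_const (1 : ℝ)).add h1).const_mul (3 * C)
  refine h2.mono' (aestronglyMeasurable_comp_continuousOn hS.isOpen hA.cont
    hS.V_meas.aestronglyMeasurable) ?_
  filter_upwards [ae_restrict_mem hS.isOpen.measurableSet] with x hx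
  exact hA.norm_le hq hx (V x)

lemma SmoothSolution.integrable_flux (hS : SmoothSolution q Ω' A U V W)
    (hA : GrowthField p q Ω' A c C) (hq : 2 ≤ q) :
    Integrable (Ω'.indicator fun x => A x (V x)) := by
  have hfin : IsFiniteMeasure (volume.restrict Ω') :=
    ⟨by rw [Measure.restrict_apply_univ]; exact hS.volume_ne_top.lt_top⟩
  have h := hS.memLp_flux hA hq
  rw [memLp_indicator_iff_restrict hS.isOpen.measurableSet] at h
  rw [integrable_indicator_iff hS.isOpen.measurableSet]
  refine h.integrable ?_
  rw [ENNReal.one_le_ofReal, one_le_div (by linarith)]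
  linarith

lemma fderiv_eq_sum (F : E n → ℝ) (x w : E n) :
    fderiv ℝ F x w = ∑ j, fderiv ℝ F x (EuclideanSpace.single j 1) * w j := by
  rw [← gradient_apply_eq_fderiv, PiLp.inner_apply]
  refine Finset.sum_congr rfl fun j _ => ?_
  rw [← gradient_coord]
  simp [mul_comm]

/-- Discrete differentiation of the Euler–Lagrange equation: smooth test functions. -/
lemma SmoothSolution.integral_fderiv_difference (hS : SmoothSolution q Ω' A U V W)
    (hA : GrowthField p q Ω' A c C) (hq : 2 ≤ q) {x₀ : E n} {R ρ t : ℝ} {s : Fin n}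
    (hR : Metric.ball x₀ R ⊆ Ω') (ht : ρ + |t| < R) {φ : E n → ℝ} (hφ : ContDiff ℝ 1 φ)
    (hφs : tsupport φ ⊆ Metric.closedBall x₀ ρ) :
    ∫ x in Metric.closedBall x₀ ρ, fderiv ℝ φ x
      (A (x + t • EuclideanSpace.single s 1) (V (x + t • EuclideanSpace.single s 1)) -
        A x (V x)) = 0 := by
  set e : E n := EuclideanSpace.single s 1 with he
  set a : E n → E n := Ω'.indicator (fun x => A x (V x)) with ha
  have hai : Integrable a := hS.integrable_flux hA hq
  have hφc : HasCompactSupport φ :=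
    (isCompact_closedBall x₀ ρ).of_isClosed_subset (isClosed_tsupport _) hφs
  have hdc : Continuous (fderiv ℝ φ) := hφ.continuous_fderiv one_ne_zero
  obtain ⟨M, hM⟩ := (hφc.fderiv ℝ).exists_bound_of_continuous hdc
  have hbdd : ∀ (L : E n → E n →L[ℝ] ℝ), Continuous L → (∀ x, ‖L x‖ ≤ M) →
      ∀ b : E n → E n, Integrable b → Integrable (fun x => L x (b x)) := by
    intro L hL hLM b hb
    refine (hb.norm.const_mul M).mono' ?_ (Filter.Eventually.of_forall fun x => ?_)
    · exact (ContinuousLinearMap.aestronglyMeasurable_comp₂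
        (ContinuousLinearMap.id ℝ (E n →L[ℝ] ℝ)) hL.aestronglyMeasurable hb.1)
    · exact ((L x).le_opNorm _).trans (by gcongr; exact hLM x)
  have hmem : ∀ x ∈ Metric.closedBall x₀ ρ, x ∈ Ω' ∧ x + t • e ∈ Ω' := by
    intro x hx
    rw [Metric.mem_closedBall, dist_eq_norm] at hx
    refine ⟨hR ?_, hR ?_⟩
    · rw [Metric.mem_ball, dist_eq_norm]
      linarith [abs_nonneg t]
    · rw [Metric.mem_ball, dist_eq_norm]
      have h1 : x + t • e - x₀ = (x - x₀) + t • e := by abel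
      have := norm_add_le (x - x₀) (t • e)
      rw [norm_smul_single] at this
      rw [h1]; linarith
  have hts : tsupport (fun x => φ (x - t • e) - φ x) ⊆ Metric.closedBall x₀ (ρ + |t|) := by
    apply closure_minimal _ Metric.isClosed_closedBall
    intro x hx
    rw [Metric.mem_closedBall, dist_eq_norm]
    by_contra hlt
    rw [not_le] at hlt
    apply hx
    have hz : ∀ y, ρ < ‖y - x₀‖ → φ y = 0 := fun y hy => by
      by_contra h
      have := hφs (subset_closure h)
      rw [Metric.mem_closedBall, dist_eq_norm] at this
      linarith
    have h1 : φ x = 0 := hz x (by linarith [abs_nonneg t])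
    have h2 : φ (x - t • e) = 0 := hz _ (by
      have h3 : x - x₀ = (x - t • e - x₀) + t • e := by abel
      have := norm_add_le (x - t • e - x₀) (t • e)
      rw [norm_smul_single, ← h3] at this
      linarith)
    simp [h1, h2]
  have hφt : ContDiff ℝ 1 (fun x => φ (x - t • e)) := hφ.comp (contDiff_id.sub contDiff_const)
  -- Testing with φ(·-te)-φ, whose support stays in the ball of radius ρ+|t| < R, and translating
  -- back moves the difference from the test function to the flux.
  have hE := hS.euler (fun x => φ (x - t • e) - φ x) (hφt.sub hφ)
    ((isCompact_closedBall x₀ _).of_isClosed_subset (isClosed_tsupport _) hts)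
    (hts.trans ((Metric.closedBall_subset_ball ht).trans hR))
  have hfd : ∀ x, fderiv ℝ (fun x => φ (x - t • e) - φ x) x =
      fderiv ℝ φ (x - t • e) - fderiv ℝ φ x := by
    intro x
    have h1 := fderiv_fun_sub (𝕜 := ℝ) (hφt.differentiable one_ne_zero x)
      (hφ.differentiable one_ne_zero x)
    rw [h1, fderiv_comp_sub]
  have e1 : ∫ x in Ω', fderiv ℝ (fun x => φ (x - t • e) - φ x) x (A x (V x)) =
      ∫ x, (fderiv ℝ φ (x - t • e) (a x) - fderiv ℝ φ x (a x)) := by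
    rw [← integral_indicator hS.isOpen.measurableSet]
    refine integral_congr_ae (Filter.Eventually.of_forall fun x => ?_)
    by_cases hx : x ∈ Ω'
    · simp [ha, hx, hfd]
    · simp [ha, hx]
  rw [e1, integral_sub (hbdd _ (by fun_prop) (fun x => hM _) a hai) (hbdd _ hdc hM a hai)] at hE
  have e2 : ∫ x, fderiv ℝ φ (x - t • e) (a x) = ∫ x, fderiv ℝ φ x (a (x + t • e)) := by
    rw [← integral_add_right_eq_self _ (t • e)]
    simp
  rw [e2, ← integral_sub (hbdd _ hdc hM (fun x => a (x + t • e)) (hai.comp_add_right _))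
    (hbdd _ hdc hM a hai)] at hE
  have hz : ∀ x ∉ Metric.closedBall x₀ ρ,
      fderiv ℝ φ x (a (x + t • e)) - fderiv ℝ φ x (a x) = 0 := by
    intro x hx
    have : fderiv ℝ φ x = 0 := by
      by_contra h
      exact hx (hφs (support_fderiv_subset ℝ h))
    simp [this]
  rw [← hE, ← setIntegral_eq_integral_of_forall_compl_eq_zero hz]
  refine setIntegral_congr_fun measurableSet_closedBall fun x hx => ?_
  simp [ha, (hmem x hx).1, (hmem x hx).2, map_sub]

end Difference

/-! ### Nonlinear test functions -/

section DifferenceTest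

lemma lintegral_rpow_lt_top_of_memLp {α F : Type*} [MeasurableSpace α] [NormedAddCommGroup F]
    {μ : Measure α} {f : α → F} {q : ℝ} (hq : 0 < q) (hf : MemLp f (ENNReal.ofReal q) μ) :
    ∫⁻ x, ‖f x‖ₑ ^ q ∂μ < ⊤ := by
  have := (eLpNorm_lt_top_iff_lintegral_rpow_enorm_lt_top (by simpa using hq)
    ENNReal.ofReal_ne_top).1 hf.2
  rwa [ENNReal.toReal_ofReal hq.le] at this

lemma memLp_of_lintegral_rpow_lt_top {α F : Type*} [MeasurableSpace α] [NormedAddCommGroup F]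
    {μ : Measure α} {f : α → F} {q : ℝ} (hq : 0 < q) (hfm : AEStronglyMeasurable f μ)
    (hf : ∫⁻ x, ‖f x‖ₑ ^ q ∂μ < ⊤) : MemLp f (ENNReal.ofReal q) μ := by
  refine ⟨hfm, (eLpNorm_lt_top_iff_lintegral_rpow_enorm_lt_top (by simpa using hq)
    ENNReal.ofReal_ne_top).2 ?_⟩
  rwa [ENNReal.toReal_ofReal hq.le]

lemma integrable_bdd_mul_mul {α : Type*} [MeasurableSpace α] {μ : Measure α} {q q' : ℝ}
    (hq : q.HolderConjugate q') {b f d : α → ℝ} {L : ℝ} (hb : AEStronglyMeasurable b μ)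
    (hbL : ∀ x, |b x| ≤ L) (hf : MemLp f (ENNReal.ofReal q) μ)
    (hd : MemLp d (ENNReal.ofReal q') μ) : Integrable (fun x => b x * f x * d x) μ := by
  have : ENNReal.HolderConjugate (ENNReal.ofReal q) (ENNReal.ofReal q') := hq.ennrealOfReal
  have h1 : Integrable (fun x => f x * d x) μ := hf.integrable_mul hd
  have h2 := h1.bdd_mul (c := L) hb (Filter.Eventually.of_forall hbL)
  refine h2.congr (Filter.Eventually.of_forall fun x => ?_)
  simp only; ring

/-- The bounded factors converge only pointwise, so they are treated by dominated convergence, while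
the L^q factors converge strongly and are paired with d in the dual space by Hölder. -/
lemma tendsto_integral_mul_mul {α : Type*} [MeasurableSpace α] {μ : Measure α} {q q' : ℝ}
    (hq : q.HolderConjugate q') {b f : ℕ → α → ℝ} {b' f' d : α → ℝ} {L : ℝ}
    (hb : ∀ k, AEStronglyMeasurable (b k) μ) (hbL : ∀ k x, |b k x| ≤ L)
    (hf : ∀ k, MemLp (f k) (ENNReal.ofReal q) μ) (hf' : MemLp f' (ENNReal.ofReal q) μ)
    (hd : MemLp d (ENNReal.ofReal q') μ)
    (hblim : ∀ᵐ x ∂μ, Filter.Tendsto (fun k => b k x) Filter.atTop (nhds (b' x)))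
    (hlim : Filter.Tendsto (fun k => ∫⁻ x, ‖f k x - f' x‖ₑ ^ q ∂μ) Filter.atTop (nhds 0)) :
    Filter.Tendsto (fun k => ∫ x, b k x * f k x * d x ∂μ) Filter.atTop
      (nhds (∫ x, b' x * f' x * d x ∂μ)) := by
  have : ENNReal.HolderConjugate (ENNReal.ofReal q) (ENNReal.ofReal q') := hq.ennrealOfReal
  have hI : ∀ k, Integrable (fun x => b k x * f k x * d x) μ := fun k =>
    integrable_bdd_mul_mul hq (hb k) (hbL k) (hf k) hd
  have hI' : ∀ k, Integrable (fun x => b k x * f' x * d x) μ := fun k =>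
    integrable_bdd_mul_mul hq (hb k) (hbL k) hf' hd
  have h2 : Filter.Tendsto (fun k => ∫ x, b k x * f' x * d x ∂μ) Filter.atTop
      (nhds (∫ x, b' x * f' x * d x ∂μ)) := by
    have hfd : Integrable (fun x => f' x * d x) μ := hf'.integrable_mul hd
    refine tendsto_integral_of_dominated_convergence (fun x => L * |f' x * d x|)
      (fun k => (hI' k).1) (hfd.abs.const_mul L) (fun k => Filter.Eventually.of_forall fun x => ?_)
      ?_
    · rw [Real.norm_eq_abs, mul_assoc, abs_mul]
      exact mul_le_mul_of_nonneg_right (hbL k x) (abs_nonneg _)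
    · filter_upwards [hblim] with x hx
      exact (hx.mul_const _).mul_const _
  have h3 : Filter.Tendsto (fun k => ∫ x, b k x * f k x * d x ∂μ - ∫ x, b k x * f' x * d x ∂μ)
      Filter.atTop (nhds 0) := by
    rw [tendsto_zero_iff_enorm_tendsto_zero]
    have h4 := tendsto_lintegral_mul_zero hq (μ := μ) (f := fun k x => ‖f k x - f' x‖ₑ)
      (fun k => ((hf k).1.sub hf'.1).enorm) hd.1.enorm
      (lintegral_rpow_lt_top_of_memLp hq.symm.pos hd).ne hlim
    have h5 := ENNReal.Tendsto.const_mul (a := ENNReal.ofReal L) h4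
      (Or.inr ENNReal.ofReal_ne_top)
    rw [mul_zero] at h5
    refine tendsto_of_tendsto_of_tendsto_of_le_of_le tendsto_const_nhds h5 (fun k => zero_le)
      fun k => ?_
    refine (enorm_integral_sub_integral_le (hI k).1 (hI' k).1).trans ?_
    rw [← lintegral_const_mul' _ _ ENNReal.ofReal_ne_top]
    refine lintegral_mono fun x => ?_
    have : b k x * f k x * d x - b k x * f' x * d x = b k x * ((f k x - f' x) * d x) := by ring
    rw [this, enorm_mul, enorm_mul]
    gcongr
    rw [← ofReal_norm]
    exact ENNReal.ofReal_le_ofReal (hbL k x)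
  simpa using h3.add h2

variable {n : ℕ} {p q c C : ℝ} {Ω' : Set (E n)} {A : E n → E n → E n} {U : E n → ℝ} {V : E n → E n}
  {W : E n → Fin n → E n}

lemma memLp_avg {μ : Measure (E n)} [IsProbabilityMeasure μ] {f : E n → ℝ} (hfm : Measurable f)
    {q : ℝ} (hq : 1 ≤ q) (hf : MemLp f (ENNReal.ofReal q)) :
    MemLp (avg μ f) (ENNReal.ofReal q) := by
  have hq0 : 0 < q := by linarith
  refine memLp_of_lintegral_rpow_lt_top hq0 (measurable_avg μ hfm).aestronglyMeasurable ?_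
  have := lintegral_avg_rpow_le (μ := μ) hfm (K := univ) (L := univ) MeasurableSet.univ
    MeasurableSet.univ (by simp) hq
  simp only [Measure.restrict_univ] at this
  exact this.trans_lt (lintegral_rpow_lt_top_of_memLp hq0 hf)

/-- The differentiated Euler–Lagrange equation tested with `η² G(Δ_t u)`. -/
lemma SmoothSolution.euler_difference (hS : SmoothSolution q Ω' A U V W)
    (hA : GrowthField p q Ω' A c C) (hq : 2 ≤ q) {x₀ : E n} {R ρ t : ℝ} {s : Fin n}
    (hR : Metric.ball x₀ R ⊆ Ω') (ht : ρ + |t| < R) (ht0 : t ≠ 0) {η : E n → ℝ}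
    (hη : ContDiff ℝ 1 η) (hηs : tsupport η ⊆ Metric.closedBall x₀ ρ)
    {G g : ℝ → ℝ} (hG : ∀ r, HasDerivAt G (g r) r) (hg : Continuous g) {L : ℝ}
    (hL : ∀ r, |g r| ≤ L) (hG0 : G 0 = 0) {v : E n → ℝ}
    (hv : v = avg (segMeasure s t) (fun x => V x s)) {D : E n → E n}
    (hD : D = fun x => A (x + t • EuclideanSpace.single s 1) (V (x + t • EuclideanSpace.single s 1)) -
        A x (V x)) {Q : E n → E n}
    (hQ : Q = fun x => t⁻¹ • (V (x + t • EuclideanSpace.single s 1) - V x)) :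
    IntegrableOn (fun x => 2 * η x * G (v x) * fderiv ℝ η x (D x) +
      η x ^ 2 * g (v x) * inner ℝ (D x) (Q x)) (Metric.closedBall x₀ ρ) ∧
    ∫ x in Metric.closedBall x₀ ρ, (2 * η x * G (v x) * fderiv ℝ η x (D x) +
      η x ^ 2 * g (v x) * inner ℝ (D x) (Q x)) = 0 := by
  have hq1 : 1 ≤ q := by linarith
  have hq0 : 0 < q := by linarith
  have hconj : q.HolderConjugate (q / (q - 1)) := Real.HolderConjugate.conjExponent (by linarith)
  set e : E n := EuclideanSpace.single s 1 with he
  set B := Metric.closedBall x₀ ρ with hB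
  have hBm : MeasurableSet B := measurableSet_closedBall
  have hηc : HasCompactSupport η :=
    (isCompact_closedBall x₀ ρ).of_isClosed_subset (isClosed_tsupport _) hηs
  have hdc : Continuous (fderiv ℝ η) := hη.continuous_fderiv one_ne_zero
  obtain ⟨M, hM⟩ := (hηc.fderiv ℝ).exists_bound_of_continuous hdc
  obtain ⟨M', hM'⟩ := hηc.exists_bound_of_continuous hη.continuous
  have hL0 : 0 ≤ L := (abs_nonneg _).trans (hL 0)
  have hGl : ∀ a b, |G a - G b| ≤ L * |a - b| := by
    intro a b
    have := Convex.norm_image_sub_le_of_norm_hasDerivWithin_le (f := G) (f' := g) (s := univ)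
      (C := L) (x := b) (y := a) (fun r _ => (hG r).hasDerivWithinAt) (fun r _ => hL r) convex_univ
      (mem_univ _) (mem_univ _)
    simpa using this
  have hGc : Continuous G := continuous_iff_continuousAt.2 fun r => (hG r).continuousAt
  have hVm : ∀ i, Measurable fun x => V x i := fun i => (measurable_coord i).comp hS.V_meas
  have hVq : ∀ i, MemLp (fun x => V x i) (ENNReal.ofReal q) := fun i => memLp_coord hS.V_mem i
  have hVi : ∀ i, Integrable fun x => V x i := fun i =>
    memLp_one_iff_integrable.1 (memLp_coord (memLp_one_iff_integrable.2 hS.V_int) i)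
  -- the flux
  set a : E n → E n := Ω'.indicator (fun x => A x (V x)) with ha
  have haq : MemLp a (ENNReal.ofReal (q / (q - 1))) := hS.memLp_flux hA hq
  have hmem : ∀ x ∈ B, x ∈ Ω' ∧ x + t • e ∈ Ω' := by
    intro x hx
    rw [hB, Metric.mem_closedBall, dist_eq_norm] at hx
    refine ⟨hR ?_, hR ?_⟩
    · rw [Metric.mem_ball, dist_eq_norm]
      linarith [abs_nonneg t]
    · rw [Metric.mem_ball, dist_eq_norm]
      have h1 : x + t • e - x₀ = (x - x₀) + t • e := by abel
      have := norm_add_le (x - x₀) (t • e)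
      rw [norm_smul_single] at this
      rw [h1]; linarith
  have htr : MeasurePreserving (fun x : E n => x + t • e) := measurePreserving_add_right _ _
  have hDq : MemLp D (ENNReal.ofReal (q / (q - 1))) (volume.restrict B) := by
    have h1 : MemLp (fun x => a (x + t • e) - a x) (ENNReal.ofReal (q / (q - 1)))
        (volume.restrict B) := ((haq.comp_measurePreserving htr).sub haq).restrict B
    refine h1.ae_eq ?_
    filter_upwards [ae_restrict_mem hBm] with x hx
    simp [hD, ha, (hmem x hx).1, (hmem x hx).2]
  have hDi : ∀ i, MemLp (fun x => η x ^ 2 * D x i) (ENNReal.ofReal (q / (q - 1)))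
      (volume.restrict B) := by
    intro i
    refine (hDq.norm.const_mul (M' ^ 2)).of_le ((hη.continuous.pow 2).aestronglyMeasurable.mul
      ((by fun_prop : Continuous fun v : E n => v i).comp_aestronglyMeasurable hDq.1))
      (Filter.Eventually.of_forall fun x => ?_)
    have h1 : |η x| ≤ M' := hM' x
    rw [Real.norm_eq_abs, Real.norm_eq_abs, abs_mul, abs_mul, abs_norm, abs_pow, abs_pow]
    exact mul_le_mul (pow_le_pow_left₀ (abs_nonneg _) (h1.trans (le_abs_self _)) 2)
      (abs_apply_le_norm _ _) (abs_nonneg _) (by positivity)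
  have hDη : MemLp (fun x => 2 * η x * fderiv ℝ η x (D x)) (ENNReal.ofReal (q / (q - 1)))
      (volume.restrict B) := by
    refine (hDq.norm.const_mul (2 * M' * M)).of_le
      ((continuous_const.mul hη.continuous).aestronglyMeasurable.mul
      (ContinuousLinearMap.aestronglyMeasurable_comp₂
        (ContinuousLinearMap.id ℝ (E n →L[ℝ] ℝ)) hdc.aestronglyMeasurable hDq.1))
      (Filter.Eventually.of_forall fun x => ?_)
    have h1 : |η x| ≤ M' := hM' x
    have h2 : ‖fderiv ℝ η x (D x)‖ ≤ M * ‖D x‖ :=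
      ((fderiv ℝ η x).le_opNorm _).trans (by gcongr; exact hM x)
    have hM0 : 0 ≤ M := (norm_nonneg _).trans (hM x)
    have hM'0 : 0 ≤ M' := (norm_nonneg _).trans (hM' x)
    rw [norm_mul, norm_mul, norm_mul, norm_norm, Real.norm_of_nonneg (by positivity : (0:ℝ) ≤ 2 * M' * M),
      Real.norm_eq_abs (η x), Real.norm_ofNat]
    calc 2 * |η x| * ‖fderiv ℝ η x (D x)‖ ≤ 2 * M' * (M * ‖D x‖) := by gcongr
      _ = _ := by ring
  -- approximations
  have hmm : ∀ k i, Measurable (moll k (fun x => V x i)) := fun k i => measurable_moll k (hVm i)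
  have hmq : ∀ k i, MemLp (moll k (fun x => V x i)) (ENNReal.ofReal q) := fun k i =>
    memLp_avg (hVm i) hq1 (hVq i)
  -- `wk` is the difference quotient of the mollified U on the ball considered, and `Qk` below is
  -- its gradient. Test functions must be C¹, so the identity is first proved with these and then
  -- passed to the limit; G has bounded derivative and vanishes at 0, which keeps G(`wk`) in L^q.
  set wk : ℕ → E n → ℝ := fun k => avg (segMeasure s t) (moll k (fun x => V x s)) with hwk
  have hwkm : ∀ k, Measurable (wk k) := fun k => measurable_avg _ (hmm k s)
  have hwkq : ∀ k, MemLp (wk k) (ENNReal.ofReal q) := fun k => memLp_avg (hmm k s) hq1 (hmq k s)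
  have hvm : Measurable v := hv ▸ measurable_avg _ (hVm s)
  have hvq : MemLp v (ENNReal.ofReal q) := hv ▸ memLp_avg (hVm s) hq1 (hVq s)
  have hwlim : Filter.Tendsto (fun k => ∫⁻ x, ‖wk k x - v x‖ₑ ^ q) Filter.atTop (nhds 0) := by
    refine tendsto_of_tendsto_of_tendsto_of_le_of_le tendsto_const_nhds
      (tendsto_lintegral_moll_sub (hVm s) hq1 (hVq s)) (fun k => zero_le) fun k => ?_
    have := lintegral_avg_sub_rpow_le (μ := segMeasure s t) (hmm k s) (hVm s) (K := univ)
      (L := univ) MeasurableSet.univ MeasurableSet.univ (by simp) hq1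
    simpa [hv, hwk] using this
  set Qk : ℕ → Fin n → E n → ℝ := fun k i x =>
    t⁻¹ * (moll k (fun x => V x i) (x + t • e) - moll k (fun x => V x i) x) with hQk
  have hQkq : ∀ k i, MemLp (Qk k i) (ENNReal.ofReal q) := fun k i =>
    (((hmq k i).comp_measurePreserving htr).sub (hmq k i)).const_mul _
  have hQiq : ∀ i, MemLp (fun x => Q x i) (ENNReal.ofReal q) := fun i => by
    have := (((hVq i).comp_measurePreserving htr).sub (hVq i)).const_mul t⁻¹
    simpa [hQ] using this
  have hQlim : ∀ i, Filter.Tendsto (fun k => ∫⁻ x, ‖Qk k i x - Q x i‖ₑ ^ q) Filter.atTop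
      (nhds 0) := by
    intro i
    have h1 := tendsto_lintegral_moll_sub (hVm i) hq1 (hVq i)
    set d : ℕ → E n → ℝ≥0∞ := fun k x => ‖moll k (fun x => V x i) x - V x i‖ₑ ^ q with hd
    have hdm : ∀ k, Measurable (d k) := fun k => ((hmm k i).sub (hVm i)).enorm.pow_const _
    have h2 : Filter.Tendsto (fun k => ‖t⁻¹‖ₑ ^ q * (2 ^ (q - 1) * ((∫⁻ x, d k x) + ∫⁻ x, d k x)))
        Filter.atTop (nhds 0) := by
      have := ENNReal.Tendsto.const_mul (a := ‖t⁻¹‖ₑ ^ q) (ENNReal.Tendsto.const_mul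
        (a := 2 ^ (q - 1)) (h1.add h1) (Or.inr (ENNReal.rpow_ne_top_of_nonneg (by linarith) (by simp))))
        (Or.inr (ENNReal.rpow_ne_top_of_nonneg hq0.le enorm_ne_top))
      simpa using this
    refine tendsto_of_tendsto_of_tendsto_of_le_of_le tendsto_const_nhds h2 (fun k => zero_le)
      fun k => ?_
    have h3 : ∫⁻ x, d k (x + t • e) = ∫⁻ x, d k x :=
      lintegral_add_right_eq_self (μ := volume) (d k) (t • e)
    calc ∫⁻ x, ‖Qk k i x - Q x i‖ₑ ^ q
        ≤ ∫⁻ x, ‖t⁻¹‖ₑ ^ q * (2 ^ (q - 1) * (d k (x + t • e) + d k x)) := by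
          refine lintegral_mono fun x => ?_
          have h4 : Qk k i x - Q x i = t⁻¹ * ((moll k (fun x => V x i) (x + t • e) - V (x + t • e) i)
            - (moll k (fun x => V x i) x - V x i)) := by
            simp [hQk, hQ]; ring
          rw [h4, enorm_mul, ENNReal.mul_rpow_of_nonneg _ _ hq0.le]
          gcongr
          refine (ENNReal.rpow_le_rpow enorm_sub_le hq0.le).trans ?_
          exact ENNReal.rpow_add_le_mul_rpow_add_rpow _ _ hq1
      _ = _ := by
          rw [lintegral_const_mul _ (by fun_prop), lintegral_const_mul _ (by fun_prop),
            lintegral_add_left (by fun_prop), h3]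
  -- a.e. convergence
  have hwae : ∀ᵐ x ∂(volume.restrict B), Filter.Tendsto (fun k => wk k x) Filter.atTop
      (nhds (v x)) := by
    -- The closed ball is placed inside a slightly larger open one, on which v is almost everywhere
    -- the difference quotient of U. Pointwise convergence then follows from that of the
    -- mollifications of U at x and at x + te.
    obtain ⟨ρ', hρ', hρ'R⟩ : ∃ ρ', ρ < ρ' ∧ ρ' + |t| < R :=
      ⟨(ρ + (R - |t|)) / 2, by linarith, by linarith⟩
    have h1 := (hS.U_weak s).sub_eq_mul_avg hS.U_int hS.U_meas (hVi s) (hVm s) hR hρ'R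
    have h2 := ae_tendsto_moll hS.U_int.locallyIntegrable
    have h3 : ∀ᵐ x, Filter.Tendsto (fun k => moll k U (x + t • e)) Filter.atTop
        (nhds (U (x + t • e))) := htr.quasiMeasurePreserving.ae h2
    rw [ae_restrict_iff' hBm]
    filter_upwards [h1, h2, h3] with x h1 h2 h3 hx
    have h4 := h1 (Metric.closedBall_subset_ball hρ' hx)
    have h5 : v x = t⁻¹ * (U (x + t • e) - U x) := by
      rw [h4, hv]; field_simp
    rw [h5]
    refine ((h3.sub h2).const_mul t⁻¹).congr' ?_
    have h6 : Filter.Tendsto (fun k : ℕ => 1 / ((k : ℝ) + 1)) Filter.atTop (nhds 0) :=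
      tendsto_one_div_add_atTop_nhds_zero_nat
    filter_upwards [h6.eventually_lt_const (by linarith : 0 < R - ρ - |t|)] with k hk
    rw [moll_sub_eq_mul_avg (hS.U_weak s) hS.U_int.locallyIntegrable (hVm s) hR (ρ := ρ)
      (by linarith) hx]
    field_simp
    rfl
  -- limits
  set T1 : ℕ → ℝ := fun k => ∫ x in B, 1 * G (wk k x) * (2 * η x * fderiv ℝ η x (D x)) with hT1
  set T2 : ℕ → Fin n → ℝ := fun k i => ∫ x in B, g (wk k x) * Qk k i x * (η x ^ 2 * D x i) with hT2
  have hGmem : ∀ w : E n → ℝ, Measurable w → MemLp w (ENNReal.ofReal q) →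
      MemLp (fun x => G (w x)) (ENNReal.ofReal q) (volume.restrict B) := by
    intro w hwm hw
    refine ((hw.const_mul L).of_le (hGc.measurable.comp hwm).aestronglyMeasurable
      (Filter.Eventually.of_forall fun x => ?_)).restrict B
    have := hGl (w x) 0
    rw [hG0, sub_zero, sub_zero] at this
    rw [Real.norm_eq_abs, Real.norm_eq_abs, abs_mul, abs_of_nonneg hL0]
    exact this
  have hrestr : ∀ f : ℕ → E n → ℝ≥0∞, Filter.Tendsto (fun k => ∫⁻ x, f k x) Filter.atTop (nhds 0) →
      Filter.Tendsto (fun k => ∫⁻ x in B, f k x) Filter.atTop (nhds 0) := fun f hf =>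
    tendsto_of_tendsto_of_tendsto_of_le_of_le tendsto_const_nhds hf (fun k => zero_le)
      fun k => setLIntegral_le_lintegral _ _
  have hT1lim : Filter.Tendsto T1 Filter.atTop
      (nhds (∫ x in B, 1 * G (v x) * (2 * η x * fderiv ℝ η x (D x)))) := by
    refine tendsto_integral_mul_mul hconj (b := fun _ _ => 1) (b' := fun _ => 1) (L := 1)
      (fun k => aestronglyMeasurable_const) (fun k x => by simp) (fun k => hGmem _ (hwkm k) (hwkq k))
      (hGmem _ hvm hvq) hDη (Filter.Eventually.of_forall fun x => tendsto_const_nhds) ?_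
    have h1 := ENNReal.Tendsto.const_mul (a := ENNReal.ofReal L ^ q) (hrestr _ hwlim)
      (Or.inr (ENNReal.rpow_ne_top_of_nonneg hq0.le ENNReal.ofReal_ne_top))
    rw [mul_zero] at h1
    refine tendsto_of_tendsto_of_tendsto_of_le_of_le tendsto_const_nhds h1 (fun k => zero_le)
      fun k => ?_
    simp only
    rw [← lintegral_const_mul' _ _ (ENNReal.rpow_ne_top_of_nonneg hq0.le ENNReal.ofReal_ne_top)]
    refine lintegral_mono fun x => ?_
    rw [← ENNReal.mul_rpow_of_nonneg _ _ hq0.le, ← ofReal_norm, ← ofReal_norm,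
      ← ENNReal.ofReal_mul hL0]
    gcongr
    exact hGl _ _
  have hT2lim : ∀ i, Filter.Tendsto (fun k => T2 k i) Filter.atTop
      (nhds (∫ x in B, g (v x) * Q x i * (η x ^ 2 * D x i))) := by
    intro i
    refine tendsto_integral_mul_mul hconj (L := L)
      (fun k => (hg.measurable.comp (hwkm k)).aestronglyMeasurable) (fun k x => hL _)
      (fun k => (hQkq k i).restrict B) ((hQiq i).restrict B) (hDi i) ?_ (hrestr _ (hQlim i))
    filter_upwards [hwae] with x hx
    exact (hg.tendsto _).comp hx
  have hI1 : Integrable (fun x => 1 * G (v x) * (2 * η x * fderiv ℝ η x (D x)))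
      (volume.restrict B) :=
    integrable_bdd_mul_mul hconj (b := fun _ => 1) (L := 1) aestronglyMeasurable_const (by simp)
      (hGmem _ hvm hvq) hDη
  have hI2 : ∀ i, Integrable (fun x => g (v x) * Q x i * (η x ^ 2 * D x i))
      (volume.restrict B) := fun i =>
    integrable_bdd_mul_mul hconj (L := L) (hg.measurable.comp hvm).aestronglyMeasurable
      (fun x => hL _) ((hQiq i).restrict B) (hDi i)
  have hHeq : (fun x => 2 * η x * G (v x) * fderiv ℝ η x (D x) +
      η x ^ 2 * g (v x) * inner ℝ (D x) (Q x)) = fun x =>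
      1 * G (v x) * (2 * η x * fderiv ℝ η x (D x)) +
        ∑ i, g (v x) * Q x i * (η x ^ 2 * D x i) := by
    funext x
    rw [PiLp.inner_apply, Finset.mul_sum]
    congr 1
    · ring
    · refine Finset.sum_congr rfl fun i _ => ?_
      simp; ring
  have hI2s := integrable_finsetSum Finset.univ (fun i _ => hI2 i)
  refine ⟨by rw [hHeq]; exact hI1.add hI2s, ?_⟩
  rw [hHeq, integral_add hI1 hI2s, integral_finsetSum _ (fun i _ => hI2 i)]
  have hlim := hT1lim.add (tendsto_finsetSum Finset.univ fun i _ => hT2lim i)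
  refine tendsto_nhds_unique hlim (tendsto_const_nhds.congr' ?_)
  have h6 : Filter.Tendsto (fun k : ℕ => 1 / ((k : ℝ) + 1)) Filter.atTop (nhds 0) :=
    tendsto_one_div_add_atTop_nhds_zero_nat
  filter_upwards [h6.eventually_lt_const (by linarith : 0 < R - ρ - |t|)] with k hk
  -- the smooth test function
  set ζ : E n → ℝ := fun x => t⁻¹ * (moll k U (x + t • e) - moll k U x) with hζ
  have hUs : ContDiff ℝ 1 (moll k U) := contDiff_moll k hS.U_int.locallyIntegrable (m := 1)
  have hζs : ContDiff ℝ 1 ζ := contDiff_const.mul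
    ((hUs.comp (contDiff_id.add contDiff_const)).sub hUs)
  have hGs : ContDiff ℝ 1 G := by
    rw [contDiff_one_iff_deriv]
    refine ⟨fun r => (hG r).differentiableAt, ?_⟩
    have : deriv G = g := funext fun r => (hG r).deriv
    rwa [this]
  have hφs : ContDiff ℝ 1 (fun x => η x ^ 2 * G (ζ x)) := (hη.pow 2).mul (hGs.comp hζs)
  have hφt : tsupport (fun x => η x ^ 2 * G (ζ x)) ⊆ B := by
    refine (closure_mono fun x hx => ?_).trans hηs
    intro h0
    apply hx
    simp [h0]
  have hE := hS.integral_fderiv_difference hA hq (s := s) hR ht hφs hφt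
  rw [← hE, hT1, hT2]
  have hJ1 : Integrable (fun x => 1 * G (wk k x) * (2 * η x * fderiv ℝ η x (D x)))
      (volume.restrict B) :=
    integrable_bdd_mul_mul hconj (b := fun _ => 1) (L := 1) aestronglyMeasurable_const (by simp)
      (hGmem _ (hwkm k) (hwkq k)) hDη
  have hJ2 : ∀ i, Integrable (fun x => g (wk k x) * Qk k i x * (η x ^ 2 * D x i))
      (volume.restrict B) := fun i =>
    integrable_bdd_mul_mul hconj (L := L) (hg.measurable.comp (hwkm k)).aestronglyMeasurable
      (fun x => hL _) ((hQkq k i).restrict B) (hDi i)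
  simp only
  rw [← integral_finsetSum _ (fun i _ => hJ2 i), ← integral_add hJ1 (integrable_finsetSum _ fun i _ => hJ2 i)]
  refine setIntegral_congr_fun hBm fun x hx => ?_
  have hζw : ζ x = wk k x := by
    rw [hζ]; simp only
    rw [moll_sub_eq_mul_avg (hS.U_weak s) hS.U_int.locallyIntegrable (hVm s) hR (ρ := ρ)
      (by linarith) hx]
    field_simp
    rfl
  have hcb : ∀ y, ‖y - x₀‖ ≤ ρ + |t| → Metric.closedBall y (1 / ((k : ℝ) + 1)) ⊆ Ω' := by
    intro y hy z hz
    apply hR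
    rw [Metric.mem_closedBall, dist_eq_norm] at hz
    rw [Metric.mem_ball, dist_eq_norm]
    have h1 : z - x₀ = (z - y) + (y - x₀) := by abel
    rw [h1]
    have := norm_add_le (z - y) (y - x₀)
    linarith
  have hxn : ‖x - x₀‖ ≤ ρ := by rwa [Metric.mem_closedBall, dist_eq_norm] at hx
  have hζd : ∀ i, fderiv ℝ ζ x (EuclideanSpace.single i 1) = Qk k i x := by
    intro i
    have hd1 : HasFDerivAt (fun y => moll k U (y + t • e)) (fderiv ℝ (moll k U) (x + t • e)) x := by
      rw [hasFDerivAt_comp_add_right]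
      exact (hUs.differentiable one_ne_zero _).hasFDerivAt
    have hd2 : HasFDerivAt ζ (t⁻¹ • (fderiv ℝ (moll k U) (x + t • e) - fderiv ℝ (moll k U) x)) x :=
      (hd1.sub (hUs.differentiable one_ne_zero _).hasFDerivAt).const_mul t⁻¹
    rw [hd2.fderiv]
    have e1 := (hS.U_weak i).fderiv_moll hS.U_int.locallyIntegrable (hcb x (by linarith [abs_nonneg t]))
    have e2 := (hS.U_weak i).fderiv_moll hS.U_int.locallyIntegrable (hcb (x + t • e) (by
      have h1 : x + t • e - x₀ = (x - x₀) + t • e := by abel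
      have := norm_add_le (x - x₀) (t • e)
      rw [norm_smul_single] at this
      rw [h1]; linarith))
    simp [hQk, e1, e2]
  have hd : HasFDerivAt (fun x => η x ^ 2 * G (ζ x))
      ((η x ^ 2) • (g (ζ x) • fderiv ℝ ζ x) + (G (ζ x)) • ((2 * η x) • fderiv ℝ η x)) x := by
    have h1 : HasFDerivAt (fun x => η x ^ 2) ((2 * η x) • fderiv ℝ η x) x := by
      have := (hη.differentiable one_ne_zero x).hasFDerivAt.pow 2
      simpa using this
    have h2 : HasFDerivAt (fun x => G (ζ x)) (g (ζ x) • fderiv ℝ ζ x) x :=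
      (hG (ζ x)).comp_hasFDerivAt x (hζs.differentiable one_ne_zero x).hasFDerivAt
    exact h1.mul h2
  have hDx : D x = A (x + t • e) (V (x + t • e)) - A x (V x) := by rw [hD]
  simp only
  rw [← hDx, hd.fderiv]
  simp only [add_apply, smul_apply, smul_eq_mul]
  rw [fderiv_eq_sum ζ, hζw, Finset.mul_sum, Finset.mul_sum,
    add_comm (∑ i, η x ^ 2 * (g (wk k x) * _))]
  congr 1
  · ring
  · refine Finset.sum_congr rfl fun i _ => ?_
    rw [hζd i]; ring

end DifferenceTest

/-! ### The maximum norm, bounded below by one -/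

section MaxNorm

variable {n : ℕ}

/-- The maximum of `1` and the absolute values of the coordinates. -/
def maxNorm (ξ : E n) : ℝ := max 1 ‖(ξ.ofLp : Fin n → ℝ)‖

lemma one_le_maxNorm (ξ : E n) : 1 ≤ maxNorm ξ := le_max_left _ _

lemma maxNorm_pos (ξ : E n) : 0 < maxNorm ξ := zero_lt_one.trans_le (one_le_maxNorm ξ)

lemma abs_apply_le_maxNorm (ξ : E n) (i : Fin n) : |ξ i| ≤ maxNorm ξ :=
  (norm_le_pi_norm (ξ.ofLp) i).trans (le_max_right _ _)

lemma maxNorm_le {ξ : E n} {r : ℝ} (hr : 1 ≤ r) (h : ∀ i, |ξ i| ≤ r) : maxNorm ξ ≤ r :=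
  max_le hr ((pi_norm_le_iff_of_nonneg (by linarith)).2 h)

lemma continuous_maxNorm : Continuous (maxNorm : E n → ℝ) := by
  unfold maxNorm
  fun_prop

lemma norm_le_mul_maxNorm (ξ : E n) : ‖ξ‖ ≤ n * maxNorm ξ := by
  refine (norm_le_sum_abs ξ).trans ?_
  calc ∑ i, |ξ i| ≤ ∑ _i : Fin n, maxNorm ξ :=
        Finset.sum_le_sum fun i _ => abs_apply_le_maxNorm ξ i
    _ = _ := by simp

lemma maxNorm_le_max_one_norm (ξ : E n) : maxNorm ξ ≤ max 1 ‖ξ‖ :=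
  maxNorm_le (le_max_left _ _) fun i => (abs_apply_le_norm ξ i).trans (le_max_right _ _)

lemma maxNorm_rpow_le (ξ : E n) {α : ℝ} (hα : 0 < α) :
    maxNorm ξ ^ α ≤ 1 + ∑ i, |ξ i| ^ α := by
  have hs : ∀ i, 0 ≤ |ξ i| ^ α := fun i => by positivity
  have hs' : 0 ≤ ∑ i, |ξ i| ^ α := Finset.sum_nonneg fun i _ => hs i
  have h1 : maxNorm ξ ≤ (1 + ∑ i, |ξ i| ^ α) ^ (1 / α) := by
    refine maxNorm_le (Real.one_le_rpow (by linarith) (by positivity)) fun i => ?_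
    calc |ξ i| = (|ξ i| ^ α) ^ (1 / α) := by
          rw [← Real.rpow_mul (abs_nonneg _), mul_one_div_cancel hα.ne', Real.rpow_one]
      _ ≤ _ := by
          refine Real.rpow_le_rpow (hs i) ?_ (by positivity)
          have := Finset.single_le_sum (fun j _ => hs j) (Finset.mem_univ i)
          linarith
  calc maxNorm ξ ^ α ≤ ((1 + ∑ i, |ξ i| ^ α) ^ (1 / α)) ^ α :=
        Real.rpow_le_rpow (maxNorm_pos ξ).le h1 hα.le
    _ = _ := by
        rw [← Real.rpow_mul (by linarith), one_div_mul_cancel hα.ne', Real.rpow_one]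

end MaxNorm

/-! ### Truncated powers and their primitives -/

section Truncation

/-- A truncated power. -/
def truncPow (k a : ℝ) (r : ℝ) : ℝ := min |r| k ^ a

/-- The primitive of a truncated power. -/
def truncPowPrim (k a : ℝ) (r : ℝ) : ℝ := ∫ τ in (0 : ℝ)..r, truncPow k a τ

variable {k a : ℝ}

lemma truncPow_nonneg (hk : 0 ≤ k) (r : ℝ) : 0 ≤ truncPow k a r :=
  Real.rpow_nonneg (le_min (abs_nonneg _) hk) _

lemma truncPow_le (hk : 0 ≤ k) (ha : 0 ≤ a) (r : ℝ) : truncPow k a r ≤ |r| ^ a :=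
  Real.rpow_le_rpow (le_min (abs_nonneg _) hk) (min_le_left _ _) ha

lemma truncPow_le_const (hk : 0 ≤ k) (ha : 0 ≤ a) (r : ℝ) : |truncPow k a r| ≤ k ^ a := by
  rw [abs_of_nonneg (truncPow_nonneg hk r)]
  exact Real.rpow_le_rpow (le_min (abs_nonneg _) hk) (min_le_right _ _) ha

lemma continuous_truncPow (ha : 0 ≤ a) : Continuous (truncPow k a) :=
  (Real.continuous_rpow_const ha).comp (continuous_abs.min continuous_const)

lemma hasDerivAt_truncPowPrim (ha : 0 ≤ a) (r : ℝ) :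
    HasDerivAt (truncPowPrim k a) (truncPow k a r) r :=
  (continuous_truncPow ha).integral_hasStrictDerivAt 0 r |>.hasDerivAt

lemma truncPowPrim_zero : truncPowPrim k a 0 = 0 := by simp [truncPowPrim]

/-- The truncated power is nondecreasing in |r|, so its value at r dominates it on the interval of
integration. This is the relation |G| ≤ |v| g required in `absorb_flux`. -/
lemma abs_truncPowPrim_le (hk : 0 ≤ k) (ha : 0 ≤ a) (r : ℝ) :
    |truncPowPrim k a r| ≤ |r| * truncPow k a r := by
  have h := intervalIntegral.norm_integral_le_of_norm_le_const (a := (0 : ℝ)) (b := r)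
    (f := truncPow k a) (C := truncPow k a r) (fun τ hτ => ?_)
  · rw [sub_zero, mul_comm] at h
    exact h
  · rw [Real.norm_of_nonneg (truncPow_nonneg hk _)]
    refine Real.rpow_le_rpow (le_min (abs_nonneg _) hk) (min_le_min_right _ ?_) ha
    rcases le_total 0 r with h0 | h0
    · rw [uIoc_of_le h0] at hτ
      rw [abs_of_pos hτ.1, abs_of_nonneg h0]; exact hτ.2
    · rw [uIoc_of_ge h0] at hτ
      rw [abs_of_nonpos hτ.2, abs_of_nonpos h0]; linarith [hτ.1]

end Truncation

/-! ### Absorption of the flux -/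

section Caccioppoli

/-- Absorption of the flux terms in the differentiated equation. -/
lemma absorb_flux {F : Type*} [NormedAddCommGroup F] [InnerProductSpace ℝ F] {X Y Q : F}
    {ℓ : F →L[ℝ] ℝ} {c C m p q η κ v G g : ℝ} (hc : 0 < c) (hC : 0 < C) (hm : 0 ≤ m)
    (hp : 2 ≤ p) (hη : 0 ≤ η) (hη1 : η ≤ 1) (hg : 0 ≤ g) (hℓ : ‖ℓ‖ ≤ κ) (hG : |G| ≤ |v| * g)
    (h1 : c * m ^ (p - 2) * ‖Q‖ ^ 2 ≤ inner ℝ X Q)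
    (h2 : ‖X‖ ^ 2 ≤ C * (1 + m ^ (q - 2)) * inner ℝ X Q) (h3 : ‖Y‖ ≤ C * m ^ (p - 1)) :
    1 / 2 * η ^ 2 * g * inner ℝ X Q ≤
      (2 * η * G * ℓ (X + Y) + η ^ 2 * g * inner ℝ (X + Y) Q) +
      g * (4 * C * κ ^ 2 * ((1 + m ^ (q - 2)) * v ^ 2) + C ^ 2 / c * m ^ p +
        2 * κ * C * (m ^ (p - 1) * |v|)) := by
  set P := inner ℝ X Q with hP
  have hκ : 0 ≤ κ := (norm_nonneg _).trans hℓ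
  have hb : 0 < 1 + m ^ (q - 2) := by positivity
  set b := 1 + m ^ (q - 2) with hbdef
  -- Young's inequality weighted by C b, the cocoercivity constant: a quarter of η² P is absorbed
  -- and the remainder carries the factor 1+m^{q-2} only once. This is why the final exponent is
  -- q+2β.
  have hX : 2 * η * |v| * κ * ‖X‖ ≤ 1 / 4 * η ^ 2 * P + 4 * C * κ ^ 2 * (b * v ^ 2) := by
    have hs : 2 * η * |v| * κ * ‖X‖ ≤
        1 / 4 * η ^ 2 * (‖X‖ ^ 2 / (C * b)) + 4 * C * κ ^ 2 * (b * v ^ 2) := by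
      have hCb : 0 < C * b := by positivity
      have h4 : 1 / 4 * η ^ 2 * (‖X‖ ^ 2 / (C * b)) + 4 * C * κ ^ 2 * (b * v ^ 2) -
          2 * η * |v| * κ * ‖X‖ = (η * ‖X‖ / 2 - 2 * (C * b) * κ * |v|) ^ 2 / (C * b) := by
        field_simp
        rw [← sq_abs v]
        ring
      have h5 : 0 ≤ (η * ‖X‖ / 2 - 2 * (C * b) * κ * |v|) ^ 2 / (C * b) := by positivity
      linarith
    have h6 : ‖X‖ ^ 2 / (C * b) ≤ P := by
      rw [div_le_iff₀ (by positivity)]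
      linarith [h2]
    have := mul_le_mul_of_nonneg_left h6 (by positivity : 0 ≤ 1 / 4 * η ^ 2)
    linarith
  -- Young's inequality with the coercivity c m^{p-2}|Q|² ≤ P, splitting m^{p-1} = m^{(p-2)/2}
  -- m^{p/2}. Together with the previous step half of η² P is used up and half remains.
  have hYQ : ‖Y‖ * ‖Q‖ ≤ 1 / 4 * P + C ^ 2 / c * m ^ p := by
    have h4 : ‖Y‖ * ‖Q‖ ≤ C * m ^ (p - 1) * ‖Q‖ := by gcongr
    have e1 : m ^ (p - 1) = m ^ ((p - 2) / 2) * m ^ (p / 2) := by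
      rw [← Real.rpow_add_of_nonneg hm (by linarith) (by linarith)]
      congr 1; ring
    have e2 : m ^ (p - 2) = (m ^ ((p - 2) / 2)) ^ 2 := by
      rw [← Real.rpow_natCast, ← Real.rpow_mul hm]; congr 1; push_cast; ring
    have e3 : m ^ p = (m ^ (p / 2)) ^ 2 := by
      rw [← Real.rpow_natCast, ← Real.rpow_mul hm]; congr 1; push_cast; ring
    rw [e2] at h1
    rw [e1] at h4
    rw [e3]
    set a := m ^ ((p - 2) / 2)
    set d := m ^ (p / 2)
    have h5 : 1 / 4 * (c * a ^ 2 * ‖Q‖ ^ 2) + C ^ 2 / c * d ^ 2 - C * (a * d) * ‖Q‖ =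
        (c * a * ‖Q‖ / 2 - C * d) ^ 2 / c := by
      field_simp; ring
    have h6 : 0 ≤ (c * a * ‖Q‖ / 2 - C * d) ^ 2 / c := by positivity
    linarith
  have hPn : 0 ≤ P := le_trans (by positivity) h1
  have hlin : |2 * η * G * ℓ (X + Y)| ≤ g * (2 * η * |v| * κ * ‖X‖ + 2 * η * |v| * κ * ‖Y‖) := by
    have h4 : |ℓ (X + Y)| ≤ κ * (‖X‖ + ‖Y‖) :=
      (ℓ.le_opNorm _).trans (mul_le_mul hℓ (norm_add_le _ _) (norm_nonneg _) hκ)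
    rw [abs_mul, abs_mul, abs_of_nonneg (by positivity : 0 ≤ 2 * η)]
    calc 2 * η * |G| * |ℓ (X + Y)| ≤ 2 * η * (|v| * g) * (κ * (‖X‖ + ‖Y‖)) := by gcongr
      _ = _ := by ring
  have hY2 : 2 * η * |v| * κ * ‖Y‖ ≤ 2 * κ * C * (m ^ (p - 1) * |v|) := by
    calc 2 * η * |v| * κ * ‖Y‖ ≤ 2 * 1 * |v| * κ * (C * m ^ (p - 1)) := by gcongr
      _ = _ := by ring
  have hin : -(‖Y‖ * ‖Q‖) ≤ inner ℝ Y Q := neg_le_of_abs_le (abs_real_inner_le_norm Y Q)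
  rw [inner_add_left, ← hP]
  have hη2 : η ^ 2 ≤ 1 := by nlinarith
  have hrest : η ^ 2 * (‖Y‖ * ‖Q‖) ≤ 1 / 4 * η ^ 2 * P + C ^ 2 / c * m ^ p := by
    have h7 : 0 ≤ C ^ 2 / c * m ^ p := by positivity
    have h8 := mul_le_mul_of_nonneg_left hYQ (sq_nonneg η)
    have h9 : η ^ 2 * (C ^ 2 / c * m ^ p) ≤ 1 * (C ^ 2 / c * m ^ p) :=
      mul_le_mul_of_nonneg_right hη2 h7
    linarith
  have hkey : 1 / 2 * η ^ 2 * P ≤ η ^ 2 * P + η ^ 2 * inner ℝ Y Q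
      - (2 * η * |v| * κ * ‖X‖ + 2 * η * |v| * κ * ‖Y‖) +
      (4 * C * κ ^ 2 * (b * v ^ 2) + C ^ 2 / c * m ^ p + 2 * κ * C * (m ^ (p - 1) * |v|)) := by
    have h10 := mul_le_mul_of_nonneg_left hin (sq_nonneg η)
    linarith
  have := mul_le_mul_of_nonneg_left hkey hg
  have h11 := neg_le_of_abs_le hlin
  linarith

/-- The lower order terms are controlled by a power of the largest of the quantities involved. -/
lemma lower_order_le {c C m p q κ v Z : ℝ} {n : ℕ} (hn : 1 ≤ n) (hc : 0 < c) (hC : 0 < C)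
    (hm : 0 ≤ m) (hp : 2 ≤ p) (hpq : p ≤ q) (hκ : 0 ≤ κ) (hZ : 1 ≤ Z) (hmZ : m ≤ n * Z)
    (hvZ : |v| ≤ Z) :
    4 * C * κ ^ 2 * ((1 + m ^ (q - 2)) * v ^ 2) + C ^ 2 / c * m ^ p +
        2 * κ * C * (m ^ (p - 1) * |v|) ≤
      (n : ℝ) ^ q * (8 * C + C ^ 2 / c) * (1 + κ) ^ 2 * Z ^ q := by
  have hn1 : (1 : ℝ) ≤ n := by exact_mod_cast hn
  have hZ0 : 0 < Z := by linarith
  have hb : ∀ a, 0 ≤ a → a ≤ q → m ^ a ≤ (n : ℝ) ^ q * Z ^ a := by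
    intro a ha haq
    calc m ^ a ≤ (n * Z) ^ a := Real.rpow_le_rpow hm hmZ ha
      _ = (n : ℝ) ^ a * Z ^ a := Real.mul_rpow (by linarith) hZ0.le
      _ ≤ _ := by gcongr
  have hnq : 1 ≤ (n : ℝ) ^ q := Real.one_le_rpow hn1 (by linarith)
  have h1 : (1 + m ^ (q - 2)) * v ^ 2 ≤ 2 * ((n : ℝ) ^ q * Z ^ q) := by
    have e1 : Z ^ q = Z ^ (q - 2) * Z ^ 2 := by
      rw [← Real.rpow_natCast Z 2, ← Real.rpow_add hZ0]; congr 1; push_cast; ring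
    have h2 : v ^ 2 ≤ Z ^ 2 := by
      rw [← sq_abs]; gcongr
    have h3 := hb (q - 2) (by linarith) (by linarith)
    have h4 : 1 ≤ (n : ℝ) ^ q * Z ^ (q - 2) :=
      one_le_mul_of_one_le_of_one_le hnq (Real.one_le_rpow hZ (by linarith))
    calc (1 + m ^ (q - 2)) * v ^ 2 ≤
        ((n : ℝ) ^ q * Z ^ (q - 2) + (n : ℝ) ^ q * Z ^ (q - 2)) * Z ^ 2 := by gcongr
      _ = _ := by rw [e1]; ring
  have h2 : m ^ p ≤ (n : ℝ) ^ q * Z ^ q :=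
    (hb p (by linarith) hpq).trans (by gcongr)
  have h3 : m ^ (p - 1) * |v| ≤ (n : ℝ) ^ q * Z ^ q := by
    have h4 := hb (p - 1) (by linarith) (by linarith)
    calc m ^ (p - 1) * |v| ≤ (n : ℝ) ^ q * Z ^ (p - 1) * Z := by gcongr
      _ = (n : ℝ) ^ q * Z ^ p := by
        rw [mul_assoc]
        congr 1
        nth_rewrite 2 [← Real.rpow_one Z]
        rw [← Real.rpow_add hZ0]; congr 1; ring
      _ ≤ _ := by gcongr
  set T := (n : ℝ) ^ q * Z ^ q with hT
  have hT0 : 0 ≤ T := by positivity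
  have hCc : 0 < C ^ 2 / c := by positivity
  calc _ ≤ 4 * C * κ ^ 2 * (2 * T) + C ^ 2 / c * T + 2 * κ * C * T := by gcongr
    _ = (8 * C * κ ^ 2 + C ^ 2 / c + 2 * κ * C) * T := by ring
    _ ≤ ((8 * C + C ^ 2 / c) * (1 + κ) ^ 2) * T := by
        refine mul_le_mul_of_nonneg_right ?_ hT0
        have h5 : 0 ≤ C ^ 2 / c * (2 * κ + κ ^ 2) := by positivity
        have h6 : 0 ≤ C * (8 + 14 * κ) := by positivity
        nlinarith
    _ = _ := by rw [hT]; ring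

/-- If F is not integrable there is nothing to prove. The Caccioppoli inequality can therefore be
stated without knowing that its right-hand side is finite. -/
lemma lintegral_ofReal_le_of_le_add {α : Type*} [MeasurableSpace α] {μ : Measure α}
    {L H F : α → ℝ} (hL : ∀ᵐ x ∂μ, 0 ≤ L x) (hF : ∀ᵐ x ∂μ, 0 ≤ F x)
    (hFm : AEStronglyMeasurable F μ)
    (hH : Integrable H μ) (hH0 : ∫ x, H x ∂μ = 0) (h : ∀ᵐ x ∂μ, L x ≤ H x + F x) :
    ∫⁻ x, ENNReal.ofReal (L x) ∂μ ≤ ∫⁻ x, ENNReal.ofReal (F x) ∂μ := by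
  by_cases htop : ∫⁻ x, ENNReal.ofReal (F x) ∂μ = ⊤
  · rw [htop]; exact le_top
  · have hFi : Integrable F μ :=
      ⟨hFm, (hasFiniteIntegral_iff_ofReal hF).2 (lt_top_iff_ne_top.2 htop)⟩
    calc ∫⁻ x, ENNReal.ofReal (L x) ∂μ ≤ ∫⁻ x, ENNReal.ofReal (H x + F x) ∂μ :=
          lintegral_mono_ae (h.mono fun x hx => ENNReal.ofReal_le_ofReal hx)
      _ = ENNReal.ofReal (∫ x, (H x + F x) ∂μ) := by
          refine (ofReal_integral_eq_lintegral_ofReal (hH.add hFi) ?_).symm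
          filter_upwards [h, hL] with x h1 h2
          exact h2.trans h1
      _ = _ := by
          rw [integral_add hH hFi, hH0, zero_add, ofReal_integral_eq_lintegral_ofReal hFi hF]

/-- Along a subsequence the integrals are at most 2^{-j}, so the sum of the functions is integrable,
finite almost everywhere, and its terms tend to 0 there. -/
lemma exists_seq_tendsto_ae_of_lintegral {α : Type*} [MeasurableSpace α] {μ : Measure α}
    {f : ℕ → α → ℝ≥0∞} (hf : ∀ k, Measurable (f k))
    (hlim : Filter.Tendsto (fun k => ∫⁻ x, f k x ∂μ) Filter.atTop (nhds 0)) :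
    ∃ φ : ℕ → ℕ, StrictMono φ ∧
      ∀ᵐ x ∂μ, Filter.Tendsto (fun k => f (φ k) x) Filter.atTop (nhds 0) := by
  obtain ⟨φ, hφ, h⟩ := Filter.extraction_forall_of_eventually
    (P := fun j k => ∫⁻ x, f k x ∂μ ≤ (2⁻¹ : ℝ≥0∞) ^ j) (fun j => by
      have hpos : (0 : ℝ≥0∞) < (2⁻¹ : ℝ≥0∞) ^ j := ENNReal.pow_pos (by simp) j
      exact hlim.eventually_le_const hpos)
  refine ⟨φ, hφ, ?_⟩
  have hsum : ∫⁻ x, ∑' j, f (φ j) x ∂μ ≠ ⊤ := by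
    rw [lintegral_tsum fun j => (hf _).aemeasurable]
    refine ne_top_of_le_ne_top ?_ (ENNReal.tsum_le_tsum h)
    rw [ENNReal.tsum_geometric]
    simp
  filter_upwards [ae_lt_top' (AEMeasurable.tsum fun j => (hf (φ j)).aemeasurable) hsum]
    with x hx
  exact ENNReal.tendsto_atTop_zero_of_tsum_ne_top hx.ne

end Caccioppoli

/-! ### The Caccioppoli inequality -/

section CaccioppoliDifference

variable {n : ℕ} {p q c C : ℝ} {Ω' : Set (E n)} {A : E n → E n → E n} {U : E n → ℝ} {V : E n → E n}
  {W : E n → Fin n → E n}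

lemma mem_ball_of_closedBall_sub {x₀ x y : E n} {r R δ : ℝ} (hR : r + δ < R)
    (hx : x ∈ Metric.closedBall x₀ r) (hy : ‖y‖ ≤ δ) : x - y ∈ Metric.ball x₀ R := by
  rw [Metric.mem_closedBall, dist_eq_norm] at hx
  rw [Metric.mem_ball, dist_eq_norm]
  have h1 : x - y - x₀ = (x - x₀) - y := by abel
  have := norm_sub_le (x - x₀) y
  rw [h1]; linarith

lemma mem_ball_of_closedBall_add {x₀ x : E n} {r R t : ℝ} {s : Fin n} (hR : r + |t| < R)
    (hx : x ∈ Metric.closedBall x₀ r) :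
    x + t • EuclideanSpace.single s (1 : ℝ) ∈ Metric.ball x₀ R := by
  have := mem_ball_of_closedBall_sub (y := -(t • EuclideanSpace.single s (1 : ℝ))) hR hx
    (by rw [norm_neg, norm_smul_single])
  rwa [sub_neg_eq_add] at this

/-- The Caccioppoli inequality for difference quotients. -/
lemma SmoothSolution.caccioppoli_difference (hS : SmoothSolution q Ω' A U V W)
    (hA : GrowthField p q Ω' A c C) (hn : 1 ≤ n) (hp : 2 ≤ p) (hpq : p ≤ q) {x₀ : E n}
    {R r ρ t κ β k : ℝ} {s : Fin n} (hR : Metric.ball x₀ R ⊆ Ω') (ht : r + |t| < R) (ht0 : t ≠ 0)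
    (hρr : ρ < r) {η : E n → ℝ} (hη : ContDiff ℝ 1 η) (hη1 : ∀ x, 0 ≤ η x ∧ η x ≤ 1)
    (hηρ : ∀ x ∈ Metric.ball x₀ ρ, η x = 1) (hηs : tsupport η ⊆ Metric.closedBall x₀ r)
    (hκ : ∀ x, ‖fderiv ℝ η x‖ ≤ κ) (hβ : 0 ≤ β) (hk : 0 ≤ k) {v : E n → ℝ}
    (hv : v = avg (segMeasure s t) (fun x => V x s)) {Q : E n → E n}
    (hQ : Q = fun x => t⁻¹ • (V (x + t • EuclideanSpace.single s 1) - V x)) :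
    ∫⁻ x in Metric.ball x₀ ρ, ENNReal.ofReal
        (truncPow k (2 * β) (v x) * (‖V x‖ ^ (p - 2) * ‖Q x‖ ^ 2)) ≤
      ENNReal.ofReal (6 / c * ((n : ℝ) ^ q * (8 * C + C ^ 2 / c)) * (1 + κ) ^ 2) *
        ∫⁻ x in Metric.ball x₀ R, ENNReal.ofReal (maxNorm (V x) ^ (q + 2 * β)) := by
  have hc := hA.c_pos
  have hC := hA.C_pos
  have hq : 2 ≤ q := hp.trans hpq
  have hκ0 : 0 ≤ κ := (norm_nonneg _).trans (hκ x₀)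
  set e : E n := EuclideanSpace.single s 1 with he
  set α := q + 2 * β with hα
  have hα1 : 1 ≤ α := by linarith
  set D : E n → E n := fun x => A (x + t • e) (V (x + t • e)) - A x (V x) with hD
  set H : E n → ℝ := fun x => 2 * η x * truncPowPrim k (2 * β) (v x) * fderiv ℝ η x (D x) +
      η x ^ 2 * truncPow k (2 * β) (v x) * inner ℝ (D x) (Q x) with hH
  obtain ⟨hHi, hH0⟩ := hS.euler_difference hA hq (s := s) hR ht ht0 hη hηs
    (fun r => hasDerivAt_truncPowPrim (k := k) (a := 2 * β) (by linarith) r)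
    (continuous_truncPow (by linarith)) (fun r => truncPow_le_const hk (by linarith) r)
    truncPowPrim_zero hv hD hQ
  have hVm : ∀ i, Measurable fun x => V x i := fun i => (measurable_coord i).comp hS.V_meas
  have hvm : Measurable v := hv ▸ measurable_avg _ (hVm s)
  have hNm : Measurable fun x => maxNorm (V x) := continuous_maxNorm.measurable.comp hS.V_meas
  set B : ℝ := (n : ℝ) ^ q * (8 * C + C ^ 2 / c) * (1 + κ) ^ 2 with hB
  have hB0 : 0 ≤ B := by positivity
  set F : E n → ℝ := fun x => B * (maxNorm (V x) ^ α + maxNorm (V (x + t • e)) ^ α + |v x| ^ α)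
    with hF
  set L : E n → ℝ := fun x => c / 2 * (η x ^ 2 *
    (truncPow k (2 * β) (v x) * (‖V x‖ ^ (p - 2) * ‖Q x‖ ^ 2))) with hLdef
  have hNα : ∀ ξ : E n, 0 ≤ maxNorm ξ ^ α := fun ξ => Real.rpow_nonneg (maxNorm_pos ξ).le _
  have hpt : ∀ x ∈ Metric.closedBall x₀ r, L x ≤ t⁻¹ * H x + F x := by
    intro x hx
    have hxt := mem_ball_of_closedBall_add (s := s) ht hx
    have hxR : x ∈ Metric.ball x₀ R :=
      Metric.closedBall_subset_ball (by linarith [abs_nonneg t]) hx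
    -- The difference quotient of the flux splits into X, where only the gradient varies and x is
    -- frozen, and Y, where only x varies. Monotonicity and cocoercivity apply to X, the Lipschitz
    -- condition in x to Y.
    set X := t⁻¹ • (A x (V (x + t • e)) - A x (V x)) with hX
    set Y := t⁻¹ • (A (x + t • e) (V (x + t • e)) - A x (V (x + t • e))) with hY
    set m := max ‖V (x + t • e)‖ ‖V x‖ with hm
    have hm0 : 0 ≤ m := le_max_of_le_left (norm_nonneg _)
    have hQx : Q x = t⁻¹ • (V (x + t • e) - V x) := by rw [hQ]
    have hDx : D x = t • (X + Y) := by
      rw [hX, hY, ← smul_add, smul_smul, mul_inv_cancel₀ ht0, one_smul, hD]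
      simp only
      abel
    have hXQ : inner ℝ X (Q x) = (t⁻¹) ^ 2 *
        inner ℝ (A x (V (x + t • e)) - A x (V x)) (V (x + t • e) - V x) := by
      rw [hQx, hX, inner_smul_left, inner_smul_right]
      simp; ring
    have h1 : c * m ^ (p - 2) * ‖Q x‖ ^ 2 ≤ inner ℝ X (Q x) := by
      rw [hXQ, hQx, norm_smul, mul_pow, Real.norm_eq_abs, sq_abs]
      have := mul_le_mul_of_nonneg_left (hA.mono x (hR hxR) (V (x + t • e)) (V x))
        (sq_nonneg t⁻¹)
      linarith
    have h2 : ‖X‖ ^ 2 ≤ C * (1 + m ^ (q - 2)) * inner ℝ X (Q x) := by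
      rw [hXQ, hX, norm_smul, mul_pow, Real.norm_eq_abs, sq_abs]
      have := mul_le_mul_of_nonneg_left (hA.coco x (hR hxR) (V (x + t • e)) (V x))
        (sq_nonneg t⁻¹)
      linarith
    have h3 : ‖Y‖ ≤ C * m ^ (p - 1) := by
      have h4 := hA.lip x₀ R hR s t x hxR hxt (V (x + t • e))
      have h5 : ‖V (x + t • e)‖ ^ (p - 1) ≤ m ^ (p - 1) :=
        Real.rpow_le_rpow (norm_nonneg _) (le_max_left _ _) (by linarith)
      rw [hY, norm_smul, norm_inv, Real.norm_eq_abs]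
      have ht' : 0 < |t| := abs_pos.2 ht0
      rw [inv_mul_le_iff₀ ht']
      calc _ ≤ C * ‖V (x + t • e)‖ ^ (p - 1) * |t| := h4
        _ ≤ C * m ^ (p - 1) * |t| := by gcongr
        _ = _ := by ring
    have hg0 := truncPow_nonneg (a := 2 * β) hk (v x)
    have key := absorb_flux (ℓ := fderiv ℝ η x) (κ := κ) (v := v x)
      (G := truncPowPrim k (2 * β) (v x)) (g := truncPow k (2 * β) (v x)) hc hC hm0 hp (hη1 x).1
      (hη1 x).2 hg0 (hκ x) (abs_truncPowPrim_le hk (by linarith) (v x)) h1 h2 h3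
    have hHx : t⁻¹ * H x = 2 * η x * truncPowPrim k (2 * β) (v x) * fderiv ℝ η x (X + Y) +
        η x ^ 2 * truncPow k (2 * β) (v x) * inner ℝ (X + Y) (Q x) := by
      rw [hH]
      simp only [hDx, map_smul, inner_smul_left, smul_eq_mul, conj_trivial]
      field_simp
    rw [← hHx] at key
    set Z := max (max (maxNorm (V x)) (maxNorm (V (x + t • e)))) |v x| with hZ
    have hZ1 : 1 ≤ Z := (one_le_maxNorm (V x)).trans ((le_max_left _ _).trans (le_max_left _ _))
    have hmZ : m ≤ n * Z := by
      refine max_le ((norm_le_mul_maxNorm _).trans ?_) ((norm_le_mul_maxNorm _).trans ?_)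
      · exact mul_le_mul_of_nonneg_left ((le_max_right _ _).trans (le_max_left _ _))
          (Nat.cast_nonneg n)
      · exact mul_le_mul_of_nonneg_left ((le_max_left _ _).trans (le_max_left _ _))
          (Nat.cast_nonneg n)
    have low := lower_order_le hn hc hC hm0 hp hpq hκ0 hZ1 hmZ (le_max_right _ _ : |v x| ≤ Z)
    rw [← hB] at low
    have hgZ : truncPow k (2 * β) (v x) ≤ Z ^ (2 * β) :=
      (truncPow_le hk (by linarith) _).trans
        (Real.rpow_le_rpow (abs_nonneg _) (le_max_right _ _) (by linarith))
    have hZα : Z ^ α ≤ maxNorm (V x) ^ α + maxNorm (V (x + t • e)) ^ α + |v x| ^ α := by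
      have hv0 : 0 ≤ |v x| ^ α := by positivity
      have a1 := hNα (V x)
      have a2 := hNα (V (x + t • e))
      rcases max_choice (max (maxNorm (V x)) (maxNorm (V (x + t • e)))) |v x| with h | h
      · rcases max_choice (maxNorm (V x)) (maxNorm (V (x + t • e))) with h' | h'
        · rw [hZ, h, h']; linarith
        · rw [hZ, h, h']; linarith
      · rw [hZ, h]; linarith
    have hFx : truncPow k (2 * β) (v x) * (B * Z ^ q) ≤ F x := by
      calc _ ≤ Z ^ (2 * β) * (B * Z ^ q) := by gcongr
        _ = B * Z ^ α := by
          rw [hα, Real.rpow_add (by linarith)]; ring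
        _ ≤ _ := mul_le_mul_of_nonneg_left hZα hB0
    have hlow : L x ≤ 1 / 2 * η x ^ 2 * truncPow k (2 * β) (v x) * inner ℝ X (Q x) := by
      have h6 : c * ‖V x‖ ^ (p - 2) * ‖Q x‖ ^ 2 ≤ inner ℝ X (Q x) := by
        refine le_trans ?_ h1
        have h7 : ‖V x‖ ^ (p - 2) ≤ m ^ (p - 2) :=
          Real.rpow_le_rpow (norm_nonneg _) (le_max_right _ _) (by linarith)
        gcongr
      have := mul_le_mul_of_nonneg_left h6
        (by positivity : 0 ≤ 1 / 2 * η x ^ 2 * truncPow k (2 * β) (v x))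
      calc L x = 1 / 2 * η x ^ 2 * truncPow k (2 * β) (v x) *
            (c * ‖V x‖ ^ (p - 2) * ‖Q x‖ ^ 2) := by rw [hLdef]; ring
        _ ≤ _ := this
    have := mul_le_mul_of_nonneg_left low hg0
    linarith
  have hL0 : ∀ x, 0 ≤ L x := fun x => by
    have := truncPow_nonneg (a := 2 * β) hk (v x)
    rw [hLdef]; positivity
  have hF0 : ∀ x, 0 ≤ F x := fun x => by
    have a1 := hNα (V x)
    have a2 := hNα (V (x + t • e))
    rw [hF]; positivity
  have hNtm : Measurable fun x => maxNorm (V (x + t • e)) := hNm.comp (measurable_add_const _)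
  have hFm : Measurable F := by
    rw [hF]
    exact (((hNm.pow_const α).add (hNtm.pow_const α)).add
      ((measurable_abs.comp hvm).pow_const α)).const_mul B
  have hLF : ∫⁻ x in Metric.closedBall x₀ r, ENNReal.ofReal (L x) ≤
      ∫⁻ x in Metric.closedBall x₀ r, ENNReal.ofReal (F x) := by
    refine lintegral_ofReal_le_of_le_add (H := fun x => t⁻¹ * H x) (Filter.Eventually.of_forall hL0)
      (Filter.Eventually.of_forall hF0) hFm.aestronglyMeasurable (hHi.const_mul _) ?_ ?_
    · rw [integral_const_mul, hH0, mul_zero]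
    · filter_upwards [ae_restrict_mem measurableSet_closedBall] with x hx
      exact hpt x hx
  -- All three parts of F are bounded by B times the integral I over the larger ball, because r+|t|
  -- < R: directly, by translation, and by the contraction property of averages. This factor 3 and
  -- the 2/c from L make the constant 6/c.
  set I := ∫⁻ x in Metric.ball x₀ R, ENNReal.ofReal (maxNorm (V x) ^ α) with hI
  have hsub : Metric.closedBall x₀ r ⊆ Metric.ball x₀ R :=
    Metric.closedBall_subset_ball (by linarith [abs_nonneg t])
  have i1 : ∫⁻ x in Metric.closedBall x₀ r, ENNReal.ofReal (maxNorm (V x) ^ α) ≤ I :=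
    lintegral_mono_set hsub
  have i2 : ∫⁻ x in Metric.closedBall x₀ r, ENNReal.ofReal (maxNorm (V (x + t • e)) ^ α) ≤ I := by
    rw [hI, ← lintegral_indicator measurableSet_closedBall, ← lintegral_indicator measurableSet_ball]
    refine le_trans (lintegral_mono fun x => ?_) (le_of_eq
      (lintegral_add_right_eq_self (μ := volume) ((Metric.ball x₀ R).indicator
        fun x => ENNReal.ofReal (maxNorm (V x) ^ α)) (t • e)))
    by_cases hx : x ∈ Metric.closedBall x₀ r
    · rw [indicator_of_mem hx, indicator_of_mem (mem_ball_of_closedBall_add ht hx)]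
    · rw [indicator_of_notMem hx]; exact zero_le
  have i3 : ∫⁻ x in Metric.closedBall x₀ r, ENNReal.ofReal (|v x| ^ α) ≤ I := by
    have h1 := lintegral_avg_rpow_le (μ := segMeasure s t) (hVm s)
      (K := Metric.closedBall x₀ r) (L := Metric.ball x₀ R) measurableSet_closedBall
      measurableSet_ball (by
        filter_upwards [ae_segMeasure_norm_le s t] with y hy x hx
        exact mem_ball_of_closedBall_sub ht hx hy) hα1
    have h2 : ∀ a : ℝ, ENNReal.ofReal (|a| ^ α) = ‖a‖ₑ ^ α := fun a => by
      rw [← ENNReal.ofReal_rpow_of_nonneg (abs_nonneg _) (by linarith), ← Real.norm_eq_abs,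
        ofReal_norm]
    simp only [h2]
    rw [hv]
    refine h1.trans (lintegral_mono fun x => ?_)
    rw [← h2]
    exact ENNReal.ofReal_le_ofReal (Real.rpow_le_rpow (abs_nonneg _) (abs_apply_le_maxNorm _ _)
      (by linarith))
  have hFI : ∫⁻ x in Metric.closedBall x₀ r, ENNReal.ofReal (F x) ≤ ENNReal.ofReal (3 * B) * I := by
    have h1 : ∀ x, ENNReal.ofReal (F x) = ENNReal.ofReal B * (ENNReal.ofReal (maxNorm (V x) ^ α) +
        ENNReal.ofReal (maxNorm (V (x + t • e)) ^ α) + ENNReal.ofReal (|v x| ^ α)) := by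
      intro x
      have a1 := hNα (V x)
      have a2 := hNα (V (x + t • e))
      rw [hF, ENNReal.ofReal_mul hB0, ENNReal.ofReal_add (by positivity) (by positivity),
        ENNReal.ofReal_add a1 a2]
    simp only [h1]
    have m1 : Measurable fun x => ENNReal.ofReal (maxNorm (V x) ^ α) :=
      (hNm.pow_const α).ennreal_ofReal
    have m2 : Measurable fun x => ENNReal.ofReal (maxNorm (V (x + t • e)) ^ α) :=
      (hNtm.pow_const α).ennreal_ofReal
    have m3 : Measurable fun x => ENNReal.ofReal (maxNorm (V x) ^ α) +
      ENNReal.ofReal (maxNorm (V (x + t • e)) ^ α) := m1.add m2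
    rw [lintegral_const_mul' _ _ ENNReal.ofReal_ne_top, lintegral_add_left m3,
      lintegral_add_left m1]
    calc _ ≤ ENNReal.ofReal B * (I + I + I) := by gcongr
      _ = _ := by
        rw [ENNReal.ofReal_mul (p := 3) (by norm_num), ENNReal.ofReal_ofNat]; ring
  calc _ = ∫⁻ x in Metric.ball x₀ ρ, ENNReal.ofReal (2 / c) * ENNReal.ofReal (L x) := by
        refine setLIntegral_congr_fun measurableSet_ball fun x hx => ?_
        simp only [hLdef, hηρ x hx]
        rw [← ENNReal.ofReal_mul (by positivity)]
        congr 1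
        field_simp
    _ = ENNReal.ofReal (2 / c) * ∫⁻ x in Metric.ball x₀ ρ, ENNReal.ofReal (L x) :=
        lintegral_const_mul' _ _ ENNReal.ofReal_ne_top
    _ ≤ ENNReal.ofReal (2 / c) * (ENNReal.ofReal (3 * B) * I) := by
        gcongr
        refine le_trans ?_ (hLF.trans hFI)
        exact lintegral_mono_set (Metric.ball_subset_closedBall.trans
          (Metric.closedBall_subset_closedBall hρr.le))
    _ = _ := by
        rw [← mul_assoc, ← ENNReal.ofReal_mul (by positivity)]
        congr 2
        rw [hB]; ring

/-- The Caccioppoli inequality for the second derivatives. -/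
lemma SmoothSolution.caccioppoli (hS : SmoothSolution q Ω' A U V W)
    (hA : GrowthField p q Ω' A c C) (hn : 1 ≤ n) (hp : 2 ≤ p) (hpq : p ≤ q) {K : ℝ} (hK0 : 0 < K)
    (hK : ∀ (x₀ : E n) (ρ R : ℝ), 0 < ρ → ρ < R →
      ∃ η : E n → ℝ, ContDiff ℝ 1 η ∧ (∀ x, 0 ≤ η x ∧ η x ≤ 1) ∧
      (∀ x ∈ Metric.ball x₀ ρ, η x = 1) ∧ tsupport η ⊆ Metric.closedBall x₀ R ∧
      HasCompactSupport η ∧ ∀ x, ‖fderiv ℝ η x‖ ≤ K / (R - ρ)) {x₀ : E n}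
    {R ρ β k : ℝ} {s : Fin n} (hR : Metric.ball x₀ R ⊆ Ω') (hρ : 0 < ρ) (hρR : ρ < R) (hR1 : R ≤ 1)
    (hβ : 0 ≤ β) (hk : 0 ≤ k) :
    ∫⁻ x in Metric.ball x₀ ρ, ENNReal.ofReal
        (truncPow k (2 * β) (V x s) * (‖V x‖ ^ (p - 2) * ∑ i, W x i s ^ 2)) ≤
      ENNReal.ofReal (6 / c * ((n : ℝ) ^ q * (8 * C + C ^ 2 / c)) * (1 + 2 * K) ^ 2 / (R - ρ) ^ 2) *
        ∫⁻ x in Metric.ball x₀ R, ENNReal.ofReal (maxNorm (V x) ^ (q + 2 * β)) := by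
  have hc := hA.c_pos
  have hC := hA.C_pos
  set r := (ρ + R) / 2 with hr
  have hρr : ρ < r := by linarith
  have hrR : r < R := by linarith
  obtain ⟨η, hη, hη1, hηρ, hηs, -, hηK⟩ := hK x₀ ρ r hρ hρr
  -- The shift by 2 makes already the first increment strictly smaller than R-r, as required by
  -- r+|t| < R.
  set t : ℕ → ℝ := fun j => (R - r) / ((j : ℝ) + 2) with htdef
  have htpos : ∀ j, 0 < t j := fun j => div_pos (by linarith) (by positivity)
  have htlt : ∀ j, r + |t j| < R := fun j => by
    rw [abs_of_pos (htpos j)]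
    have : t j < R - r := by
      rw [htdef]
      simp only
      rw [div_lt_iff₀ (by positivity)]
      nlinarith [(Nat.cast_nonneg j : (0 : ℝ) ≤ j)]
    linarith
  have htlim : Filter.Tendsto (fun j => |t j|) Filter.atTop (nhds 0) := by
    have h1 : Filter.Tendsto (fun j : ℕ => ((j : ℝ) + 2)) Filter.atTop Filter.atTop :=
      Filter.tendsto_atTop_add_const_right _ _ tendsto_natCast_atTop_atTop
    have h2 : Filter.Tendsto t Filter.atTop (nhds 0) := h1.const_div_atTop (R - r)
    simpa using h2.abs
  have hVm : ∀ i, Measurable fun x => V x i := fun i => (measurable_coord i).comp hS.V_meas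
  have hWm : ∀ i j, Measurable fun x => W x i j := fun i j => (measurable_coord j).comp (hS.W_meas i)
  have hVi : ∀ i, Integrable fun x => V x i := fun i =>
    memLp_one_iff_integrable.1 (memLp_coord (memLp_one_iff_integrable.2 hS.V_int) i)
  have hWi : ∀ i j, Integrable fun x => W x i j := fun i j =>
    memLp_one_iff_integrable.1 (memLp_coord (memLp_one_iff_integrable.2 (hS.W_int i)) j)
  set v : ℕ → E n → ℝ := fun j => avg (segMeasure s (t j)) (fun x => V x s) with hv
  set w : ℕ → Fin n → E n → ℝ := fun j i => avg (segMeasure s (t j)) (fun x => W x i s) with hw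
  have hvm : ∀ j, Measurable (v j) := fun j => measurable_avg _ (hVm s)
  have hwm : ∀ j i, Measurable (w j i) := fun j i => measurable_avg _ (hWm i s)
  set S : ℕ → E n → ℝ≥0∞ := fun j x => ‖v j x - V x s‖ₑ ^ (2 : ℝ) +
    ∑ i, ‖w j i x - W x i s‖ₑ ^ (2 : ℝ) with hSdef
  have hSm : ∀ j, Measurable (S j) := fun j =>
    (((hvm j).sub (hVm s)).enorm.pow_const _).add (Finset.measurable_fun_sum _ fun i _ =>
      (((hwm j i).sub (hWm i s)).enorm.pow_const _))
  have h2 : (2 : ℝ≥0∞) = ENNReal.ofReal 2 := by simp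
  have hSlim : Filter.Tendsto (fun j => ∫⁻ x, S j x) Filter.atTop (nhds 0) := by
    have a1 := tendsto_lintegral_avg_sub (hVm s) (a := 2) (by norm_num)
      (h2 ▸ memLp_coord hS.V_two s) htlim (μ := fun j => segMeasure s (t j))
      (fun j => ae_segMeasure_norm_le s (t j))
    have a2 := fun i => tendsto_lintegral_avg_sub (hWm i s) (a := 2) (by norm_num)
      (h2 ▸ memLp_coord (hS.W_two i) s) htlim (μ := fun j => segMeasure s (t j))
      (fun j => ae_segMeasure_norm_le s (t j))
    have a3 := a1.add (tendsto_finsetSum Finset.univ fun i _ => a2 i)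
    simp only [Finset.sum_const_zero, add_zero] at a3
    refine a3.congr fun j => ?_
    rw [hSdef]
    simp only
    have m1 : Measurable fun x => ‖v j x - V x s‖ₑ ^ (2 : ℝ) :=
      ((hvm j).sub (hVm s)).enorm.pow_const _
    have m2 : ∀ i, Measurable fun x => ‖w j i x - W x i s‖ₑ ^ (2 : ℝ) := fun i =>
      ((hwm j i).sub (hWm i s)).enorm.pow_const _
    rw [lintegral_add_left m1, lintegral_finsetSum _ fun i _ => m2 i]
  obtain ⟨φ, -, hφlim⟩ := exists_seq_tendsto_ae_of_lintegral hSm hSlim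
  have hQae : ∀ᵐ x, ∀ j i, x ∈ Metric.ball x₀ r →
      V (x + t j • EuclideanSpace.single s 1) i - V x i = t j * w j i x := by
    rw [ae_all_iff]; intro j
    rw [ae_all_iff]; intro i
    exact (hS.V_weak i s).sub_eq_mul_avg (hVi i) (hVm i) (hWi i s) (hWm i s) hR (htlt j)
  have hconv : ∀ (a : ℕ → ℝ) (b : ℝ), Filter.Tendsto (fun j => ‖a j - b‖ₑ ^ (2 : ℝ)) Filter.atTop
      (nhds 0) → Filter.Tendsto a Filter.atTop (nhds b) := by
    intro a b hab
    rw [tendsto_iff_edist_tendsto_0]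
    have := ((ENNReal.continuous_rpow_const (y := 1 / 2)).tendsto 0).comp hab
    rw [ENNReal.zero_rpow_of_pos (by norm_num)] at this
    refine this.congr fun j => ?_
    simp only [Function.comp]
    rw [← ENNReal.rpow_mul, edist_eq_enorm_sub]
    norm_num
  -- Fatou along the subsequence on which the averages of V_s and of W_{is} converge almost
  -- everywhere. The weight |V|^{p-2} is evaluated at the unshifted point and so does not depend on
  -- j.
  refine lintegral_le_of_tendsto_ae (F := fun j x => ENNReal.ofReal
      (truncPow k (2 * β) (v (φ j) x) * (‖V x‖ ^ (p - 2) * ∑ i, w (φ j) i x ^ 2)))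
      (fun j => ?_) ?_ (b := fun _ => ENNReal.ofReal (6 / c * ((n : ℝ) ^ q * (8 * C + C ^ 2 / c)) *
        (1 + 2 * K) ^ 2 / (R - ρ) ^ 2) *
        ∫⁻ x in Metric.ball x₀ R, ENNReal.ofReal (maxNorm (V x) ^ (q + 2 * β)))
      (Filter.Eventually.of_forall fun j => ?_) tendsto_const_nhds
  · refine (Measurable.ennreal_ofReal ?_).aemeasurable
    refine Measurable.mul ?_ (Measurable.mul (hS.V_meas.norm.pow_const _)
      (Finset.measurable_fun_sum _ fun i _ => (hwm _ i).pow_const _))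
    exact (continuous_truncPow (by linarith)).measurable.comp (hvm _)
  · refine ae_restrict_of_ae ?_
    filter_upwards [hφlim] with x hx
    have b1 : Filter.Tendsto (fun j => v (φ j) x) Filter.atTop (nhds (V x s)) :=
      hconv _ _ (tendsto_of_tendsto_of_tendsto_of_le_of_le tendsto_const_nhds hx
        (fun j => zero_le) fun j => le_self_add)
    have b2 : ∀ i, Filter.Tendsto (fun j => w (φ j) i x) Filter.atTop (nhds (W x i s)) := fun i =>
      hconv _ _ (tendsto_of_tendsto_of_tendsto_of_le_of_le tendsto_const_nhds hx
        (fun j => zero_le) fun j =>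
        (Finset.single_le_sum (f := fun i => ‖w (φ j) i x - W x i s‖ₑ ^ (2 : ℝ))
          (fun i _ => zero_le) (Finset.mem_univ i)).trans le_add_self)
    refine (ENNReal.continuous_ofReal.tendsto _).comp ?_
    refine Filter.Tendsto.mul (((continuous_truncPow (by linarith)).tendsto _).comp b1) ?_
    exact (tendsto_finsetSum _ fun i _ => (b2 i).pow 2).const_mul _
  · have h := hS.caccioppoli_difference hA hn hp hpq (s := s) hR (htlt (φ j)) (htpos (φ j)).ne' hρr hη
      hη1 hηρ hηs hηK hβ hk rfl rfl
    refine le_trans (le_of_eq ?_) (h.trans ?_)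
    · refine setLIntegral_congr_fun_ae measurableSet_ball ?_
      filter_upwards [hQae] with x hx hxρ
      congr 3
      rw [EuclideanSpace.norm_sq_eq]
      refine Finset.sum_congr rfl fun i _ => ?_
      have := hx (φ j) i (Metric.ball_subset_ball hρr.le hxρ)
      have ht0 := (htpos (φ j)).ne'
      simp only [PiLp.smul_apply, PiLp.sub_apply, smul_eq_mul]
      rw [this, ← mul_assoc, inv_mul_cancel₀ ht0, one_mul, Real.norm_eq_abs, sq_abs]
    · refine mul_le_mul_left ?_ _
      refine ENNReal.ofReal_le_ofReal ?_
      -- Here r-ρ is half of R-ρ, and R-ρ ≤ 1, so 1 + 2K/(R-ρ) ≤ (1+2K)/(R-ρ).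
      rw [mul_div_assoc]
      refine mul_le_mul_of_nonneg_left ?_ (by positivity)
      rw [← div_pow]
      have hRρ : 0 < R - ρ := by linarith
      have hκ0 : 0 ≤ K / (r - ρ) := div_nonneg hK0.le (by linarith)
      refine pow_le_pow_left₀ (by positivity) ?_ 2
      have e1 : r - ρ = (R - ρ) / 2 := by rw [hr]; ring
      rw [e1, add_div, div_div_eq_mul_div, mul_comm K 2]
      gcongr
      rw [le_div_iff₀ hRρ]
      linarith

end CaccioppoliDifference

/-! ### Higher integrability in one step -/

section Gain

lemma abs_truncPowPrim_of_le {k a r : ℝ} (ha : 0 ≤ a) (hr : |r| ≤ k) :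
    |truncPowPrim k a r| = |r| ^ (a + 1) / (a + 1) := by
  have hfint : ∀ b : ℝ, 0 ≤ b → ∫ τ in (0 : ℝ)..b, τ ^ a = b ^ (a + 1) / (a + 1) := by
    intro b hb
    rw [integral_rpow (Or.inl (by linarith)), Real.zero_rpow (by linarith), sub_zero]
  rcases le_total 0 r with h0 | h0
  · have h1 : truncPowPrim k a r = ∫ τ in (0 : ℝ)..r, τ ^ a := by
      refine intervalIntegral.integral_congr fun τ hτ => ?_
      rw [uIcc_of_le h0] at hτ
      rw [abs_of_nonneg h0] at hr
      simp only [truncPow]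
      rw [abs_of_nonneg hτ.1, min_eq_left (hτ.2.trans hr)]
    rw [h1, hfint r h0, abs_of_nonneg h0, abs_of_nonneg (by positivity)]
  · have h1 : truncPowPrim k a r = -∫ τ in (0 : ℝ)..(-r), τ ^ a := by
      rw [truncPowPrim, intervalIntegral.integral_symm, ← neg_zero,
        ← intervalIntegral.integral_comp_neg, neg_zero]
      congr 1
      refine intervalIntegral.integral_congr fun τ hτ => ?_
      rw [uIcc_of_le h0] at hτ
      rw [abs_of_nonpos h0] at hr
      simp only [truncPow]
      rw [abs_of_nonpos hτ.2, min_eq_left (by linarith [hτ.1])]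
    rw [h1, hfint (-r) (by linarith), abs_of_nonpos h0, abs_neg, abs_of_nonneg
      (div_nonneg (Real.rpow_nonneg (by linarith) _) (by linarith))]

/-- Since |V_s| ≤ |V|, the part of the power with exponent b = p-2 is paid for by the weight
|V|^{p-2} in the Caccioppoli inequality. -/
lemma truncPow_sq_le {k a b r m : ℝ} (hk : 0 ≤ k) (ha : 0 ≤ a) (hb : 0 ≤ b) (hm : |r| ≤ m) :
    truncPow k (a + b / 2) r ^ 2 ≤ truncPow k (2 * a) r * m ^ b := by
  have h0 : 0 ≤ min |r| k := le_min (abs_nonneg _) hk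
  have h1 : truncPow k (a + b / 2) r ^ 2 = min |r| k ^ (2 * a) * min |r| k ^ b := by
    rw [truncPow, ← Real.rpow_natCast, ← Real.rpow_mul h0,
      ← Real.rpow_add_of_nonneg h0 (by linarith) hb]
    congr 1; push_cast; ring
  rw [h1]
  exact mul_le_mul_of_nonneg_left (Real.rpow_le_rpow h0 ((min_le_left _ _).trans hm) hb)
    (Real.rpow_nonneg h0 _)

variable {n : ℕ} {p q c C : ℝ} {Ω' : Set (E n)} {A : E n → E n → E n} {U : E n → ℝ} {V : E n → E n}
  {W : E n → Fin n → E n}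

/-- The higher integrability of one partial derivative, for truncated powers. -/
lemma SmoothSolution.gain_truncated (hS : SmoothSolution q Ω' A U V W)
    (hp : 2 ≤ p) (hpq : p ≤ q) {K C₃ : ℝ} (hK0 : 0 < K) (hC₃ : 0 < C₃)
    (hK : ∀ (x₀ : E n) (ρ R : ℝ), 0 < ρ → ρ < R →
      ∃ η : E n → ℝ, ContDiff ℝ 1 η ∧ (∀ x, 0 ≤ η x ∧ η x ≤ 1) ∧
      (∀ x ∈ Metric.ball x₀ ρ, η x = 1) ∧ tsupport η ⊆ Metric.closedBall x₀ R ∧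
      HasCompactSupport η ∧ ∀ x, ‖fderiv ℝ η x‖ ≤ K / (R - ρ))
    (hcac : ∀ (x₀ : E n) (R ρ β k : ℝ) (s : Fin n), Metric.ball x₀ R ⊆ Ω' → 0 < ρ → ρ < R → R ≤ 1 →
      0 ≤ β → 0 ≤ k → ∫⁻ x in Metric.ball x₀ ρ, ENNReal.ofReal
        (truncPow k (2 * β) (V x s) * (‖V x‖ ^ (p - 2) * ∑ i, W x i s ^ 2)) ≤
      ENNReal.ofReal (C₃ / (R - ρ) ^ 2) *
        ∫⁻ x in Metric.ball x₀ R, ENNReal.ofReal (maxNorm (V x) ^ (q + 2 * β)))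
    {σ : ℝ} (hσ : 1 < σ) {CS : ℝ≥0∞} (hCST : CS ≠ ⊤) {x₀ : E n}
    (hCS : ∀ F : E n → ℝ, ContDiff ℝ 1 F → tsupport F ⊆ Metric.closedBall x₀ 1 →
      (∫⁻ x, ‖F x‖ₑ ^ (2 * σ)) ^ (1 / σ) ≤ CS * ∫⁻ x, ‖fderiv ℝ F x‖ₑ ^ (2 : ℝ))
    {R ρ β k : ℝ} {s : Fin n} (hR : Metric.ball x₀ R ⊆ Ω') (hρ : 0 < ρ) (hρR : ρ < R) (hR1 : R ≤ 1)
    (hβ : 0 ≤ β) (hk : 0 ≤ k) :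
    (∫⁻ x in Metric.ball x₀ ρ, ‖truncPowPrim k (β + (p - 2) / 2) (V x s)‖ₑ ^ (2 * σ)) ^ (1 / σ) ≤
      CS * ENNReal.ofReal ((36 * K ^ 2 + 36 * C₃) / (R - ρ) ^ 2) *
        ∫⁻ x in Metric.ball x₀ R, ENNReal.ofReal (maxNorm (V x) ^ (q + 2 * β)) := by
  have hd : 0 < R - ρ := by linarith
  -- Thirds of the gap: the cut-off descends between ρ and r, the Sobolev inequality works inside
  -- r', and the Caccioppoli inequality is used between r' and R. Each third contributes a factor 9.
  set r := ρ + (R - ρ) / 3 with hr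
  set r' := ρ + 2 * (R - ρ) / 3 with hr'
  have hρr : ρ < r := by linarith
  have hrr' : r < r' := by linarith
  have hr'R : r' < R := by linarith
  -- With this a the square of the truncated power of V_s is at most the truncated power with
  -- exponent 2β times |V|^{p-2}, which is exactly the Caccioppoli integrand.
  set a := β + (p - 2) / 2 with ha
  have ha0 : 0 ≤ a := by rw [ha]; linarith
  obtain ⟨η, hη, hη1, hηρ, hηs, -, hηK⟩ := hK x₀ ρ r hρ hρr
  have hVm : ∀ i, Measurable fun x => V x i := fun i => (measurable_coord i).comp hS.V_meas
  have hWm : ∀ i j, Measurable fun x => W x i j := fun i j => (measurable_coord j).comp (hS.W_meas i)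
  have hWi : ∀ i j, Integrable fun x => W x i j := fun i j =>
    memLp_one_iff_integrable.1 (memLp_coord (memLp_one_iff_integrable.2 (hS.W_int i)) j)
  have hsob := sobolev_comp hσ hCS hCST hR1 (hrr'.trans hr'R) hR (hVm s) (fun j => hWm s j)
    (memLp_coord hS.V_two s) (fun j => memLp_coord (hS.W_two s) j) (fun j => hS.V_weak s j)
    hη hη1 hηs hηK (Ψ := truncPowPrim k a) (fun r => hasDerivAt_truncPowPrim ha0 r)
    (continuous_truncPow ha0) (fun r => truncPow_le_const hk ha0 r)
  have hleft : (∫⁻ x in Metric.ball x₀ ρ, ‖truncPowPrim k a (V x s)‖ₑ ^ (2 * σ)) ^ (1 / σ) ≤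
      (∫⁻ x, ‖η x * truncPowPrim k a (V x s)‖ₑ ^ (2 * σ)) ^ (1 / σ) := by
    refine ENNReal.rpow_le_rpow ?_ (by positivity)
    refine le_trans (le_of_eq ?_) (setLIntegral_le_lintegral (Metric.ball x₀ ρ) _)
    refine setLIntegral_congr_fun measurableSet_ball fun x hx => ?_
    simp only [hηρ x hx, one_mul]
  refine hleft.trans (hsob.trans ?_)
  rw [mul_assoc]
  refine mul_le_mul_right ?_ CS
  set I := ∫⁻ x in Metric.ball x₀ R, ENNReal.ofReal (maxNorm (V x) ^ (q + 2 * β)) with hI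
  -- Sobolev requires the gradient of V_s, that is the entries W_{sj}, whereas the differentiated
  -- equation controls the entries W_{is}. Symmetry of the weak Hessian identifies them.
  have hsymm : ∀ᵐ x, ∀ j, x ∈ Ω' → W x s j = W x j s := by
    rw [ae_all_iff]
    intro j
    exact ae_symm_of_hasWeakPartial hS.isOpen (hS.U_weak s) (hS.U_weak j) (hS.V_weak s j)
      (hS.V_weak j s) (hWi s j) (hWi j s)
  have hKr : K / (r - ρ) = 3 * K / (R - ρ) := by
    have : r - ρ = (R - ρ) / 3 := by rw [hr]; ring
    rw [this]; field_simp
  have hηz : ∀ x ∉ Metric.ball x₀ r', η x = 0 ∧ fderiv ℝ η x = 0 := by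
    intro x hx
    have hx' : x ∉ tsupport η := fun h => hx (Metric.closedBall_subset_ball hrr' (hηs h))
    refine ⟨image_eq_zero_of_notMem_tsupport hx', ?_⟩
    by_contra h
    exact hx' (support_fderiv_subset ℝ h)
  have hbound : ∀ᵐ x, ENNReal.ofReal (4 * (‖fderiv ℝ η x‖ ^ 2 * truncPowPrim k a (V x s) ^ 2 +
        η x ^ 2 * truncPow k a (V x s) ^ 2 * ∑ j, W x s j ^ 2)) ≤
      (Metric.ball x₀ r').indicator (fun x => ENNReal.ofReal (36 * K ^ 2 / (R - ρ) ^ 2) *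
        ENNReal.ofReal (maxNorm (V x) ^ (q + 2 * β)) + 4 * ENNReal.ofReal
        (truncPow k (2 * β) (V x s) * (‖V x‖ ^ (p - 2) * ∑ i, W x i s ^ 2))) x := by
    filter_upwards [hsymm] with x hx
    by_cases hxr : x ∈ Metric.ball x₀ r'
    swap
    · simp [hηz x hxr, hxr]
    have hxΩ : x ∈ Ω' := hR (Metric.ball_subset_ball hr'R.le hxr)
    rw [indicator_of_mem hxr]
    have hsum : ∑ j, W x s j ^ 2 = ∑ i, W x i s ^ 2 :=
      Finset.sum_congr rfl fun j _ => by rw [hx j hxΩ]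
    have hN := maxNorm_pos (V x)
    have hVs := abs_apply_le_maxNorm (V x) s
    have h1 : ‖fderiv ℝ η x‖ ^ 2 ≤ 9 * K ^ 2 / (R - ρ) ^ 2 := by
      have := pow_le_pow_left₀ (norm_nonneg _) (hηK x) 2
      rw [hKr, div_pow, mul_pow] at this
      norm_num at this
      exact this
    have h2 : truncPowPrim k a (V x s) ^ 2 ≤ maxNorm (V x) ^ (q + 2 * β) := by
      have h3 : |truncPowPrim k a (V x s)| ≤ maxNorm (V x) ^ (a + 1) := by
        refine (abs_truncPowPrim_le hk ha0 _).trans ?_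
        rw [Real.rpow_add hN, Real.rpow_one, mul_comm]
        refine mul_le_mul ((truncPow_le hk ha0 _).trans (Real.rpow_le_rpow (abs_nonneg _) hVs ha0))
          hVs (abs_nonneg _) (by positivity)
      rw [← sq_abs]
      calc _ ≤ (maxNorm (V x) ^ (a + 1)) ^ 2 := pow_le_pow_left₀ (abs_nonneg _) h3 2
        _ = maxNorm (V x) ^ (p + 2 * β) := by
          rw [← Real.rpow_natCast, ← Real.rpow_mul hN.le]; congr 1; rw [ha]; push_cast; ring
        _ ≤ _ := Real.rpow_le_rpow_of_exponent_le (one_le_maxNorm _) (by linarith)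
    have h3 := truncPow_sq_le (k := k) (a := β) (b := p - 2) (r := V x s) (m := ‖V x‖) hk hβ
      (by linarith) (abs_apply_le_norm _ _)
    rw [← ha] at h3
    have hs0 : 0 ≤ ∑ i, W x i s ^ 2 := Finset.sum_nonneg fun i _ => sq_nonneg _
    have hg0 := truncPow_nonneg (a := 2 * β) hk (V x s)
    have hη2 : η x ^ 2 ≤ 1 := pow_le_one₀ (hη1 x).1 (hη1 x).2
    rw [hsum, ← ENNReal.ofReal_mul (by positivity), ← ENNReal.ofReal_ofNat 4,
      ← ENNReal.ofReal_mul (by norm_num), ← ENNReal.ofReal_add (by positivity) (by positivity)]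
    refine ENNReal.ofReal_le_ofReal ?_
    have h4 : ‖fderiv ℝ η x‖ ^ 2 * truncPowPrim k a (V x s) ^ 2 ≤
        9 * K ^ 2 / (R - ρ) ^ 2 * maxNorm (V x) ^ (q + 2 * β) :=
      mul_le_mul h1 h2 (sq_nonneg _) (by positivity)
    have h5 : η x ^ 2 * truncPow k a (V x s) ^ 2 * ∑ i, W x i s ^ 2 ≤
        1 * (truncPow k (2 * β) (V x s) * ‖V x‖ ^ (p - 2)) * ∑ i, W x i s ^ 2 := by
      gcongr
    calc _ ≤ 4 * (9 * K ^ 2 / (R - ρ) ^ 2 * maxNorm (V x) ^ (q + 2 * β) +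
          1 * (truncPow k (2 * β) (V x s) * ‖V x‖ ^ (p - 2)) * ∑ i, W x i s ^ 2) := by linarith
      _ = _ := by ring
  refine (lintegral_mono_ae hbound).trans ?_
  have hNm : Measurable fun x => ENNReal.ofReal (36 * K ^ 2 / (R - ρ) ^ 2) *
      ENNReal.ofReal (maxNorm (V x) ^ (q + 2 * β)) :=
    ((continuous_maxNorm.measurable.comp hS.V_meas).pow_const _).ennreal_ofReal.const_mul _
  rw [lintegral_indicator measurableSet_ball, lintegral_add_left hNm,
    lintegral_const_mul' _ _ ENNReal.ofReal_ne_top, lintegral_const_mul' _ _ (by simp)]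
  have hc1 := hcac x₀ R r' β k s hR (by linarith) hr'R hR1 hβ hk
  have hRr : R - r' = (R - ρ) / 3 := by rw [hr']; ring
  have h9 : C₃ / (R - r') ^ 2 = 9 * C₃ / (R - ρ) ^ 2 := by
    rw [hRr]; field_simp; ring
  rw [h9] at hc1
  calc _ ≤ ENNReal.ofReal (36 * K ^ 2 / (R - ρ) ^ 2) * I +
        4 * (ENNReal.ofReal (9 * C₃ / (R - ρ) ^ 2) * I) := by
        gcongr
        exact lintegral_mono_set (Metric.ball_subset_ball hr'R.le)
    _ = _ := by
        rw [← mul_assoc, ← ENNReal.ofReal_ofNat 4, ← ENNReal.ofReal_mul (by norm_num), ← add_mul,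
          ← ENNReal.ofReal_add (by positivity) (by positivity)]
        congr 2
        ring

/-- The higher integrability of one partial derivative. -/
lemma lintegral_rpow_le_of_truncated {s : Fin n} {σ a : ℝ} (hσ : 1 < σ) (ha : 0 ≤ a)
    (hVm : Measurable V) {S : Set (E n)} {B : ℝ≥0∞}
    (h : ∀ k : ℝ, 0 ≤ k → (∫⁻ x in S, ‖truncPowPrim k a (V x s)‖ₑ ^ (2 * σ)) ^ (1 / σ) ≤ B) :
    ∫⁻ x in S, ENNReal.ofReal (|V x s| ^ (σ * (2 * a + 2))) ≤
      (ENNReal.ofReal ((a + 1) ^ 2) * B) ^ σ := by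
  have hσ0 : 0 < σ := by linarith
  have h1 : ∫⁻ x in S, ENNReal.ofReal ((|V x s| ^ (a + 1) / (a + 1)) ^ (2 * σ)) ≤ B ^ σ := by
    refine lintegral_le_of_tendsto_ae (F := fun (k : ℕ) x => ‖truncPowPrim k a (V x s)‖ₑ ^ (2 * σ))
      (fun k => ?_) (Filter.Eventually.of_forall fun x => ?_) (b := fun _ => B ^ σ)
      (Filter.Eventually.of_forall fun k => ?_) tendsto_const_nhds
    · have hc : Continuous (truncPowPrim (k : ℝ) a) :=
        continuous_iff_continuousAt.2 fun r => (hasDerivAt_truncPowPrim ha r).continuousAt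
      exact ((hc.measurable.comp ((measurable_coord s).comp hVm)).enorm.pow_const _).aemeasurable
    · refine tendsto_const_nhds.congr' ?_
      filter_upwards [Filter.eventually_ge_atTop ⌈|V x s|⌉₊] with k hk
      have hk' : |V x s| ≤ k := (Nat.le_ceil _).trans (by exact_mod_cast hk)
      rw [← ofReal_norm, Real.norm_eq_abs, abs_truncPowPrim_of_le ha hk',
        ENNReal.ofReal_rpow_of_nonneg (by positivity) (by positivity)]
    · have := ENNReal.rpow_le_rpow (h k (Nat.cast_nonneg k)) hσ0.le
      rwa [← ENNReal.rpow_mul, one_div_mul_cancel hσ0.ne', ENNReal.rpow_one] at this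
  calc _ = ∫⁻ x in S, ENNReal.ofReal ((a + 1) ^ (2 * σ)) *
        ENNReal.ofReal ((|V x s| ^ (a + 1) / (a + 1)) ^ (2 * σ)) := by
        refine lintegral_congr fun x => ?_
        rw [← ENNReal.ofReal_mul (by positivity), ← Real.mul_rpow (by positivity) (by positivity),
          mul_div_cancel₀ _ (by positivity), ← Real.rpow_mul (abs_nonneg _)]
        congr 2; ring
    _ = ENNReal.ofReal ((a + 1) ^ (2 * σ)) *
        ∫⁻ x in S, ENNReal.ofReal ((|V x s| ^ (a + 1) / (a + 1)) ^ (2 * σ)) :=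
        lintegral_const_mul' _ _ ENNReal.ofReal_ne_top
    _ ≤ ENNReal.ofReal ((a + 1) ^ (2 * σ)) * B ^ σ := by gcongr
    _ = _ := by
        rw [ENNReal.mul_rpow_of_nonneg _ _ hσ0.le, ENNReal.ofReal_rpow_of_nonneg (by positivity)
          hσ0.le, Real.rpow_mul (by positivity), Real.rpow_two]

/-- The energy with exponent `α` on a ball, increased by one. -/
def powEnergy (V : E n → E n) (x₀ : E n) (α r : ℝ) : ℝ≥0∞ :=
  1 + ∫⁻ x in Metric.ball x₀ r, ENNReal.ofReal (maxNorm (V x) ^ α)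

lemma one_le_powEnergy (V : E n → E n) (x₀ : E n) (α r : ℝ) : 1 ≤ powEnergy V x₀ α r :=
  le_self_add

/-- The fundamental step of the Moser iteration. -/
lemma SmoothSolution.exists_gain (hp : 2 ≤ p) (hpq : p ≤ q) {K C₃ : ℝ} (hK0 : 0 < K)
    (hC₃ : 0 < C₃)
    (hK : ∀ (x₀ : E n) (ρ R : ℝ), 0 < ρ → ρ < R →
      ∃ η : E n → ℝ, ContDiff ℝ 1 η ∧ (∀ x, 0 ≤ η x ∧ η x ≤ 1) ∧
      (∀ x ∈ Metric.ball x₀ ρ, η x = 1) ∧ tsupport η ⊆ Metric.closedBall x₀ R ∧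
      HasCompactSupport η ∧ ∀ x, ‖fderiv ℝ η x‖ ≤ K / (R - ρ))
    {σ : ℝ} (hσ : 1 < σ) {CS : ℝ≥0∞} (hCST : CS ≠ ⊤)
    (hCS : ∀ (x₀ : E n) (F : E n → ℝ), ContDiff ℝ 1 F → tsupport F ⊆ Metric.closedBall x₀ 1 →
      (∫⁻ x, ‖F x‖ₑ ^ (2 * σ)) ^ (1 / σ) ≤ CS * ∫⁻ x, ‖fderiv ℝ F x‖ₑ ^ (2 : ℝ)) :
    ∃ C₄ : ℝ, 1 ≤ C₄ ∧ ∀ (Ω' : Set (E n)) (A : E n → E n → E n) (U : E n → ℝ) (V : E n → E n)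
      (W : E n → Fin n → E n), SmoothSolution q Ω' A U V W →
      (∀ (x₀ : E n) (R ρ β k : ℝ) (s : Fin n), Metric.ball x₀ R ⊆ Ω' → 0 < ρ → ρ < R → R ≤ 1 →
      0 ≤ β → 0 ≤ k → ∫⁻ x in Metric.ball x₀ ρ, ENNReal.ofReal
        (truncPow k (2 * β) (V x s) * (‖V x‖ ^ (p - 2) * ∑ i, W x i s ^ 2)) ≤
      ENNReal.ofReal (C₃ / (R - ρ) ^ 2) *
        ∫⁻ x in Metric.ball x₀ R, ENNReal.ofReal (maxNorm (V x) ^ (q + 2 * β))) →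
      ∀ (x₀ : E n) (R ρ β : ℝ), Metric.ball x₀ R ⊆ Ω' → 0 < ρ → ρ < R → R ≤ 1 → 0 ≤ β →
        powEnergy V x₀ (σ * (p + 2 * β)) ρ ≤
          (ENNReal.ofReal (C₄ * (p + 2 * β) ^ 2 / (R - ρ) ^ 2) *
            powEnergy V x₀ (q + 2 * β) R) ^ σ := by
  set v₁ : ℝ := (volume (Metric.ball (0 : E n) 1)).toReal with hv₁
  have hv₁0 : 0 ≤ v₁ := ENNReal.toReal_nonneg
  set C₅ : ℝ := max 1 (CS.toReal * (36 * K ^ 2 + 36 * C₃)) with hC₅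
  have hC₅1 : 1 ≤ C₅ := le_max_left _ _
  refine ⟨(1 + v₁ + n) * C₅, one_le_mul_of_one_le_of_one_le (by
    have : (0 : ℝ) ≤ n := Nat.cast_nonneg n
    linarith) hC₅1, ?_⟩
  intro Ω' A U V W hS hcac x₀ R ρ β hR hρ hρR hR1 hβ
  have hd : 0 < R - ρ := by linarith
  have hσ0 : 0 < σ := by linarith
  set J := powEnergy V x₀ (q + 2 * β) R with hJ
  have hJ1 : 1 ≤ J := one_le_powEnergy _ _ _ _
  set a := β + (p - 2) / 2 with ha
  have ha0 : 0 ≤ a := by rw [ha]; linarith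
  set T := ENNReal.ofReal (C₅ * (p + 2 * β) ^ 2 / (R - ρ) ^ 2) * J with hT
  have hs : ∀ s, ∫⁻ x in Metric.ball x₀ ρ, ENNReal.ofReal (|V x s| ^ (σ * (p + 2 * β))) ≤ T ^ σ := by
    intro s
    have h1 := lintegral_rpow_le_of_truncated (s := s) hσ ha0 hS.V_meas (fun k hk =>
      hS.gain_truncated hp hpq hK0 hC₃ hK hcac hσ hCST (hCS x₀) hR hρ hρR hR1 hβ hk)
    -- The gain: exponent q+2β is spent on the right and σ(p+2β) is obtained on the left.
    have e1 : σ * (2 * a + 2) = σ * (p + 2 * β) := by rw [ha]; ring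
    rw [e1] at h1
    refine h1.trans (ENNReal.rpow_le_rpow ?_ hσ0.le)
    rw [← mul_assoc]
    refine mul_le_mul' ?_ (le_add_self)
    rw [← ENNReal.ofReal_toReal hCST, ← ENNReal.ofReal_mul ENNReal.toReal_nonneg,
      ← ENNReal.ofReal_mul (by positivity)]
    refine ENNReal.ofReal_le_ofReal ?_
    have e2 : (a + 1) ^ 2 = (p + 2 * β) ^ 2 / 4 := by rw [ha]; ring
    rw [e2, ← mul_div_assoc, ← mul_div_assoc, div_le_div_iff_of_pos_right (by positivity), mul_comm]
    refine mul_le_mul (le_max_right _ _) ?_ (by positivity) (by linarith)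
    have : 0 ≤ (p + 2 * β) ^ 2 := sq_nonneg _
    linarith
  have hT1 : 1 ≤ T := by
    refine one_le_mul_of_one_le_of_one_le ?_ hJ1
    rw [ENNReal.one_le_ofReal, one_le_div (by positivity)]
    have h1 : (R - ρ) ^ 2 ≤ 1 := pow_le_one₀ hd.le (by linarith)
    have h2 : 1 ≤ (p + 2 * β) ^ 2 := one_le_pow₀ (by linarith)
    exact h1.trans (one_le_mul_of_one_le_of_one_le hC₅1 h2)
  have hTσ : 1 ≤ T ^ σ := ENNReal.one_le_rpow hT1 hσ0
  have hvol : volume (Metric.ball x₀ ρ) ≤ ENNReal.ofReal v₁ := by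
    rw [hv₁, ENNReal.ofReal_toReal measure_ball_lt_top.ne,
      ← Measure.addHaar_ball_center volume x₀ 1]
    exact measure_mono (Metric.ball_subset_ball (by linarith))
  have hα0 : 0 < σ * (p + 2 * β) := by positivity
  have hVm : ∀ i, Measurable fun x => V x i := fun i => (measurable_coord i).comp hS.V_meas
  have hsm : ∀ s, Measurable fun x => ENNReal.ofReal (|V x s| ^ (σ * (p + 2 * β))) := fun s =>
    ((measurable_abs.comp (hVm s)).pow_const _).ennreal_ofReal
  have hfin : powEnergy V x₀ (σ * (p + 2 * β)) ρ ≤ ENNReal.ofReal (1 + v₁ + n) * T ^ σ := by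
    calc powEnergy V x₀ (σ * (p + 2 * β)) ρ
        ≤ 1 + ∫⁻ x in Metric.ball x₀ ρ, (1 + ∑ s, ENNReal.ofReal (|V x s| ^ (σ * (p + 2 * β)))) := by
          unfold powEnergy
          gcongr with x
          rw [← ENNReal.ofReal_one, ← ENNReal.ofReal_sum_of_nonneg (fun i _ => by positivity),
            ← ENNReal.ofReal_add zero_le_one (Finset.sum_nonneg fun i _ => by positivity)]
          exact ENNReal.ofReal_le_ofReal (maxNorm_rpow_le (V x) hα0)
      _ = 1 + (volume (Metric.ball x₀ ρ) +
          ∑ s, ∫⁻ x in Metric.ball x₀ ρ, ENNReal.ofReal (|V x s| ^ (σ * (p + 2 * β)))) := by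
          rw [lintegral_add_left measurable_const, lintegral_finsetSum _ fun i _ => hsm i]
          simp
      _ ≤ T ^ σ + (ENNReal.ofReal v₁ * T ^ σ + ∑ _s : Fin n, T ^ σ) := by
          gcongr with s
          · calc volume (Metric.ball x₀ ρ) ≤ ENNReal.ofReal v₁ * 1 := by rwa [mul_one]
              _ ≤ _ := by gcongr
          · exact hs s
      _ = _ := by
          rw [Finset.sum_const, Finset.card_univ, Fintype.card_fin, nsmul_eq_mul,
            ENNReal.ofReal_add (by linarith) (Nat.cast_nonneg n), ENNReal.ofReal_add zero_le_one hv₁0,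
            ENNReal.ofReal_one, ENNReal.ofReal_natCast]
          ring
  refine hfin.trans ?_
  have h1n : 1 ≤ ENNReal.ofReal (1 + v₁ + n) := by
    rw [ENNReal.one_le_ofReal]
    have : (0 : ℝ) ≤ n := Nat.cast_nonneg n
    linarith
  calc _ ≤ ENNReal.ofReal (1 + v₁ + n) ^ σ * T ^ σ := by
        gcongr
        exact ENNReal.le_rpow_self_of_one_le h1n hσ.le
    _ = _ := by
        rw [← ENNReal.mul_rpow_of_nonneg _ _ hσ0.le, hT, ← mul_assoc,
          ← ENNReal.ofReal_mul (by have : (0 : ℝ) ≤ n := Nat.cast_nonneg n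
                                   linarith)]
        congr 3
        ring

end Gain

/-! ### Two numerical iterations -/

section Iteration

/-- The weight K^m Λ^{mk+m(m-1)} is chosen so that the weighted sequence satisfies S_{k+1} ≤ S_k^σ
without any constant; the exponents match because m + σ = mσ. -/
lemma moser_iterate {T : ℕ → ℝ≥0∞} {K Λ m σ : ℝ} (hK : 0 < K) (hΛ : 0 < Λ) (hm : 1 < m)
    (hσ : σ = m / (m - 1)) (h : ∀ k : ℕ, T (k + 1) ≤ (ENNReal.ofReal (K * Λ ^ (k : ℝ)) * T k) ^ σ)
    (k : ℕ) :
    ENNReal.ofReal (K ^ m * Λ ^ (m * k + m * (m - 1))) * T k ≤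
      (ENNReal.ofReal (K ^ m * Λ ^ (m * (m - 1))) * T 0) ^ (σ ^ (k : ℝ)) := by
  have hm1 : 0 < m - 1 := by linarith
  have hσ0 : 0 < σ := by rw [hσ]; positivity
  induction k with
  | zero => simp
  | succ k ih =>
    have hreal : K ^ m * Λ ^ (m * ((k : ℝ) + 1) + m * (m - 1)) * (K * Λ ^ (k : ℝ)) ^ σ =
        (K ^ m * Λ ^ (m * (k : ℝ) + m * (m - 1))) ^ σ := by
      rw [Real.mul_rpow hK.le (by positivity), Real.mul_rpow (by positivity) (by positivity),
        ← Real.rpow_mul hΛ.le, ← Real.rpow_mul hK.le, ← Real.rpow_mul hΛ.le]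
      calc _ = (K ^ m * K ^ σ) * (Λ ^ (m * ((k : ℝ) + 1) + m * (m - 1)) * Λ ^ ((k : ℝ) * σ)) := by
            ring
        _ = _ := by
            rw [← Real.rpow_add hK, ← Real.rpow_add hΛ]
            congr 2
            · rw [hσ]; field_simp; ring
            · rw [hσ]; field_simp; ring
    push_cast
    calc _ ≤ ENNReal.ofReal (K ^ m * Λ ^ (m * ((k : ℝ) + 1) + m * (m - 1))) *
          (ENNReal.ofReal (K * Λ ^ (k : ℝ)) * T k) ^ σ := by gcongr; exact h k
      _ = (ENNReal.ofReal (K ^ m * Λ ^ (m * k + m * (m - 1))) * T k) ^ σ := by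
          rw [ENNReal.mul_rpow_of_nonneg _ _ hσ0.le, ENNReal.mul_rpow_of_nonneg _ _ hσ0.le,
            ENNReal.ofReal_rpow_of_nonneg (by positivity) hσ0.le,
            ENNReal.ofReal_rpow_of_nonneg (by positivity) hσ0.le, ← mul_assoc,
            ← ENNReal.ofReal_mul (by positivity), hreal]
      _ ≤ ((ENNReal.ofReal (K ^ m * Λ ^ (m * (m - 1))) * T 0) ^ (σ ^ (k : ℝ))) ^ σ :=
          ENNReal.rpow_le_rpow ih hσ0.le
      _ = _ := by
          rw [← ENNReal.rpow_mul, Real.rpow_add hσ0, Real.rpow_one]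

/-- The weights w_i solve the recursion with equality, so M_i/w_i ≤ (M_{i+1}/w_{i+1})^δ. Iterating,
the uniform bound B enters only as B^{δ^j}, which tends to 1: finiteness of B is needed, but its
size does not appear in the conclusion. -/
lemma interpolation_iterate {M : ℕ → ℝ} {D Λ δ B : ℝ} (hD : 1 ≤ D) (hΛ : 1 ≤ Λ) (hδ0 : 0 ≤ δ)
    (hδ : δ < 1) (h1 : ∀ i, 1 ≤ M i) (hB : ∀ i, M i ≤ B)
    (h : ∀ i : ℕ, M i ≤ D * Λ ^ (i : ℝ) * M (i + 1) ^ δ) :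
    M 0 ≤ D ^ (1 / (1 - δ)) * Λ ^ (δ / (1 - δ) ^ 2) := by
  have hd : 0 < 1 - δ := by linarith
  have hD0 : 0 < D := by linarith
  have hΛ0 : 0 < Λ := by linarith
  set a := 1 / (1 - δ) with ha
  set b := δ / (1 - δ) ^ 2 with hb
  have ha0 : 0 < a := by positivity
  have hb0 : 0 ≤ b := by positivity
  set w : ℕ → ℝ := fun i => D ^ a * Λ ^ (a * i + b) with hw
  have hw1 : ∀ i, 1 ≤ w i := fun i =>
    one_le_mul_of_one_le_of_one_le (Real.one_le_rpow hD ha0.le) (Real.one_le_rpow hΛ (by positivity))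
  have hstep : ∀ i : ℕ, D * Λ ^ (i : ℝ) * (w (i + 1)) ^ δ = w i := by
    intro i
    rw [hw]
    simp only
    rw [Real.mul_rpow (by positivity) (by positivity), ← Real.rpow_mul hD0.le,
      ← Real.rpow_mul hΛ0.le]
    calc _ = (D ^ (1 : ℝ) * D ^ (a * δ)) *
          (Λ ^ (i : ℝ) * Λ ^ ((a * ((i + 1 : ℕ) : ℝ) + b) * δ)) := by rw [Real.rpow_one]; ring
      _ = _ := by
          rw [← Real.rpow_add hD0, ← Real.rpow_add hΛ0]
          congr 2
          · rw [ha]; field_simp; ring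
          · rw [ha, hb]; push_cast; field_simp; ring
  have hind : ∀ j : ℕ, M 0 ≤ w 0 * (M j / w j) ^ (δ ^ j) := by
    intro j
    induction j with
    | zero =>
      have : 0 < w 0 := zero_lt_one.trans_le (hw1 0)
      simp only [pow_zero, Real.rpow_one]
      rw [mul_div_cancel₀ _ this.ne']
    | succ j ih =>
      have hwj : 0 < w j := zero_lt_one.trans_le (hw1 j)
      have hwj' : 0 < w (j + 1) := zero_lt_one.trans_le (hw1 (j + 1))
      have hMj : 0 < M j := zero_lt_one.trans_le (h1 j)
      have hMj' : 0 < M (j + 1) := zero_lt_one.trans_le (h1 (j + 1))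
      have h2 : M j / w j ≤ (M (j + 1) / w (j + 1)) ^ δ := by
        rw [Real.div_rpow hMj'.le hwj'.le, div_le_div_iff₀ hwj (by positivity)]
        calc M j * w (j + 1) ^ δ ≤ D * Λ ^ (j : ℝ) * M (j + 1) ^ δ * w (j + 1) ^ δ := by
              gcongr; exact h j
          _ = M (j + 1) ^ δ * (D * Λ ^ (j : ℝ) * (w (j + 1)) ^ δ) := by ring
          _ = _ := by rw [hstep]
      refine ih.trans (mul_le_mul_of_nonneg_left ?_ (zero_le_one.trans (hw1 0)))
      rw [pow_succ', Real.rpow_mul (by positivity)]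
      exact Real.rpow_le_rpow (by positivity) h2 (by positivity)
  have hB1 : 1 ≤ B := (h1 0).trans (hB 0)
  have hle : ∀ j : ℕ, M 0 ≤ w 0 * B ^ (δ ^ j) := by
    intro j
    refine (hind j).trans (mul_le_mul_of_nonneg_left ?_ (zero_le_one.trans (hw1 0)))
    have hMj : 0 < M j := zero_lt_one.trans_le (h1 j)
    refine Real.rpow_le_rpow (div_nonneg hMj.le (zero_le_one.trans (hw1 j))) ?_ (by positivity)
    exact (div_le_self hMj.le (hw1 j)).trans (hB j)
  have hlim : Filter.Tendsto (fun j : ℕ => w 0 * B ^ (δ ^ j)) Filter.atTop (nhds (w 0 * 1)) := by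
    refine Filter.Tendsto.const_mul _ ?_
    have := ((Real.continuous_const_rpow (by linarith : B ≠ 0)).tendsto 0).comp
      (tendsto_pow_atTop_nhds_zero_of_lt_one hδ0 hδ)
    rwa [Real.rpow_zero] at this
  have := ge_of_tendsto' hlim hle
  rw [mul_one] at this
  simpa [hw] using this

end Iteration

/-! ### From power integrals to the supremum -/

section Moser

variable {n : ℕ} {V : E n → E n}

/-- By Chebyshev, the set where N^d > (1+ε)Y, with N the maximum norm of V, has measure at most
(1+ε)^{-σ^k} for every k, hence measure zero. Since N ≥ 1, only a lower bound on the exponents α_k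
is needed. -/
lemma ae_rpow_le_of_powEnergy_le {x₀ : E n} {d σ ρ : ℝ} (hσ : 1 < σ)
    (hV : Measurable V) {Y : ℝ} (hY : 1 ≤ Y) {α : ℕ → ℝ} (hα : ∀ k : ℕ, d * σ ^ (k : ℝ) ≤ α k)
    (h : ∀ k : ℕ, ∫⁻ x in Metric.ball x₀ ρ, ENNReal.ofReal (maxNorm (V x) ^ α k) ≤
      ENNReal.ofReal Y ^ (σ ^ (k : ℝ))) :
    ∀ᵐ x ∂(volume.restrict (Metric.ball x₀ ρ)), maxNorm (V x) ^ d ≤ Y := by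
  have hσ0 : 0 < σ := by linarith
  have hY0 : 0 < Y := by linarith
  have key : ∀ j : ℕ, ∀ᵐ x ∂(volume.restrict (Metric.ball x₀ ρ)),
      maxNorm (V x) ^ d ≤ Y * (1 + 1 / ((j : ℝ) + 1)) := by
    intro j
    set ε : ℝ := 1 / ((j : ℝ) + 1) with hε
    have hε0 : 0 < ε := by positivity
    set S := {x | Y * (1 + ε) < maxNorm (V x) ^ d} with hS
    have hSm : MeasurableSet S := measurableSet_lt measurable_const
      ((continuous_maxNorm.measurable.comp hV).pow_const d)
    set μ := volume.restrict (Metric.ball x₀ ρ) with hμ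
    have hbound : ∀ k : ℕ, ENNReal.ofReal ((1 + ε) ^ (σ ^ (k : ℝ))) * μ S ≤ 1 := by
      intro k
      have hs : 0 < σ ^ (k : ℝ) := by positivity
      have h1 : ENNReal.ofReal ((Y * (1 + ε)) ^ (σ ^ (k : ℝ))) * μ S ≤
          ENNReal.ofReal Y ^ (σ ^ (k : ℝ)) := by
        refine le_trans ?_ (h k)
        rw [← setLIntegral_const]
        refine le_trans (setLIntegral_mono' hSm fun x hx => ?_) (setLIntegral_le_lintegral S _)
        refine ENNReal.ofReal_le_ofReal ?_
        calc (Y * (1 + ε)) ^ (σ ^ (k : ℝ)) ≤ (maxNorm (V x) ^ d) ^ (σ ^ (k : ℝ)) :=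
              Real.rpow_le_rpow (by positivity) (le_of_lt hx) hs.le
          _ = maxNorm (V x) ^ (d * σ ^ (k : ℝ)) := by rw [← Real.rpow_mul (maxNorm_pos _).le]
          _ ≤ _ := Real.rpow_le_rpow_of_exponent_le (one_le_maxNorm _) (hα k)
      rw [Real.mul_rpow hY0.le (by positivity), ENNReal.ofReal_mul (by positivity),
        ENNReal.ofReal_rpow_of_pos hY0, mul_assoc] at h1
      have hne : ENNReal.ofReal (Y ^ (σ ^ (k : ℝ))) ≠ 0 := by
        simpa using Real.rpow_pos_of_pos hY0 _
      exact (ENNReal.mul_le_mul_iff_right hne ENNReal.ofReal_ne_top).1 (by rwa [mul_one])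
    have hzero : μ S = 0 := by
      by_contra hne
      have hfin : μ S ≠ ⊤ := ((measure_mono (subset_univ _)).trans_lt (by
        rw [hμ, Measure.restrict_apply_univ]; exact measure_ball_lt_top)).ne
      have hpos : 0 < (μ S).toReal := ENNReal.toReal_pos hne hfin
      have hb : ∀ k : ℕ, (1 + ε) ^ (σ ^ (k : ℝ)) * (μ S).toReal ≤ 1 := by
        intro k
        have := hbound k
        rw [← ENNReal.ofReal_toReal hfin, ← ENNReal.ofReal_mul (by positivity),
          ENNReal.ofReal_le_one] at this
        exact this
      have hlim : Filter.Tendsto (fun k : ℕ => (1 + ε) ^ (σ ^ (k : ℝ))) Filter.atTop Filter.atTop := by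
        have h1 : Filter.Tendsto (fun k : ℕ => σ ^ (k : ℝ)) Filter.atTop Filter.atTop := by
          simpa using tendsto_pow_atTop_atTop_of_one_lt hσ
        exact (tendsto_rpow_atTop_of_base_gt_one (1 + ε) (by linarith)).comp h1
      obtain ⟨k, hk⟩ := (hlim.eventually_gt_atTop (1 / (μ S).toReal)).exists
      rw [div_lt_iff₀ hpos] at hk
      linarith [hb k]
    rw [ae_iff]
    simpa [hS] using hzero
  rw [← ae_all_iff] at key
  filter_upwards [key] with x hx
  have hlim : Filter.Tendsto (fun j : ℕ => Y * (1 + 1 / ((j : ℝ) + 1))) Filter.atTop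
      (nhds (Y * (1 + 0))) :=
    (tendsto_one_div_add_atTop_nhds_zero_nat.const_add 1).const_mul Y
  rw [add_zero, mul_one] at hlim
  exact ge_of_tendsto' hlim hx

/-- The Moser iteration: local boundedness. -/
lemma ae_rpow_le_of_gain {x₀ : E n} {p q m σ C₄ ρ R : ℝ} (hp : 2 ≤ p) (hpq : p ≤ q) (hm : 1 < m)
    (hσ : σ = m / (m - 1)) (hmp : m * (q - p) < p) (hC₄ : 1 ≤ C₄) (hV : Measurable V) (hρ : 0 < ρ)
    (hρR : ρ < R) (hR1 : R ≤ 1)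
    (hgain : ∀ R' ρ' β : ℝ, R' ≤ R → 0 < ρ' → ρ' < R' → 0 ≤ β →
        powEnergy V x₀ (σ * (p + 2 * β)) ρ' ≤
          (ENNReal.ofReal (C₄ * (p + 2 * β) ^ 2 / (R' - ρ') ^ 2) *
            powEnergy V x₀ (q + 2 * β) R') ^ σ)
    (hfin : powEnergy V x₀ q R ≠ ⊤) :
    ∀ᵐ x ∂(volume.restrict (Metric.ball x₀ ρ)), maxNorm (V x) ^ (q - m * (q - p)) ≤
      (4 * C₄ * q ^ 2) ^ m * (4 * σ ^ 2) ^ (m * (m - 1)) / (R - ρ) ^ (2 * m) *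
        (powEnergy V x₀ q R).toReal := by
  have hm1 : 0 < m - 1 := by linarith
  have hq0 : 0 < q := by linarith
  have hσ1 : 1 < σ := by rw [hσ, one_lt_div hm1]; linarith
  have hσ0 : 0 < σ := by linarith
  have hd : 0 < q - m * (q - p) := by linarith
  set d := q - m * (q - p) with hdd
  have hRρ : 0 < R - ρ := by linarith
  -- The solution of α_{k+1} = σ(α_k-(q-p)) with α_0 = q. Its fixed point is m(q-p), because σ/(σ-1)
  -- = m, and the distance d from it is multiplied by σ at each step.
  set α : ℕ → ℝ := fun k => m * (q - p) + d * σ ^ (k : ℝ) with hα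
  set r : ℕ → ℝ := fun k => ρ + (R - ρ) * (1 / 2) ^ k with hr
  have hmq : 0 ≤ m * (q - p) := mul_nonneg (by linarith) (by linarith)
  have hσk : ∀ k : ℕ, 1 ≤ σ ^ (k : ℝ) := fun k => Real.one_le_rpow hσ1.le (Nat.cast_nonneg k)
  -- The gap r_k - r_{k+1} = (R-ρ)2^{-k}/2 contributes 4·4^k/(R-ρ)², and p+2β ≤ qσ^k contributes
  -- q²σ^{2k}; together they form KΛ^k.
  set K := 4 * C₄ * q ^ 2 / (R - ρ) ^ 2 with hK
  set Λ := 4 * σ ^ 2 with hΛ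
  have hK0 : 0 < K := by positivity
  have hΛ0 : 0 < Λ := by positivity
  set T : ℕ → ℝ≥0∞ := fun k => powEnergy V x₀ (α k) (r k) with hT
  have hstep : ∀ k : ℕ, T (k + 1) ≤ (ENNReal.ofReal (K * Λ ^ (k : ℝ)) * T k) ^ σ := by
    intro k
    have hhalf : (0 : ℝ) < (1 / 2) ^ k := by positivity
    have hhalf1 : ((1 : ℝ) / 2) ^ k ≤ 1 := pow_le_one₀ (by norm_num) (by norm_num)
    have hrk : r k - r (k + 1) = (R - ρ) * (1 / 2) ^ k / 2 := by
      rw [hr]; simp only [pow_succ]; ring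
    have hαq : q ≤ α k := by
      have := mul_le_mul_of_nonneg_left (hσk k) hd.le
      rw [hα]; simp only; linarith
    set β := (α k - q) / 2 with hβ
    have hβ0 : 0 ≤ β := by rw [hβ]; linarith
    have e1 : σ * (p + 2 * β) = α (k + 1) := by
      have h1 : σ * (m - 1) = m := by rw [hσ]; field_simp
      rw [hβ, hα]
      simp only
      push_cast
      rw [Real.rpow_add hσ0, Real.rpow_one]
      linear_combination (q - p) * h1
    have e2 : q + 2 * β = α k := by rw [hβ]; ring
    have hg := hgain (r k) (r (k + 1)) β ?_ ?_ ?_ hβ0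
    · rw [e1, e2] at hg
      refine hg.trans (ENNReal.rpow_le_rpow (mul_le_mul_left (ENNReal.ofReal_le_ofReal ?_) _) hσ0.le)
      rw [hrk, hK, hΛ]
      have h2 : p + 2 * β ≤ q * σ ^ (k : ℝ) := by
        have h3 : m * (q - p) ≤ m * (q - p) * σ ^ (k : ℝ) := le_mul_of_one_le_right hmq (hσk k)
        have h4 : p + 2 * β ≤ α k := by linarith
        have h5 : α k ≤ q * σ ^ (k : ℝ) := by rw [hα, hdd]; simp only; linarith
        linarith
      have h6 : (p + 2 * β) ^ 2 ≤ (q * σ ^ (k : ℝ)) ^ 2 :=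
        pow_le_pow_left₀ (by linarith) h2 2
      have h7 : (4 * σ ^ 2) ^ (k : ℝ) = 4 ^ k * (σ ^ (k : ℝ)) ^ 2 := by
        rw [Real.rpow_natCast, Real.rpow_natCast, mul_pow]; ring
      have h8 : ((1 : ℝ) / 2) ^ k * (1 / 2) ^ k * 4 ^ k = 1 := by
        rw [← mul_pow, ← mul_pow]; norm_num
      rw [h7, div_le_iff₀ (by positivity)]
      calc C₄ * (p + 2 * β) ^ 2 ≤ C₄ * (q * σ ^ (k : ℝ)) ^ 2 := by gcongr
        _ = C₄ * q ^ 2 * (σ ^ (k : ℝ)) ^ 2 * (((1 : ℝ) / 2) ^ k * (1 / 2) ^ k * 4 ^ k) := by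
            rw [h8]; ring
        _ = _ := by field_simp; ring
    · rw [hr]; simp only
      have := mul_le_mul_of_nonneg_left hhalf1 hRρ.le
      linarith
    · rw [hr]; positivity
    · have : 0 < (R - ρ) * (1 / 2) ^ k / 2 := by positivity
      linarith
  have hT0 : T 0 = powEnergy V x₀ q R := by
    rw [hT, hα, hr]; simp [hdd]
  have hKm : 1 ≤ K := by
    rw [hK, one_le_div (by positivity)]
    have h1 : (R - ρ) ^ 2 ≤ 1 := pow_le_one₀ hRρ.le (by linarith)
    have h2 : 1 ≤ q ^ 2 := one_le_pow₀ (by linarith)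
    have h3 : 1 ≤ C₄ * q ^ 2 := one_le_mul_of_one_le_of_one_le hC₄ h2
    linarith
  have hΛ1 : 1 ≤ Λ := by
    have : 1 ≤ σ ^ 2 := one_le_pow₀ hσ1.le
    rw [hΛ]; linarith
  have hJ1 : 1 ≤ (powEnergy V x₀ q R).toReal := by
    have := ENNReal.toReal_mono hfin (one_le_powEnergy V x₀ q R)
    simpa using this
  set Y := K ^ m * Λ ^ (m * (m - 1)) * (powEnergy V x₀ q R).toReal with hY
  have hY1 : 1 ≤ Y := one_le_mul_of_one_le_of_one_le (one_le_mul_of_one_le_of_one_le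
    (Real.one_le_rpow hKm (by linarith)) (Real.one_le_rpow hΛ1 (by positivity))) hJ1
  have hfinal := ae_rpow_le_of_powEnergy_le (x₀ := x₀) (ρ := ρ) (d := d) hσ1 hV hY1 (α := α)
    (fun k => by rw [hα]; simp only; linarith) (fun k => ?_)
  · filter_upwards [hfinal] with x hx
    refine hx.trans (le_of_eq ?_)
    rw [hY, hK, Real.div_rpow (by positivity) (by positivity), ← Real.rpow_natCast (R - ρ) 2,
      ← Real.rpow_mul hRρ.le]
    push_cast
    ring
  · have hit := moser_iterate hK0 hΛ0 hm hσ hstep k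
    rw [hT0, ← ENNReal.ofReal_toReal hfin, ← ENNReal.ofReal_mul (by positivity), ← hY] at hit
    refine le_trans ?_ hit
    have h1 : 1 ≤ ENNReal.ofReal (K ^ m * Λ ^ (m * k + m * (m - 1))) := by
      rw [ENNReal.one_le_ofReal]
      exact one_le_mul_of_one_le_of_one_le (Real.one_le_rpow hKm (by linarith))
        (Real.one_le_rpow hΛ1 (by positivity))
    calc _ ≤ ∫⁻ x in Metric.ball x₀ (r k), ENNReal.ofReal (maxNorm (V x) ^ α k) := by
          refine lintegral_mono_set (Metric.ball_subset_ball ?_)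
          rw [hr]; simp only
          have : 0 ≤ (R - ρ) * (1 / 2) ^ k := by positivity
          linarith
      _ ≤ T k := le_add_self
      _ = 1 * T k := (one_mul _).symm
      _ ≤ _ := by gcongr

end Moser

/-! ### Interpolation down to the p-energy -/

section Interpolation

variable {n : ℕ} {V : E n → E n}

/-- The essential supremum of `maxNorm (V x)` over a ball. -/
def ballSup (V : E n → E n) (x₀ : E n) (r : ℝ) : ℝ :=
  max 1 (essSup (fun x => ENNReal.ofReal (maxNorm (V x)))
    (volume.restrict (Metric.ball x₀ r))).toReal

lemma one_le_ballSup (V : E n → E n) (x₀ : E n) (r : ℝ) : 1 ≤ ballSup V x₀ r := le_max_left _ _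

lemma ballSup_le {x₀ : E n} {r b : ℝ} (hb : 1 ≤ b)
    (h : ∀ᵐ x ∂(volume.restrict (Metric.ball x₀ r)), maxNorm (V x) ≤ b) : ballSup V x₀ r ≤ b := by
  refine max_le hb ?_
  have h1 := essSup_le_of_ae_le (f := fun x => ENNReal.ofReal (maxNorm (V x))) (ENNReal.ofReal b)
    (h.mono fun x hx => ENNReal.ofReal_le_ofReal hx)
  exact ENNReal.toReal_le_of_le_ofReal (by linarith) h1

lemma ae_le_ballSup {x₀ : E n} {r b : ℝ}
    (h : ∀ᵐ x ∂(volume.restrict (Metric.ball x₀ r)), maxNorm (V x) ≤ b) :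
    ∀ᵐ x ∂(volume.restrict (Metric.ball x₀ r)), maxNorm (V x) ≤ ballSup V x₀ r := by
  have h1 := essSup_le_of_ae_le (f := fun x => ENNReal.ofReal (maxNorm (V x))) (ENNReal.ofReal b)
    (h.mono fun x hx => ENNReal.ofReal_le_ofReal hx)
  have h2 := ne_top_of_le_ne_top ENNReal.ofReal_ne_top h1
  filter_upwards [ENNReal.ae_le_essSup (μ := volume.restrict (Metric.ball x₀ r))
    (fun x => ENNReal.ofReal (maxNorm (V x)))] with x hx
  refine le_trans ?_ (le_max_right _ _)
  exact (ENNReal.ofReal_le_iff_le_toReal h2).1 hx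

lemma powEnergy_le_mul {x₀ : E n} {p q r R M : ℝ} (hpq : p ≤ q) (hrR : r ≤ R)
    (hM : 1 ≤ M) (h : ∀ᵐ x ∂(volume.restrict (Metric.ball x₀ r)), maxNorm (V x) ≤ M) :
    powEnergy V x₀ q r ≤ ENNReal.ofReal (M ^ (q - p)) * powEnergy V x₀ p R := by
  have h1 : 1 ≤ ENNReal.ofReal (M ^ (q - p)) := by
    rw [ENNReal.one_le_ofReal]; exact Real.one_le_rpow hM (by linarith)
  unfold powEnergy
  rw [mul_add, mul_one]
  refine add_le_add h1 ?_
  rw [← lintegral_const_mul' _ _ ENNReal.ofReal_ne_top]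
  refine le_trans (lintegral_mono_ae (h.mono fun x hx => ?_))
    (lintegral_mono_set (Metric.ball_subset_ball hrR))
  rw [← ENNReal.ofReal_mul (by positivity)]
  refine ENNReal.ofReal_le_ofReal ?_
  have hN := maxNorm_pos (V x)
  calc maxNorm (V x) ^ q = maxNorm (V x) ^ (q - p) * maxNorm (V x) ^ p := by
        rw [← Real.rpow_add hN]; congr 1; ring
    _ ≤ _ := by
        refine mul_le_mul_of_nonneg_right ?_ (by positivity)
        exact Real.rpow_le_rpow hN.le hx (by linarith)

lemma powEnergy_mono {x₀ : E n} {p q r R : ℝ} (hpq : p ≤ q) (hrR : r ≤ R) :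
    powEnergy V x₀ p r ≤ powEnergy V x₀ q R := by
  unfold powEnergy
  gcongr 1 + ?_
  refine le_trans (lintegral_mono fun x => ?_) (lintegral_mono_set (Metric.ball_subset_ball hrR))
  exact ENNReal.ofReal_le_ofReal (Real.rpow_le_rpow_of_exponent_le (one_le_maxNorm _) hpq)

/-- The local Lipschitz estimate in terms of the `p`-energy. -/
lemma exists_sup_bound {p q m σ C₄ : ℝ} (hp : 2 ≤ p) (hpq : p ≤ q) (hm : 1 < m)
    (hσ : σ = m / (m - 1)) (hmp : m * (q - p) < p) (hC₄ : 1 ≤ C₄) :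
    ∃ C₇ : ℝ, 1 ≤ C₇ ∧ ∀ (V : E n → E n) (x₀ : E n) (ρ R : ℝ), Measurable V → 0 < ρ → ρ < R →
      R ≤ 1 →
      (∀ R' ρ' β : ℝ, R' ≤ R → 0 < ρ' → ρ' < R' → 0 ≤ β →
        powEnergy V x₀ (σ * (p + 2 * β)) ρ' ≤
          (ENNReal.ofReal (C₄ * (p + 2 * β) ^ 2 / (R' - ρ') ^ 2) *
            powEnergy V x₀ (q + 2 * β) R') ^ σ) → powEnergy V x₀ q R ≠ ⊤ →
      ∀ᵐ x ∂(volume.restrict (Metric.ball x₀ ρ)), maxNorm (V x) ≤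
        C₇ * ((powEnergy V x₀ p R).toReal / (R - ρ) ^ (2 * m)) ^ (1 / (p - m * (q - p))) := by
  have hq0 : 0 < q := by linarith
  have hm1 : 0 < m - 1 := by linarith
  have hσ1 : 1 < σ := by rw [hσ, one_lt_div hm1]; linarith
  have hd : 0 < q - m * (q - p) := by linarith
  have hc₀ : 0 < p - m * (q - p) := by linarith
  set d := q - m * (q - p) with hdd
  set c₀ := p - m * (q - p) with hcc
  set C₆ := (4 * C₄ * q ^ 2) ^ m * (4 * σ ^ 2) ^ (m * (m - 1)) with hC₆
  have hC₆1 : 1 ≤ C₆ := by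
    refine one_le_mul_of_one_le_of_one_le (Real.one_le_rpow ?_ (by linarith))
      (Real.one_le_rpow ?_ (by positivity))
    · have h2 : 1 ≤ q ^ 2 := one_le_pow₀ (by linarith)
      have h3 : 1 ≤ C₄ * q ^ 2 := one_le_mul_of_one_le_of_one_le hC₄ h2
      linarith
    · have : 1 ≤ σ ^ 2 := one_le_pow₀ hσ1.le
      linarith
  -- The power with which the supremum over the larger ball returns after N^q ≤ (sup N)^{q-p} N^p.
  -- Since 1-δ = c₀/d, it is below 1 precisely because m(q-p) < p.
  set δ := (q - p) / d with hδ
  have hδ0 : 0 ≤ δ := div_nonneg (by linarith) hd.le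
  have hδ1 : δ < 1 := by rw [hδ, div_lt_one hd]; linarith
  have h1δ : 1 - δ = c₀ / d := by rw [hδ, hcc]; field_simp; rw [hdd]; ring
  -- Each halving of the gap multiplies its power -2m by 2^{2m}, of which the root of order d is
  -- taken.
  set Λ : ℝ := 2 ^ (2 * m / d) with hΛ
  have hΛ1 : 1 ≤ Λ := Real.one_le_rpow (by norm_num) (by positivity)
  refine ⟨(C₆ * 4 ^ (2 * m)) ^ (1 / c₀) * Λ ^ (δ / (1 - δ) ^ 2), ?_, ?_⟩
  · refine one_le_mul_of_one_le_of_one_le (Real.one_le_rpow ?_ (by positivity))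
      (Real.one_le_rpow hΛ1 (by positivity))
    exact one_le_mul_of_one_le_of_one_le hC₆1 (Real.one_le_rpow (by norm_num) (by positivity))
  intro V x₀ ρ R hV hρ hρR hR1 hgain hfin
  have hRρ : 0 < R - ρ := by linarith
  have hPfin : powEnergy V x₀ p R ≠ ⊤ := ne_top_of_le_ne_top hfin (powEnergy_mono hpq le_rfl)
  set P := (powEnergy V x₀ p R).toReal with hP
  have hP1 : 1 ≤ P := by
    have := ENNReal.toReal_mono hPfin (one_le_powEnergy V x₀ p R)
    simpa using this
  have hmos : ∀ r r', 0 < r → r < r' → r' ≤ R →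
      ∀ᵐ x ∂(volume.restrict (Metric.ball x₀ r)), maxNorm (V x) ≤
        (C₆ / (r' - r) ^ (2 * m) * (powEnergy V x₀ q r').toReal) ^ (1 / d) := by
    intro r r' hr hrr' hr'
    have h1 := ae_rpow_le_of_gain (x₀ := x₀) hp hpq hm hσ hmp hC₄ hV hr hrr' (hr'.trans hR1)
      (fun R' ρ' β hR' => hgain R' ρ' β (hR'.trans hr'))
      (ne_top_of_le_ne_top hfin (powEnergy_mono le_rfl hr'))
    filter_upwards [h1] with x hx
    rw [← hdd, ← hC₆] at hx
    have h2 := Real.rpow_le_rpow (Real.rpow_nonneg (maxNorm_pos (V x)).le _) hx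
      (by positivity : 0 ≤ 1 / d)
    rwa [← Real.rpow_mul (maxNorm_pos _).le, mul_one_div_cancel hd.ne', Real.rpow_one] at h2
  -- The radii of the iteration increase from ρ towards R' < R, so that one application of the Moser
  -- bound between R' and R gives a finite bound B common to all of them.
  set R' := (ρ + R) / 2 with hR'
  have hglob := hmos R' R (by linarith) (by linarith) le_rfl
  set B := (C₆ / (R - R') ^ (2 * m) * (powEnergy V x₀ q R).toReal) ^ (1 / d) with hB
  have hres : ∀ r ≤ R', ∀ᵐ x ∂(volume.restrict (Metric.ball x₀ r)), maxNorm (V x) ≤ B :=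
    fun r hr => ae_restrict_of_ae_restrict_of_subset (Metric.ball_subset_ball hr) hglob
  set rad : ℕ → ℝ := fun i => R' - (R' - ρ) * (1 / 2) ^ i with hrad
  have hR'ρ : 0 < R' - ρ := by linarith
  have hhalf : ∀ i : ℕ, (0 : ℝ) < (1 / 2) ^ i := fun i => by positivity
  have hhalf1 : ∀ i : ℕ, ((1 : ℝ) / 2) ^ i ≤ 1 := fun i => pow_le_one₀ (by norm_num) (by norm_num)
  have hrad1 : ∀ i, ρ ≤ rad i := fun i => by
    have := mul_le_mul_of_nonneg_left (hhalf1 i) hR'ρ.le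
    rw [hrad]; simp only; linarith
  have hrad2 : ∀ i, rad i ≤ R' := fun i => by
    have := mul_pos hR'ρ (hhalf i)
    rw [hrad]; simp only; linarith
  have hrad3 : ∀ i, rad (i + 1) - rad i = (R - ρ) / 4 * (1 / 2) ^ i := fun i => by
    rw [hrad, hR']; simp only [pow_succ]; ring
  have hB1 : 1 ≤ max 1 B := le_max_left _ _
  set D := (C₆ * 4 ^ (2 * m) * (P / (R - ρ) ^ (2 * m))) ^ (1 / d) with hD
  have hRm : (R - ρ) ^ (2 * m) ≤ 1 := Real.rpow_le_one hRρ.le (by linarith) (by linarith)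
  have hPR : 1 ≤ P / (R - ρ) ^ (2 * m) := by
    rw [one_le_div (by positivity)]; exact hRm.trans hP1
  have hD1 : 1 ≤ D := Real.one_le_rpow (one_le_mul_of_one_le_of_one_le
    (one_le_mul_of_one_le_of_one_le hC₆1 (Real.one_le_rpow (by norm_num) (by positivity))) hPR)
    (by positivity)
  have hfinal := interpolation_iterate (M := fun i => ballSup V x₀ (rad i)) (B := max 1 B) hD1 hΛ1
    hδ0 hδ1 (fun i => one_le_ballSup _ _ _)
    (fun i => ballSup_le hB1 ((hres _ (hrad2 i)).mono fun x hx => hx.trans (le_max_right _ _)))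
    (fun i => ?_)
  · have hrad0 : rad 0 = ρ := by rw [hrad]; simp
    simp only [hrad0] at hfinal
    filter_upwards [ae_le_ballSup (hres ρ (by linarith))] with x hx
    refine hx.trans (hfinal.trans (le_of_eq ?_))
    have e1 : 1 / d * (1 / (1 - δ)) = 1 / c₀ := by rw [h1δ]; field_simp
    rw [hD, ← Real.rpow_mul (by positivity), e1, Real.mul_rpow (by positivity) (by positivity)]
    ring
  · have hM1 := one_le_ballSup V x₀ (rad (i + 1))
    set M := ballSup V x₀ (rad (i + 1)) with hM
    have hrr : rad i < rad (i + 1) := by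
      have : 0 < (R - ρ) / 4 * (1 / 2) ^ i := by positivity
      linarith [hrad3 i]
    have hbd : D * Λ ^ (i : ℝ) * M ^ δ =
        (C₆ / (rad (i + 1) - rad i) ^ (2 * m) * (M ^ (q - p) * P)) ^ (1 / d) := by
      have e1 : Λ ^ (i : ℝ) = ((2 : ℝ) ^ (2 * m * i)) ^ (1 / d) := by
        rw [hΛ, ← Real.rpow_mul (by norm_num), ← Real.rpow_mul (by norm_num)]
        congr 1; ring
      have e2 : M ^ δ = (M ^ (q - p)) ^ (1 / d) := by
        rw [← Real.rpow_mul (by linarith), hδ]; congr 1; ring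
      rw [hD, e1, e2, ← Real.mul_rpow (by positivity) (by positivity),
        ← Real.mul_rpow (by positivity) (by positivity)]
      congr 1
      have e3 : (rad (i + 1) - rad i) ^ (2 * m) = (R - ρ) ^ (2 * m) / 4 ^ (2 * m) /
          2 ^ (2 * m * i) := by
        have e4 : (R - ρ) / 4 * (1 / 2) ^ i = (R - ρ) / 4 / 2 ^ (i : ℝ) := by
          rw [Real.rpow_natCast, one_div, inv_pow]; rfl
        rw [hrad3, e4, Real.div_rpow (by positivity) (by positivity),
          Real.div_rpow (by positivity) (by positivity), ← Real.rpow_mul (by norm_num)]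
        congr 2; ring
      rw [e3]
      field_simp
    rw [hbd]
    refine ballSup_le ?_ ?_
    · rw [← hbd]
      exact one_le_mul_of_one_le_of_one_le (one_le_mul_of_one_le_of_one_le hD1
        (Real.one_le_rpow hΛ1 (Nat.cast_nonneg i))) (Real.one_le_rpow hM1 hδ0)
    · filter_upwards [hmos (rad i) (rad (i + 1)) (by linarith [hrad1 i]) hrr
        ((hrad2 _).trans (by linarith))] with x hx
      refine hx.trans (Real.rpow_le_rpow (by
        have : 0 < rad (i + 1) - rad i := by linarith
        positivity) ?_ (by positivity))
      refine mul_le_mul_of_nonneg_left ?_ (by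
        have : 0 < rad (i + 1) - rad i := by linarith
        positivity)
      have h1 := powEnergy_le_mul (p := p) hpq ((hrad2 (i + 1)).trans (by linarith) :
        rad (i + 1) ≤ R) hM1 (ae_le_ballSup (hres _ (hrad2 (i + 1))))
      have h2 := ENNReal.toReal_mono (ENNReal.mul_ne_top ENNReal.ofReal_ne_top hPfin) h1
      rwa [ENNReal.toReal_mul, ENNReal.toReal_ofReal (by positivity)] at h2

end Interpolation

/-! ### A-priori estimates for minimizers -/

section Core

variable {n : ℕ}

lemma HasWeakGradient.hasWeakPartial {Ω' : Set (E n)} (hΩ' : IsOpen Ω') {u : E n → ℝ}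
    {G : E n → E n} (h : HasWeakGradient Ω' u G) {U : E n → ℝ} {V : E n → ℝ} (i : Fin n)
    (hU : u =ᵐ[volume.restrict Ω'] U) (hV : (fun x => G x i) =ᵐ[volume.restrict Ω'] V) :
    HasWeakPartial Ω' i (Ω'.indicator U) (Ω'.indicator V) := by
  intro φ hφ hc hs
  have h1 := h.2.2 φ hφ hc hs i
  have e1 : ∫ x, Ω'.indicator U x * fderiv ℝ φ x (EuclideanSpace.single i 1) =
      ∫ x in Ω', u x * fderiv ℝ φ x (EuclideanSpace.single i 1) := by
    rw [← integral_indicator hΩ'.measurableSet]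
    refine integral_congr_ae ?_
    rw [Filter.EventuallyEq, ae_restrict_iff' hΩ'.measurableSet] at hU
    filter_upwards [hU] with x hx
    by_cases hxΩ : x ∈ Ω'
    · simp [hxΩ, hx hxΩ]
    · simp [hxΩ]
  have e2 : ∫ x, Ω'.indicator V x * φ x = ∫ x in Ω', G x i * φ x := by
    rw [← integral_indicator hΩ'.measurableSet]
    refine integral_congr_ae ?_
    rw [Filter.EventuallyEq, ae_restrict_iff' hΩ'.measurableSet] at hV
    filter_upwards [hV] with x hx
    by_cases hxΩ : x ∈ Ω'
    · simp [hxΩ, hx hxΩ]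
    · simp [hxΩ]
  rw [e1, e2, h1]

lemma memLp_of_smoothClass {q : ℝ} (hq : 2 ≤ q) {Ω' : Set (E n)} {Du : E n → E n}
    (hm : AEStronglyMeasurable Du (volume.restrict Ω'))
    (h : IntegrableOn (fun x => ‖Du x‖ ^ (2 * (1 : ℝ)) *
      (1 + ‖Du x‖ ^ (q - 2)) ^ (2 * (1 : ℝ) - 1)) Ω') :
    IntegrableOn (fun x => ‖Du x‖ ^ q) Ω' := by
  refine Integrable.mono' h (hm.norm.aemeasurable.pow_const q).aestronglyMeasurable
    (Filter.Eventually.of_forall fun x => ?_)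
  have h0 := norm_nonneg (Du x)
  rw [Real.norm_of_nonneg (by positivity)]
  have e1 : 2 * (1 : ℝ) - 1 = 1 := by norm_num
  have e2 : ‖Du x‖ ^ q = ‖Du x‖ ^ (2 * (1 : ℝ)) * ‖Du x‖ ^ (q - 2) := by
    rw [← Real.rpow_add_of_nonneg h0 (by norm_num) (by linarith)]; congr 1; ring
  rw [e1, Real.rpow_one, e2]
  gcongr
  linarith

/-- Measurable representatives of a minimizer, extended by zero. -/
lemma exists_smoothSolution (hn : 2 ≤ n) {p q : ℝ} (hp : 2 ≤ p) (hpq : p ≤ q) {Ω : Set (E n)}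
    {h : E n → E n → ℝ} (hh : IsPElliptic p Ω h) {Ω' : Set (E n)} (hΩ' : CompactlyContained Ω' Ω)
    {c C : ℝ} (hA : GrowthField p q Ω' (fun x => ∇ (anisotropicIntegrand hn q h x)) c C)
    {u : E n → ℝ} {Du : E n → E n} {D2u : E n → Fin n → E n}
    (hu : IsSmoothLocalMinimizer q Ω (anisotropicIntegrand hn q h) u Du D2u) :
    ∃ (U : E n → ℝ) (V : E n → E n) (W : E n → Fin n → E n),
      SmoothSolution q Ω' (fun x => ∇ (anisotropicIntegrand hn q h x)) U V W ∧
      u =ᵐ[volume.restrict Ω'] U ∧ Du =ᵐ[volume.restrict Ω'] V ∧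
      ∀ i, (fun x => D2u x i) =ᵐ[volume.restrict Ω'] fun x => W x i := by
  have hq : 2 ≤ q := hp.trans hpq
  obtain ⟨⟨hW1, hW2⟩, hI1, -⟩ := hu.2 Ω' hΩ'
  have hopen := hΩ'.1
  have hms := hopen.measurableSet
  have hvol : volume Ω' ≠ ⊤ :=
    ((measure_mono subset_closure).trans_lt hΩ'.2.1.measure_lt_top).ne
  have hfinm : IsFiniteMeasure (volume.restrict Ω') :=
    ⟨by rw [Measure.restrict_apply_univ]; exact hvol.lt_top⟩
  have hum := hW1.2.1.1
  have hDum := hW1.2.2.1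
  have hD2m : ∀ i, AEStronglyMeasurable (fun x => D2u x i) (volume.restrict Ω') := fun i =>
    (hW2 i).2.2.1
  set U₀ := hum.mk u with hU₀
  set V₀ := hDum.mk Du with hV₀
  set W₀ : Fin n → E n → E n := fun i => (hD2m i).mk _ with hW₀
  have eU : u =ᵐ[volume.restrict Ω'] U₀ := hum.ae_eq_mk
  have eV : Du =ᵐ[volume.restrict Ω'] V₀ := hDum.ae_eq_mk
  have eW : ∀ i, (fun x => D2u x i) =ᵐ[volume.restrict Ω'] W₀ i := fun i => (hD2m i).ae_eq_mk
  have hDq : IntegrableOn (fun x => ‖Du x‖ ^ q) Ω' := memLp_of_smoothClass hq hDum hI1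
  have hDuq : MemLp Du (ENNReal.ofReal q) (volume.restrict Ω') := by
    refine (integrable_norm_rpow_iff hDum (by simpa using by linarith) ENNReal.ofReal_ne_top).1 ?_
    rw [ENNReal.toReal_ofReal (by linarith)]
    exact hDq
  have eind : ∀ {F : Type} [Zero F] (f : E n → F), f =ᵐ[volume.restrict Ω'] Ω'.indicator f := by
    intro F _ f
    filter_upwards [ae_restrict_mem hms] with x hx
    rw [indicator_of_mem hx]
  have hU2 : MemLp (Ω'.indicator U₀) 2 :=
    (memLp_indicator_iff_restrict hms).2 (hW1.2.1.ae_eq eU)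
  have hV2 : MemLp (Ω'.indicator V₀) 2 :=
    (memLp_indicator_iff_restrict hms).2 (hW1.2.2.ae_eq eV)
  have hWL : ∀ i, MemLp (Ω'.indicator (W₀ i)) 2 := fun i =>
    (memLp_indicator_iff_restrict hms).2 ((hW2 i).2.2.ae_eq (eW i))
  have hVcoord : ∀ i, (fun x => Ω'.indicator V₀ x i) = Ω'.indicator (fun x => V₀ x i) := by
    intro i; funext x
    by_cases hx : x ∈ Ω' <;> simp [hx]
  have hWcoord : ∀ i j, (fun x => Ω'.indicator (W₀ i) x j) = Ω'.indicator (fun x => W₀ i x j) := by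
    intro i j; funext x
    by_cases hx : x ∈ Ω' <;> simp [hx]
  refine ⟨Ω'.indicator U₀, Ω'.indicator V₀, fun x i => Ω'.indicator (W₀ i) x, ?_,
    eU.trans (eind _), eV.trans (eind _), fun i => (eW i).trans (eind _)⟩
  refine ⟨hopen, hvol, hum.stronglyMeasurable_mk.measurable.indicator hms,
    (integrable_indicator_iff hms).2 ((hW1.2.1.ae_eq eU).integrable (by norm_num)),
    hDum.stronglyMeasurable_mk.measurable.indicator hms,
    (integrable_indicator_iff hms).2 ((hW1.2.2.ae_eq eV).integrable (by norm_num)), hV2,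
    (memLp_indicator_iff_restrict hms).2 (hDuq.ae_eq eV),
    fun i => (hD2m i).stronglyMeasurable_mk.measurable.indicator hms,
    fun i => (integrable_indicator_iff hms).2 (((hW2 i).2.2.ae_eq (eW i)).integrable (by norm_num)),
    hWL, fun i => ?_, fun i j => ?_, fun ψ hψ hc hs => ?_⟩
  · rw [hVcoord]
    exact hW1.1.hasWeakPartial hopen i eU (eV.mono fun x hx => by simp only [hx])
  · rw [hVcoord, hWcoord]
    exact (hW2 i).1.hasWeakPartial hopen j (eV.mono fun x hx => by simp only [hx])
      ((eW i).mono fun x hx => by simp only [← hx])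
  · have hfd : ∀ x ∈ Ω', Differentiable ℝ (anisotropicIntegrand hn q h x) := fun x hx ξ =>
      (hasGradientAt_anisotropicIntegrand hn hq
        (hh.differentiable x (hΩ'.2.2 (subset_closure hx))) ξ).differentiableAt
    have hfcΩ : ContinuousOn (fun z : E n × E n => anisotropicIntegrand hn q h z.1 z.2)
        (Ω ×ˢ univ) := by
      refine hh.continuousOn.add (Continuous.continuousOn ?_)
      exact (Real.continuous_rpow_const (by linarith)).comp (continuous_abs.comp (by fun_prop))
    have hf0 : ∃ M₀, ∀ x ∈ closure Ω', |anisotropicIntegrand hn q h x 0| ≤ M₀ := by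
      have hc0 : ContinuousOn (fun x => anisotropicIntegrand hn q h x 0) (closure Ω') :=
        hfcΩ.comp (f := fun x : E n => (x, (0 : E n))) (by fun_prop)
          (fun x hx => ⟨hΩ'.2.2 hx, mem_univ _⟩)
      exact hΩ'.2.1.exists_bound_of_continuousOn hc0
    obtain ⟨M₀, hM₀⟩ := hf0
    have hE := hu.1.euler_lagrange hΩ' hA hq hfd (fun x hx => hM₀ x (subset_closure hx))
      (hfcΩ.mono (prod_mono (subset_closure.trans hΩ'.2.2) subset_rfl)) hDum hDq hψ hc hs
    rw [← hE]
    refine integral_congr_ae ?_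
    filter_upwards [eV.trans (eind _)] with x hx
    rw [hx]

/-- The bound on q/p amounts to (n/2)(q-p) < p, a strict inequality that survives a small increase
of n/2. The condition m > n/2 is the one needed for the Sobolev exponent, and it makes σ = m/(m-1)
finite for n = 2 as well. This is the only place where the bound on q/p is used. -/
lemma exists_moser_exponent (hn : 2 ≤ n) {p q : ℝ} (hp : 2 ≤ p) (hpq : p ≤ q)
    (hratio : q / p < 1 + 2 / (n : ℝ)) :
    ∃ m : ℝ, (n : ℝ) / 2 < m ∧ m * (q - p) < p := by
  have hn0 : (0 : ℝ) < n := by exact_mod_cast (by omega : 0 < n)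
  have hp0 : 0 < p := by linarith
  have h1 : (n : ℝ) / 2 * (q - p) < p := by
    rw [div_lt_iff₀ hp0] at hratio
    have h2 : n / 2 * ((1 + 2 / (n : ℝ)) * p - p) = p := by field_simp; ring
    have := mul_lt_mul_of_pos_left (sub_lt_sub_right hratio p) (by positivity : (0 : ℝ) < n / 2)
    linarith
  set ε := (p - (n : ℝ) / 2 * (q - p)) / (2 * (q - p + 1)) with hε
  have hd : 0 < q - p + 1 := by linarith
  have hε0 : 0 < ε := div_pos (by linarith) (by linarith)
  refine ⟨n / 2 + ε, by linarith, ?_⟩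
  have h3 : ε * (2 * (q - p + 1)) = p - (n : ℝ) / 2 * (q - p) := by
    rw [hε]; field_simp
  nlinarith

/-- The a-priori estimates for representatives of the derivatives of a minimizer. -/
lemma exists_apriori_estimates (hn : 2 ≤ n) {p q : ℝ} (hp : 2 ≤ p) (hpq : p ≤ q)
    {m : ℝ} (hm : (n : ℝ) / 2 < m) (hmp : m * (q - p) < p) {Ω : Set (E n)}
    {h : E n → E n → ℝ} (hh : IsPElliptic p Ω h) {Ω' : Set (E n)} (hΩ' : CompactlyContained Ω' Ω) :
    ∃ C₃ C₇ : ℝ, 0 < C₃ ∧ 1 ≤ C₇ ∧ ∀ (u : E n → ℝ) (Du : E n → E n) (D2u : E n → Fin n → E n),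
      IsSmoothLocalMinimizer q Ω (anisotropicIntegrand hn q h) u Du D2u →
      ∃ (U : E n → ℝ) (V : E n → E n) (W : E n → Fin n → E n),
        SmoothSolution q Ω' (fun x => ∇ (anisotropicIntegrand hn q h x)) U V W ∧
        u =ᵐ[volume.restrict Ω'] U ∧ Du =ᵐ[volume.restrict Ω'] V ∧
        (∀ i, (fun x => D2u x i) =ᵐ[volume.restrict Ω'] fun x => W x i) ∧
        (∀ (x₀ : E n) (R : ℝ), powEnergy V x₀ q R ≠ ⊤) ∧
        ∀ (x₀ : E n) (ρ R : ℝ), 0 < ρ → ρ < R → R ≤ 1 → Metric.ball x₀ R ⊆ Ω' →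
          (∀ᵐ x ∂(volume.restrict (Metric.ball x₀ ρ)), maxNorm (V x) ≤
            C₇ * ((powEnergy V x₀ p R).toReal / (R - ρ) ^ (2 * m)) ^ (1 / (p - m * (q - p)))) ∧
          ∀ s, ∫⁻ x in Metric.ball x₀ ρ, ENNReal.ofReal (‖V x‖ ^ (p - 2) * ∑ i, W x i s ^ 2) ≤
            ENNReal.ofReal (C₃ / (R - ρ) ^ 2) * powEnergy V x₀ q R := by
  have hn2 : (2 : ℝ) ≤ n := by exact_mod_cast hn
  have hm1 : 1 < m := by linarith
  obtain ⟨c, C, hA⟩ := exists_growthField_anisotropic hn hp hpq hh hΩ'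
  obtain ⟨K, hK0, hK⟩ := exists_cutoff n
  set σ := m / (m - 1) with hσ
  have hσ1 : 1 < σ := by rw [hσ, one_lt_div (by linarith)]; linarith
  obtain ⟨CS, hCST, hCS⟩ := exists_sobolev hn hσ1 (by
    have h1 : 1 / (2 * σ) = 1 / 2 - 1 / (2 * m) := by
      have : m - 1 ≠ 0 := by linarith
      rw [hσ]; field_simp
    have h2 : 1 / (2 * m) < 1 / (n : ℝ) := one_div_lt_one_div_of_lt (by linarith) (by linarith)
    rw [h1]; linarith)
  have hc := hA.c_pos
  have hC := hA.C_pos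
  set C₃ := 6 / c * ((n : ℝ) ^ q * (8 * C + C ^ 2 / c)) * (1 + 2 * K) ^ 2 with hC₃
  have hC₃0 : 0 < C₃ := by positivity
  obtain ⟨C₄, hC₄, hgain⟩ := SmoothSolution.exists_gain hp hpq hK0 hC₃0 hK hσ1 hCST hCS
  obtain ⟨C₇, hC₇, hsup⟩ := exists_sup_bound (n := n) hp hpq hm1 hσ hmp hC₄
  refine ⟨C₃, C₇, hC₃0, hC₇, fun u Du D2u hu => ?_⟩
  obtain ⟨U, V, W, hS, eU, eV, eW⟩ := exists_smoothSolution hn hp hpq hh hΩ' hA hu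
  have hcac := fun (x₀ : E n) (R ρ β k : ℝ) (s : Fin n) (hR : Metric.ball x₀ R ⊆ Ω') (hρ : 0 < ρ)
    (hρR : ρ < R) (hR1 : R ≤ 1) (hβ : 0 ≤ β) (hk : 0 ≤ k) =>
    hS.caccioppoli hA (by omega) hp hpq hK0 hK (s := s) hR hρ hρR hR1 hβ hk
  have hg := hgain _ _ U V W hS hcac
  have hfin : ∀ (x₀ : E n) (R : ℝ), powEnergy V x₀ q R ≠ ⊤ := by
    intro x₀ R
    refine ENNReal.add_ne_top.2 ⟨by simp, ?_⟩
    have h1 : ∫⁻ x in Metric.ball x₀ R, (1 + ‖V x‖ₑ ^ q) ≠ ⊤ := by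
      rw [lintegral_add_left measurable_const]
      refine ENNReal.add_ne_top.2 ⟨by simpa using measure_ball_lt_top.ne, ?_⟩
      exact ((setLIntegral_le_lintegral _ _).trans_lt
        (lintegral_rpow_lt_top_of_memLp (by linarith) hS.V_mem)).ne
    refine ne_top_of_le_ne_top h1 (lintegral_mono fun x => ?_)
    rw [← ofReal_norm, ENNReal.ofReal_rpow_of_nonneg (norm_nonneg _) (by linarith),
      ← ENNReal.ofReal_one, ← ENNReal.ofReal_add zero_le_one (by positivity)]
    refine ENNReal.ofReal_le_ofReal ?_
    refine (Real.rpow_le_rpow (maxNorm_pos _).le (maxNorm_le_max_one_norm _) (by linarith)).trans ?_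
    rcases max_choice 1 ‖V x‖ with h2 | h2
    · rw [h2, Real.one_rpow]
      have : 0 ≤ ‖V x‖ ^ q := by positivity
      linarith
    · rw [h2]; linarith
  refine ⟨U, V, W, hS, eU, eV, eW, hfin, fun x₀ ρ R hρ hρR hR1 hR => ⟨?_, fun s => ?_⟩⟩
  · exact hsup V x₀ ρ R hS.V_meas hρ hρR hR1 (fun R' ρ' β hR' hρ' hρR' hβ =>
      hg x₀ R' ρ' β ((Metric.ball_subset_ball hR').trans hR) hρ' hρR' (hR'.trans hR1) hβ)
      (hfin x₀ R)
  · have h1 := hcac x₀ R ρ 0 1 s hR hρ hρR hR1 le_rfl zero_le_one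
    simp only [mul_zero, add_zero, truncPow, Real.rpow_zero, one_mul] at h1
    exact h1.trans (mul_le_mul_right le_add_self _)

end Core

/-! ### Locally Lipschitz representatives -/

section Representative

variable {n : ℕ}

lemma ae_bumpMeasure_sub {P : E n → Prop} {x₀ x : E n} {r ρ : ℝ} {k : ℕ}
    (h : ∀ᵐ z ∂(volume.restrict (Metric.ball x₀ r)), P z) (hx : x ∈ Metric.ball x₀ ρ)
    (hk : ρ + 1 / ((k : ℝ) + 1) ≤ r) : ∀ᵐ y ∂(bumpMeasure n k), P (x - y) := by
  rw [ae_restrict_iff' measurableSet_ball] at h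
  have h1 : ∀ᵐ y : E n, x - y ∈ Metric.ball x₀ r → P (x - y) :=
    (Measure.measurePreserving_sub_left volume x).quasiMeasurePreserving.ae h
  have h2 : ∀ᵐ y ∂(bumpMeasure n k), x - y ∈ Metric.ball x₀ r → P (x - y) :=
    (withDensity_absolutelyContinuous _ _).ae_le h1
  filter_upwards [h2, ae_bumpMeasure_norm_le k] with y hy hyn
  refine hy ?_
  rw [Metric.mem_ball, dist_eq_norm] at hx ⊢
  have e1 : x - y - x₀ = (x - x₀) - y := by abel
  have := norm_sub_le (x - x₀) y
  rw [e1]; linarith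

lemma moll_congr {f g : E n → ℝ} {x₀ x : E n} {r ρ : ℝ} {k : ℕ}
    (h : f =ᵐ[volume.restrict (Metric.ball x₀ r)] g) (hx : x ∈ Metric.ball x₀ ρ)
    (hk : ρ + 1 / ((k : ℝ) + 1) ≤ r) : moll k f x = moll k g x :=
  integral_congr_ae (ae_bumpMeasure_sub (P := fun z => f z = g z) h hx hk)

lemma abs_moll_le {f : E n → ℝ} {x₀ x : E n} {r ρ M : ℝ} {k : ℕ}
    (h : ∀ᵐ z ∂(volume.restrict (Metric.ball x₀ r)), |f z| ≤ M) (hx : x ∈ Metric.ball x₀ ρ)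
    (hk : ρ + 1 / ((k : ℝ) + 1) ≤ r) : |moll k f x| ≤ M := by
  have h1 := norm_integral_le_of_norm_le_const (f := fun y => f (x - y))
    (ae_bumpMeasure_sub (P := fun z => ‖f z‖ ≤ M) h hx hk)
  simpa [moll, avg] using h1

lemma tendsto_moll_of_continuous {g : E n → ℝ} (hg : Continuous g) (x : E n) :
    Filter.Tendsto (fun k => moll k g x) Filter.atTop (nhds (g x)) := by
  have h1 : Filter.Tendsto (fun k : ℕ => (bump n k).rOut) Filter.atTop (nhds 0) :=
    tendsto_one_div_add_atTop_nhds_zero_nat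
  have := ContDiffBump.convolution_tendsto_right_of_continuous (μ := volume) h1 hg x
  simpa only [moll_eq_convolution] using this

lemma eventually_one_div_lt {ε : ℝ} (hε : 0 < ε) :
    ∀ᶠ k : ℕ in Filter.atTop, 1 / ((k : ℝ) + 1) < ε :=
  tendsto_one_div_add_atTop_nhds_zero_nat.eventually_lt_const hε

/-- For small mollifier radius the mollified partial derivatives are bounded by M on the half ball,
so the mollifications of U are Lipschitz there with constant nM. The bound passes to U on its points
of convergence, a set of full measure in the half ball, and the restriction extends to a Lipschitz
function on the whole space. -/
lemma exists_lipschitz_of_bounded_partials {Ω' : Set (E n)} {U : E n → ℝ} {V : E n → E n}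
    (hU : Integrable U) (hw : ∀ i, HasWeakPartial Ω' i U (fun x => V x i)) {x₀ : E n} {r M : ℝ}
    (hr : 0 < r) (hrΩ : Metric.ball x₀ r ⊆ Ω') (hM0 : 0 ≤ M)
    (hM : ∀ᵐ x ∂(volume.restrict (Metric.ball x₀ r)), ∀ i, |V x i| ≤ M) :
    ∃ (K : NNReal) (g : E n → ℝ), LipschitzWith K g ∧
      U =ᵐ[volume.restrict (Metric.ball x₀ (r / 2))] g := by
  set K : NNReal := Real.toNNReal (n * M) with hK
  have hlip : ∀ᶠ k : ℕ in Filter.atTop, LipschitzOnWith K (moll k U) (Metric.ball x₀ (r / 2)) := by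
    filter_upwards [eventually_one_div_lt (half_pos hr)] with k hk
    refine Convex.lipschitzOnWith_of_nnnorm_fderiv_le (𝕜 := ℝ) (fun x _ =>
      (contDiff_moll k hU.locallyIntegrable (m := 1)).differentiable (by simp) x) (fun x hx => ?_)
      (convex_ball _ _)
    have hc : ∀ i, |fderiv ℝ (moll k U) x (EuclideanSpace.single i 1)| ≤ M := by
      intro i
      rw [(hw i).fderiv_moll hU.locallyIntegrable]
      · exact abs_moll_le (hM.mono fun z hz => hz i) hx (by linarith)
      · intro z hz
        apply hrΩ
        rw [Metric.mem_closedBall, dist_eq_norm] at hz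
        rw [Metric.mem_ball, dist_eq_norm] at hx ⊢
        have e1 : z - x₀ = (z - x) + (x - x₀) := by abel
        have := norm_add_le (z - x) (x - x₀)
        rw [e1]; linarith
    rw [← NNReal.coe_le_coe, coe_nnnorm, hK, Real.coe_toNNReal _ (by positivity)]
    refine ContinuousLinearMap.opNorm_le_bound _ (by positivity) fun w => ?_
    rw [fderiv_eq_sum, Real.norm_eq_abs]
    calc |∑ j, fderiv ℝ (moll k U) x (EuclideanSpace.single j 1) * w j|
        ≤ ∑ j, |fderiv ℝ (moll k U) x (EuclideanSpace.single j 1) * w j| :=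
          Finset.abs_sum_le_sum_abs _ _
      _ ≤ ∑ _j : Fin n, M * ‖w‖ := by
          refine Finset.sum_le_sum fun j _ => ?_
          rw [abs_mul]
          exact mul_le_mul (hc j) (abs_apply_le_norm w j) (abs_nonneg _) hM0
      _ = _ := by simp [mul_assoc]
  set S : Set (E n) := {x | x ∈ Metric.ball x₀ (r / 2) ∧
    Filter.Tendsto (fun k => moll k U x) Filter.atTop (nhds (U x))} with hS
  have hUS : LipschitzOnWith K U S := by
    refine LipschitzOnWith.of_dist_le_mul fun x hx y hy => ?_
    refine le_of_tendsto (hx.2.dist hy.2) ?_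
    filter_upwards [hlip] with k hk
    exact hk.dist_le_mul x hx.1 y hy.1
  obtain ⟨g, hg, hgS⟩ := hUS.extend_real
  refine ⟨K, g, hg, ?_⟩
  rw [Filter.EventuallyEq, ae_restrict_iff' measurableSet_ball]
  filter_upwards [ae_tendsto_moll hU.locallyIntegrable] with x hx hxb
  exact hgS ⟨hxb, hx⟩

/-- Patching local Lipschitz representatives. -/
lemma exists_locallyLipschitz_representative {Ω : Set (E n)} (hΩ : IsOpen Ω) {u : E n → ℝ}
    (h : ∀ x ∈ Ω, ∃ r > 0, ∃ (K : NNReal) (g : E n → ℝ), LipschitzWith K g ∧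
      u =ᵐ[volume.restrict (Metric.ball x r)] g) :
    ∃ v : E n → ℝ, LocallyLipschitzOn Ω v ∧ u =ᵐ[volume.restrict Ω] v := by
  -- The limit of the mollifications depends only on the almost-everywhere class of u, so it
  -- coincides with every local Lipschitz representative and no gluing argument is needed. Its
  -- values outside Ω play no role.
  set v : E n → ℝ := fun x => Filter.atTop.limUnder (fun k => moll k u x) with hv
  have hvg : ∀ (x₀ : E n) (r : ℝ) (g : E n → ℝ), Continuous g →
      u =ᵐ[volume.restrict (Metric.ball x₀ r)] g → ∀ x ∈ Metric.ball x₀ r, v x = g x := by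
    intro x₀ r g hg hug x hx
    refine Filter.Tendsto.limUnder_eq ((tendsto_moll_of_continuous hg x).congr' ?_)
    rw [Metric.mem_ball] at hx
    filter_upwards [eventually_one_div_lt (by linarith : 0 < (r - dist x x₀) / 2)] with k hk
    exact (moll_congr hug (ρ := (r + dist x x₀) / 2)
      (by rw [Metric.mem_ball]; linarith) (by linarith)).symm
  refine ⟨v, ?_, ?_⟩
  · intro x hx
    obtain ⟨r, hr, K, g, hg, hug⟩ := h x hx
    refine ⟨K, Metric.ball x r, mem_nhdsWithin_of_mem_nhds (Metric.ball_mem_nhds x hr), ?_⟩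
    intro y hy z hz
    rw [hvg x r g hg.continuous hug y hy, hvg x r g hg.continuous hug z hz]
    exact hg y z
  · have hnull : volume {x | x ∈ Ω ∧ u x ≠ v x} = 0 := by
      refine measure_null_of_locally_null _ fun x hx => ?_
      obtain ⟨r, hr, K, g, hg, hug⟩ := h x hx.1
      refine ⟨Metric.ball x r ∩ {x | x ∈ Ω ∧ u x ≠ v x},
        Filter.inter_mem (mem_nhdsWithin_of_mem_nhds (Metric.ball_mem_nhds x hr))
          self_mem_nhdsWithin, ?_⟩
      rw [Filter.EventuallyEq, ae_restrict_iff' measurableSet_ball, ae_iff] at hug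
      refine measure_mono_null (fun y hy => ?_) hug
      simp only [mem_ofPred_eq, Classical.not_imp]
      refine ⟨hy.1, fun h0 => hy.2.2 ?_⟩
      rw [h0, hvg x r g hg.continuous (by
        rw [Filter.EventuallyEq, ae_restrict_iff' measurableSet_ball, ae_iff]; exact hug) y hy.1]
    have h1 : ∀ᵐ x, ¬ (x ∈ Ω ∧ u x ≠ v x) := by
      rw [ae_iff]; simpa using hnull
    have h2 : ∀ᵐ x, x ∈ Ω → u x = v x := by
      filter_upwards [h1] with x hx hxΩ
      by_contra h3
      exact hx ⟨hxΩ, h3⟩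
    exact (ae_restrict_iff' hΩ.measurableSet).2 h2

/-- Local Lipschitz continuity of minimizers. -/
lemma locallyLipschitzMinimizers_anisotropic (hn : 2 ≤ n) {p q : ℝ} (hp : 2 ≤ p) (hpq : p ≤ q)
    (hratio : q / p < 1 + 2 / (n : ℝ)) {Ω : Set (E n)} (hΩ : IsOpen Ω) {h : E n → E n → ℝ}
    (hh : IsPElliptic p Ω h) :
    LocallyLipschitzMinimizers q Ω (anisotropicIntegrand hn q h) := by
  intro u Du D2u hu
  obtain ⟨m, hm, hmp⟩ := exists_moser_exponent hn hp hpq hratio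
  refine exists_locallyLipschitz_representative hΩ fun x hx => ?_
  obtain ⟨r₀, hr₀, hr₀Ω⟩ := Metric.isOpen_iff.1 hΩ x hx
  set r := min (r₀ / 2) 1 with hr
  have hr0 : 0 < r := lt_min (by linarith) one_pos
  have hsub : Metric.closedBall x r ⊆ Ω :=
    (Metric.closedBall_subset_ball (by linarith [min_le_left (r₀ / 2) 1])).trans hr₀Ω
  have hΩ' : CompactlyContained (Metric.ball x r) Ω :=
    ⟨Metric.isOpen_ball, (isCompact_closedBall x r).of_isClosed_subset isClosed_closure
      Metric.closure_ball_subset_closedBall, Metric.closure_ball_subset_closedBall.trans hsub⟩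
  obtain ⟨C₃, C₇, -, hC₇, hest⟩ := exists_apriori_estimates hn hp hpq hm hmp hh hΩ'
  obtain ⟨U, V, W, hS, eU, -, -, -, hB⟩ := hest u Du D2u hu
  have hsup := (hB x (r / 2) r (by linarith) (by linarith) (min_le_right _ _) subset_rfl).1
  set M := C₇ * ((powEnergy V x p r).toReal / (r - r / 2) ^ (2 * m)) ^ (1 / (p - m * (q - p)))
    with hM
  have hM0 : 0 ≤ M := by
    have : 0 < r - r / 2 := by linarith
    have := ENNReal.toReal_nonneg (a := powEnergy V x p r)
    positivity
  obtain ⟨K, g, hg, hUg⟩ := exists_lipschitz_of_bounded_partials hS.U_int hS.U_weak (half_pos hr0)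
    (Metric.ball_subset_ball (by linarith)) hM0
    (hsup.mono fun z hz i => (abs_apply_le_maxNorm _ i).trans hz)
  refine ⟨r / 2 / 2, by positivity, K, g, hg, ?_⟩
  have eU' : u =ᵐ[volume.restrict (Metric.ball x (r / 2 / 2))] U :=
    ae_restrict_of_ae_restrict_of_subset (Metric.ball_subset_ball (by linarith)) eU
  exact eU'.trans hUg

end Representative

/-! ### Estimates in terms of the energy -/

section Uniform

variable {n : ℕ}

/-- The lower bound F ≥ c₁τ^n allows the constant 1 to be absorbed into F at the price of τ^{-n}.
One more factor F/(c₁τ^n) ≥ 1 raises the exponent from b to b+1, so that it exceeds 1 whatever b > 0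
is. -/
lemma rpow_energy_le {P F τ c₁ κ b : ℝ} {n : ℕ} (hτ : 0 < τ) (hτ1 : τ ≤ 1) (hc₁ : 0 < c₁)
    (hκ : 0 < κ) (hb : 0 < b) (hP : 0 ≤ P) (hPF : P ≤ 1 + κ⁻¹ * F) (hF : c₁ * τ ^ n ≤ F) :
    P ^ b ≤ (c₁⁻¹ + κ⁻¹) ^ b * c₁⁻¹ / τ ^ (n * (b + 1)) * F ^ (b + 1) := by
  have hτn : 0 < τ ^ n := by positivity
  have hF0 : 0 < F := lt_of_lt_of_le (by positivity) hF
  have hinv : 1 ≤ (τ ^ n)⁻¹ := (one_le_inv₀ hτn).2 (pow_le_one₀ hτ.le hτ1)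
  have h1 : 1 ≤ c₁⁻¹ * (τ ^ n)⁻¹ * F := by
    calc (1 : ℝ) = c₁⁻¹ * (τ ^ n)⁻¹ * (c₁ * τ ^ n) := by field_simp
      _ ≤ _ := by gcongr
  have h2 : P ≤ (c₁⁻¹ + κ⁻¹) * (τ ^ n)⁻¹ * F := by
    have h3 : κ⁻¹ * F * 1 ≤ κ⁻¹ * F * (τ ^ n)⁻¹ := by gcongr
    calc P ≤ c₁⁻¹ * (τ ^ n)⁻¹ * F + κ⁻¹ * F * (τ ^ n)⁻¹ := by linarith
      _ = _ := by ring
  have e0 : (τ ^ n) ^ b * τ ^ n = τ ^ (n * (b + 1)) := by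
    rw [← Real.rpow_natCast, ← Real.rpow_mul hτ.le, ← Real.rpow_add hτ]; congr 1; ring
  calc P ^ b ≤ ((c₁⁻¹ + κ⁻¹) * (τ ^ n)⁻¹ * F) ^ b := Real.rpow_le_rpow hP h2 hb.le
    _ = (c₁⁻¹ + κ⁻¹) ^ b * ((τ ^ n) ^ b)⁻¹ * F ^ b * 1 := by
        rw [Real.mul_rpow (by positivity) hF0.le, Real.mul_rpow (by positivity) (by positivity),
          Real.inv_rpow hτn.le, mul_one]
    _ ≤ (c₁⁻¹ + κ⁻¹) ^ b * ((τ ^ n) ^ b)⁻¹ * F ^ b * (c₁⁻¹ * (τ ^ n)⁻¹ * F) := by gcongr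
    _ = _ := by
        rw [← e0, Real.rpow_add hF0, Real.rpow_one]
        field_simp

/-- The uniform a-priori estimates. -/
lemma uniformEstimates_anisotropic (hn : 2 ≤ n) {p q : ℝ} (hp : 2 ≤ p) (hpq : p ≤ q)
    (hratio : q / p < 1 + 2 / (n : ℝ)) {Ω : Set (E n)} {h : E n → E n → ℝ}
    (hh : IsPElliptic p Ω h) {Ω' : Set (E n)} (hΩ' : CompactlyContained Ω' Ω) {ε : ℝ} (hε : 0 < ε)
    (hpos : ∀ x ∈ Ω', ∀ ξ, ε ≤ 1 + anisotropicIntegrand hn q h x ξ) :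
    UniformEstimates p q Ω Ω' (anisotropicIntegrand hn q h) := by
  have hn0 : (0 : ℝ) < n := by exact_mod_cast (by omega : 0 < n)
  obtain ⟨m, hm, hmp⟩ := exists_moser_exponent hn hp hpq hratio
  have hm0 : 0 < m := by linarith [half_pos hn0]
  obtain ⟨κ, hκ, hcoer⟩ := exists_coercive_anisotropic hn hp hh hΩ' hε hpos
  obtain ⟨C₃, C₇, hC₃, hC₇, hest⟩ := exists_apriori_estimates hn hp hpq hm hmp hh hΩ'
  have hc₀ : 0 < p - m * (q - p) := by linarith
  set c₀ := p - m * (q - p) with hcc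
  have hqp : 0 ≤ q - p := by linarith
  have hne : Nonempty (Fin n) := ⟨⟨0, by omega⟩⟩
  set v₁ : ℝ := (volume (Metric.ball (0 : E n) 1)).toReal with hv₁
  have hv₁0 : 0 < v₁ := ENNReal.toReal_pos (Metric.measure_ball_pos volume _ one_pos).ne'
    measure_ball_lt_top.ne
  set c₁ := ε * v₁ with hc₁
  have hc₁0 : 0 < c₁ := by positivity
  -- b₁ is the exponent of the p-energy P in the squared supremum bound. b₂ is its exponent in
  -- M^{q-p}P, which is what remains of the q-energy after interpolation with the supremum M.
  set b₁ := 2 / c₀ with hb₁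
  set b₂ := (q - p) / c₀ + 1 with hb₂
  have hb₁0 : 0 < b₁ := by positivity
  have hb₂0 : 0 < b₂ := by positivity
  set D₁ := (n * C₇) ^ 2 * ((c₁⁻¹ + κ⁻¹) ^ b₁ * c₁⁻¹) with hD₁
  set D₂ := n * (4 * C₃) * (C₇ ^ (q - p) * (2 ^ (2 * m)) ^ ((q - p) / c₀)) *
    ((c₁⁻¹ + κ⁻¹) ^ b₂ * c₁⁻¹) with hD₂
  have hD₁0 : 0 < D₁ := by positivity
  have hD₂0 : 0 < D₂ := by positivity
  refine ⟨b₁ + 1, 2 * m * b₁ + n * (b₁ + 1), b₂ + 1,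
    2 + 2 * m * ((q - p) / c₀) + n * (b₂ + 1), 1, D₁ + D₂, by linarith, by positivity, by linarith,
    by positivity, one_pos, by positivity, ?_⟩
  intro u Du D2u hu x₀ ρ R hρ hρR hR1 hRΩ
  obtain ⟨U, V, W, hS, eU, eV, eW, hfin, hB⟩ := hest u Du D2u hu
  set τ := R - ρ with hτ
  have hτ0 : 0 < τ := by linarith
  have hτ1 : τ ≤ 1 := by linarith
  set F := ∫ x in Metric.ball x₀ R, (1 + anisotropicIntegrand hn q h x (Du x)) with hF
  have hfint : IntegrableOn (fun x => 1 + anisotropicIntegrand hn q h x (Du x))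
      (Metric.ball x₀ R) := by
    have h1 := ((hu.1.2 Ω' hΩ').1).mono_set hRΩ
    exact (integrableOn_const measure_ball_lt_top.ne).add h1
  have hFlow : c₁ * τ ^ n ≤ F := by
    have h1 : ∫ _x in Metric.ball x₀ R, ε ≤ F := by
      refine setIntegral_mono_on (integrableOn_const measure_ball_lt_top.ne) hfint measurableSet_ball
        fun x hx => hpos x (hRΩ hx) _
    rw [setIntegral_const, Measure.real, Measure.addHaar_ball volume x₀ (by linarith),
      ENNReal.toReal_mul, ENNReal.toReal_ofReal (pow_nonneg (by linarith) _), finrank_euclideanSpace,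
      Fintype.card_fin, smul_eq_mul] at h1
    refine le_trans ?_ h1
    have h2 : τ ^ n ≤ R ^ n := pow_le_pow_left₀ hτ0.le (by linarith) n
    calc c₁ * τ ^ n ≤ c₁ * R ^ n := by gcongr
      _ = _ := by rw [hc₁, hv₁]; ring
  have hF0 : 0 < F := lt_of_lt_of_le (by positivity) hFlow
  have hres : ∀ r ≤ R, Metric.ball x₀ r ⊆ Ω' := fun r hr =>
    (Metric.ball_subset_ball hr).trans hRΩ
  have hPfin : powEnergy V x₀ p R ≠ ⊤ :=
    ne_top_of_le_ne_top (hfin x₀ R) (powEnergy_mono hpq le_rfl)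
  set P := (powEnergy V x₀ p R).toReal with hP
  have hP1 : 1 ≤ P := by
    have := ENNReal.toReal_mono hPfin (one_le_powEnergy V x₀ p R)
    simpa using this
  have hPF : P ≤ 1 + κ⁻¹ * F := by
    refine ENNReal.toReal_le_of_le_ofReal (by positivity) ?_
    rw [ENNReal.ofReal_add zero_le_one (by positivity), ENNReal.ofReal_one]
    unfold powEnergy
    gcongr 1 + ?_
    have h1 : ENNReal.ofReal (κ⁻¹ * F) = ∫⁻ x in Metric.ball x₀ R,
        ENNReal.ofReal (κ⁻¹ * (1 + anisotropicIntegrand hn q h x (Du x))) := by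
      rw [hF, ← integral_const_mul]
      refine ofReal_integral_eq_lintegral_ofReal (hfint.const_mul _) ?_
      filter_upwards [ae_restrict_mem measurableSet_ball] with x hx
      have := hpos x (hRΩ hx) (Du x)
      exact mul_nonneg (by positivity) (by linarith)
    rw [h1]
    refine lintegral_mono_ae ?_
    filter_upwards [ae_restrict_of_ae_restrict_of_subset hRΩ eV,
      ae_restrict_mem measurableSet_ball] with x hx hxR
    refine ENNReal.ofReal_le_ofReal ?_
    rw [← hx]
    have h2 := hcoer x (hRΩ hxR) (Du x)
    rw [← div_eq_inv_mul, le_div_iff₀ hκ]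
    refine le_trans ?_ h2
    rw [mul_comm]
    refine mul_le_mul_of_nonneg_left ?_ hκ.le
    refine (Real.rpow_le_rpow (maxNorm_pos _).le (maxNorm_le_max_one_norm _) (by linarith)).trans ?_
    rcases max_choice 1 ‖Du x‖ with h3 | h3
    · rw [h3, Real.one_rpow]
      have : 0 ≤ ‖Du x‖ ^ p := by positivity
      linarith
    · rw [h3]; linarith
  refine ⟨?_, ?_⟩
  · obtain ⟨hsup, -⟩ := hB x₀ ρ R hρ hρR hR1 hRΩ
    rw [← hP, ← hτ] at hsup
    set M := C₇ * (P / τ ^ (2 * m)) ^ (1 / c₀) with hM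
    have hM0 : 0 ≤ M := by positivity
    have hDu : ∀ᵐ x ∂(volume.restrict (Metric.ball x₀ ρ)), ‖Du x‖ ≤ n * M := by
      filter_upwards [hsup, ae_restrict_of_ae_restrict_of_subset (hres ρ hρR.le) eV] with x h1 h2
      rw [h2]
      exact (norm_le_mul_maxNorm _).trans (by gcongr)
    have h1 : eLpNorm Du ∞ (volume.restrict (Metric.ball x₀ ρ)) ≤ ENNReal.ofReal (n * M) := by
      rw [eLpNorm_exponent_top]
      exact eLpNormEssSup_le_of_ae_bound hDu
    refine (pow_le_pow_left' h1 2).trans ?_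
    rw [← ENNReal.ofReal_pow (by positivity)]
    refine ENNReal.ofReal_le_ofReal ?_
    have e1 : (n * M) ^ 2 = (n * C₇) ^ 2 / τ ^ (2 * m * b₁) * P ^ b₁ := by
      have e2 : ((P / τ ^ (2 * m)) ^ (1 / c₀)) ^ 2 = P ^ b₁ / τ ^ (2 * m * b₁) := by
        rw [← Real.rpow_natCast, ← Real.rpow_mul (by positivity),
          Real.div_rpow (by positivity) (by positivity), ← Real.rpow_mul hτ0.le]
        have e3 : 1 / c₀ * ((2 : ℕ) : ℝ) = b₁ := by rw [hb₁]; push_cast; ring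
        rw [e3]
      rw [hM, mul_pow, mul_pow, e2, mul_pow]
      ring
    have h2 := rpow_energy_le hτ0 hτ1 hc₁0 hκ hb₁0 (by linarith) hPF hFlow
    calc (n * M) ^ 2 ≤ (n * C₇) ^ 2 / τ ^ (2 * m * b₁) *
          ((c₁⁻¹ + κ⁻¹) ^ b₁ * c₁⁻¹ / τ ^ (n * (b₁ + 1)) * F ^ (b₁ + 1)) := by
          rw [e1]; gcongr
      _ = D₁ / τ ^ (2 * m * b₁ + n * (b₁ + 1)) * F ^ (b₁ + 1) := by
          rw [Real.rpow_add hτ0, hD₁]; field_simp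
      _ ≤ _ := by gcongr; linarith
  -- The Caccioppoli inequality between ρ and R' leaves a q-energy on the ball of radius R'. There
  -- the supremum bound obtained between R' and R reduces it to a p-energy.
  · set R' := (ρ + R) / 2 with hR'
    have hR'τ : R' - ρ = τ / 2 := by rw [hR', hτ]; ring
    have hRR' : R - R' = τ / 2 := by rw [hR', hτ]; ring
    obtain ⟨hsup, -⟩ := hB x₀ R' R (by linarith) (by linarith) hR1 hRΩ
    obtain ⟨-, hcac⟩ := hB x₀ ρ R' hρ (by linarith) (by linarith) (hres R' (by linarith))
    rw [← hP, hRR'] at hsup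
    rw [hR'τ] at hcac
    set M := C₇ * (P / (τ / 2) ^ (2 * m)) ^ (1 / c₀) with hM
    have hM1 : 1 ≤ M := by
      refine one_le_mul_of_one_le_of_one_le hC₇ (Real.one_le_rpow ?_ (by positivity))
      rw [one_le_div (by positivity)]
      exact (Real.rpow_le_one (by positivity) (by linarith) (by positivity)).trans hP1
    have hJ := powEnergy_le_mul (p := p) (R := R) hpq (by linarith) hM1 hsup
    rw [← ENNReal.ofReal_toReal hPfin, ← hP, ← ENNReal.ofReal_mul (by positivity)] at hJ
    have eqI : ∫ x in Metric.ball x₀ ρ, ‖Du x‖ ^ (p - 2) * hessSq D2u x =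
        ∫ x in Metric.ball x₀ ρ, ‖V x‖ ^ (p - 2) * ∑ s, ∑ i, W x i s ^ 2 := by
      refine integral_congr_ae ?_
      have hW := ae_all_iff.2 fun i =>
        ae_restrict_of_ae_restrict_of_subset (hres ρ hρR.le) (eW i)
      filter_upwards [hW, ae_restrict_of_ae_restrict_of_subset (hres ρ hρR.le) eV] with x h1 h2
      rw [h2, hessSq, Finset.sum_comm]
      congr 1
      refine Finset.sum_congr rfl fun i _ => ?_
      rw [h1 i, EuclideanSpace.norm_sq_eq]
      refine Finset.sum_congr rfl fun j _ => ?_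
      rw [Real.norm_eq_abs, sq_abs]
    have hWm : ∀ i j, Measurable fun x => W x i j := fun i j =>
      (measurable_coord j).comp (hS.W_meas i)
    have hsm : ∀ s, Measurable fun x => ‖V x‖ ^ (p - 2) * ∑ i, W x i s ^ 2 := fun s =>
      (hS.V_meas.norm.pow_const _).mul
        (Finset.measurable_fun_sum _ fun i _ => (hWm i s).pow_const _)
    have hs0 : ∀ s x, 0 ≤ ‖V x‖ ^ (p - 2) * ∑ i, W x i s ^ 2 := fun s x =>
      mul_nonneg (by positivity) (Finset.sum_nonneg fun i _ => sq_nonneg _)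
    have hsum : ∀ x, ‖V x‖ ^ (p - 2) * ∑ s, ∑ i, W x i s ^ 2 =
        ∑ s, ‖V x‖ ^ (p - 2) * ∑ i, W x i s ^ 2 := fun x => Finset.mul_sum _ _ _
    set T := C₃ / (τ / 2) ^ 2 * (M ^ (q - p) * P) with hT
    have hT0 : 0 ≤ T := by positivity
    have hle : ∫ x in Metric.ball x₀ ρ, ‖V x‖ ^ (p - 2) * ∑ s, ∑ i, W x i s ^ 2 ≤ n * T := by
      simp only [hsum]
      rw [integral_eq_lintegral_of_nonneg_ae
        (Filter.Eventually.of_forall fun x => Finset.sum_nonneg fun s _ => hs0 s x)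
        (Finset.measurable_fun_sum _ fun s _ => hsm s).aestronglyMeasurable]
      refine ENNReal.toReal_le_of_le_ofReal (by positivity) ?_
      simp_rw [ENNReal.ofReal_sum_of_nonneg fun s (_ : s ∈ Finset.univ) => hs0 s _]
      rw [lintegral_finsetSum _ fun s _ => (hsm s).ennreal_ofReal]
      calc _ ≤ ∑ _s : Fin n, ENNReal.ofReal T := by
            refine Finset.sum_le_sum fun s _ => (hcac s).trans ?_
            rw [hT, ENNReal.ofReal_mul (by positivity)]
            gcongr
        _ = _ := by
            rw [Finset.sum_const, Finset.card_univ, Fintype.card_fin, nsmul_eq_mul,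
              ENNReal.ofReal_mul hn0.le, ENNReal.ofReal_natCast]
    rw [eqI]
    refine hle.trans ?_
    have hMq : M ^ (q - p) = C₇ ^ (q - p) * (2 ^ (2 * m)) ^ ((q - p) / c₀) /
        τ ^ (2 * m * ((q - p) / c₀)) * P ^ ((q - p) / c₀) := by
      rw [hM, Real.mul_rpow (by linarith) (by positivity), ← Real.rpow_mul (by positivity)]
      have e1 : 1 / c₀ * (q - p) = (q - p) / c₀ := by ring
      rw [e1, Real.div_rpow (x := τ) hτ0.le (by norm_num), div_div_eq_mul_div,
        Real.div_rpow (by positivity) (by positivity), Real.mul_rpow (by linarith) (by positivity),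
        ← Real.rpow_mul hτ0.le]
      ring
    have hTe : n * T = n * (4 * C₃) * (C₇ ^ (q - p) * (2 ^ (2 * m)) ^ ((q - p) / c₀)) /
        (τ ^ 2 * τ ^ (2 * m * ((q - p) / c₀))) * P ^ b₂ := by
      rw [hT, hMq, hb₂, Real.rpow_add (by linarith), Real.rpow_one]
      field_simp
      norm_num
    have h2 := rpow_energy_le hτ0 hτ1 hc₁0 hκ hb₂0 (by linarith) hPF hFlow
    calc n * T ≤ n * (4 * C₃) * (C₇ ^ (q - p) * (2 ^ (2 * m)) ^ ((q - p) / c₀)) /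
        (τ ^ 2 * τ ^ (2 * m * ((q - p) / c₀))) *
          ((c₁⁻¹ + κ⁻¹) ^ b₂ * c₁⁻¹ / τ ^ (n * (b₂ + 1)) * F ^ (b₂ + 1)) := by
          rw [hTe]; gcongr
      _ = D₂ / τ ^ (2 + 2 * m * ((q - p) / c₀) + n * (b₂ + 1)) * F ^ (b₂ + 1) := by
          rw [Real.rpow_add hτ0, Real.rpow_add hτ0, Real.rpow_two, hD₂]; field_simp
      _ ≤ _ := by gcongr; linarith

end Uniform

/-! ### Quadratic integrands -/

section EllipticMatrix

variable {n : ℕ}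

/-- The vector `(M + Mᵀ) ξ`. -/
def symmMul (M : Matrix (Fin n) (Fin n) ℝ) (ξ : E n) : E n :=
  WithLp.toLp 2 fun k => ∑ j, (M k j + M j k) * ξ j

lemma symmMul_apply (M : Matrix (Fin n) (Fin n) ℝ) (ξ : E n) (k : Fin n) :
    symmMul M ξ k = ∑ j, (M k j + M j k) * ξ j := rfl

lemma symmMul_sub_right (M : Matrix (Fin n) (Fin n) ℝ) (ξ ξ' : E n) :
    symmMul M (ξ - ξ') = symmMul M ξ - symmMul M ξ' := by
  ext k
  simp only [symmMul_apply, PiLp.sub_apply, ← Finset.sum_sub_distrib]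
  exact Finset.sum_congr rfl fun j _ => by ring

lemma symmMul_sub_left (M M' : Matrix (Fin n) (Fin n) ℝ) (ξ : E n) :
    symmMul (M - M') ξ = symmMul M ξ - symmMul M' ξ := by
  ext k
  simp only [symmMul_apply, PiLp.sub_apply, ← Finset.sum_sub_distrib, Matrix.sub_apply]
  exact Finset.sum_congr rfl fun j _ => by ring

lemma norm_symmMul_le {M : Matrix (Fin n) (Fin n) ℝ} {L : ℝ} (h : ∀ i j, |M i j| ≤ L) (ξ : E n) :
    ‖symmMul M ξ‖ ≤ 2 * n ^ 2 * L * ‖ξ‖ := by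
  refine (norm_le_sum_abs _).trans ?_
  calc ∑ k, |symmMul M ξ k| ≤ ∑ _k : Fin n, ∑ _j : Fin n, 2 * L * ‖ξ‖ := by
        refine Finset.sum_le_sum fun k _ => ?_
        rw [symmMul_apply]
        refine (Finset.abs_sum_le_sum_abs _ _).trans (Finset.sum_le_sum fun j _ => ?_)
        rw [abs_mul]
        have h1 : |M k j + M j k| ≤ 2 * L := by
          linarith [abs_add_le (M k j) (M j k), h k j, h j k]
        exact mul_le_mul h1 (abs_apply_le_norm ξ j) (abs_nonneg _) ((abs_nonneg _).trans h1)
    _ = _ := by simp; ring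

lemma inner_symmMul (M : Matrix (Fin n) (Fin n) ℝ) (ξ v : E n) :
    inner ℝ (symmMul M ξ) v = ∑ i, ∑ j, M i j * (ξ i * v j + ξ j * v i) := by
  have h1 : inner ℝ (symmMul M ξ) v =
      ∑ k, ∑ j, M k j * ξ j * v k + ∑ k, ∑ j, M j k * ξ j * v k := by
    rw [PiLp.inner_apply, ← Finset.sum_add_distrib]
    refine Finset.sum_congr rfl fun k _ => ?_
    rw [← Finset.sum_add_distrib, symmMul_apply]
    simp only [RCLike.inner_apply, conj_trivial]
    rw [Finset.mul_sum]
    exact Finset.sum_congr rfl fun j _ => by ring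
  rw [h1, Finset.sum_comm (f := fun k j => M j k * ξ j * v k), ← Finset.sum_add_distrib]
  refine Finset.sum_congr rfl fun i _ => ?_
  rw [← Finset.sum_add_distrib]
  exact Finset.sum_congr rfl fun j _ => by ring

lemma hasGradientAt_quadratic (M : Matrix (Fin n) (Fin n) ℝ) (ξ : E n) :
    HasGradientAt (fun ξ : E n => ∑ i, ∑ j, M i j * ξ i * ξ j) (symmMul M ξ) ξ := by
  rw [hasGradientAt_iff_hasFDerivAt]
  have hc : ∀ i, HasFDerivAt (fun ξ : E n => ξ i) (EuclideanSpace.proj i : E n →L[ℝ] ℝ) ξ := fun i =>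
    (EuclideanSpace.proj i : E n →L[ℝ] ℝ).hasFDerivAt
  have h1 : HasFDerivAt (fun ξ : E n => ∑ i, ∑ j, M i j * ξ i * ξ j)
      (∑ i, ∑ j, ((M i j * ξ i) • (EuclideanSpace.proj j : E n →L[ℝ] ℝ) +
        ξ j • (M i j • (EuclideanSpace.proj i : E n →L[ℝ] ℝ)))) ξ :=
    HasFDerivAt.fun_sum fun i _ => HasFDerivAt.fun_sum fun j _ => ((hc i).const_mul (M i j)).mul (hc j)
  refine h1.congr_fderiv ?_
  ext v
  rw [InnerProductSpace.toDual_apply_apply, inner_symmMul]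
  simp only [sum_apply, add_apply, smul_apply,
    PiLp.proj_apply, EuclideanSpace.proj, smul_eq_mul]
  refine Finset.sum_congr rfl fun i _ => Finset.sum_congr rfl fun j _ => ?_
  ring

lemma inner_symmMul_self (M : Matrix (Fin n) (Fin n) ℝ) (v : E n) :
    inner ℝ (symmMul M v) v = 2 * ∑ i, ∑ j, M i j * v i * v j := by
  rw [inner_symmMul, Finset.mul_sum]
  refine Finset.sum_congr rfl fun i _ => ?_
  rw [Finset.mul_sum]
  exact Finset.sum_congr rfl fun j _ => by ring

lemma fderiv_symmMul (M : Matrix (Fin n) (Fin n) ℝ) (ξ v : E n) :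
    fderiv ℝ (symmMul M) ξ v = symmMul M v := by
  let ℓ : E n →ₗ[ℝ] E n :=
    { toFun := symmMul M
      map_add' := fun x y => by
        have := symmMul_sub_right M (x + y) y
        rw [add_sub_cancel_right] at this
        rw [this, sub_add_cancel]
      map_smul' := fun r x => by
        ext k
        simp only [symmMul_apply, PiLp.smul_apply, smul_eq_mul, RingHom.id_apply, Finset.mul_sum]
        exact Finset.sum_congr rfl fun j _ => by ring }
  have h1 : symmMul M = LinearMap.toContinuousLinearMap ℓ := rfl
  rw [h1, ContinuousLinearMap.fderiv]

lemma exists_lipschitz_entries {Ω S : Set (E n)} {a : E n → Matrix (Fin n) (Fin n) ℝ}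
    (ha : ∀ i j, LocallyLipschitzOn Ω (fun x => a x i j)) (hS : IsCompact S) (hSΩ : S ⊆ Ω) :
    ∃ L : ℝ, 0 ≤ L ∧ ∀ x ∈ S, ∀ i j, |a x i j| ≤ L ∧ ∀ y ∈ S, |a x i j - a y i j| ≤ L * ‖x - y‖ := by
  have h1 : ∀ i j, ∃ L : ℝ, 0 ≤ L ∧ ∀ x ∈ S, |a x i j| ≤ L ∧
      ∀ y ∈ S, |a x i j - a y i j| ≤ L * ‖x - y‖ := by
    intro i j
    obtain ⟨K, hK⟩ := ((ha i j).mono hSΩ).exists_lipschitzOnWith_of_compact hS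
    obtain ⟨M, hM⟩ := hS.exists_bound_of_continuousOn ((ha i j).continuousOn.mono hSΩ)
    refine ⟨max K M, le_max_of_le_left K.2, fun x hx => ⟨(hM x hx).trans (le_max_right _ _),
      fun y hy => ?_⟩⟩
    have := hK.dist_le_mul x hx y hy
    rw [Real.dist_eq, dist_eq_norm] at this
    exact this.trans (mul_le_mul_of_nonneg_right (le_max_left _ _) (norm_nonneg _))
  choose L hL0 hL using h1
  have hle : ∀ i j, L i j ≤ ∑ i, ∑ j, L i j := fun i j =>
    (Finset.single_le_sum (f := fun j => L i j) (fun j _ => hL0 i j) (Finset.mem_univ j)).trans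
      (Finset.single_le_sum (f := fun i => ∑ j, L i j)
        (fun i _ => Finset.sum_nonneg fun j _ => hL0 i j) (Finset.mem_univ i))
  refine ⟨∑ i, ∑ j, L i j, Finset.sum_nonneg fun i _ => Finset.sum_nonneg fun j _ => hL0 i j,
    fun x hx i j => ⟨(hL i j x hx).1.trans (hle i j), fun y hy => ((hL i j x hx).2 y hy).trans ?_⟩⟩
  exact mul_le_mul_of_nonneg_right (hle i j) (norm_nonneg _)

/-- Quadratic forms with an elliptic matrix satisfy the assumptions with `p = 2`. -/
lemma IsEllipticMatrix.isPElliptic {Ω : Set (E n)} (hΩ : IsOpen Ω)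
    {a : E n → Matrix (Fin n) (Fin n) ℝ} (ha : IsEllipticMatrix Ω a) :
    IsPElliptic 2 Ω (fun x ξ => ∑ i, ∑ j, a x i j * ξ i * ξ j) := by
  have hgrad : ∀ x, ∇ (fun ξ : E n => ∑ i, ∑ j, a x i j * ξ i * ξ j) = symmMul (a x) := fun x =>
    funext fun ξ => (hasGradientAt_quadratic (a x) ξ).gradient
  refine ⟨?_, fun x _ ξ => (hasGradientAt_quadratic (a x) ξ).differentiableAt, ?_, ?_⟩
  · refine continuousOn_finsetSum _ fun i _ => continuousOn_finsetSum _ fun j _ => ?_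
    have h1 : ContinuousOn (fun z : E n × E n => a z.1 i j) (Ω ×ˢ univ) :=
      (ha.1 i j).continuousOn.comp continuousOn_fst fun z hz => hz.1
    exact (h1.mul (Continuous.continuousOn (by fun_prop))).mul (Continuous.continuousOn (by fun_prop))
  · rintro ⟨x₀, ξ₀⟩ ⟨hx₀, -⟩
    obtain ⟨r, hr, hrΩ⟩ := Metric.nhds_basis_closedBall.mem_iff.1 (hΩ.mem_nhds hx₀)
    obtain ⟨L, hL0, hL⟩ := exists_lipschitz_entries ha.1 (isCompact_closedBall x₀ r) hrΩ
    refine ⟨Real.toNNReal (2 * n ^ 2 * L * (‖ξ₀‖ + 2)),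
      Metric.closedBall x₀ r ×ˢ Metric.closedBall ξ₀ 1, mem_nhdsWithin_of_mem_nhds
        (prod_mem_nhds (Metric.closedBall_mem_nhds _ hr) (Metric.closedBall_mem_nhds _ one_pos)), ?_⟩
    refine LipschitzOnWith.of_dist_le_mul ?_
    rintro ⟨x, ξ⟩ ⟨hx, hξ⟩ ⟨y, ζ⟩ ⟨hy, hζ⟩
    simp only [hgrad]
    rw [Real.coe_toNNReal _ (by positivity), dist_eq_norm]
    have e1 : symmMul (a x) ξ - symmMul (a y) ζ =
        symmMul (a x) (ξ - ζ) + symmMul (a x - a y) ζ := by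
      rw [symmMul_sub_right, symmMul_sub_left]; abel
    have hζn : ‖ζ‖ ≤ ‖ξ₀‖ + 1 := by
      rw [Metric.mem_closedBall, dist_eq_norm] at hζ
      have := norm_add_le (ζ - ξ₀) ξ₀
      rw [sub_add_cancel] at this
      linarith
    have d1 : ‖ξ - ζ‖ ≤ dist (x, ξ) (y, ζ) := by
      rw [← dist_eq_norm, Prod.dist_eq]; exact le_max_right _ _
    have d2 : ‖x - y‖ ≤ dist (x, ξ) (y, ζ) := by
      rw [← dist_eq_norm, Prod.dist_eq]; exact le_max_left _ _
    set d := dist (x, ξ) (y, ζ)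
    have hd0 : 0 ≤ d := dist_nonneg
    have b1 := norm_symmMul_le (fun i j => (hL x hx i j).1) (ξ - ζ)
    have b2 := norm_symmMul_le (M := a x - a y) (fun i j => (hL x hx i j).2 y hy) ζ
    rw [e1]
    refine (norm_add_le _ _).trans ((add_le_add b1 b2).trans ?_)
    calc 2 * n ^ 2 * L * ‖ξ - ζ‖ + 2 * n ^ 2 * (L * ‖x - y‖) * ‖ζ‖
        ≤ 2 * n ^ 2 * L * d + 2 * n ^ 2 * (L * d) * (‖ξ₀‖ + 1) := by gcongr
      _ = _ := by ring
  · intro Ω' hΩ'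
    obtain ⟨c₁, c₂, hc₁, hc₂, hell⟩ := ha.2 Ω' hΩ'
    obtain ⟨L, hL0, hL⟩ := exists_lipschitz_entries ha.1 hΩ'.2.1 hΩ'.2.2
    refine ⟨2 * c₁, 2 * c₂, n * (2 * n ^ 2 * L) + 1, by positivity, by positivity, by positivity,
      Filter.Eventually.of_forall ?_⟩
    rintro ⟨x, ξ⟩ hx
    simp only at hx
    refine ⟨fun v => ?_, fun k => ?_⟩
    · simp only [hgrad, fderiv_symmMul, inner_symmMul_self, sub_self, Real.rpow_zero]
      obtain ⟨h1, h2⟩ := hell x hx v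
      have h3 : 0 ≤ c₂ * ‖v‖ ^ 2 := by positivity
      constructor <;> linarith
    · simp only [hgrad]
      have hd : ‖fderiv ℝ (fun y => symmMul (a y) ξ) x‖ ≤ 2 * n ^ 2 * L * ‖ξ‖ := by
        -- A Lipschitz bound at x controls `fderiv` even if the map is not differentiable there,
        -- since the default value is 0. Hence the bounds of `IsPElliptic` hold at every point and
        -- not merely almost everywhere.
        refine norm_fderiv_le_of_lip' ℝ (by positivity) ?_
        filter_upwards [hΩ'.1.mem_nhds hx] with y hy
        rw [← symmMul_sub_left]
        refine (norm_symmMul_le (fun i j =>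
          (hL y (subset_closure hy) i j).2 x (subset_closure hx)) ξ).trans (le_of_eq ?_)
        ring
      have e1 : (2 : ℝ) - 1 = 1 := by norm_num
      rw [e1, Real.rpow_one]
      set w := fderiv ℝ (fun y => symmMul (a y) ξ) x (EuclideanSpace.single k 1) with hw
      have hwn : ‖w‖ ≤ 2 * n ^ 2 * L * ‖ξ‖ := by
        refine ((fderiv ℝ (fun y => symmMul (a y) ξ) x).le_opNorm _).trans ?_
        simpa using hd
      calc ∑ i, |w i| ≤ ∑ _i : Fin n, 2 * n ^ 2 * L * ‖ξ‖ :=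
            Finset.sum_le_sum fun i _ => (abs_apply_le_norm w i).trans hwn
        _ = n * (2 * n ^ 2 * L) * ‖ξ‖ := by simp; ring
        _ ≤ _ := by
            have := norm_nonneg ξ
            linarith

end EllipticMatrix

end AnisotropicEnergy

end

theorem mainTheorem3 {n : ℕ} (hn : 2 ≤ n) {p q : ℝ} (hp : 2 ≤ p) (hpq : p ≤ q)
    (hratio : q / p < 1 + 2 / (n : ℝ)) (Ω : Set (AnisotropicEnergy.E n)) (hΩ : IsOpen Ω) :
    (∀ h : AnisotropicEnergy.E n → AnisotropicEnergy.E n → ℝ,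
      AnisotropicEnergy.IsPElliptic p Ω h →
        AnisotropicEnergy.LocallyLipschitzMinimizers q Ω
          (AnisotropicEnergy.anisotropicIntegrand hn q h) ∧
        ∀ Ω', AnisotropicEnergy.CompactlyContained Ω' Ω →
          (∃ ε : ℝ, 0 < ε ∧ ∀ x ∈ Ω', ∀ ξ,
            ε ≤ 1 + AnisotropicEnergy.anisotropicIntegrand hn q h x ξ) →
          AnisotropicEnergy.UniformEstimates p q Ω Ω'
            (AnisotropicEnergy.anisotropicIntegrand hn q h)) ∧
    (p = 2 → ∀ a : AnisotropicEnergy.E n → Matrix (Fin n) (Fin n) ℝ,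
      AnisotropicEnergy.IsEllipticMatrix Ω a →
        AnisotropicEnergy.LocallyLipschitzMinimizers q Ω
          (AnisotropicEnergy.anisotropicIntegrand hn q
            (fun x ξ => ∑ i, ∑ j, a x i j * ξ i * ξ j)) ∧
        ∀ Ω', AnisotropicEnergy.CompactlyContained Ω' Ω →
          AnisotropicEnergy.UniformEstimates p q Ω Ω'
            (AnisotropicEnergy.anisotropicIntegrand hn q
              (fun x ξ => ∑ i, ∑ j, a x i j * ξ i * ξ j))) := by
  refine ⟨fun h hh => ⟨AnisotropicEnergy.locallyLipschitzMinimizers_anisotropic hn hp hpq hratio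
    hΩ hh, fun Ω' hΩ' hε => ?_⟩, fun h2 a ha => ?_⟩
  · obtain ⟨ε, hε, hpos⟩ := hε
    exact AnisotropicEnergy.uniformEstimates_anisotropic hn hp hpq hratio hh hΩ' hε hpos
  · subst h2
    have hh := ha.isPElliptic hΩ
    refine ⟨AnisotropicEnergy.locallyLipschitzMinimizers_anisotropic hn hp hpq hratio hΩ hh,
      fun Ω' hΩ' => AnisotropicEnergy.uniformEstimates_anisotropic hn hp hpq hratio hh hΩ' one_pos
        fun x hx ξ => ?_⟩
    obtain ⟨c₁, c₂, hc₁, -, hell⟩ := ha.2 Ω' hΩ'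
    -- Ellipticity makes the quadratic form nonnegative on Ω', so 1 + f ≥ 1 there and the lower
    -- bound required in (ii) holds with ε = 1 for every Ω'.
    have h1 : 0 ≤ ∑ i, ∑ j, a x i j * ξ i * ξ j :=
      le_trans (by positivity) (hell x hx ξ).1
    have h3 : 0 ≤ |ξ ⟨n - 1, by omega⟩| ^ q := by positivity
    unfold AnisotropicEnergy.anisotropicIntegrand
    linarith
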